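/- **Setting.** The Cartan group $G\cong\mathbb R^5$ (coordinates of the first kind $x,y,z,v,w$) carries the left-invariant fields $X=\partial_x-\frac y2\partial_z-\left(\frac z2+\frac{xy}{12}\right)\partial_v-\frac{y^2}{12}\partial_w$ and $Y=\partial_y+\frac x2\partial_z+\frac{x^2}{12}\partial_v+\left(\frac{xy}{12}-\frac z2\right)\partial_w$. Let $F$ be an arbitrary quasinorm on $\mathbb R^2$ (positive definite, subadditive, positively homogeneous), $U=\{F\le 1\}$, $F_U(h)=\max_{u\in U}h\cdot u$, $U^*=\{F_U\le 1\}$, let $r=r(\theta)$ be the polar equation of the curve $F_U=1$, and let $d$ be the left-invariant sub-Finsler quasimetric defined by $F$ on the distribution spanned by $X,Y$. A *normal extremal* from the unit is an absolutely continuous curve $g(t)=(x,y,z,v,w)(t)$, $t\in\mathbb R$, $g(0)=0$, which satisfies the Pontryagin Maximum Principle: for a measurable control $u(t)\in U$ and an absolutely continuous nowhere vanishing covector function $\psi(t)$, and for $\mathcal H(g;\psi;u)=\psi(u_1X(g)+u_2Y(g))$, almost everywhere $\dot g=\partial\mathcal H/\partial\psi$, $\dot\psi=-\partial\mathcal H/\partial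 g$ and $\mathcal H(g(t);\psi(t);u(t))=\max_{u\in U}\mathcal H(g(t);\psi(t);u)=M$ with a constant $M>0$. Multiplying $\psi$ by $1/M$ one takes $M=1$; let $(\varphi_1,\dots,\varphi_5)=\psi(0)$ after this normalization, $h_1=\psi(X)$, $h_2=\psi(Y)$. The curve $(h_1,h_2)(t)$ lies on $\{F_U=1\}$, so that $h_1(t)=r(\theta(t))\cos\theta(t)$, $h_2(t)=r(\theta(t))\sin\theta(t)$ for a continuous function $\theta(t)$; let $\theta_0=\theta(0)$, so that $r(\theta_0)\cos\theta_0=\varphi_1$, $r(\theta_0)\sin\theta_0=\varphi_2$. Put $h_1(\theta)=r(\theta)\cos\theta$, $h_2(\theta)=r(\theta)\sin\theta$, let $r'(\theta)$ denote any value between the one-sided derivatives of $r$ at $\theta$, and $$\mathcal E=\tfrac{\varphi_3^2}2+\varphi_1\varphi_5-\varphi_2\varphi_4,\quad \mathcal E_0=\max_{h\in U^*}(\varphi_5h_1-\varphi_4h_2),\quad \mathcal E_{-1}=\min_{h\in U^*}(\varphi_5h_1-\varphi_4h_2),$$ $$N(\theta)=\varphi_3^2+2\varphi_4(h_2(\theta)-\varphi_2)-2\varphi_5(h_1(\theta)-\varphi_1).$$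 **Theorem.** Let $\varphi_4^2+\varphi_5^2\ne0$. The normal extremals from the unit with initial data $\varphi$, together with their functions $\theta(t)$, are exactly the curves given by $$x(t)=\int_0^t\frac{r'(\theta(\tau))\sin\theta(\tau)+r(\theta(\tau))\cos\theta(\tau)}{r^2(\theta(\tau))}d\tau,\quad y(t)=\int_0^t\frac{r(\theta(\tau))\sin\theta(\tau)-r'(\theta(\tau))\cos\theta(\tau)}{r^2(\theta(\tau))}d\tau$$ with arbitrary measurable choice of $r'(\theta(\tau))$ and a continuously differentiable $\theta(t)$ such that $(h_1,h_2)(\theta(0))=(\varphi_1,\varphi_2)$, $$\frac{d}{dt}\int_0^{\theta(t)}r^2(\xi)\,d\xi=\varphi_3+\varphi_4x(t)+\varphi_5y(t)=r^2(\theta(t))\dot\theta(t),\qquad \dot\theta^2=N(\theta)/r^4(\theta),$$ and by the following formulas. If $\varphi_5\neq0$, then $$z=\tfrac1{\varphi_5}\left(\varphi_2+(\varphi_3+\tfrac12\varphi_4x+\tfrac12\varphi_5y)x-r(\theta)\sin\theta\right),\quad v=\tfrac13\int_0^t(x\dot z-z\dot x)d\tau-\tfrac16xz,$$ $$w=\tfrac1{3\varphi_5}\left(t-\varphi_1x-\varphi_2y-2\varphi_3z-3\varphi_4v-\tfrac{\varphi_4}2xz-\tfrac{\varphi_5}2yz\right).$$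 If $\varphi_5=0$, then $$z=\tfrac1{\varphi_4}\left(\varphi_1-(\varphi_3+\tfrac12\varphi_4x)y-r(\theta)\cos\theta\right),\quad v=\tfrac1{3\varphi_4}\left(t-\varphi_1x-\varphi_2y-2\varphi_3z-\tfrac{\varphi_4}2xz\right),\quad w=\tfrac13\int_0^t(y\dot z-z\dot y)d\tau-\tfrac16yz.$$ One of the following cases takes place. 1. $\varphi_3\ne0$, $\mathcal E>\mathcal E_0$. Then $\theta(t)$, $t\in\mathbb R$, is the inverse function of $$t(\theta)=\int_{\theta_0}^{\theta}\frac{r^2(\xi)\,d\xi}{\varphi_3\sqrt{1+(2\varphi_4/\varphi_3^2)(r(\xi)\sin\xi-\varphi_2)-(2\varphi_5/\varphi_3^2)(r(\xi)\cos\xi-\varphi_1)}}.\qquad(*)$$ 2. $\varphi_3=0$, $\mathcal E=\mathcal E_{-1}$. Then $\theta(t)\equiv\theta_0$ and the extremal is a metric straight line (that is, $d(g(s),g(t))=t-s$ for $s\le t$), namely, for some $s=\pm1$: $x=0$, $y=st/F(0,s)$ if $\varphi_5=0$; $x=st/F(s,0)$, $y=0$ if $\varphi_4=0$; $x=s\varphi_5t/F(s\varphi_5,-s\varphi_4)$,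 $y=-\varphi_4x/\varphi_5$ if $\varphi_4\varphi_5\ne0$; and $z=v=w=0$. 3. $\mathcal E_{-1}<\mathcal E<\mathcal E_0$. Then there are $t_1<t_2$ such that for all $t\in\mathbb R$, $k\in\mathbb Z$, $i=1,2$ $$\theta(t+2k(t_2-t_1))=\theta(t),\quad\dot\theta(t_i+t)=-\dot\theta(t_i-t),\quad\theta(t_i+t)=\theta(t_i-t).$$ 3.1. If $\varphi_3\neq0$, then $t_i=t(\theta_i)$ by $(*)$ (a finite integral), where $\theta_1,\theta_2$ are the zeros of $N$ nearest to $\theta_0$ on its two sides, with $\varphi_3(\theta_2-\theta_1)>0$. 3.2. If $\varphi_3=0$, then $t_1=0$ and $t_2=t(\theta_2)$, where $$t(\theta)=\pm\int_{\theta_0}^\theta\frac{r^2(\xi)\,d\xi}{\sqrt{2\varphi_4(r(\xi)\sin\xi-\varphi_2)-2\varphi_5(r(\xi)\cos\xi-\varphi_1)}}\qquad(**)$$ (finite for $\theta=\theta_2$), with $+$ if $\theta_2>\theta_0$ and $-$ if $\theta_2<\theta_0$, and $\theta_2\neq\theta_0$ is such that $\varphi_4(h_2(\theta)-h_2(\theta_0))\ge\varphi_5(h_1(\theta)-h_1(\theta_0))$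 for all $\theta$ between $\theta_0$ and $\theta_2$, with equality only for $\theta=\theta_0$ and $\theta=\theta_2$. In the remaining cases, "*$\theta$ is not unique, with constant values in $S$*" means: at least two functions $\theta$ correspond to the given $\varphi$ and $\theta_0$; if $\theta$ is constant on a non-degenerate segment $J$, its value belongs to $S$; each $c\in S$ is taken, for suitable extremals, on a maximal segment of any prescribed positive length; and on each such $J$ one has $\mathcal E\ne0$ and, for $t,t_0\in J$, $\tau=t-t_0$, $(x_0,\dots,w_0)=(x,\dots,w)(t_0)$: if $\varphi_5\neq0$, $$x=x_0+\tfrac{\varphi_5}{\mathcal E}\tau,\quad y=-\tfrac{\varphi_4}{\mathcal E}\tau-\tfrac1{\varphi_5}(\varphi_3+\varphi_4x_0),\quad z=z_0+\tfrac{\varphi_3}{2\mathcal E}\tau,\quad v=v_0-\tfrac{\varphi_3\varphi_5}{12\mathcal E^2}\tau^2+\tfrac1{12\mathcal E}(\varphi_3x_0-6\varphi_5z_0)\tau,$$ $$w=w_0+\tfrac{\varphi_3\varphi_4}{12\mathcal E^2}\tau^2+\tfrac1{12\varphi_5\mathcal E}(6\varphi_4\varphi_5z_0-\varphi_3\varphi_4x_0-\varphi_3^2)\tau;$$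 if $\varphi_5=0$, $$x=-\tfrac{\varphi_3}{\varphi_4},\quad y=y_0-\tfrac{\varphi_4}{\mathcal E}\tau,\quad z=z_0+\tfrac{\varphi_3}{2\mathcal E}\tau,\quad v=v_0-\tfrac{\varphi_3^2}{12\varphi_4\mathcal E}\tau,\quad w=w_0+\tfrac{\varphi_3\varphi_4}{12\mathcal E^2}\tau^2+\tfrac1{12\mathcal E}(\varphi_3y_0+6\varphi_4z_0)\tau.$$ "*With arbitrary alternation*" means moreover: for every sequence $(p_n)_{n\in\mathbb Z}$ in $S$ with $|p_{n+1}-p_n|=2\pi$ (with the start prescribed below) and all lengths $\ell_n\ge0$ there is an extremal for which $\theta$ successively takes the values $p_n$ on segments of lengths $\ell_n$ and is strictly monotone in between. 4. $\varphi_3\ne0$, $\mathcal E=\mathcal E_0$. Then there are zeros $\theta_1<\theta_0<\theta_2$ of $N$ nearest to $\theta_0$. If the improper integrals $(*)$ diverge for $\theta=\theta_1$ and for $\theta=\theta_2$, then $\theta(t)\in(\theta_1,\theta_2)$, $t\in\mathbb R$, is the inverse function of $t(\theta)$. If both are finite and $\theta_2=\theta_1+2\pi$, then $\theta$ is not unique,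 with constant values in $S=\{\theta_1+2\pi k: k\in\mathbb Z\}$ and with arbitrary alternation ($t=0$ lies inside the interval of monotonicity from $p_{-1}$ to $p_0$, where $(p_{-1},p_0)=(\theta_1,\theta_2)$ if $\varphi_3>0$ and $(\theta_2,\theta_1)$ if $\varphi_3<0$). If at least one is finite, in all other cases, $\theta$ is not unique, with constant values in the set $S$ of those $\theta_i$, $i\in\{1,2\}$, for which $(*)$ is finite. 5. $\varphi_3=0$, $\mathcal E=\mathcal E_0$. Then there is a largest segment $[\theta_1,\theta_2]\ni\theta_0$, $\theta_1\le\theta_2$, on which $\varphi_5(h_1(\theta)-\varphi_1)=\varphi_4(h_2(\theta)-\varphi_2)$. Say that $t(\theta)$ is finite on the left (on the right) of $\theta_0$ if the integral $(**)$ from $\theta_0$ to $\theta$ converges for some $\theta<\theta_0$ (some $\theta>\theta_0$), and infinite there otherwise. Then $\theta(t)\equiv\theta_0$ and the extremal is a metric straight line as in case 2, if: 5.1. $\theta_1=\theta_0=\theta_2$ and $t(\theta)$ is infinite on both sides; 5.2. $\theta_1<\theta_0<\theta_2$; 5.3. $\theta_0=\theta_1<\theta_2$ and $t(\theta)$ is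 infinite on the left; 5.4. $\theta_1<\theta_2=\theta_0$ and $t(\theta)$ is infinite on the right. In all other cases $\theta$ is not unique, with constant values in $S$, where: 1) $S=\{\theta_0,\theta_1+2\pi\}$ if $\theta_1<\theta_0=\theta_2$, $t(\theta)$ is finite on the right and $t(\theta_1+2\pi)$ is finite; 2) $S=\{\theta_0,\theta_2-2\pi\}$ if $\theta_0=\theta_1<\theta_2$, $t(\theta)$ is finite on the left and $t(\theta_2-2\pi)$ is finite; 3) $S=\{\theta_0+2\pi k: k\in\mathbb Z\}$, with arbitrary alternation ($p_0=\theta_0$ and $t=0$ lies in the segment with value $p_0$), if $\theta_0=\theta_1=\theta_2$ and $t(\theta)$ is finite on both sides; 4) $S=\{\theta_0\}$ otherwise. -/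

import Mathlib

open MeasureTheory Set Filter

noncomputable section

namespace SubFinslerCartan

/-! ### The Cartan group in coordinates of the first kind

A point is `g : Fin 5 → ℝ`, whose coordinates `g 0, …, g 4` are `x, y, z, v, w`. The unit is `0`. -/

/-- Multiplication of the Cartan group in coordinates of the first kind. -/
def mul (g h : Fin 5 → ℝ) : Fin 5 → ℝ :=
  ![g 0 + h 0,
    g 1 + h 1,
    g 2 + h 2 + (1 / 2) * (g 0 * h 1 - h 0 * g 1),
    g 3 + h 3 + (1 / 2) * (g 0 * h 2 - h 0 * g 2)
      + (1 / 12) * (g 0 ^ 2 * h 1 - g 0 * h 0 * g 1 - g 0 * h 0 * h 1 + h 0 ^ 2 * g 1),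
    g 4 + h 4 + (1 / 2) * (g 1 * h 2 - h 1 * g 2)
      + (1 / 12) * (g 0 * g 1 * h 1 + h 0 * g 1 * h 1 - h 0 * g 1 ^ 2 - g 0 * h 1 ^ 2)]

/-- The left-invariant vector field `X`. -/
def fieldX (g : Fin 5 → ℝ) : Fin 5 → ℝ :=
  ![1, 0, -(g 1) / 2, -(g 2) / 2 - g 0 * g 1 / 12, -(g 1 ^ 2) / 12]

/-- The left-invariant vector field `Y`. -/
def fieldY (g : Fin 5 → ℝ) : Fin 5 → ℝ :=
  ![0, 1, g 0 / 2, g 0 ^ 2 / 12, g 0 * g 1 / 12 - g 2 / 2]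

/-- `X` and `Y` are the left translates of the first two basis vectors at the unit. -/
lemma hasDerivAt_mul_X (g : Fin 5 → ℝ) :
    HasDerivAt (fun s : ℝ => mul g ![s, 0, 0, 0, 0]) (fieldX g) 0 := by
  have key : ∀ (f : ℝ → ℝ) (a b c : ℝ), (∀ s, f s = a + b * s + c * s ^ 2) → HasDerivAt f b 0 := by
    intro f a b c hf
    have h := (((hasDerivAt_id (0 : ℝ)).const_mul b).const_add a).add
      ((hasDerivAt_pow 2 (0 : ℝ)).const_mul c)
    refine (h.congr_of_eventuallyEq (Eventually.of_forall hf)).congr_deriv ?_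
    simp
  rw [hasDerivAt_pi]
  intro i
  fin_cases i
  · exact key _ (g 0) 1 0 fun s => by simp [mul]
  · exact key _ (g 1) 0 0 fun s => by simp [mul]
  · exact key _ (g 2) (-(g 1) / 2) 0 fun s => by simp [mul]; ring
  · exact key _ (g 3) (-(g 2) / 2 - g 0 * g 1 / 12) (g 1 / 12) fun s => by simp [mul]; ring
  · exact key _ (g 4) (-(g 1 ^ 2) / 12) 0 fun s => by simp [mul]; ring

lemma hasDerivAt_mul_Y (g : Fin 5 → ℝ) :
    HasDerivAt (fun s : ℝ => mul g ![0, s, 0, 0, 0]) (fieldY g) 0 := by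
  have key : ∀ (f : ℝ → ℝ) (a b c : ℝ), (∀ s, f s = a + b * s + c * s ^ 2) → HasDerivAt f b 0 := by
    intro f a b c hf
    have h := (((hasDerivAt_id (0 : ℝ)).const_mul b).const_add a).add
      ((hasDerivAt_pow 2 (0 : ℝ)).const_mul c)
    refine (h.congr_of_eventuallyEq (Eventually.of_forall hf)).congr_deriv ?_
    simp
  rw [hasDerivAt_pi]
  intro i
  fin_cases i
  · exact key _ (g 0) 0 0 fun s => by simp [mul]
  · exact key _ (g 1) 1 0 fun s => by simp [mul]
  · exact key _ (g 2) (g 0 / 2) 0 fun s => by simp [mul]; ring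
  · exact key _ (g 3) (g 0 ^ 2 / 12) 0 fun s => by simp [mul]; ring
  · exact key _ (g 4) (g 0 * g 1 / 12 - g 2 / 2) (-(g 0) / 12) fun s => by simp [mul]; ring

/-! ### Quasinorms on the plane and their polar figures -/

/-- A quasinorm on the plane: all the properties of a norm, except that homogeneity is required
for nonnegative factors only. -/
structure IsQuasinorm (F : ℝ × ℝ → ℝ) : Prop where
  nonneg : ∀ u, 0 ≤ F u
  eq_zero_iff : ∀ u, F u = 0 ↔ u = 0
  add_le : ∀ u v, F (u + v) ≤ F u + F v
  smul_eq : ∀ (c : ℝ) (u : ℝ × ℝ), 0 ≤ c → F (c • u) = c * F u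

/-- The unit ball `U` of `F`, which is the control region. -/
def unitBall (F : ℝ × ℝ → ℝ) : Set (ℝ × ℝ) := {u | F u ≤ 1}

/-- The support function `F_U(h) = max_{u ∈ U} h ⬝ u`. -/
def supportFn (F : ℝ × ℝ → ℝ) (h : ℝ × ℝ) : ℝ :=
  sSup ((fun u : ℝ × ℝ => h.1 * u.1 + h.2 * u.2) '' unitBall F)

/-- The polar figure `U* = {h | F_U(h) ≤ 1}`. -/
def polarBall (F : ℝ × ℝ → ℝ) : Set (ℝ × ℝ) := {h | supportFn F h ≤ 1}

/-- The polar equation `r = r(θ)` of the curve `F_U = 1`. -/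
def rad (F : ℝ × ℝ → ℝ) (θ : ℝ) : ℝ := 1 / supportFn F (Real.cos θ, Real.sin θ)

/-- `ρ` lies between the one-sided derivatives of `f` at `θ` (which are required to exist). -/
def BetweenOneSidedDerivs (f : ℝ → ℝ) (θ ρ : ℝ) : Prop :=
  ∃ a b : ℝ, HasDerivWithinAt f a (Iio θ) θ ∧ HasDerivWithinAt f b (Ioi θ) θ ∧ ρ ∈ uIcc a b

/-! ### Sub-Finsler length, quasimetric and metric straight lines -/

/-- `g` is a horizontal curve on `[0, T]` with measurable control `u`. -/
structure IsHorizontal (T : ℝ) (u : ℝ → ℝ × ℝ) (g : ℝ → Fin 5 → ℝ) : Prop where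
  measurable : Measurable u
  absCont : ∀ i, AbsolutelyContinuousOnInterval (fun t => g t i) 0 T
  deriv_eq : ∀ᵐ t, t ∈ Icc 0 T → ∀ i,
    HasDerivAt (fun s => g s i) ((u t).1 * fieldX (g t) i + (u t).2 * fieldY (g t) i) t

/-- The left-invariant sub-Finsler quasimetric: the infimum of the lengths `∫ F(u(t)) dt` of the
horizontal curves from `p` to `q`. -/
def sfDist (F : ℝ × ℝ → ℝ) (p q : Fin 5 → ℝ) : ENNReal :=
  sInf {L | ∃ (T : ℝ) (u : ℝ → ℝ × ℝ) (g : ℝ → Fin 5 → ℝ), 0 ≤ T ∧ IsHorizontal T u g ∧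
    g 0 = p ∧ g T = q ∧ L = ∫⁻ t in Icc 0 T, ENNReal.ofReal (F (u t))}

/-- `g` is a metric straight line: each of its arcs is a shortest one, parametrized by arc
length. -/
def IsMetricLine (F : ℝ × ℝ → ℝ) (g : ℝ → Fin 5 → ℝ) : Prop :=
  ∀ s t : ℝ, s ≤ t → sfDist F (g s) (g t) = ENNReal.ofReal (t - s)

/-! ### Extremals of the Pontryagin Maximum Principle -/

/-- The function `𝓗(g; ψ; u) = ψ(u₁ X(g) + u₂ Y(g))`. -/
def ham (g ψ : Fin 5 → ℝ) (u : ℝ × ℝ) : ℝ :=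
  ∑ i, ψ i * (u.1 * fieldX g i + u.2 * fieldY g i)

/-- `g : ℝ → G` with control `u` and covector function `ψ` satisfies the Pontryagin Maximum
Principle, the maximum of the Hamiltonian being the constant `M`. -/
structure IsExtremal (F : ℝ × ℝ → ℝ) (M : ℝ) (g ψ : ℝ → Fin 5 → ℝ) (u : ℝ → ℝ × ℝ) : Prop where
  measurable : Measurable u
  mem_unitBall : ∀ t, u t ∈ unitBall F
  absCont : ∀ i a b, AbsolutelyContinuousOnInterval (fun t => g t i) a b
  absCont_covector : ∀ i a b, AbsolutelyContinuousOnInterval (fun t => ψ t i) a b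
  covector_ne_zero : ∀ t, ψ t ≠ 0
  /-- `ẋ = ∂𝓗/∂ψ` -/
  state_eq : ∀ᵐ t, ∀ i, HasDerivAt (fun s => g s i)
    (deriv (fun p => ham (g t) (Function.update (ψ t) i p) (u t)) (ψ t i)) t
  /-- `ψ̇ = -∂𝓗/∂x` -/
  adjoint_eq : ∀ᵐ t, ∀ i, HasDerivAt (fun s => ψ s i)
    (-deriv (fun q => ham (Function.update (g t) i q) (ψ t) (u t)) (g t i)) t
  nonneg : 0 ≤ M
  isMax : ∀ᵐ t, IsMaxOn (ham (g t) (ψ t)) (unitBall F) (u t) ∧ ham (g t) (ψ t) (u t) = M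

/-- The initial data `φ₁, …, φ₅` of the normalized covector function. -/
structure InitialData where
  (φ₁ φ₂ φ₃ φ₄ φ₅ : ℝ)

/-- The initial data as a covector. -/
def InitialData.toVec (P : InitialData) : Fin 5 → ℝ := ![P.φ₁, P.φ₂, P.φ₃, P.φ₄, P.φ₅]

/-- The Casimir value `𝓔`. -/
def InitialData.casimir (P : InitialData) : ℝ := P.φ₃ ^ 2 / 2 + P.φ₁ * P.φ₅ - P.φ₂ * P.φ₄

/-- `𝓔₀ = max_{h ∈ U*} (φ₅ h₁ - φ₄ h₂)`. -/
def InitialData.casimirMax (F : ℝ × ℝ → ℝ) (P : InitialData) : ℝ :=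
  sSup ((fun h : ℝ × ℝ => P.φ₅ * h.1 - P.φ₄ * h.2) '' polarBall F)

/-- `𝓔₋₁ = min_{h ∈ U*} (φ₅ h₁ - φ₄ h₂)`. -/
def InitialData.casimirMin (F : ℝ × ℝ → ℝ) (P : InitialData) : ℝ :=
  sInf ((fun h : ℝ × ℝ => P.φ₅ * h.1 - P.φ₄ * h.2) '' polarBall F)

/-- `h₁ = ψ(X)` and `h₂ = ψ(Y)`, as functions of the point and the covector. -/
def hX (g ψ : Fin 5 → ℝ) : ℝ := ∑ i, ψ i * fieldX g i

def hY (g ψ : Fin 5 → ℝ) : ℝ := ∑ i, ψ i * fieldY g i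

/-- `g` is a normal extremal starting at the unit for a covector function `ψ` with maximum
`M > 0`; the covector function normalized to maximum `1`, that is `ψ / M`, has initial value
`(φ₁, …, φ₅)`, and `θ` is a continuous polar angle of its components
`(h₁(t), h₂(t)) = r(θ(t)) (cos θ(t), sin θ(t))`. -/
def IsNormalExtremal (F : ℝ × ℝ → ℝ) (P : InitialData) (g : ℝ → Fin 5 → ℝ) (θ : ℝ → ℝ) : Prop :=
  ∃ (M : ℝ) (ψ : ℝ → Fin 5 → ℝ) (u : ℝ → ℝ × ℝ), 0 < M ∧ IsExtremal F M g ψ u ∧ g 0 = 0 ∧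
    ψ 0 = M • P.toVec ∧ Continuous θ ∧
    ∀ t, hX (g t) (ψ t) = M * (rad F (θ t) * Real.cos (θ t)) ∧
      hY (g t) (ψ t) = M * (rad F (θ t) * Real.sin (θ t))

/-! ### The explicit formulas -/

/-- The numerator `φ₃² + 2φ₄(h₂(ξ) - φ₂) - 2φ₅(h₁(ξ) - φ₁)`. -/
def numer (F : ℝ × ℝ → ℝ) (P : InitialData) (ξ : ℝ) : ℝ :=
  P.φ₃ ^ 2 + 2 * P.φ₄ * (rad F ξ * Real.sin ξ - P.φ₂) - 2 * P.φ₅ * (rad F ξ * Real.cos ξ - P.φ₁)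

/-- The right-hand side of the equation `θ̇² = numer / r⁴`. -/
def rhs (F : ℝ × ℝ → ℝ) (P : InitialData) (ξ : ℝ) : ℝ := numer F P ξ / rad F ξ ^ 4

/-- The formulas for the curve `(x, y, z, v, w)` in terms of the function `θ`. -/
structure GivenByFormulas (F : ℝ × ℝ → ℝ) (P : InitialData) (x y z v w θ : ℝ → ℝ) : Prop where
  contDiff : ContDiff ℝ 1 θ
  init_cos : rad F (θ 0) * Real.cos (θ 0) = P.φ₁
  init_sin : rad F (θ 0) * Real.sin (θ 0) = P.φ₂
  /-- the doubled oriented area `σ(t)` of the sector has derivative `φ₃ + φ₄ x + φ₅ y` -/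
  area : ∀ t, HasDerivAt (fun s => ∫ ξ in (0 : ℝ)..θ s, rad F ξ ^ 2)
    (P.φ₃ + P.φ₄ * x t + P.φ₅ * y t) t
  deriv_theta : ∀ t, P.φ₃ + P.φ₄ * x t + P.φ₅ * y t = rad F (θ t) ^ 2 * deriv θ t
  deriv_theta_sq : ∀ t, deriv θ t ^ 2 = rhs F P (θ t)
  /-- `ρ τ` is the chosen value `r'(θ(τ))` between the one-sided derivatives of `r` -/
  xy_eq : ∃ ρ : ℝ → ℝ, Measurable ρ ∧ (∀ τ, BetweenOneSidedDerivs (rad F) (θ τ) (ρ τ)) ∧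
    (∀ t, x t = ∫ τ in (0 : ℝ)..t,
      (ρ τ * Real.sin (θ τ) + rad F (θ τ) * Real.cos (θ τ)) / rad F (θ τ) ^ 2) ∧
    (∀ t, y t = ∫ τ in (0 : ℝ)..t,
      (rad F (θ τ) * Real.sin (θ τ) - ρ τ * Real.cos (θ τ)) / rad F (θ τ) ^ 2)
  zvw_of_ne : P.φ₅ ≠ 0 → ∀ t,
    z t = (1 / P.φ₅) * (P.φ₂ + (P.φ₃ + P.φ₄ * x t / 2 + P.φ₅ * y t / 2) * x t
      - rad F (θ t) * Real.sin (θ t)) ∧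
    v t = (1 / 3) * (∫ τ in (0 : ℝ)..t, (x τ * deriv z τ - z τ * deriv x τ))
      - (1 / 6) * x t * z t ∧
    w t = 1 / (3 * P.φ₅) * (t - P.φ₁ * x t - P.φ₂ * y t - 2 * P.φ₃ * z t - 3 * P.φ₄ * v t
      - P.φ₄ / 2 * x t * z t - P.φ₅ / 2 * y t * z t)
  zvw_of_eq : P.φ₅ = 0 → ∀ t,
    z t = (1 / P.φ₄) * (P.φ₁ - (P.φ₃ + P.φ₄ * x t / 2) * y t - rad F (θ t) * Real.cos (θ t)) ∧
    v t = 1 / (3 * P.φ₄) * (t - P.φ₁ * x t - P.φ₂ * y t - 2 * P.φ₃ * z t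
      - P.φ₄ / 2 * x t * z t) ∧
    w t = (1 / 3) * (∫ τ in (0 : ℝ)..t, (y τ * deriv z τ - z τ * deriv y τ))
      - (1 / 6) * y t * z t

/-- The integrand of `t(θ)` in the case `φ₃ ≠ 0`. -/
def integrand (F : ℝ × ℝ → ℝ) (P : InitialData) (ξ : ℝ) : ℝ :=
  rad F ξ ^ 2 / (P.φ₃ * Real.sqrt (1 + 2 * P.φ₄ / P.φ₃ ^ 2 * (rad F ξ * Real.sin ξ - P.φ₂)
    - 2 * P.φ₅ / P.φ₃ ^ 2 * (rad F ξ * Real.cos ξ - P.φ₁)))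

/-- The function `t(θ)` in the case `φ₃ ≠ 0`. -/
def timeFn (F : ℝ × ℝ → ℝ) (P : InitialData) (θ₀ θ : ℝ) : ℝ := ∫ ξ in θ₀..θ, integrand F P ξ

/-- The integrand of `t(θ)` in the case `φ₃ = 0`. -/
def integrand₀ (F : ℝ × ℝ → ℝ) (P : InitialData) (ξ : ℝ) : ℝ :=
  rad F ξ ^ 2 / Real.sqrt (2 * P.φ₄ * (rad F ξ * Real.sin ξ - P.φ₂)
    - 2 * P.φ₅ * (rad F ξ * Real.cos ξ - P.φ₁))

/-- The function `t(θ)` in the case `φ₃ = 0`, with sign `+` for `θ > θ₀` and `-` for `θ < θ₀`. -/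
def timeFn₀ (F : ℝ × ℝ → ℝ) (P : InitialData) (θ₀ θ : ℝ) : ℝ :=
  (if θ₀ < θ then 1 else -1) * ∫ ξ in θ₀..θ, integrand₀ F P ξ

/-- The improper integral of `f` from `a` to `b` is finite. (It is used for functions that are
continuous and of constant sign on the open interval between `a` and `b`.) -/
def FiniteIntegral (f : ℝ → ℝ) (a b : ℝ) : Prop := IntervalIntegrable f volume a b

/-- In the case `φ₃ = 0`: `t(θ)` is finite for `θ ↗ θ₀`. -/
def FiniteLeft (F : ℝ × ℝ → ℝ) (P : InitialData) (θ₀ : ℝ) : Prop :=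
  ∃ η < θ₀, FiniteIntegral (integrand₀ F P) η θ₀

/-- In the case `φ₃ = 0`: `t(θ)` is finite for `θ ↘ θ₀`. -/
def FiniteRight (F : ℝ × ℝ → ℝ) (P : InitialData) (θ₀ : ℝ) : Prop :=
  ∃ η > θ₀, FiniteIntegral (integrand₀ F P) θ₀ η

/-- The four cases in which `φ₃ = 0`, `𝓔 = 𝓔₀` force `θ` to be constant; `[θ₁, θ₂]` is the largest
segment containing `θ₀` on which `φ₅ h₁ - φ₄ h₂` is constant. -/
def Rigid (F : ℝ × ℝ → ℝ) (P : InitialData) (θ₀ θ₁ θ₂ : ℝ) : Prop :=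
  (θ₁ = θ₀ ∧ θ₀ = θ₂ ∧ ¬ FiniteLeft F P θ₀ ∧ ¬ FiniteRight F P θ₀) ∨
  (θ₁ < θ₀ ∧ θ₀ < θ₂) ∨
  (θ₀ = θ₁ ∧ θ₁ < θ₂ ∧ ¬ FiniteLeft F P θ₀) ∨
  (θ₀ = θ₂ ∧ θ₁ < θ₂ ∧ ¬ FiniteRight F P θ₀)

/-- `θ` leaves the right end `θ₀` of the segment and reaches the next segment in finite time. -/
def ReachesRight (F : ℝ × ℝ → ℝ) (P : InitialData) (θ₀ θ₁ θ₂ : ℝ) : Prop :=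
  θ₁ < θ₀ ∧ θ₀ = θ₂ ∧ FiniteRight F P θ₀ ∧
    FiniteIntegral (integrand₀ F P) θ₀ (θ₁ + 2 * Real.pi)

/-- `θ` leaves the left end `θ₀` of the segment and reaches the next segment in finite time. -/
def ReachesLeft (F : ℝ × ℝ → ℝ) (P : InitialData) (θ₀ θ₁ θ₂ : ℝ) : Prop :=
  θ₀ = θ₁ ∧ θ₁ < θ₂ ∧ FiniteLeft F P θ₀ ∧
    FiniteIntegral (integrand₀ F P) (θ₂ - 2 * Real.pi) θ₀

/-- The segment is one point, which can be left and reached on both sides in finite time. -/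
def ReachesBoth (F : ℝ × ℝ → ℝ) (P : InitialData) (θ₀ θ₁ θ₂ : ℝ) : Prop :=
  θ₀ = θ₁ ∧ θ₁ = θ₂ ∧ FiniteLeft F P θ₀ ∧ FiniteRight F P θ₀

/-- The one-parameter subgroups that occur as extremals with constant `θ`. -/
def IsLineExtremal (F : ℝ × ℝ → ℝ) (P : InitialData) (g : ℝ → Fin 5 → ℝ) : Prop :=
  ∃ s : ℝ, (s = 1 ∨ s = -1) ∧
    (P.φ₅ = 0 → ∀ t, g t = ![0, s * t / F (0, s), 0, 0, 0]) ∧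
    (P.φ₄ = 0 → ∀ t, g t = ![s * t / F (s, 0), 0, 0, 0, 0]) ∧
    (P.φ₄ ≠ 0 → P.φ₅ ≠ 0 → ∀ t,
      g t = ![s * P.φ₅ * t / F (s * P.φ₅, -s * P.φ₄),
        -P.φ₄ * (s * P.φ₅ * t / F (s * P.φ₅, -s * P.φ₄)) / P.φ₅, 0, 0, 0])

/-- The period and the reflection symmetries of an oscillating function `θ`. -/
def Oscillates (θ : ℝ → ℝ) (t₁ t₂ : ℝ) : Prop :=
  t₁ < t₂ ∧ ∀ t : ℝ,
    (∀ k : ℤ, θ (t + 2 * k * (t₂ - t₁)) = θ t) ∧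
    deriv θ (t₁ + t) = -deriv θ (t₁ - t) ∧ deriv θ (t₂ + t) = -deriv θ (t₂ - t) ∧
    θ (t₁ + t) = θ (t₁ - t) ∧ θ (t₂ + t) = θ (t₂ - t)

/-- The formulas valid on an interval `J = [a, b]` of constancy of `θ`, for `t₀ ∈ J` and
`x₀ = x(t₀), …, w₀ = w(t₀)`. For `φ₃ = 0` they take their simpler form. -/
def PauseFormulas (P : InitialData) (a b : ℝ) (x y z v w : ℝ → ℝ) : Prop :=
  P.casimir ≠ 0 ∧ ∀ t₀ ∈ Icc a b, ∀ t ∈ Icc a b,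
    (P.φ₅ ≠ 0 →
      x t = x t₀ + P.φ₅ / P.casimir * (t - t₀) ∧
      y t = -(P.φ₄ / P.casimir) * (t - t₀) - (1 / P.φ₅) * (P.φ₃ + P.φ₄ * x t₀) ∧
      z t = z t₀ + P.φ₃ / (2 * P.casimir) * (t - t₀) ∧
      v t = v t₀ - P.φ₃ * P.φ₅ / (12 * P.casimir ^ 2) * (t - t₀) ^ 2
        + 1 / (12 * P.casimir) * (P.φ₃ * x t₀ - 6 * P.φ₅ * z t₀) * (t - t₀) ∧
      w t = w t₀ + P.φ₃ * P.φ₄ / (12 * P.casimir ^ 2) * (t - t₀) ^ 2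
        + 1 / (12 * P.φ₅ * P.casimir)
          * (6 * P.φ₄ * P.φ₅ * z t₀ - P.φ₃ * P.φ₄ * x t₀ - P.φ₃ ^ 2) * (t - t₀)) ∧
    (P.φ₅ = 0 →
      x t = -(P.φ₃ / P.φ₄) ∧
      y t = y t₀ - P.φ₄ / P.casimir * (t - t₀) ∧
      z t = z t₀ + P.φ₃ / (2 * P.casimir) * (t - t₀) ∧
      v t = v t₀ - P.φ₃ ^ 2 / (12 * P.φ₄ * P.casimir) * (t - t₀) ∧
      w t = w t₀ + P.φ₃ * P.φ₄ / (12 * P.casimir ^ 2) * (t - t₀) ^ 2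
        + 1 / (12 * P.casimir) * (P.φ₃ * y t₀ + 6 * P.φ₄ * z t₀) * (t - t₀))

/-- `[a, b]` is a maximal segment on which `θ` is equal to `c`. -/
def IsMaximalPause (θ : ℝ → ℝ) (c a b : ℝ) : Prop :=
  (∀ t ∈ Icc a b, θ t = c) ∧
    ∀ a' b', a' ≤ a → b ≤ b' → (∀ t ∈ Icc a' b', θ t = c) → a' = a ∧ b' = b

/-- For the data `P` and `θ(0) = θ₀`, the function `θ` is not unique; its constant values on
non-degenerate segments belong to `S`, and on such segments the explicit formulas are valid; each
value in `S` is taken, for some extremal, on a maximal segment of any prescribed length. -/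
def NonUniqueWithPauses (F : ℝ × ℝ → ℝ) (P : InitialData) (θ₀ : ℝ) (S : Set ℝ) : Prop :=
  (∃ g g' θ θ', IsNormalExtremal F P g θ ∧ IsNormalExtremal F P g' θ' ∧ θ 0 = θ₀ ∧ θ' 0 = θ₀ ∧
    θ ≠ θ') ∧
  (∀ g θ, IsNormalExtremal F P g θ → θ 0 = θ₀ → ∀ a b c : ℝ, a < b →
    (∀ t ∈ Icc a b, θ t = c) → c ∈ S ∧
      PauseFormulas P a b (fun t => g t 0) (fun t => g t 1) (fun t => g t 2) (fun t => g t 3)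
        (fun t => g t 4)) ∧
  (∀ c ∈ S, ∀ ℓ : ℝ, 0 < ℓ → ∃ g θ, IsNormalExtremal F P g θ ∧ θ 0 = θ₀ ∧
    ∃ a, IsMaximalPause θ c a (a + ℓ))

/-- `θ` is strictly monotone on each of the segments `[a n, b n]`, `n ∈ ℤ`, and takes the constant
value `p n` on the segment `[b n, a (n + 1)]` of length `ℓ n`; these segments cover the line. So
`θ` increases or decreases on `[a n, b n]` according to the sign of `p n - p (n - 1)`. -/
structure FollowsItinerary (θ : ℝ → ℝ) (p ℓ a b : ℤ → ℝ) : Prop where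
  lt : ∀ n, a n < b n
  next : ∀ n, a (n + 1) = b n + ℓ n
  tendsto_top : Tendsto a atTop atTop
  tendsto_bot : Tendsto a atBot atBot
  pause : ∀ n, ∀ t ∈ Icc (b n) (a (n + 1)), θ t = p n
  move : ∀ n, StrictMonoOn θ (Icc (a n) (b n)) ∨ StrictAntiOn θ (Icc (a n) (b n))

end SubFinslerCartan

end

open SubFinslerCartan

open scoped Topology NNReal Interval

noncomputable section

namespace SubFinslerCartan

section

/-! ### Duality of quasinorms -/

/-! Everything is reduced to a scalar equation for the polar angle. Let h₃ = φ₃ + φ₄x + φ₅y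
(`InitialData.hZ`). Along an extremal ḣ₁ = -u₂h₃, ḣ₂ = u₁h₃, ḣ₃ = φ₄u₁ + φ₅u₂, the maximum condition
says h₁u₁ + h₂u₂ = 1 with u in the ball, and the area law is r²θ̇ = h₃. These equations integrate
explicitly in terms of the coordinates (`Traj.bdry_fst`, `Traj.bdry_snd`, `Traj.time_eq`), which
gives the formulas for z, v, w. They also conserve 𝓔 = h₃²/2 + φ₅h₁ - φ₄h₂, so that h₃² = N(θ)
(`Traj.numer_eq_of_init`) and |θ̇| = √N(θ)/r(θ)² (`speed`).

No smoothness of F is available. The face of the ball dual to a boundary point of the polar figure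
is described by the one-sided derivatives of r (`face_iff`). The velocity of the boundary curve
follows from the fact that its pairing with a fixed maximizing control has a maximum at the instant
considered (`bdry_velocity`). The structure `Traj` collects the resulting system, with the maximum
condition at every time; `isNormalExtremal_iff` and `GivenByFormulas.exists_traj` show that nothing
is lost.

Since N = 2(𝓔 - `level`), where `level` is φ₅h₁ - φ₄h₂ along the boundary, the position of 𝓔
relative to 𝓔₋₁ and 𝓔₀ decides the behaviour. Above 𝓔₀ the speed never vanishes, and θ inverts the
time integral. At 𝓔₋₁ the inequality N ≤ 0 forces h₃ = 0, so θ is constant and the control is a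
constant multiple of (φ₅, -φ₄); a linear function of (x, y) calibrates the resulting line
(`isMetricLine_of_linear`). Strictly between the two values ḣ₃ cannot vanish at a zero of N, because
ḣ₃ = 0 makes u parallel to (φ₅, -φ₄), which happens only at an extreme level
(`level_extremal_of_kap_eq_zero`). By compactness the zeros of N are then simple
(`exists_numer_bound`), the time integrals converge like that of an inverse square root, and a
rescaled time phase of θ rotates uniformly (`Traj.oscillates`); periodicity and reflections are read
off from the cosine.

At 𝓔₀ one has N ≥ 0, with one closed arc of zeros (possibly a point) in each period. Here the scalar
equation |θ'| = f(θ), with the right initial value and derivative, is also sufficient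
(`exists_isNormalExtremal_of_isSol`): at the maximal level the control (φ₅, -φ₄)/𝓔₀ is admissible
and keeps h₃ at rest. All existence statements become constructions of scalar solutions: a monotone
profile between neighbouring zeros (`exists_profile`) is folded, paused, translated and glued
(`Profile.exists_pause_right`, `Profile.exists_itinerary`). The restrictions come from two facts: a
passage through an interval without zeros makes its time integral finite
(`IsSol.intervalIntegrable`), and a non-degenerate segment of zeros cannot be crossed
(`IsSol.barrier`). -/

/-- The pairing of a covector and a vector of the plane. -/
def dot (h u : ℝ × ℝ) : ℝ := h.1 * u.1 + h.2 * u.2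

lemma dot_add_left (h k u : ℝ × ℝ) : dot (h + k) u = dot h u + dot k u := by
  simp [dot]; ring

lemma dot_smul_left (c : ℝ) (h u : ℝ × ℝ) : dot (c • h) u = c * dot h u := by
  simp [dot]; ring

lemma dot_smul_right (c : ℝ) (h u : ℝ × ℝ) : dot h (c • u) = c * dot h u := by
  simp [dot]; ring

lemma continuous_dot (h : ℝ × ℝ) : Continuous (dot h) := by
  unfold dot; fun_prop

namespace IsQuasinorm

variable {F : ℝ × ℝ → ℝ}

lemma map_zero (hF : IsQuasinorm F) : F 0 = 0 := (hF.eq_zero_iff 0).2 rfl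

lemma pos (hF : IsQuasinorm F) {u : ℝ × ℝ} (hu : u ≠ 0) : 0 < F u :=
  lt_of_le_of_ne (hF.nonneg u) fun h => hu ((hF.eq_zero_iff u).1 h.symm)

lemma convexOn (hF : IsQuasinorm F) : ConvexOn ℝ univ F := by
  refine ⟨convex_univ, fun u _ v _ a b ha hb _ => ?_⟩
  calc F (a • u + b • v) ≤ F (a • u) + F (b • v) := hF.add_le _ _
    _ = a • F u + b • F v := by rw [hF.smul_eq _ _ ha, hF.smul_eq _ _ hb]; rfl

lemma continuous (hF : IsQuasinorm F) : Continuous F := hF.convexOn.locallyLipschitz.continuous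

lemma exists_lower_bound (hF : IsQuasinorm F) : ∃ m > 0, ∀ u, m * ‖u‖ ≤ F u := by
  obtain ⟨u₀, hu₀, hmin⟩ := (isCompact_sphere (0 : ℝ × ℝ) 1).exists_isMinOn
    ⟨((1 : ℝ), (0 : ℝ)), by simp [Prod.norm_def]⟩ hF.continuous.continuousOn
  have hne : u₀ ≠ 0 := by
    rintro rfl; simp at hu₀
  refine ⟨F u₀, hF.pos hne, fun u => ?_⟩
  rcases eq_or_ne u 0 with rfl | hu
  · simp [hF.map_zero]
  have hn : 0 < ‖u‖ := norm_pos_iff.2 hu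
  have h1 : F u₀ ≤ F (‖u‖⁻¹ • u) := hmin (by simp [norm_smul, hn.ne'])
  rw [hF.smul_eq _ _ (inv_nonneg.2 hn.le)] at h1
  calc F u₀ * ‖u‖ ≤ ‖u‖⁻¹ * F u * ‖u‖ := by gcongr
    _ = F u := by field_simp

lemma exists_upper_bound (hF : IsQuasinorm F) : ∃ C > 0, ∀ u, F u ≤ C * ‖u‖ := by
  obtain ⟨u₀, hu₀, hmax⟩ := (isCompact_sphere (0 : ℝ × ℝ) 1).exists_isMaxOn
    ⟨((1 : ℝ), (0 : ℝ)), by simp [Prod.norm_def]⟩ hF.continuous.continuousOn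
  have hne : u₀ ≠ 0 := by
    rintro rfl; simp at hu₀
  refine ⟨F u₀, hF.pos hne, fun u => ?_⟩
  rcases eq_or_ne u 0 with rfl | hu
  · simp [hF.map_zero]
  have hn : 0 < ‖u‖ := norm_pos_iff.2 hu
  have h1 : F (‖u‖⁻¹ • u) ≤ F u₀ := hmax (by simp [norm_smul, hn.ne'])
  rw [hF.smul_eq _ _ (inv_nonneg.2 hn.le)] at h1
  calc F u = ‖u‖⁻¹ * F u * ‖u‖ := by field_simp
    _ ≤ F u₀ * ‖u‖ := by gcongr

/-- Subadditivity is applied to `v - u` and to `u - v` separately, because `F` need not be even; the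
upper bound controls both. -/
lemma exists_lipschitz (hF : IsQuasinorm F) : ∃ C > 0, ∀ u v, |F u - F v| ≤ C * ‖u - v‖ := by
  obtain ⟨C, hC, h⟩ := hF.exists_upper_bound
  refine ⟨C, hC, fun u v => abs_le.2 ⟨?_, ?_⟩⟩
  · have h1 := hF.add_le u (v - u)
    have h2 := h (v - u)
    rw [norm_sub_rev] at h2
    rw [add_sub_cancel] at h1
    linarith
  · have h1 := hF.add_le v (u - v)
    have h2 := h (u - v)
    rw [add_sub_cancel] at h1
    linarith

lemma isCompact_unitBall (hF : IsQuasinorm F) : IsCompact (unitBall F) := by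
  refine Metric.isCompact_of_isClosed_isBounded
    (isClosed_le hF.continuous continuous_const) ?_
  obtain ⟨m, hm, h⟩ := hF.exists_lower_bound
  refine (Metric.isBounded_closedBall (x := (0 : ℝ × ℝ)) (r := 1 / m)).subset fun u hu => ?_
  have h1 : m * ‖u‖ ≤ 1 := (h u).trans hu
  simp only [Metric.mem_closedBall, dist_zero_right]
  rw [le_div_iff₀ hm]; linarith

lemma zero_mem_unitBall (hF : IsQuasinorm F) : (0 : ℝ × ℝ) ∈ unitBall F := by
  simp [unitBall, hF.map_zero]

lemma convex_unitBall (hF : IsQuasinorm F) : Convex ℝ (unitBall F) := by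
  simpa [unitBall] using hF.convexOn.convex_le 1

lemma exists_smul_mem_unitBall (hF : IsQuasinorm F) (u : ℝ × ℝ) : ∃ c > (0 : ℝ), c • u ∈ unitBall F := by
  refine ⟨1 / (F u + 1), by have := hF.nonneg u; positivity, ?_⟩
  have := hF.nonneg u
  simp only [unitBall, mem_ofPred_eq]
  rw [hF.smul_eq _ _ (by positivity), one_div_mul_eq_div, div_le_one (by positivity)]
  linarith

lemma dot_le_supportFn (hF : IsQuasinorm F) (h : ℝ × ℝ) {u : ℝ × ℝ} (hu : u ∈ unitBall F) :
    dot h u ≤ supportFn F h :=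
  le_csSup (hF.isCompact_unitBall.bddAbove_image (continuous_dot h).continuousOn) ⟨u, hu, rfl⟩

lemma exists_dot_eq_supportFn (hF : IsQuasinorm F) (h : ℝ × ℝ) :
    ∃ u ∈ unitBall F, dot h u = supportFn F h :=
  (hF.isCompact_unitBall.image (continuous_dot h)).sSup_mem
    ⟨_, mem_image_of_mem _ hF.zero_mem_unitBall⟩

lemma supportFn_le (hF : IsQuasinorm F) {h : ℝ × ℝ} {c : ℝ} (H : ∀ u ∈ unitBall F, dot h u ≤ c) :
    supportFn F h ≤ c := by
  obtain ⟨u, hu, h1⟩ := hF.exists_dot_eq_supportFn h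
  exact h1 ▸ H u hu

/-- Duality stays inside the class of quasinorms, so continuity, compactness of the unit ball and
the two-sided bounds transfer to the polar figure at once. Definiteness holds because the ball
contains a positive multiple of `h` itself. -/
lemma isQuasinorm_supportFn (hF : IsQuasinorm F) : IsQuasinorm (supportFn F) where
  nonneg h := by
    simpa [dot] using hF.dot_le_supportFn h hF.zero_mem_unitBall
  eq_zero_iff h := by
    constructor
    · intro h0
      obtain ⟨c, hc, hm⟩ := hF.exists_smul_mem_unitBall h
      have h1 := hF.dot_le_supportFn h hm
      rw [h0, dot_smul_right] at h1
      have h2 : dot h h ≤ 0 := by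
        by_contra! h3
        exact absurd h1 (not_le.2 (mul_pos hc h3))
      unfold dot at h2
      have h3 : h.1 = 0 := by nlinarith [mul_self_nonneg h.1, mul_self_nonneg h.2]
      have h4 : h.2 = 0 := by nlinarith [mul_self_nonneg h.1, mul_self_nonneg h.2]
      exact Prod.ext h3 h4
    · rintro rfl
      obtain ⟨u, hu, h1⟩ := hF.exists_dot_eq_supportFn 0
      rw [← h1]; simp [dot]
  add_le h k := by
    refine hF.supportFn_le fun u hu => ?_
    rw [dot_add_left]
    exact add_le_add (hF.dot_le_supportFn h hu) (hF.dot_le_supportFn k hu)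
  smul_eq c h hc := by
    obtain ⟨u, hu, h1⟩ := hF.exists_dot_eq_supportFn h
    refine le_antisymm (hF.supportFn_le fun v hv => ?_) ?_
    · rw [dot_smul_left]
      exact mul_le_mul_of_nonneg_left (hF.dot_le_supportFn h hv) hc
    · rw [← h1, ← dot_smul_left]
      exact hF.dot_le_supportFn _ hu

lemma isCompact_polarBall (hF : IsQuasinorm F) : IsCompact (polarBall F) :=
  hF.isQuasinorm_supportFn.isCompact_unitBall

lemma mem_polarBall_iff (hF : IsQuasinorm F) {h : ℝ × ℝ} :
    h ∈ polarBall F ↔ ∀ u ∈ unitBall F, dot h u ≤ 1 :=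
  ⟨fun hh _ hu => (hF.dot_le_supportFn h hu).trans hh, fun H => hF.supportFn_le H⟩

lemma dot_le_mul (hF : IsQuasinorm F) (h u : ℝ × ℝ) : dot h u ≤ supportFn F h * F u := by
  rcases eq_or_ne u 0 with rfl | hu
  · simp [dot, hF.map_zero]
  have h0 := hF.pos hu
  have h1 : (F u)⁻¹ • u ∈ unitBall F := by
    simp only [unitBall, mem_ofPred_eq]
    rw [hF.smul_eq _ _ (inv_nonneg.2 h0.le), inv_mul_cancel₀ h0.ne']
  have h2 := hF.dot_le_supportFn h h1
  rw [dot_smul_right, inv_mul_le_iff₀ h0] at h2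
  linarith

/-- The bipolar theorem. -/
lemma mem_unitBall_of_dot_le (hF : IsQuasinorm F) {u : ℝ × ℝ}
    (hu : ∀ h, dot h u ≤ supportFn F h) : u ∈ unitBall F := by
  by_contra hn
  -- A functional separating `u` from the closed convex ball is pairing with the covector of its
  -- values on the standard basis; that covector violates the assumption.
  obtain ⟨f, c, h1, h2⟩ := geometric_hahn_banach_closed_point hF.convex_unitBall
    hF.isCompact_unitBall.isClosed hn
  have key : ∀ v, f v = dot (f (1, 0), f (0, 1)) v := by
    intro v
    have : v = v.1 • ((1 : ℝ), (0 : ℝ)) + v.2 • ((0 : ℝ), (1 : ℝ)) := by ext <;> simp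
    conv_lhs => rw [this]
    rw [map_add, map_smul, map_smul]
    simp [dot]; ring
  have h3 : supportFn F (f (1, 0), f (0, 1)) ≤ c :=
    hF.supportFn_le fun v hv => by rw [← key]; exact (h1 v hv).le
  have h4 := hu (f (1, 0), f (0, 1))
  rw [← key] at h4
  linarith

lemma mem_unitBall_of_dot_le_one (hF : IsQuasinorm F) {u : ℝ × ℝ}
    (hu : ∀ h ∈ polarBall F, dot h u ≤ 1) : u ∈ unitBall F := by
  have hH := hF.isQuasinorm_supportFn
  refine hF.mem_unitBall_of_dot_le fun h => ?_
  rcases eq_or_ne h 0 with rfl | hne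
  · simp [dot, hH.map_zero]
  have h0 := hH.pos hne
  have h1 := hu ((supportFn F h)⁻¹ • h) (by
    simp only [polarBall, mem_ofPred_eq]
    rw [hH.smul_eq _ _ (inv_nonneg.2 h0.le), inv_mul_cancel₀ h0.ne'])
  rw [dot_smul_left, inv_mul_le_iff₀ h0] at h1
  linarith

end IsQuasinorm

/-! ### The boundary of the polar figure in polar coordinates -/

/-- The point of the curve `F_U = 1` with polar angle `ξ`. -/
def bdry (F : ℝ × ℝ → ℝ) (ξ : ℝ) : ℝ × ℝ := (rad F ξ * Real.cos ξ, rad F ξ * Real.sin ξ)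

section bdry

variable {F : ℝ × ℝ → ℝ}

lemma cos_sin_ne_zero (ξ : ℝ) : ((Real.cos ξ, Real.sin ξ) : ℝ × ℝ) ≠ 0 := by
  intro h
  have h1 : Real.cos ξ = 0 := congrArg Prod.fst h
  have h2 : Real.sin ξ = 0 := congrArg Prod.snd h
  have := Real.sin_sq_add_cos_sq ξ
  rw [h1, h2] at this
  norm_num at this

lemma supportFn_cos_sin_pos (hF : IsQuasinorm F) (ξ : ℝ) :
    0 < supportFn F (Real.cos ξ, Real.sin ξ) :=
  hF.isQuasinorm_supportFn.pos (cos_sin_ne_zero ξ)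

lemma rad_pos (hF : IsQuasinorm F) (ξ : ℝ) : 0 < rad F ξ :=
  one_div_pos.2 (supportFn_cos_sin_pos hF ξ)

lemma rad_add_int_mul_two_pi (F : ℝ × ℝ → ℝ) (ξ : ℝ) (k : ℤ) :
    rad F (ξ + 2 * Real.pi * k) = rad F ξ := by
  have : ξ + 2 * Real.pi * k = ξ + k * (2 * Real.pi) := by ring
  simp [rad, this]

lemma bdry_add_int_mul_two_pi (F : ℝ × ℝ → ℝ) (ξ : ℝ) (k : ℤ) :
    bdry F (ξ + 2 * Real.pi * k) = bdry F ξ := by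
  have : ξ + 2 * Real.pi * k = ξ + k * (2 * Real.pi) := by ring
  simp only [bdry, rad_add_int_mul_two_pi]
  simp [this]

lemma bdry_eq_smul (F : ℝ × ℝ → ℝ) (ξ : ℝ) :
    bdry F ξ = rad F ξ • ((Real.cos ξ, Real.sin ξ) : ℝ × ℝ) := by
  simp [bdry]

lemma supportFn_bdry (hF : IsQuasinorm F) (ξ : ℝ) : supportFn F (bdry F ξ) = 1 := by
  rw [bdry_eq_smul, hF.isQuasinorm_supportFn.smul_eq _ _ (rad_pos hF ξ).le, rad]
  exact one_div_mul_cancel (supportFn_cos_sin_pos hF ξ).ne'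

lemma bdry_mem_polarBall (hF : IsQuasinorm F) (ξ : ℝ) : bdry F ξ ∈ polarBall F :=
  (supportFn_bdry hF ξ).le

lemma dot_bdry_le_one (hF : IsQuasinorm F) (ξ : ℝ) {u : ℝ × ℝ} (hu : u ∈ unitBall F) :
    dot (bdry F ξ) u ≤ 1 :=
  hF.mem_polarBall_iff.1 (bdry_mem_polarBall hF ξ) u hu

lemma exists_polar (h : ℝ × ℝ) : ∃ ξ ρ : ℝ, 0 ≤ ρ ∧ h = ρ • ((Real.cos ξ, Real.sin ξ) : ℝ × ℝ) := by
  refine ⟨Complex.arg ⟨h.1, h.2⟩, ‖(⟨h.1, h.2⟩ : ℂ)‖, norm_nonneg _, ?_⟩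
  ext
  · simp [Complex.norm_mul_cos_arg]
  · simp [Complex.norm_mul_sin_arg]

lemma eq_bdry_of_smul (hF : IsQuasinorm F) {h : ℝ × ℝ} (hh : supportFn F h = 1) {ξ ρ : ℝ}
    (hρ : 0 ≤ ρ) (e : h = ρ • ((Real.cos ξ, Real.sin ξ) : ℝ × ℝ)) : h = bdry F ξ := by
  have h1 := hh
  rw [e, hF.isQuasinorm_supportFn.smul_eq _ _ hρ] at h1
  have h2 : ρ = rad F ξ := by
    rw [rad, eq_div_iff (supportFn_cos_sin_pos hF ξ).ne']; exact h1
  rw [e, bdry_eq_smul, h2]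

lemma exists_eq_bdry (hF : IsQuasinorm F) {h : ℝ × ℝ} (hh : supportFn F h = 1) :
    ∃ ξ, h = bdry F ξ := by
  obtain ⟨ξ, ρ, hρ, e⟩ := exists_polar h
  exact ⟨ξ, eq_bdry_of_smul hF hh hρ e⟩

lemma exists_rad_bounds (hF : IsQuasinorm F) : ∃ m > 0, ∃ M > 0, ∀ ξ, m ≤ rad F ξ ∧ rad F ξ ≤ M := by
  obtain ⟨a, ha, h1⟩ := hF.isQuasinorm_supportFn.exists_lower_bound
  obtain ⟨b, hb, h2⟩ := hF.isQuasinorm_supportFn.exists_upper_bound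
  -- The norm of `ℝ × ℝ` is the maximum norm, so points of the Euclidean unit circle have norm
  -- between 1/2 and 1 rather than equal to 1.
  have hn1 : ∀ ξ, ‖((Real.cos ξ, Real.sin ξ) : ℝ × ℝ)‖ ≤ 1 := fun ξ => by
    simp [Prod.norm_def, Real.abs_cos_le_one, Real.abs_sin_le_one]
  have hn2 : ∀ ξ, 1 / 2 ≤ ‖((Real.cos ξ, Real.sin ξ) : ℝ × ℝ)‖ := fun ξ => by
    by_contra! h
    simp only [Prod.norm_def, sup_lt_iff, Real.norm_eq_abs] at h
    have h3 := Real.sin_sq_add_cos_sq ξ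
    have h4 := sq_lt_sq' (abs_lt.1 h.1).1 (abs_lt.1 h.1).2
    have h5 := sq_lt_sq' (abs_lt.1 h.2).1 (abs_lt.1 h.2).2
    nlinarith
  refine ⟨1 / b, by positivity, 1 / (a / 2), by positivity, fun ξ => ⟨?_, ?_⟩⟩
  · refine one_div_le_one_div_of_le (supportFn_cos_sin_pos hF ξ) ((h2 _).trans ?_)
    nlinarith [hn1 ξ]
  · refine one_div_le_one_div_of_le (by positivity) (le_trans ?_ (h1 _))
    nlinarith [hn2 ξ]

lemma exists_rad_lipschitz (hF : IsQuasinorm F) : ∃ K > 0, ∀ ξ η, |rad F ξ - rad F η| ≤ K * |ξ - η| := by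
  obtain ⟨C, hC, h1⟩ := hF.isQuasinorm_supportFn.exists_lipschitz
  obtain ⟨m, hm, M, hM, hb⟩ := exists_rad_bounds hF
  refine ⟨M * M * C, by positivity, fun ξ η => ?_⟩
  have e1 := supportFn_cos_sin_pos hF ξ
  have e2 := supportFn_cos_sin_pos hF η
  have e : rad F ξ - rad F η = rad F ξ * rad F η *
      (supportFn F (Real.cos η, Real.sin η) - supportFn F (Real.cos ξ, Real.sin ξ)) := by
    unfold rad; field_simp
  have h2 : ‖((Real.cos η, Real.sin η) : ℝ × ℝ) - (Real.cos ξ, Real.sin ξ)‖ ≤ |ξ - η| := by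
    rw [abs_sub_comm]
    simp only [Prod.mk_sub_mk, Prod.norm_def, sup_le_iff, Real.norm_eq_abs]
    exact ⟨Real.abs_cos_sub_cos_le η ξ, Real.abs_sin_sub_sin_le η ξ⟩
  have p1 := (rad_pos hF ξ).le
  have p2 := (rad_pos hF η).le
  rw [e, abs_mul, abs_mul, abs_of_nonneg p1, abs_of_nonneg p2, mul_assoc (M * M)]
  gcongr
  · exact (hb ξ).2
  · exact (hb η).2
  · exact (h1 _ _).trans (by gcongr)

lemma continuous_rad (hF : IsQuasinorm F) : Continuous (rad F) := by
  obtain ⟨K, hK, h⟩ := exists_rad_lipschitz hF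
  exact (LipschitzWith.of_dist_le_mul (K := K.toNNReal) fun ξ η => by
    simpa [Real.dist_eq, hK.le] using h ξ η).continuous

/-- The boundary may have corners; Lipschitz continuity is what makes its composition with a
continuously differentiable angle absolutely continuous. -/
lemma exists_bdry_lipschitz (hF : IsQuasinorm F) : ∃ K : ℝ≥0,
    LipschitzWith K (fun ξ => (bdry F ξ).1) ∧ LipschitzWith K (fun ξ => (bdry F ξ).2) := by
  obtain ⟨K, hK, h⟩ := exists_rad_lipschitz hF
  obtain ⟨m, hm, M, hM, hb⟩ := exists_rad_bounds hF
  have key : ∀ c : ℝ → ℝ, (∀ ξ, |c ξ| ≤ 1) → (∀ ξ η, |c ξ - c η| ≤ |ξ - η|) → ∀ ξ η,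
      |rad F ξ * c ξ - rad F η * c η| ≤ (K + M) * |ξ - η| := by
    intro c h1 h2 ξ η
    have e : rad F ξ * c ξ - rad F η * c η = (rad F ξ - rad F η) * c ξ + rad F η * (c ξ - c η) := by
      ring
    rw [e]
    refine (abs_add_le _ _).trans ?_
    rw [abs_mul, abs_mul, abs_of_pos (rad_pos hF η), add_mul]
    refine add_le_add ?_ (mul_le_mul (hb η).2 (h2 ξ η) (abs_nonneg _) hM.le)
    calc _ ≤ K * |ξ - η| * 1 := by gcongr; exacts [h ξ η, h1 ξ]
        _ = _ := by ring
  refine ⟨(K + M).toNNReal, LipschitzWith.of_dist_le_mul fun ξ η => ?_,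
    LipschitzWith.of_dist_le_mul fun ξ η => ?_⟩ <;>
  · rw [Real.dist_eq, Real.dist_eq, Real.coe_toNNReal _ (by positivity)]
    apply key
    · intro; simp [Real.abs_cos_le_one, Real.abs_sin_le_one]
    · intro ξ η
      first | exact Real.abs_cos_sub_cos_le ξ η | exact Real.abs_sin_sub_sin_le ξ η

lemma continuous_bdry (hF : IsQuasinorm F) : Continuous (bdry F) := by
  have := continuous_rad hF
  unfold bdry; fun_prop

end bdry

end

section

/-! ### One-sided derivatives of the polar radius and faces of the unit ball -/

/-- The slopes of chords from `x` are monotone and tend to `a` and `b` on the two sides, so the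
slopes of supporting lines fill exactly the interval between the one-sided derivatives. -/
lemma ConvexOn.forall_add_mul_le_iff {φ : ℝ → ℝ} (hφ : ConvexOn ℝ univ φ) {x a b m : ℝ}
    (ha : HasDerivWithinAt φ a (Iio x) x) (hb : HasDerivWithinAt φ b (Ioi x) x) :
    (∀ s, φ x + m * (s - x) ≤ φ s) ↔ a ≤ m ∧ m ≤ b := by
  constructor
  · intro h
    constructor
    · refine le_of_tendsto ((hasDerivWithinAt_iff_tendsto_slope' (by simp)).1 ha) ?_
      filter_upwards [self_mem_nhdsWithin] with s hs
      have hs' : s < x := hs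
      rw [slope_def_field, div_le_iff_of_neg (by linarith)]
      linarith [h s]
    · refine ge_of_tendsto ((hasDerivWithinAt_iff_tendsto_slope' (by simp)).1 hb) ?_
      filter_upwards [self_mem_nhdsWithin] with s hs
      have hs' : x < s := hs
      rw [slope_def_field, le_div_iff₀ (by linarith)]
      linarith [h s]
  · rintro ⟨h1, h2⟩ s
    rcases lt_trichotomy s x with hs | rfl | hs
    · have := hφ.slope_le_of_hasDerivWithinAt_Iio (mem_univ s) (mem_univ x) hs ha
      rw [slope_def_field, div_le_iff₀ (by linarith)] at this
      nlinarith
    · simp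
    · have := hφ.le_slope_of_hasDerivWithinAt_Ioi (mem_univ x) (mem_univ s) hs hb
      rw [slope_def_field, le_div_iff₀ (by linarith)] at this
      nlinarith

/-- The point of the plane with coordinates `(c, s)` in the orthonormal basis rotated by `θ`. -/
def rot (θ c s : ℝ) : ℝ × ℝ :=
  (c * Real.cos θ - s * Real.sin θ, c * Real.sin θ + s * Real.cos θ)

/-- The vector `u` with `h ⬝ u = 1` determined by a value `ρ` of `r'(θ)`. -/
def ctrl (F : ℝ × ℝ → ℝ) (θ ρ : ℝ) : ℝ × ℝ :=
  ((ρ * Real.sin θ + rad F θ * Real.cos θ) / rad F θ ^ 2,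
    (rad F θ * Real.sin θ - ρ * Real.cos θ) / rad F θ ^ 2)

section

variable {F : ℝ × ℝ → ℝ}

/-- The path `rot θ 1` is affine: it is the line through the unit vector of angle `θ` orthogonal to
it. This turns the polar radius, which is neither convex nor concave in the angle, into a convex
function of one variable. -/
lemma convexOn_supportFn_rot (hF : IsQuasinorm F) (θ : ℝ) :
    ConvexOn ℝ univ fun s => supportFn F (rot θ 1 s) := by
  refine ⟨convex_univ, fun s _ t _ a b ha hb hab => ?_⟩
  have e : rot θ 1 (a • s + b • t) = a • rot θ 1 s + b • rot θ 1 t := by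
    have : b = 1 - a := by linarith
    subst this
    ext <;> simp [rot] <;> ring
  simpa only [e] using hF.isQuasinorm_supportFn.convexOn.2 (mem_univ _) (mem_univ _) ha hb hab

lemma exists_supportFn_rot_derivs (hF : IsQuasinorm F) (θ : ℝ) : ∃ a b : ℝ, a ≤ b ∧
    HasDerivWithinAt (fun s => supportFn F (rot θ 1 s)) a (Iio 0) 0 ∧
    HasDerivWithinAt (fun s => supportFn F (rot θ 1 s)) b (Ioi 0) 0 := by
  have h := convexOn_supportFn_rot hF θ
  have hi : (0 : ℝ) ∈ interior (univ : Set ℝ) := by simp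
  exact ⟨_, _, h.leftDeriv_le_rightDeriv_of_mem_interior hi,
    h.hasDerivWithinAt_leftDeriv_of_mem_interior hi,
    h.hasDerivWithinAt_rightDeriv_of_mem_interior hi⟩

lemma supportFn_rot_zero (F : ℝ × ℝ → ℝ) (θ : ℝ) :
    supportFn F (rot θ 1 0) = 1 / rad F θ := by
  simp [rot, rad]

/-- Central projection of the unit circle onto the line `rot θ 1`, combined with positive
homogeneity, which requires the cosine to be positive. -/
lemma rad_eventuallyEq (hF : IsQuasinorm F) (θ : ℝ) : ∀ᶠ ξ in 𝓝 θ,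
    rad F ξ = (Real.cos (ξ - θ) * supportFn F (rot θ 1 (Real.tan (ξ - θ))))⁻¹ := by
  have hc : ∀ᶠ ξ in 𝓝 θ, 0 < Real.cos (ξ - θ) := by
    refine ContinuousAt.eventually_lt continuousAt_const (by fun_prop) (by simp)
  filter_upwards [hc] with ξ hξ
  have e : ((Real.cos ξ, Real.sin ξ) : ℝ × ℝ)
      = Real.cos (ξ - θ) • rot θ 1 (Real.tan (ξ - θ)) := by
    have e1 : ξ = (ξ - θ) + θ := by ring
    have e2 : Real.cos (ξ - θ) * Real.tan (ξ - θ) = Real.sin (ξ - θ) := by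
      rw [mul_comm]; exact Real.tan_mul_cos hξ.ne'
    ext
    · simp only [rot, Prod.smul_mk, smul_eq_mul]
      conv_lhs => rw [e1, Real.cos_add]
      rw [← e2]; ring
    · simp only [rot, Prod.smul_mk, smul_eq_mul]
      conv_lhs => rw [e1, Real.sin_add]
      rw [← e2]; ring
  rw [rad, e, hF.isQuasinorm_supportFn.smul_eq _ _ hξ.le, one_div]

/-- At the angle `θ` the tangent has derivative 1 and the cosine derivative 0, so only the
differentiation of the reciprocal matters. The sets `s` and `t` select the side. -/
lemma hasDerivWithinAt_rad (hF : IsQuasinorm F) {θ a : ℝ} {s t : Set ℝ}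
    (hst : ∀ᶠ ξ in 𝓝[s] θ, Real.tan (ξ - θ) ∈ t)
    (h : HasDerivWithinAt (fun s => supportFn F (rot θ 1 s)) a t 0) :
    HasDerivWithinAt (rad F) (-(rad F θ ^ 2 * a)) s θ := by
  have hr := rad_pos hF θ
  have htan : HasDerivWithinAt (fun ξ => Real.tan (ξ - θ)) 1 s θ := by
    have h1 : HasDerivAt (fun ξ => ξ - θ) 1 θ := (hasDerivAt_id θ).sub_const θ
    have h2 : HasDerivAt Real.tan (1 / Real.cos (θ - θ) ^ 2) (θ - θ) :=
      Real.hasDerivAt_tan (by simp)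
    have h3 := HasDerivAt.comp (h := fun ξ => ξ - θ) θ h2 h1
    simp only [sub_self, Real.cos_zero] at h3
    norm_num at h3
    exact h3.hasDerivWithinAt
  have hcos : HasDerivWithinAt (fun ξ => Real.cos (ξ - θ)) 0 s θ := by
    have h1 : HasDerivAt (fun ξ => ξ - θ) 1 θ := (hasDerivAt_id θ).sub_const θ
    have h3 := h1.cos
    simp at h3
    exact h3.hasDerivWithinAt
  have hcomp : HasDerivWithinAt (fun ξ => supportFn F (rot θ 1 (Real.tan (ξ - θ)))) a s θ := by
    -- The chain rule needs the tangent to map the whole set into `t`; this is achieved by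
    -- intersecting `s` with a neighbourhood, which does not affect the derivative.
    obtain ⟨v, hv, hv'⟩ := (eventually_nhdsWithin_iff.1 hst).exists_mem
    have e0 : Real.tan (θ - θ) = 0 := by simp
    have h' : HasDerivWithinAt (fun s => supportFn F (rot θ 1 s)) a t (Real.tan (θ - θ)) := by
      rwa [e0]
    have h4 := h'.scomp_of_eq θ (htan.mono (inter_subset_left (t := v)))
      (fun ξ hξ => hv' ξ hξ.2 hξ.1) rfl
    rw [one_smul] at h4
    exact (hasDerivWithinAt_inter hv).1 h4
  have hne : Real.cos (θ - θ) * supportFn F (rot θ 1 (Real.tan (θ - θ))) ≠ 0 := by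
    simp only [sub_self, Real.cos_zero, Real.tan_zero, supportFn_rot_zero F]
    positivity
  have h5 := (hcos.fun_mul hcomp).fun_inv hne
  refine (h5.congr_of_eventuallyEq ((rad_eventuallyEq hF θ).filter_mono nhdsWithin_le_nhds)
    (rad_eventuallyEq hF θ).self_of_nhds).congr_deriv ?_
  simp only [sub_self, Real.cos_zero, Real.tan_zero, supportFn_rot_zero F]
  field_simp
  ring

lemma hasDerivWithinAt_rad_Ioi (hF : IsQuasinorm F) {θ a : ℝ}
    (h : HasDerivWithinAt (fun s => supportFn F (rot θ 1 s)) a (Ioi 0) 0) :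
    HasDerivWithinAt (rad F) (-(rad F θ ^ 2 * a)) (Ioi θ) θ := by
  refine hasDerivWithinAt_rad hF ?_ h
  filter_upwards [Ioo_mem_nhdsGT (show θ < θ + Real.pi / 2 by linarith [Real.pi_pos])] with ξ hξ
  exact Real.tan_pos_of_pos_of_lt_pi_div_two (by linarith [hξ.1]) (by linarith [hξ.2])

lemma hasDerivWithinAt_rad_Iio (hF : IsQuasinorm F) {θ a : ℝ}
    (h : HasDerivWithinAt (fun s => supportFn F (rot θ 1 s)) a (Iio 0) 0) :
    HasDerivWithinAt (rad F) (-(rad F θ ^ 2 * a)) (Iio θ) θ := by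
  refine hasDerivWithinAt_rad hF ?_ h
  filter_upwards [Ioo_mem_nhdsLT (show θ - Real.pi / 2 < θ by linarith [Real.pi_pos])] with ξ hξ
  exact Real.tan_neg_of_neg_of_pi_div_two_lt (by linarith [hξ.2]) (by linarith [hξ.1])

lemma ctrl_eq_rot (hF : IsQuasinorm F) (θ ρ : ℝ) :
    ctrl F θ ρ = rot θ (1 / rad F θ) (-(ρ / rad F θ ^ 2)) := by
  have hr := rad_pos hF θ
  ext <;> simp only [ctrl, rot] <;> field_simp <;> ring

lemma dot_rot_rot (θ c s c' s' : ℝ) : dot (rot θ c s) (rot θ c' s') = c * c' + s * s' := by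
  simp only [dot, rot]
  linear_combination (c * c' + s * s') * Real.sin_sq_add_cos_sq θ

lemma exists_eq_rot (θ : ℝ) (v : ℝ × ℝ) : ∃ c s, v = rot θ c s := by
  refine ⟨v.1 * Real.cos θ + v.2 * Real.sin θ, v.2 * Real.cos θ - v.1 * Real.sin θ, ?_⟩
  have := Real.sin_sq_add_cos_sq θ
  ext
  · simp only [rot]; linear_combination (-v.1) * this
  · simp only [rot]; linear_combination (-v.2) * this

lemma bdry_eq_rot (F : ℝ × ℝ → ℝ) (θ : ℝ) : bdry F θ = rot θ (rad F θ) 0 := by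
  simp [bdry, rot]

/-- Membership in the ball is tested against all covectors, while a supporting line tests only those
on the line `rot θ 1`; homogeneity and subadditivity recover the others. -/
lemma mem_unitBall_rot_iff (hF : IsQuasinorm F) (θ m : ℝ) :
    rot θ (1 / rad F θ) m ∈ unitBall F ↔
      ∀ s, supportFn F (rot θ 1 0) + m * (s - 0) ≤ supportFn F (rot θ 1 s) := by
  have hr := rad_pos hF θ
  have hH := hF.isQuasinorm_supportFn
  constructor
  · intro h s
    have := hF.dot_le_supportFn (rot θ 1 s) h
    rw [dot_rot_rot] at this
    rw [supportFn_rot_zero F]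
    linarith
  · intro h
    refine hF.mem_unitBall_of_dot_le fun v => ?_
    obtain ⟨c, s, rfl⟩ := exists_eq_rot θ v
    -- A covector with `c ≤ 0` has no positive multiple on the line. Adding its small multiple `ε`
    -- to the base covector gives a point of the open half-plane seen by the line, and subadditivity
    -- returns the inequality for the covector itself.
    set ε : ℝ := 1 / (|c| + 1) with hε
    have hc : 0 < |c| + 1 := by positivity
    have hε0 : 0 < ε := by positivity
    have hq : 0 < 1 + ε * c := by
      have h1 : -|c| ≤ c := neg_abs_le c
      have h2 : ε * (|c| + 1) = 1 := by rw [hε]; field_simp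
      nlinarith
    have e1 : rot θ 1 0 + ε • rot θ c s = (1 + ε * c) • rot θ 1 (ε * s / (1 + ε * c)) := by
      ext <;> simp only [rot, Prod.fst_add, Prod.snd_add, Prod.smul_fst, Prod.smul_snd,
        smul_eq_mul] <;> field_simp <;> ring
    have h1 := h (ε * s / (1 + ε * c))
    have h2 := hH.add_le (rot θ 1 0) (ε • rot θ c s)
    rw [e1, hH.smul_eq _ _ hq.le, hH.smul_eq _ _ hε0.le] at h2
    have h3 := mul_le_mul_of_nonneg_left h1 hq.le
    rw [supportFn_rot_zero F] at h2 h3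
    have h4 : (1 + ε * c) * (1 / rad F θ + m * (ε * s / (1 + ε * c) - 0))
        = 1 / rad F θ + ε * (c * (1 / rad F θ) + s * m) := by
      field_simp; ring
    rw [h4] at h3
    rw [dot_rot_rot]
    exact le_of_mul_le_mul_left (by linarith) hε0

/-- The face of the unit ball dual to `bdry F θ` is parametrized by the values between the
one-sided derivatives of the polar radius. -/
lemma face_iff (hF : IsQuasinorm F) (θ ρ : ℝ) :
    ctrl F θ ρ ∈ unitBall F ↔ BetweenOneSidedDerivs (rad F) θ ρ := by
  have hr := rad_pos hF θ
  obtain ⟨a, b, hab, ha, hb⟩ := exists_supportFn_rot_derivs hF θ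
  rw [ctrl_eq_rot hF, mem_unitBall_rot_iff hF,
    ConvexOn.forall_add_mul_le_iff (convexOn_supportFn_rot hF θ) ha hb]
  have h1 := hasDerivWithinAt_rad_Iio hF ha
  have h2 := hasDerivWithinAt_rad_Ioi hF hb
  have key : (a ≤ -(ρ / rad F θ ^ 2) ∧ -(ρ / rad F θ ^ 2) ≤ b) ↔
      (-(rad F θ ^ 2 * b) ≤ ρ ∧ ρ ≤ -(rad F θ ^ 2 * a)) := by
    rw [← neg_div, le_div_iff₀ (by positivity), div_le_iff₀ (by positivity)]
    constructor <;> rintro ⟨h3, h4⟩ <;> constructor <;> linarith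
  -- Passing to the reciprocal reverses the order: the left derivative of `rad F` is the larger one.
  have hle : -(rad F θ ^ 2 * b) ≤ -(rad F θ ^ 2 * a) := by
    have : 0 < rad F θ ^ 2 := by positivity
    nlinarith
  rw [key]
  constructor
  · intro h
    exact ⟨_, _, h1, h2, by rw [uIcc_of_ge hle]; exact h⟩
  · rintro ⟨a', b', h1', h2', h3⟩
    have e1 := (uniqueDiffWithinAt_Iio θ).eq_deriv _ h1 h1'
    have e2 := (uniqueDiffWithinAt_Ioi θ).eq_deriv _ h2 h2'
    rw [← e1, ← e2, uIcc_of_ge hle] at h3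
    exact h3

lemma dot_bdry_ctrl (hF : IsQuasinorm F) (θ ρ : ℝ) : dot (bdry F θ) (ctrl F θ ρ) = 1 := by
  have hr := rad_pos hF θ
  rw [ctrl_eq_rot hF, bdry_eq_rot, dot_rot_rot]
  field_simp; ring

/-- The pairing with the boundary point fixes the radial component of `u`; the tangential component
is free, and `ρ` only records it. -/
lemma eq_ctrl_of_dot_eq_one (hF : IsQuasinorm F) {θ : ℝ} {u : ℝ × ℝ} (h : dot (bdry F θ) u = 1) :
    u = ctrl F θ (rad F θ ^ 2 * (u.1 * Real.sin θ - u.2 * Real.cos θ)) := by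
  have hr := rad_pos hF θ
  rw [ctrl_eq_rot hF]
  obtain ⟨c, s, rfl⟩ := exists_eq_rot θ u
  rw [bdry_eq_rot, dot_rot_rot] at h
  have hc : c = 1 / rad F θ := by field_simp; linarith
  subst hc
  have e : -(rad F θ ^ 2 * ((rot θ (1 / rad F θ) s).1 * Real.sin θ -
      (rot θ (1 / rad F θ) s).2 * Real.cos θ) / rad F θ ^ 2) = s := by
    have := Real.sin_sq_add_cos_sq θ
    simp only [rot]
    field_simp
    linear_combination rad F θ * s * this
  rw [e]

/-- The right derivative of the polar radius. -/
def radDerivRight (F : ℝ × ℝ → ℝ) (θ : ℝ) : ℝ := derivWithin (rad F) (Ioi θ) θ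

/-- The right derivative is a canonical measurable choice among the values of r', and so provides a
measurable maximizing control wherever none is prescribed. -/
lemma measurable_radDerivRight (F : ℝ × ℝ → ℝ) : Measurable (radDerivRight F) :=
  measurable_derivWithin_Ioi (rad F)

lemma between_radDerivRight (hF : IsQuasinorm F) (θ : ℝ) :
    BetweenOneSidedDerivs (rad F) θ (radDerivRight F θ) := by
  obtain ⟨a, b, hab, ha, hb⟩ := exists_supportFn_rot_derivs hF θ
  have h2 := hasDerivWithinAt_rad_Ioi hF hb
  refine ⟨_, _, hasDerivWithinAt_rad_Iio hF ha, h2, ?_⟩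
  rw [radDerivRight, h2.derivWithin (uniqueDiffWithinAt_Ioi θ)]
  exact right_mem_uIcc

end

end

section

/-! ### Absolutely continuous functions on the line -/

lemma _root_.AbsolutelyContinuousOnInterval.of_dist_le {f g : ℝ → ℝ} {a b C : ℝ}
    (hf : AbsolutelyContinuousOnInterval f a b)
    (h : ∀ s ∈ uIcc a b, ∀ t ∈ uIcc a b, dist (g s) (g t) ≤ C * dist (f s) (f t)) :
    AbsolutelyContinuousOnInterval g a b := by
  unfold AbsolutelyContinuousOnInterval at hf ⊢
  apply squeeze_zero' ?_ ?_ (by simpa using hf.const_mul C)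
  · exact Filter.Eventually.of_forall <| fun _ ↦ Finset.sum_nonneg (fun i hi ↦ dist_nonneg)
  rw [eventually_inf_principal]
  filter_upwards with (n, I) hnI
  simp only [Finset.mul_sum]
  refine Finset.sum_le_sum fun i hi => ?_
  simp only [AbsolutelyContinuousOnInterval.disjWithin, mem_ofPred_eq] at hnI
  exact h _ (hnI.left i hi).1 _ (hnI.left i hi).2

/-- `f` is absolutely continuous on all compact intervals, with derivative `f'` almost
everywhere. -/
def ACD (f f' : ℝ → ℝ) : Prop :=
  (∀ a b, AbsolutelyContinuousOnInterval f a b) ∧ ∀ᵐ t, HasDerivAt f (f' t) t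

namespace ACD

variable {f g f' g' : ℝ → ℝ}

lemma continuous (hf : ACD f f') : Continuous f := by
  rw [continuous_iff_continuousAt]
  intro t
  refine (hf.1 (t - 1) (t + 1)).continuousOn.continuousAt ?_
  rw [uIcc_of_le (by linarith)]
  exact Icc_mem_nhds (by linarith) (by linarith)

lemma congr (hf : ACD f f') (h : ∀ᵐ t, f' t = g' t) : ACD f g' :=
  ⟨hf.1, by filter_upwards [hf.2, h] with t h1 h2; rwa [← h2]⟩

lemma congr_left (hf : ACD f f') (h : ∀ t, g t = f t) : ACD g f' := by
  rwa [show g = f from funext h]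

lemma const (c : ℝ) : ACD (fun _ => c) fun _ => 0 := by
  refine ⟨fun a b => ?_, Eventually.of_forall fun t => hasDerivAt_const t c⟩
  exact ((LipschitzWith.const c).lipschitzOnWith (s := uIcc a b)).absolutelyContinuousOnInterval

lemma add (hf : ACD f f') (hg : ACD g g') : ACD (fun t => f t + g t) fun t => f' t + g' t :=
  ⟨fun a b => (hf.1 a b).fun_add (hg.1 a b), by
    filter_upwards [hf.2, hg.2] with t h1 h2; exact h1.fun_add h2⟩

lemma sub (hf : ACD f f') (hg : ACD g g') : ACD (fun t => f t - g t) fun t => f' t - g' t :=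
  ⟨fun a b => (hf.1 a b).fun_sub (hg.1 a b), by
    filter_upwards [hf.2, hg.2] with t h1 h2; exact h1.fun_sub h2⟩

lemma mul (hf : ACD f f') (hg : ACD g g') :
    ACD (fun t => f t * g t) fun t => f' t * g t + f t * g' t :=
  ⟨fun a b => (hf.1 a b).fun_mul (hg.1 a b), by
    filter_upwards [hf.2, hg.2] with t h1 h2; exact h1.fun_mul h2⟩

lemma const_mul (c : ℝ) (hf : ACD f f') : ACD (fun t => c * f t) fun t => c * f' t :=
  ⟨fun a b => (hf.1 a b).const_mul c, by
    filter_upwards [hf.2] with t h1; exact h1.const_mul c⟩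

lemma of_hasDerivAt (h : ∀ t, HasDerivAt f (f' t) t) (hc : Continuous f') : ACD f f' := by
  refine ⟨fun a b => ?_, Eventually.of_forall h⟩
  have : ContDiff ℝ 1 f := by
    rw [contDiff_one_iff_deriv]
    exact ⟨fun t => (h t).differentiableAt, by rwa [show deriv f = f' from funext fun t => (h t).deriv]⟩
  exact this.contDiffOn.absolutelyContinuousOnInterval

lemma of_dist_le {f₁ f₁' : ℝ → ℝ} (hf : ACD f f') {C : ℝ}
    (h : ∀ s t, dist (f₁ s) (f₁ t) ≤ C * dist (f s) (f t)) (hd : ∀ᵐ t, HasDerivAt f₁ (f₁' t) t) :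
    ACD f₁ f₁' :=
  ⟨fun a b => (hf.1 a b).of_dist_le fun s _ t _ => h s t, hd⟩

lemma eq_add_of_ae_eq (hf : ACD f f') (hg : ACD g g') (h : ∀ᵐ t, f' t = g' t) (s t : ℝ) :
    f t - f s = g t - g s := by
  have h1 := (hf.sub hg)
  obtain ⟨C, hC⟩ := (h1.1 s t).const_of_ae_hasDerivAt_zero (by
    filter_upwards [h1.2, h] with τ h2 h3 _
    rwa [h3, sub_self] at h2)
  have h4 := hC s left_mem_uIcc
  have h5 := hC t right_mem_uIcc
  linarith

/-- The main tool for conservation laws: to integrate an equation it suffices to guess the answer,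
differentiate it almost everywhere and compare at time 0. -/
lemma ext (hf : ACD f f') (hg : ACD g g') (h : ∀ᵐ t, f' t = g' t) (h0 : f 0 = g 0) (t : ℝ) :
    f t = g t := by
  have := hf.eq_add_of_ae_eq hg h 0 t
  linarith

lemma intervalIntegrable (hf : ACD f f') (a b : ℝ) : IntervalIntegrable f' volume a b := by
  refine (hf.1 a b).intervalIntegrable_deriv.congr_ae (ae_restrict_of_ae ?_)
  filter_upwards [hf.2] with t h using h.deriv

lemma integral_eq (hf : ACD f f') (a b : ℝ) : ∫ t in a..b, f' t = f b - f a := by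
  rw [← (hf.1 a b).integral_deriv_eq_sub]
  refine intervalIntegral.integral_congr_ae ?_
  filter_upwards [hf.2] with t h _ using h.deriv.symm

lemma of_intervalIntegrable (h : ∀ a b, IntervalIntegrable f volume a b) (c : ℝ) :
    ACD (fun t => ∫ τ in c..t, f τ) f := by
  refine ⟨fun a b => ?_, ?_⟩
  · have h1 := (h a b).absolutelyContinuousOnInterval_intervalIntegral (c := a) left_mem_uIcc
    refine h1.of_dist_le (C := 1) fun s _ t _ => ?_
    rw [one_mul, Real.dist_eq, Real.dist_eq, intervalIntegral.integral_interval_sub_left (h _ _) (h _ _),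
      intervalIntegral.integral_interval_sub_left (h _ _) (h _ _)]
  -- Differentiation of the integral is known almost everywhere on a bounded interval; the line is
  -- exhausted by the intervals from `-n` to `n`, and the base point is moved to `-n` at the cost of
  -- a constant.
  · have key : ∀ n : ℕ, ∀ᵐ t, t ∈ uIcc (-(n : ℝ)) n → HasDerivAt (fun t => ∫ τ in c..t, f τ) (f t) t := by
      intro n
      filter_upwards [(h (-(n : ℝ)) n).ae_hasDerivAt_integral] with t ht hm
      have h1 := ht hm (-(n : ℝ)) left_mem_uIcc
      have h2 := h1.const_add (∫ τ in c..(-(n : ℝ)), f τ)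
      refine h2.congr_of_eventuallyEq (Eventually.of_forall fun s => ?_)
      exact (intervalIntegral.integral_add_adjacent_intervals (h _ _) (h _ _)).symm
    filter_upwards [ae_all_iff.2 key] with t ht
    obtain ⟨n, hn⟩ := exists_nat_ge |t|
    refine ht n ?_
    rw [uIcc_of_le (by linarith [abs_nonneg t])]
    exact abs_le.1 hn

lemma of_bounded (hm : Measurable f) {C : ℝ} (hb : ∀ t, |f t| ≤ C) (c : ℝ) :
    ACD (fun t => ∫ τ in c..t, f τ) f := by
  refine of_intervalIntegrable (fun a b => ?_) c
  refine (intervalIntegrable_const (c := C)).mono_fun hm.aestronglyMeasurable ?_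
  refine Eventually.of_forall fun t => ?_
  simpa using (hb t).trans (le_abs_self C)

lemma inv (hf : ACD f f') (h0 : ∀ t, f t ≠ 0) :
    ACD (fun t => (f t)⁻¹) fun t => -f' t / f t ^ 2 := by
  refine ⟨fun a b => ?_, by filter_upwards [hf.2] with t h using h.fun_inv (h0 t)⟩
  obtain ⟨C, hC⟩ := isCompact_uIcc.exists_bound_of_continuousOn
    (s := uIcc a b) (f := fun t => (f t)⁻¹) (hf.continuous.inv₀ h0).continuousOn
  have hC0 : 0 ≤ C := (norm_nonneg _).trans (hC a left_mem_uIcc)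
  refine (hf.1 a b).of_dist_le (C := C * C) fun s hs t ht => ?_
  have e : (f s)⁻¹ - (f t)⁻¹ = (f s)⁻¹ * (f t)⁻¹ * -(f s - f t) := by
    have := h0 s
    have := h0 t
    field_simp; ring
  rw [Real.dist_eq, Real.dist_eq, e, abs_mul, abs_mul, abs_neg]
  gcongr
  exacts [hC s hs, hC t ht]

end ACD

/-- Lifting of a curve in the punctured plane to polar coordinates, with control of the
derivative of the polar angle. -/
lemma polar_lift {p q p' q' k : ℝ → ℝ} (hp : ACD p p') (hq : ACD q q')
    (h0 : ∀ t, 0 < p t ^ 2 + q t ^ 2) (hk : Continuous k) (hpq : ∀ᵐ t, p t * q' t - q t * p' t = k t)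
    {θ₀ ρ₀ : ℝ} (hρ : 0 < ρ₀) (hp0 : p 0 = ρ₀ * Real.cos θ₀) (hq0 : q 0 = ρ₀ * Real.sin θ₀) :
    ∃ θ : ℝ → ℝ, θ 0 = θ₀ ∧ (∀ t, HasDerivAt θ (k t / (p t ^ 2 + q t ^ 2)) t) ∧
      ∀ t, ∃ ρ > 0, p t = ρ * Real.cos (θ t) ∧ q t = ρ * Real.sin (θ t) := by
  have hpc := hp.continuous
  have hqc := hq.continuous
  have hdc : Continuous fun t => k t / (p t ^ 2 + q t ^ 2) :=
    hk.div (by fun_prop) fun t => (h0 t).ne'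
  -- The angle is defined by integrating the expected angular velocity, which is continuous although
  -- the derivatives of `p` and `q` are only defined almost everywhere. That it is an angle is
  -- verified afterwards.
  set θ : ℝ → ℝ := fun t => θ₀ + ∫ τ in (0 : ℝ)..t, k τ / (p τ ^ 2 + q τ ^ 2) with hθ
  have hd : ∀ t, HasDerivAt θ (k t / (p t ^ 2 + q t ^ 2)) t := fun t =>
    (hdc.integral_hasStrictDerivAt 0 t).hasDerivAt.const_add θ₀
  have hθc : Continuous θ := continuous_iff_continuousAt.2 fun t => (hd t).continuousAt
  have hc : ACD (fun t => Real.cos (θ t)) fun t => -Real.sin (θ t) * (k t / (p t ^ 2 + q t ^ 2)) :=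
    ACD.of_hasDerivAt (fun t => (hd t).cos) (by fun_prop)
  have hs : ACD (fun t => Real.sin (θ t)) fun t => Real.cos (θ t) * (k t / (p t ^ 2 + q t ^ 2)) :=
    ACD.of_hasDerivAt (fun t => (hd t).sin) (by fun_prop)
  have hP := (hp.mul hc).add (hq.mul hs)
  have hQ := (hq.mul hc).sub (hp.mul hs)
  have hN := ((hp.mul hp).add (hq.mul hq)).inv fun t => by have := h0 t; nlinarith
  have hR := (hP.mul hP).mul hN
  have hθ0 : θ 0 = θ₀ := by simp [hθ]
  -- In the frame rotating with `θ`, the squared radial component divided by the squared length has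
  -- derivative zero and starts at 1. Thus the component transversal to the frame vanishes.
  have hone : ∀ t, (p t * Real.cos (θ t) + q t * Real.sin (θ t)) ^ 2 = p t ^ 2 + q t ^ 2 := by
    intro t
    have h1 := hR.ext (ACD.const 1) (by
      filter_upwards [hpq] with t h
      rw [← h]
      have h2 := h0 t
      have h3 : p t * p t + q t * q t ≠ 0 := by nlinarith
      field_simp
      ring) (by
      have h2 := h0 0
      rw [hp0, hq0] at h2
      have h4 := Real.sin_sq_add_cos_sq θ₀
      simp only [hθ0, hp0, hq0]
      have h5 : ρ₀ * Real.cos θ₀ * Real.cos θ₀ + ρ₀ * Real.sin θ₀ * Real.sin θ₀ = ρ₀ := by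
        linear_combination ρ₀ * h4
      have h6 : ρ₀ * Real.cos θ₀ * (ρ₀ * Real.cos θ₀) + ρ₀ * Real.sin θ₀ * (ρ₀ * Real.sin θ₀)
          = ρ₀ * ρ₀ := by
        linear_combination ρ₀ ^ 2 * h4
      rw [h5, h6]
      field_simp) t
    have h2 := h0 t
    have h3 : p t * p t + q t * q t ≠ 0 := by nlinarith
    rw [mul_inv_eq_one₀ h3] at h1
    linarith
  have hQ0 : ∀ t, q t * Real.cos (θ t) - p t * Real.sin (θ t) = 0 := by
    intro t
    have h1 := hone t
    have h4 := Real.sin_sq_add_cos_sq (θ t)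
    have : (q t * Real.cos (θ t) - p t * Real.sin (θ t)) ^ 2 = 0 := by
      linear_combination (p t ^ 2 + q t ^ 2) * h4 - h1
    exact pow_eq_zero_iff (two_ne_zero) |>.1 this
  -- The radial component never vanishes and is positive at time 0, so it cannot change sign.
  have hpos : ∀ t, 0 < p t * Real.cos (θ t) + q t * Real.sin (θ t) := by
    have hne : ∀ t, p t * Real.cos (θ t) + q t * Real.sin (θ t) ≠ 0 := fun t h => by
      have := hone t
      rw [h] at this
      have := h0 t
      linarith
    have hP0 : 0 < p 0 * Real.cos (θ 0) + q 0 * Real.sin (θ 0) := by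
      rw [hθ0, hp0, hq0]
      have h4 := Real.sin_sq_add_cos_sq θ₀
      have : ρ₀ * Real.cos θ₀ * Real.cos θ₀ + ρ₀ * Real.sin θ₀ * Real.sin θ₀ = ρ₀ := by
        linear_combination ρ₀ * h4
      rwa [this]
    intro t
    by_contra! h
    obtain ⟨s, hs⟩ := mem_range_of_exists_le_of_exists_ge hP.continuous ⟨t, h⟩ ⟨0, hP0.le⟩
    exact hne s hs
  refine ⟨θ, hθ0, hd, fun t => ⟨_, hpos t, ?_, ?_⟩⟩
  · have h4 := Real.sin_sq_add_cos_sq (θ t)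
    linear_combination (-p t) * h4 - Real.sin (θ t) * hQ0 t
  · have h4 := Real.sin_sq_add_cos_sq (θ t)
    linear_combination (-q t) * h4 + Real.cos (θ t) * hQ0 t

/-- Two continuous polar angles of the same curve which agree at `0` coincide. -/
lemma polar_angle_unique {θ η : ℝ → ℝ} (hθ : Continuous θ) (hη : Continuous η)
    (hc : ∀ t, Real.cos (θ t) = Real.cos (η t)) (hs : ∀ t, Real.sin (θ t) = Real.sin (η t))
    (h0 : θ 0 = η 0) : θ = η := by
  have hcos : ∀ t, Real.cos (θ t - η t) = 1 := fun t => by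
    rw [Real.cos_sub, hc, hs]; linarith [Real.sin_sq_add_cos_sq (η t)]
  -- The difference takes values in 2πℤ and starts at 0. To reach ±2π it would have to pass through
  -- ±π, where the cosine is -1.
  have hlt : ∀ t, θ t - η t < 2 * Real.pi ∧ -(2 * Real.pi) < θ t - η t := by
    intro t
    by_contra! h
    have key : ∃ s, θ s - η s = Real.pi ∨ θ s - η s = -Real.pi := by
      have hcont : Continuous fun s => θ s - η s := hθ.sub hη
      by_cases h1 : θ t - η t < 2 * Real.pi
      · obtain ⟨s, hs⟩ := mem_range_of_exists_le_of_exists_ge (c := -Real.pi) hcont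
          ⟨t, by linarith [h h1, Real.pi_pos]⟩ ⟨0, by simp [h0, Real.pi_pos.le]⟩
        exact ⟨s, Or.inr hs⟩
      · obtain ⟨s, hs⟩ := mem_range_of_exists_le_of_exists_ge (c := Real.pi) hcont
          ⟨0, by simp [h0, Real.pi_pos.le]⟩ ⟨t, by linarith [Real.pi_pos]⟩
        exact ⟨s, Or.inl hs⟩
    obtain ⟨s, hs | hs⟩ := key <;>
    · have := hcos s
      rw [hs] at this
      norm_num at this
  funext t
  have := (Real.cos_eq_one_iff_of_lt_of_lt (hlt t).2 (hlt t).1).1 (hcos t)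
  linarith

end

section

/-! ### Motion along the boundary of the polar figure -/

lemma ae_differentiableAt_of_ac {f : ℝ → ℝ} (h : ∀ a b, AbsolutelyContinuousOnInterval f a b) :
    ∀ᵐ t, DifferentiableAt ℝ f t := by
  have key : ∀ n : ℕ, ∀ᵐ t, t ∈ uIcc (-(n : ℝ)) n → DifferentiableAt ℝ f t := fun n =>
    (h _ _).ae_differentiableAt
  filter_upwards [ae_all_iff.2 key] with t ht
  obtain ⟨n, hn⟩ := exists_nat_ge |t|
  refine ht n ?_
  rw [uIcc_of_le (by linarith [abs_nonneg t])]
  exact abs_le.1 hn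

section

variable {F : ℝ × ℝ → ℝ}

lemma bdry_fst_sq_add_snd_sq (F : ℝ × ℝ → ℝ) (ξ : ℝ) :
    (bdry F ξ).1 ^ 2 + (bdry F ξ).2 ^ 2 = rad F ξ ^ 2 := by
  simp only [bdry]
  linear_combination rad F ξ ^ 2 * Real.sin_sq_add_cos_sq ξ

lemma ac_bdry_comp (hF : IsQuasinorm F) {θ D : ℝ → ℝ} (hθ : ∀ t, HasDerivAt θ (D t) t)
    (hD : Continuous D) (a b : ℝ) :
    AbsolutelyContinuousOnInterval (fun t => (bdry F (θ t)).1) a b ∧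
      AbsolutelyContinuousOnInterval (fun t => (bdry F (θ t)).2) a b := by
  obtain ⟨K, h1, h2⟩ := exists_bdry_lipschitz hF
  have h := (ACD.of_hasDerivAt hθ hD).1 a b
  exact ⟨h.of_dist_le fun s _ t _ => h1.dist_le_mul _ _, h.of_dist_le fun s _ t _ => h2.dist_le_mul _ _⟩

/-- Two linear equations determine the velocity without differentiating `rad F`. For fixed `u` the
pairing along the curve is at most 1 with equality at `t`, so the velocity is orthogonal to `u`; and
the identity h₁ sin θ = h₂ cos θ, differentiated, gives the areal velocity. -/
lemma bdry_velocity (hF : IsQuasinorm F) {θ : ℝ → ℝ} {t d a b : ℝ} (hθ : HasDerivAt θ d t)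
    (h1 : HasDerivAt (fun t => (bdry F (θ t)).1) a t)
    (h2 : HasDerivAt (fun t => (bdry F (θ t)).2) b t)
    {u : ℝ × ℝ} (hu : u ∈ unitBall F) (hd : dot (bdry F (θ t)) u = 1) :
    a = -u.2 * (rad F (θ t) ^ 2 * d) ∧ b = u.1 * (rad F (θ t) ^ 2 * d) := by
  have e1 : a * u.1 + b * u.2 = 0 := by
    have h3 : HasDerivAt (fun s => dot (bdry F (θ s)) u) (a * u.1 + b * u.2) t :=
      (h1.mul_const u.1).fun_add (h2.mul_const u.2)
    refine IsLocalMax.hasDerivAt_eq_zero (Eventually.of_forall fun s => ?_) h3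
    simp only [hd]
    exact dot_bdry_le_one hF _ hu
  have e2 : (bdry F (θ t)).1 * b - (bdry F (θ t)).2 * a = rad F (θ t) ^ 2 * d := by
    have h3 := (h1.fun_mul hθ.sin).fun_sub (h2.fun_mul hθ.cos)
    have h4 : (fun s => (bdry F (θ s)).1 * Real.sin (θ s) - (bdry F (θ s)).2 * Real.cos (θ s))
        = fun _ => 0 := by
      funext s; simp only [bdry]; ring
    rw [h4] at h3
    have h5 := h3.unique (hasDerivAt_const t 0)
    simp only [bdry] at h5 ⊢
    linear_combination (-rad F (θ t)) * h5 + rad F (θ t) ^ 2 * d * Real.sin_sq_add_cos_sq (θ t)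
  simp only [dot] at hd
  rw [← e2]
  constructor
  · linear_combination (-a) * hd + (bdry F (θ t)).1 * e1
  · linear_combination (-b) * hd + (bdry F (θ t)).2 * e1

/-- The exceptional null set is where one of the two coordinates fails to be differentiable, so it
does not depend on `u`. This allows a control that varies with time to be inserted later. -/
lemma ae_bdry_velocity (hF : IsQuasinorm F) {θ D : ℝ → ℝ} (hθ : ∀ t, HasDerivAt θ (D t) t)
    (hD : Continuous D) : ∀ᵐ t, ∀ u ∈ unitBall F, dot (bdry F (θ t)) u = 1 →
      HasDerivAt (fun t => (bdry F (θ t)).1) (-u.2 * (rad F (θ t) ^ 2 * D t)) t ∧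
      HasDerivAt (fun t => (bdry F (θ t)).2) (u.1 * (rad F (θ t) ^ 2 * D t)) t := by
  filter_upwards [ae_differentiableAt_of_ac fun a b => (ac_bdry_comp hF hθ hD a b).1,
    ae_differentiableAt_of_ac fun a b => (ac_bdry_comp hF hθ hD a b).2] with t h1 h2 u hu hd
  have := bdry_velocity hF (hθ t) h1.hasDerivAt h2.hasDerivAt hu hd
  exact ⟨this.1 ▸ h1.hasDerivAt, this.2 ▸ h2.hasDerivAt⟩

end

/-! ### Trajectories -/

/-- The component `h₃ = φ₃ + φ₄ x + φ₅ y` of the normalized covector along a trajectory. -/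
def InitialData.hZ (P : InitialData) (g : Fin 5 → ℝ) : ℝ := P.φ₃ + P.φ₄ * g 0 + P.φ₅ * g 1

/-- `g` is horizontal with control `u` starting at the unit, and `θ` satisfies the vertical part
of the Hamiltonian system with the initial data `P`. -/
structure Traj (F : ℝ × ℝ → ℝ) (P : InitialData) (g : ℝ → Fin 5 → ℝ) (θ : ℝ → ℝ)
    (u : ℝ → ℝ × ℝ) : Prop where
  measurable : Measurable u
  mem : ∀ t, u t ∈ unitBall F
  dot_eq : ∀ t, dot (bdry F (θ t)) (u t) = 1
  zero : g 0 = 0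
  acd : ∀ i, ACD (fun t => g t i) fun t => (u t).1 * fieldX (g t) i + (u t).2 * fieldY (g t) i
  hasDerivAt_angle : ∀ t, HasDerivAt θ (P.hZ (g t) / rad F (θ t) ^ 2) t
  init : bdry F (θ 0) = (P.φ₁, P.φ₂)

namespace Traj

variable {F : ℝ × ℝ → ℝ} {P : InitialData} {g : ℝ → Fin 5 → ℝ} {θ : ℝ → ℝ} {u : ℝ → ℝ × ℝ}

lemma acd_x (h : Traj F P g θ u) : ACD (fun t => g t 0) fun t => (u t).1 := by
  simpa [fieldX, fieldY] using h.acd 0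

lemma acd_y (h : Traj F P g θ u) : ACD (fun t => g t 1) fun t => (u t).2 := by
  simpa [fieldX, fieldY] using h.acd 1

lemma acd_z (h : Traj F P g θ u) :
    ACD (fun t => g t 2) fun t => (g t 0 * (u t).2 - g t 1 * (u t).1) / 2 :=
  (h.acd 2).congr (Eventually.of_forall fun t => by simp [fieldX, fieldY]; ring)

lemma acd_v (h : Traj F P g θ u) : ACD (fun t => g t 3) fun t =>
    (u t).1 * (-(g t 2) / 2 - g t 0 * g t 1 / 12) + (u t).2 * (g t 0 ^ 2 / 12) :=
  (h.acd 3).congr (Eventually.of_forall fun t => by simp [fieldX, fieldY])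

lemma acd_w (h : Traj F P g θ u) : ACD (fun t => g t 4) fun t =>
    (u t).1 * (-(g t 1 ^ 2) / 12) + (u t).2 * (g t 0 * g t 1 / 12 - g t 2 / 2) :=
  (h.acd 4).congr (Eventually.of_forall fun t => by simp [fieldX, fieldY])

lemma continuous_angle (h : Traj F P g θ u) : Continuous θ :=
  continuous_iff_continuousAt.2 fun t => (h.hasDerivAt_angle t).continuousAt

lemma continuous_hZ (h : Traj F P g θ u) : Continuous fun t => P.hZ (g t) := by
  have h1 := h.acd_x.continuous
  have h2 := h.acd_y.continuous
  unfold InitialData.hZ; fun_prop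

lemma continuous_deriv (hF : IsQuasinorm F) (h : Traj F P g θ u) :
    Continuous fun t => P.hZ (g t) / rad F (θ t) ^ 2 :=
  h.continuous_hZ.div (((continuous_rad hF).comp h.continuous_angle).pow 2) fun t => by
    have := rad_pos hF (θ t); positivity

lemma acd_bdry (hF : IsQuasinorm F) (h : Traj F P g θ u) :
    ACD (fun t => (bdry F (θ t)).1) (fun t => -(u t).2 * P.hZ (g t)) ∧
      ACD (fun t => (bdry F (θ t)).2) (fun t => (u t).1 * P.hZ (g t)) := by
  have h1 := fun a b => ac_bdry_comp hF h.hasDerivAt_angle (h.continuous_deriv hF) a b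
  have h2 := ae_bdry_velocity hF h.hasDerivAt_angle (h.continuous_deriv hF)
  have e : ∀ t, rad F (θ t) ^ 2 * (P.hZ (g t) / rad F (θ t) ^ 2) = P.hZ (g t) := fun t => by
    have := rad_pos hF (θ t); field_simp
  refine ⟨⟨fun a b => (h1 a b).1, ?_⟩, ⟨fun a b => (h1 a b).2, ?_⟩⟩
  · filter_upwards [h2] with t ht
    have := (ht _ (h.mem t) (h.dot_eq t)).1
    rwa [e] at this
  · filter_upwards [h2] with t ht
    have := (ht _ (h.mem t) (h.dot_eq t)).2
    rwa [e] at this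

lemma g_zero (h : Traj F P g θ u) (i : Fin 5) : g 0 i = 0 := by rw [h.zero]; rfl

/-- The right-hand side is a primitive of -u₂h₃: insert h₃ = φ₃ + φ₄x + φ₅y and use ẋ = u₁, ẏ = u₂,
2ż = xẏ - yẋ. -/
lemma bdry_fst (hF : IsQuasinorm F) (h : Traj F P g θ u) (t : ℝ) : (bdry F (θ t)).1
    = P.φ₁ - P.φ₃ * g t 1 - P.φ₅ / 2 * (g t 1 * g t 1)
      - P.φ₄ * (g t 2 + 1 / 2 * (g t 0 * g t 1)) := by
  refine (h.acd_bdry hF).1.ext ((((ACD.const P.φ₁).sub (h.acd_y.const_mul P.φ₃)).sub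
    ((h.acd_y.mul h.acd_y).const_mul (P.φ₅ / 2))).sub
    ((h.acd_z.add ((h.acd_x.mul h.acd_y).const_mul (1 / 2))).const_mul P.φ₄))
    (Eventually.of_forall fun t => ?_) ?_ t
  · simp only [InitialData.hZ]; ring
  · simp [h.g_zero, h.init]

lemma bdry_snd (hF : IsQuasinorm F) (h : Traj F P g θ u) (t : ℝ) : (bdry F (θ t)).2
    = P.φ₂ + P.φ₃ * g t 0 + P.φ₄ / 2 * (g t 0 * g t 0)
      + P.φ₅ * (1 / 2 * (g t 0 * g t 1) - g t 2) := by
  refine (h.acd_bdry hF).2.ext ((((ACD.const P.φ₂).add (h.acd_x.const_mul P.φ₃)).add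
    ((h.acd_x.mul h.acd_x).const_mul (P.φ₄ / 2))).add
    ((((h.acd_x.mul h.acd_y).const_mul (1 / 2)).sub h.acd_z).const_mul P.φ₅))
    (Eventually.of_forall fun t => ?_) ?_ t
  · simp only [InitialData.hZ]; ring
  · simp [h.g_zero, h.init]

/-- Once `bdry_fst` and `bdry_snd` are inserted, the maximum condition h₁u₁ + h₂u₂ = 1 becomes a
total derivative. Its integral is the relation from which the last coordinate is computed. -/
lemma time_eq (hF : IsQuasinorm F) (h : Traj F P g θ u) (t : ℝ) : t
    = P.φ₁ * g t 0 + P.φ₂ * g t 1 + 2 * P.φ₃ * g t 2 + 3 * P.φ₄ * g t 3 + 3 * P.φ₅ * g t 4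
      + P.φ₄ / 2 * (g t 0 * g t 2) + P.φ₅ / 2 * (g t 1 * g t 2) := by
  have hid : ACD (fun t : ℝ => t) fun _ => 1 :=
    ACD.of_hasDerivAt (fun t => hasDerivAt_id t) continuous_const
  refine hid.ext (((((((h.acd_x.const_mul P.φ₁).add (h.acd_y.const_mul P.φ₂)).add
    (h.acd_z.const_mul (2 * P.φ₃))).add (h.acd_v.const_mul (3 * P.φ₄))).add
    (h.acd_w.const_mul (3 * P.φ₅))).add ((h.acd_x.mul h.acd_z).const_mul (P.φ₄ / 2))).add
    ((h.acd_y.mul h.acd_z).const_mul (P.φ₅ / 2)))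
    (Eventually.of_forall fun t => ?_) ?_ t
  · have h1 := h.dot_eq t
    rw [dot, h.bdry_fst hF, h.bdry_snd hF] at h1
    rw [← h1]; ring
  · simp [h.g_zero]

/-- Conservation of the Casimir function, obtained here as a polynomial identity from the two
integrated components; it makes the equation for `θ` autonomous. -/
lemma numer_eq_of_init (hF : IsQuasinorm F) (h : Traj F P g θ u) (t : ℝ) :
    P.hZ (g t) ^ 2 = numer F P (θ t) := by
  have h1 := h.bdry_fst hF t
  have h2 := h.bdry_snd hF t
  simp only [bdry] at h1 h2
  rw [numer, h1, h2, InitialData.hZ]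
  ring

lemma deriv_eq (h : Traj F P g θ u) (t : ℝ) : deriv θ t = P.hZ (g t) / rad F (θ t) ^ 2 :=
  (h.hasDerivAt_angle t).deriv

lemma contDiff (hF : IsQuasinorm F) (h : Traj F P g θ u) : ContDiff ℝ 1 θ := by
  rw [contDiff_one_iff_deriv]
  refine ⟨fun t => (h.hasDerivAt_angle t).differentiableAt, ?_⟩
  rw [funext h.deriv_eq]
  exact h.continuous_deriv hF

end Traj

/-! ### Extremals are trajectories -/

lemma ham_eq_dot (g ψ : Fin 5 → ℝ) (u : ℝ × ℝ) : ham g ψ u = dot (hX g ψ, hY g ψ) u := by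
  simp only [ham, dot, hX, hY, Finset.sum_mul, ← Finset.sum_add_distrib]
  exact Finset.sum_congr rfl fun i _ => by ring

/-- The Hamiltonian is at most quadratic in each single coordinate, so this evaluates all partial
derivatives in the canonical equations. -/
lemma deriv_of_eq_quadratic {f : ℝ → ℝ} (a b c q : ℝ) (h : ∀ s, f s = a + b * s + c * s ^ 2) :
    deriv f q = b + 2 * c * q := by
  rw [show f = fun s => a + b * s + c * s ^ 2 from funext h]
  have h1 := (((hasDerivAt_id q).const_mul b).const_add a).fun_add
      ((hasDerivAt_pow 2 q).const_mul c)
  refine (h1.congr_deriv ?_).deriv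
  simp; ring

lemma deriv_ham_covector (g ψ : Fin 5 → ℝ) (u : ℝ × ℝ) (i : Fin 5) (q : ℝ) :
    deriv (fun p => ham g (Function.update ψ i p) u) q = u.1 * fieldX g i + u.2 * fieldY g i := by
  rw [deriv_of_eq_quadratic (ham g (Function.update ψ i 0) u)
    (u.1 * fieldX g i + u.2 * fieldY g i) 0 q]
  · ring
  · intro s
    fin_cases i <;> simp [ham, Fin.sum_univ_five, Function.update] <;> ring

lemma deriv_ham_point (g ψ : Fin 5 → ℝ) (u : ℝ × ℝ) (i : Fin 5) :
    deriv (fun q => ham (Function.update g i q) ψ u) (g i) =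
      ![-(u.1 * g 1 * ψ 3 / 12) + u.2 * (ψ 2 / 2 + g 0 * ψ 3 / 6 + g 1 * ψ 4 / 12),
        u.1 * (-(ψ 2) / 2 - g 0 * ψ 3 / 12 - g 1 * ψ 4 / 6) + u.2 * (g 0 * ψ 4 / 12),
        -(u.1 * ψ 3 + u.2 * ψ 4) / 2, 0, 0] i := by
  fin_cases i
  · rw [deriv_of_eq_quadratic (ham (Function.update g 0 0) ψ u)
      (-(u.1 * g 1 * ψ 3 / 12) + u.2 * (ψ 2 / 2 + g 1 * ψ 4 / 12)) (u.2 * ψ 3 / 12)]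
    · simp; ring
    · intro s
      simp [ham, Fin.sum_univ_five, fieldX, fieldY, Function.update]; ring
  · rw [deriv_of_eq_quadratic (ham (Function.update g 1 0) ψ u)
      (u.1 * (-(ψ 2) / 2 - g 0 * ψ 3 / 12) + u.2 * (g 0 * ψ 4 / 12)) (-(u.1 * ψ 4) / 12)]
    · simp; ring
    · intro s
      simp [ham, Fin.sum_univ_five, fieldX, fieldY, Function.update]; ring
  · rw [deriv_of_eq_quadratic (ham (Function.update g 2 0) ψ u)
      (-(u.1 * ψ 3 + u.2 * ψ 4) / 2) 0]
    · simp
    · intro s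
      simp [ham, Fin.sum_univ_five, fieldX, fieldY, Function.update]; ring
  · rw [deriv_of_eq_quadratic (ham g ψ u) 0 0]
    · simp
    · intro s
      simp [ham, Fin.sum_univ_five, fieldX, fieldY, Function.update]
  · rw [deriv_of_eq_quadratic (ham g ψ u) 0 0]
    · simp
    · intro s
      simp [ham, Fin.sum_univ_five, fieldX, fieldY, Function.update]

section

variable {F : ℝ × ℝ → ℝ} {P : InitialData}

lemma hX_eq (g ψ : Fin 5 → ℝ) :
    hX g ψ = ψ 0 - 1 / 2 * (g 1 * ψ 2) - 1 / 2 * (g 2 * ψ 3) - 1 / 12 * (g 0 * g 1 * ψ 3)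
      - 1 / 12 * (g 1 * g 1 * ψ 4) := by
  simp [hX, Fin.sum_univ_five, fieldX]; ring

lemma hY_eq (g ψ : Fin 5 → ℝ) :
    hY g ψ = ψ 1 + 1 / 2 * (g 0 * ψ 2) + 1 / 12 * (g 0 * g 0 * ψ 3)
      + 1 / 12 * (g 0 * g 1 * ψ 4) - 1 / 2 * (g 2 * ψ 4) := by
  simp [hY, Fin.sum_univ_five, fieldY]; ring

lemma IsExtremal.acd {M : ℝ} {g ψ : ℝ → Fin 5 → ℝ} {u : ℝ → ℝ × ℝ} (h : IsExtremal F M g ψ u)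
    (i : Fin 5) :
    ACD (fun t => g t i) fun t => (u t).1 * fieldX (g t) i + (u t).2 * fieldY (g t) i := by
  refine ⟨h.absCont i, ?_⟩
  filter_upwards [h.state_eq] with t ht
  simpa only [deriv_ham_covector] using ht i

lemma IsExtremal.acd_covector {M : ℝ} {g ψ : ℝ → Fin 5 → ℝ} {u : ℝ → ℝ × ℝ}
    (h : IsExtremal F M g ψ u) (i : Fin 5) :
    ACD (fun t => ψ t i) fun t => -(![-((u t).1 * g t 1 * ψ t 3 / 12)
        + (u t).2 * (ψ t 2 / 2 + g t 0 * ψ t 3 / 6 + g t 1 * ψ t 4 / 12),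
        (u t).1 * (-(ψ t 2) / 2 - g t 0 * ψ t 3 / 12 - g t 1 * ψ t 4 / 6)
          + (u t).2 * (g t 0 * ψ t 4 / 12),
        -((u t).1 * ψ t 3 + (u t).2 * ψ t 4) / 2, 0, 0] i) := by
  refine ⟨h.absCont_covector i, ?_⟩
  filter_upwards [h.adjoint_eq] with t ht
  simpa only [deriv_ham_point] using ht i

/-- Passage from coordinate components of the covector to left-invariant ones. The components 3 and
4 are constant and component 2 is affine in x, y; after substituting them, the derivatives of ψ(X)
and ψ(Y) collapse to multiples of h₃. -/
lemma IsExtremal.vertical {M : ℝ} {g ψ : ℝ → Fin 5 → ℝ} {u : ℝ → ℝ × ℝ}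
    (h : IsExtremal F M g ψ u) (hg : g 0 = 0) (hψ : ψ 0 = M • P.toVec) :
    ACD (fun t => hX (g t) (ψ t)) (fun t => -(u t).2 * (M * P.hZ (g t))) ∧
      ACD (fun t => hY (g t) (ψ t)) (fun t => (u t).1 * (M * P.hZ (g t))) := by
  have x : ACD (fun t => g t 0) fun t => (u t).1 := by
    simpa [fieldX, fieldY] using h.acd 0
  have y : ACD (fun t => g t 1) fun t => (u t).2 := by
    simpa [fieldX, fieldY] using h.acd 1
  have z : ACD (fun t => g t 2) fun t => (u t).1 * (-(g t 1) / 2) + (u t).2 * (g t 0 / 2) := by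
    simpa [fieldX, fieldY] using h.acd 2
  have hg0 : ∀ i, g 0 i = 0 := fun i => by rw [hg]; rfl
  have q3 : ∀ t, ψ t 3 = M * P.φ₄ := fun t => by
    refine (h.acd_covector 3).ext (ACD.const _) (Eventually.of_forall fun t => by simp) ?_ t
    rw [hψ]; simp [InitialData.toVec]
  have q4 : ∀ t, ψ t 4 = M * P.φ₅ := fun t => by
    refine (h.acd_covector 4).ext (ACD.const _) (Eventually.of_forall fun t => by simp) ?_ t
    rw [hψ]; simp [InitialData.toVec]
  have q2 : ∀ t, ψ t 2 = M * P.φ₃ + M * P.φ₄ / 2 * g t 0 + M * P.φ₅ / 2 * g t 1 := fun t => by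
    refine (h.acd_covector 2).ext (((ACD.const (M * P.φ₃)).add (x.const_mul (M * P.φ₄ / 2))).add
      (y.const_mul (M * P.φ₅ / 2))) (Eventually.of_forall fun t => ?_) ?_ t
    · simp [q3, q4]; ring
    · rw [hψ]; simp [InitialData.toVec, hg0]
  have a0 := h.acd_covector 0
  have a1 := h.acd_covector 1
  have a2 := h.acd_covector 2
  have a3 := h.acd_covector 3
  have a4 := h.acd_covector 4
  constructor
  · refine (((((a0.sub ((y.mul a2).const_mul (1 / 2))).sub ((z.mul a3).const_mul (1 / 2))).sub
      (((x.mul y).mul a3).const_mul (1 / 12))).sub (((y.mul y).mul a4).const_mul (1 / 12))).congr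
      (Eventually.of_forall fun t => ?_)).congr_left fun t => hX_eq _ _
    simp [q2, q3, q4, InitialData.hZ]; ring
  · refine (((((a1.add ((x.mul a2).const_mul (1 / 2))).add
      (((x.mul x).mul a3).const_mul (1 / 12))).add (((x.mul y).mul a4).const_mul (1 / 12))).sub
      ((z.mul a4).const_mul (1 / 2))).congr
      (Eventually.of_forall fun t => ?_)).congr_left fun t => hY_eq _ _
    simp [q2, q3, q4, InitialData.hZ]; ring

/-- The maximum condition gives the equality only almost everywhere; both sides are continuous in
time, hence it holds everywhere. -/
lemma IsExtremal.supportFn_eq (hF : IsQuasinorm F) {M : ℝ} {g ψ : ℝ → Fin 5 → ℝ} {u : ℝ → ℝ × ℝ}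
    (h : IsExtremal F M g ψ u) (hg : g 0 = 0) (hψ : ψ 0 = M • P.toVec) (t : ℝ) :
    supportFn F (hX (g t) (ψ t), hY (g t) (ψ t)) = M := by
  have hv := h.vertical hg hψ
  have hc : Continuous fun t => supportFn F (hX (g t) (ψ t), hY (g t) (ψ t)) :=
    hF.isQuasinorm_supportFn.continuous.comp (hv.1.continuous.prodMk hv.2.continuous)
  have hae : ∀ᵐ t, supportFn F (hX (g t) (ψ t), hY (g t) (ψ t)) = M := by
    filter_upwards [h.isMax] with t ht
    rw [← ht.2, ham_eq_dot]
    refine le_antisymm (hF.supportFn_le fun v hv => ?_) (hF.dot_le_supportFn _ (h.mem_unitBall t))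
    have := ht.1 hv
    simpa [ham_eq_dot] using this
  exact congrFun ((Continuous.ae_eq_iff_eq volume hc continuous_const).1 hae) t

lemma IsExtremal.exists_angle (hF : IsQuasinorm F) {M : ℝ} {g ψ : ℝ → Fin 5 → ℝ} {u : ℝ → ℝ × ℝ}
    (hM : 0 < M) (h : IsExtremal F M g ψ u) (hg : g 0 = 0) (hψ : ψ 0 = M • P.toVec) {θ₀ : ℝ}
    (hθ₀ : bdry F θ₀ = (P.φ₁, P.φ₂)) :
    ∃ θ : ℝ → ℝ, θ 0 = θ₀ ∧ (∀ t, HasDerivAt θ (P.hZ (g t) / rad F (θ t) ^ 2) t) ∧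
      ∀ t, (hX (g t) (ψ t), hY (g t) (ψ t)) = M • bdry F (θ t) := by
  obtain ⟨h1, h2⟩ := h.vertical hg hψ
  have hp := h1.const_mul M⁻¹
  have hq := h2.const_mul M⁻¹
  have x : ACD (fun t => g t 0) fun t => (u t).1 := by
    simpa [fieldX, fieldY] using h.acd 0
  have y : ACD (fun t => g t 1) fun t => (u t).2 := by
    simpa [fieldX, fieldY] using h.acd 1
  have xc := x.continuous
  have yc := y.continuous
  have hH := hF.isQuasinorm_supportFn
  have hs : ∀ t, supportFn F (M⁻¹ * hX (g t) (ψ t), M⁻¹ * hY (g t) (ψ t)) = 1 := fun t => by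
    have := hH.smul_eq M⁻¹ (hX (g t) (ψ t), hY (g t) (ψ t)) (by positivity)
    rw [h.supportFn_eq hF hg hψ, inv_mul_cancel₀ hM.ne'] at this
    exact this
  have h00 : hX (g 0) (ψ 0) = M * P.φ₁ ∧ hY (g 0) (ψ 0) = M * P.φ₂ := by
    rw [hX_eq, hY_eq, hψ, hg]
    simp [InitialData.toVec]
  have hb1 := congrArg Prod.fst hθ₀
  have hb2 := congrArg Prod.snd hθ₀
  simp only [bdry] at hb1 hb2
  -- The areal velocity h₁ḣ₂ - h₂ḣ₁ equals h₃(h₁u₁ + h₂u₂) = h₃ for the normalized covector. It is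
  -- continuous in time, as the lifting requires.
  obtain ⟨θ, e0, e1, e2⟩ := polar_lift (k := fun t => P.hZ (g t)) (θ₀ := θ₀) hp hq (fun t => by
      by_contra! hn
      have z1 : M⁻¹ * hX (g t) (ψ t) = 0 := by nlinarith [sq_nonneg (M⁻¹ * hX (g t) (ψ t)), sq_nonneg (M⁻¹ * hY (g t) (ψ t))]
      have z2 : M⁻¹ * hY (g t) (ψ t) = 0 := by nlinarith [sq_nonneg (M⁻¹ * hX (g t) (ψ t)), sq_nonneg (M⁻¹ * hY (g t) (ψ t))]
      have := hs t
      rw [z1, z2] at this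
      have h3 := hH.map_zero
      rw [Prod.zero_eq_mk] at h3
      linarith) (by unfold InitialData.hZ; fun_prop) (by
      filter_upwards [h.isMax] with t ht
      have h3 := ht.2
      rw [ham_eq_dot] at h3
      simp only [dot] at h3
      have : M ≠ 0 := hM.ne'
      field_simp
      linear_combination (P.hZ (g t)) * h3) (rad_pos hF θ₀)
      (by rw [h00.1, hb1]; field_simp) (by rw [h00.2, hb2]; field_simp)
  have e3 : ∀ t, (M⁻¹ * hX (g t) (ψ t), M⁻¹ * hY (g t) (ψ t)) = bdry F (θ t) := fun t => by
    obtain ⟨ρ, hρ, a, b⟩ := e2 t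
    exact eq_bdry_of_smul hF (hs t) hρ.le (by rw [a, b]; rfl)
  refine ⟨θ, e0, fun t => ?_, fun t => ?_⟩
  · have := e1 t
    rwa [← bdry_fst_sq_add_snd_sq, ← e3]
  · rw [← e3]
    ext <;> simp [hM.ne']

end

end

/-! ### Normal extremals and trajectories coincide -/

section

variable {F : ℝ × ℝ → ℝ} {P : InitialData}

lemma ctrl_radDerivRight_mem (hF : IsQuasinorm F) (θ : ℝ) :
    ctrl F θ (radDerivRight F θ) ∈ unitBall F :=
  (face_iff hF _ _).2 (between_radDerivRight hF θ)

lemma measurable_ctrl (hF : IsQuasinorm F) {θ ρ : ℝ → ℝ} (hθ : Continuous θ) (hρ : Measurable ρ) :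
    Measurable fun t => ctrl F (θ t) (ρ t) := by
  have h1 : Measurable fun t => rad F (θ t) := ((continuous_rad hF).comp hθ).measurable
  have h2 : Measurable fun t => Real.cos (θ t) := (Real.continuous_cos.comp hθ).measurable
  have h3 : Measurable fun t => Real.sin (θ t) := (Real.continuous_sin.comp hθ).measurable
  unfold ctrl
  exact (((hρ.mul h3).add (h1.mul h2)).div (h1.pow_const 2)).prodMk
    (((h1.mul h3).sub (hρ.mul h2)).div (h1.pow_const 2))

/-- The control satisfies the maximum condition only almost everywhere. On the exceptional null set
it is replaced by the measurable maximizing choice, which leaves the state equations intact. -/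
lemma IsExtremal.exists_traj (hF : IsQuasinorm F) {M : ℝ} {g ψ : ℝ → Fin 5 → ℝ} {u : ℝ → ℝ × ℝ}
    (hM : 0 < M) (h : IsExtremal F M g ψ u) (hg : g 0 = 0) {θ : ℝ → ℝ}
    (h0 : bdry F (θ 0) = (P.φ₁, P.φ₂)) (hd : ∀ t, HasDerivAt θ (P.hZ (g t) / rad F (θ t) ^ 2) t)
    (hh : ∀ t, (hX (g t) (ψ t), hY (g t) (ψ t)) = M • bdry F (θ t)) :
    ∃ u, Traj F P g θ u := by
  classical
  have hθ : Continuous θ := continuous_iff_continuousAt.2 fun t => (hd t).continuousAt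
  have hae : ∀ᵐ t, dot (bdry F (θ t)) (u t) = 1 := by
    filter_upwards [h.isMax] with t ht
    have h3 := ht.2
    rw [ham_eq_dot, hh, dot_smul_left] at h3
    exact mul_left_cancel₀ hM.ne' (by rw [h3, mul_one])
  have hms : MeasurableSet {t | dot (bdry F (θ t)) (u t) = 1} := by
    have h1 : Measurable fun t => bdry F (θ t) := ((continuous_bdry hF).comp hθ).measurable
    have h2 : Measurable fun t => dot (bdry F (θ t)) (u t) := by
      unfold dot
      exact (h1.fst.mul h.measurable.fst).add (h1.snd.mul h.measurable.snd)
    exact h2 (measurableSet_singleton 1)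
  refine ⟨fun t => if dot (bdry F (θ t)) (u t) = 1 then u t else ctrl F (θ t) (radDerivRight F (θ t)),
    ?_, fun t => ?_, fun t => ?_, hg, fun i => ?_, hd, h0⟩
  · exact Measurable.ite hms h.measurable
      (measurable_ctrl hF hθ ((measurable_radDerivRight F).comp hθ.measurable))
  · split_ifs
    · exact h.mem_unitBall t
    · exact ctrl_radDerivRight_mem hF _
  · split_ifs with h1
    · exact h1
    · exact dot_bdry_ctrl hF _ _
  · refine (h.acd i).congr ?_
    filter_upwards [hae] with t ht
    rw [if_pos ht]

lemma IsNormalExtremal.exists_traj (hF : IsQuasinorm F) {g : ℝ → Fin 5 → ℝ} {θ : ℝ → ℝ}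
    (h : IsNormalExtremal F P g θ) : ∃ u, Traj F P g θ u := by
  obtain ⟨M, ψ, u, hM, he, hg, hψ, hθ, hh⟩ := h
  have h0 : bdry F (θ 0) = (P.φ₁, P.φ₂) := by
    have h1 := hh 0
    rw [hX_eq, hY_eq, hψ, hg] at h1
    simp [InitialData.toVec, hM.ne'] at h1
    ext
    · exact h1.1.symm
    · exact h1.2.symm
  -- The given angle is merely continuous. It is compared with the differentiable lift starting at
  -- the same value: both describe the same boundary curve, so radii agree first and then the
  -- angles.
  obtain ⟨η, e0, e1, e2⟩ := he.exists_angle hF hM hg hψ h0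
  have hη : Continuous η := continuous_iff_continuousAt.2 fun t => (e1 t).continuousAt
  have hb : ∀ t, bdry F (θ t) = bdry F (η t) := fun t => by
    have h2 := e2 t
    rw [Prod.ext_iff] at h2
    simp only [(hh t).1, (hh t).2, Prod.smul_fst, Prod.smul_snd, smul_eq_mul] at h2
    ext
    · exact mul_left_cancel₀ hM.ne' h2.1
    · exact mul_left_cancel₀ hM.ne' h2.2
  have hr : ∀ t, rad F (θ t) = rad F (η t) := fun t => by
    have h2 := bdry_fst_sq_add_snd_sq F (θ t)
    rw [hb, bdry_fst_sq_add_snd_sq] at h2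
    exact ((sq_eq_sq₀ (rad_pos hF _).le (rad_pos hF _).le).1 h2).symm
  have : θ = η := by
    refine polar_angle_unique hθ hη (fun t => ?_) (fun t => ?_) e0.symm
    · have := congrArg Prod.fst (hb t)
      simp only [bdry, hr] at this
      exact mul_left_cancel₀ (rad_pos hF _).ne' this
    · have := congrArg Prod.snd (hb t)
      simp only [bdry, hr] at this
      exact mul_left_cancel₀ (rad_pos hF _).ne' this
  subst this
  exact he.exists_traj hF hM hg h0 e1 e2

lemma Traj.isNormalExtremal (hF : IsQuasinorm F) {g : ℝ → Fin 5 → ℝ} {θ : ℝ → ℝ} {u : ℝ → ℝ × ℝ}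
    (h : Traj F P g θ u) : IsNormalExtremal F P g θ := by
  have x := h.acd_x
  have y := h.acd_y
  have z := h.acd_z
  obtain ⟨b1, b2⟩ := h.acd_bdry hF
  -- The covector is rebuilt with maximum 1: its components 2, 3, 4 are the explicit integrals, and
  -- `ψ₀`, `ψ₁` are obtained by solving `hX_eq` and `hY_eq` for the prescribed boundary point.
  set k : ℝ → ℝ := fun t => P.φ₃ + 1 / 2 * (P.φ₄ * g t 0) + 1 / 2 * (P.φ₅ * g t 1) with hk
  have hkd : ACD k fun t => 0 + 1 / 2 * (P.φ₄ * (u t).1) + 1 / 2 * (P.φ₅ * (u t).2) :=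
    ((ACD.const P.φ₃).add ((x.const_mul _).const_mul _)).add ((y.const_mul _).const_mul _)
  set ψ₀ : ℝ → ℝ := fun t => (bdry F (θ t)).1 + 1 / 2 * (g t 1 * k t)
    + 1 / 2 * (P.φ₄ * g t 2) + 1 / 12 * (P.φ₄ * (g t 0 * g t 1))
    + 1 / 12 * (P.φ₅ * (g t 1 * g t 1)) with hψ₀
  set ψ₁ : ℝ → ℝ := fun t => (bdry F (θ t)).2 - 1 / 2 * (g t 0 * k t)
    - 1 / 12 * (P.φ₄ * (g t 0 * g t 0)) - 1 / 12 * (P.φ₅ * (g t 0 * g t 1))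
    + 1 / 2 * (P.φ₅ * g t 2) with hψ₁
  set ψ : ℝ → Fin 5 → ℝ := fun t => ![ψ₀ t, ψ₁ t, k t, P.φ₄, P.φ₅] with hψ
  have hx : ∀ t, hX (g t) (ψ t) = (bdry F (θ t)).1 := fun t => by
    rw [hX_eq]; simp [hψ, hψ₀]; ring
  have hy : ∀ t, hY (g t) (ψ t) = (bdry F (θ t)).2 := fun t => by
    rw [hY_eq]; simp [hψ, hψ₁]; ring
  have hb : ∀ t, (hX (g t) (ψ t), hY (g t) (ψ t)) = bdry F (θ t) := fun t => by
    rw [hx, hy]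
  have hacd : ∀ i, ACD (fun t => ψ t i) fun t => -(![-((u t).1 * g t 1 * ψ t 3 / 12)
        + (u t).2 * (ψ t 2 / 2 + g t 0 * ψ t 3 / 6 + g t 1 * ψ t 4 / 12),
        (u t).1 * (-(ψ t 2) / 2 - g t 0 * ψ t 3 / 12 - g t 1 * ψ t 4 / 6)
          + (u t).2 * (g t 0 * ψ t 4 / 12),
        -((u t).1 * ψ t 3 + (u t).2 * ψ t 4) / 2, 0, 0] i) := by
    intro i
    fin_cases i
    · refine ((((b1.add ((y.mul hkd).const_mul (1 / 2))).add
        ((z.const_mul P.φ₄).const_mul (1 / 2))).add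
        (((x.mul y).const_mul P.φ₄).const_mul (1 / 12))).add
        (((y.mul y).const_mul P.φ₅).const_mul (1 / 12))).congr (Eventually.of_forall fun t => ?_)
      simp [hψ, hk, InitialData.hZ]; ring
    · refine ((((b2.sub ((x.mul hkd).const_mul (1 / 2))).sub
        (((x.mul x).const_mul P.φ₄).const_mul (1 / 12))).sub
        (((x.mul y).const_mul P.φ₅).const_mul (1 / 12))).add
        ((z.const_mul P.φ₅).const_mul (1 / 2))).congr (Eventually.of_forall fun t => ?_)
      simp [hψ, hk, InitialData.hZ]; ring
    · refine hkd.congr (Eventually.of_forall fun t => ?_)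
      simp [hψ]; ring
    · refine (ACD.const P.φ₄).congr (Eventually.of_forall fun t => ?_)
      simp
    · refine (ACD.const P.φ₅).congr (Eventually.of_forall fun t => ?_)
      simp
  refine ⟨1, ψ, u, one_pos, ⟨h.measurable, h.mem, fun i a b => (h.acd i).1 a b,
    fun i a b => (hacd i).1 a b, fun t h0 => ?_, ?_, ?_, zero_le_one, ?_⟩, h.zero, ?_,
    h.continuous_angle, fun t => ?_⟩
  · have h1 := hb t
    rw [hX_eq, hY_eq, h0] at h1
    have h2 := bdry_fst_sq_add_snd_sq F (θ t)
    rw [← h1] at h2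
    have h3 := rad_pos hF (θ t)
    simp at h2
    exact (pow_pos h3 2).ne' h2.symm
  · filter_upwards [ae_all_iff.2 fun i => (h.acd i).2] with t ht i
    rw [deriv_ham_covector]
    exact ht i
  · filter_upwards [ae_all_iff.2 fun i => (hacd i).2] with t ht i
    rw [deriv_ham_point]
    exact ht i
  · refine Eventually.of_forall fun t => ⟨fun v hv => ?_, ?_⟩
    · simp only [mem_ofPred_eq, ham_eq_dot, hb, h.dot_eq]
      exact dot_bdry_le_one hF _ hv
    · rw [ham_eq_dot, hb, h.dot_eq]
  · have h1 : (bdry F (θ 0)).1 = P.φ₁ := by rw [h.init]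
    have h2 : (bdry F (θ 0)).2 = P.φ₂ := by rw [h.init]
    ext i
    fin_cases i <;> simp [hψ, hψ₀, hψ₁, hk, h.g_zero, InitialData.toVec, h1, h2]
  · rw [hx, hy]; simp [bdry]

lemma isNormalExtremal_iff (hF : IsQuasinorm F) {g : ℝ → Fin 5 → ℝ} {θ : ℝ → ℝ} :
    IsNormalExtremal F P g θ ↔ ∃ u, Traj F P g θ u :=
  ⟨fun h => h.exists_traj hF, fun ⟨_, h⟩ => h.isNormalExtremal hF⟩

lemma exists_isNormalExtremal_of_isExtremal (hF : IsQuasinorm F) {M : ℝ} {g ψ : ℝ → Fin 5 → ℝ}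
    {u : ℝ → ℝ × ℝ} (hM : 0 < M) (h : IsExtremal F M g ψ u) (hg : g 0 = 0)
    (hψ : ψ 0 = M • P.toVec) : ∃ θ, IsNormalExtremal F P g θ := by
  have h1 := h.supportFn_eq hF hg hψ 0
  rw [hX_eq, hY_eq, hψ, hg] at h1
  have h2 : supportFn F (P.φ₁, P.φ₂) = 1 := by
    have h3 := hF.isQuasinorm_supportFn.smul_eq M (P.φ₁, P.φ₂) hM.le
    simp [InitialData.toVec] at h1 h3
    rw [h1] at h3
    exact mul_left_cancel₀ hM.ne' (by linarith)
  obtain ⟨θ₀, h3⟩ := exists_eq_bdry hF h2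
  obtain ⟨θ, e0, e1, e2⟩ := h.exists_angle hF hM hg hψ h3.symm
  obtain ⟨v, hv⟩ := h.exists_traj hF hM hg (by rw [e0, h3]) e1 e2
  exact ⟨θ, hv.isNormalExtremal hF⟩

/-! ### Trajectories are given by the formulas -/

lemma exists_unitBall_bound (hF : IsQuasinorm F) :
    ∃ C : ℝ, ∀ u ∈ unitBall F, |u.1| ≤ C ∧ |u.2| ≤ C := by
  obtain ⟨C, hC⟩ := hF.isCompact_unitBall.isBounded.exists_norm_le
  refine ⟨C, fun u hu => ?_⟩
  have := hC u hu
  exact ⟨(norm_fst_le u).trans this, (norm_snd_le u).trans this⟩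

lemma Traj.givenByFormulas (hF : IsQuasinorm F) (hP : P.φ₄ ^ 2 + P.φ₅ ^ 2 ≠ 0)
    {g : ℝ → Fin 5 → ℝ} {θ : ℝ → ℝ} {u : ℝ → ℝ × ℝ} (h : Traj F P g θ u) :
    GivenByFormulas F P (fun t => g t 0) (fun t => g t 1) (fun t => g t 2) (fun t => g t 3)
      (fun t => g t 4) θ := by
  have x := h.acd_x
  have y := h.acd_y
  have z := h.acd_z
  have hr : ∀ t, rad F (θ t) ≠ 0 := fun t => (rad_pos hF _).ne'
  have hi := h.init
  rw [Prod.ext_iff] at hi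
  have hI3 := h.time_eq hF
  have hI1 := h.bdry_fst hF
  have hI2 := h.bdry_snd hF
  simp only [bdry] at hI1 hI2
  refine ⟨h.contDiff hF, hi.1, hi.2, fun t => ?_, fun t => ?_, fun t => ?_, ?_, fun h5 t => ?_,
    fun h5 t => ?_⟩
  · have hc : Continuous fun ξ => rad F ξ ^ 2 := (continuous_rad hF).pow 2
    have h1 := (hc.integral_hasStrictDerivAt 0 (θ t)).hasDerivAt.comp t (h.hasDerivAt_angle t)
    refine h1.congr_deriv ?_
    have := hr t
    simp only [InitialData.hZ]
    field_simp
  · have := hr t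
    rw [h.deriv_eq, InitialData.hZ]
    field_simp
  · have := hr t
    rw [h.deriv_eq, rhs, ← h.numer_eq_of_init hF]
    field_simp
  · have hθ := h.continuous_angle
    have h2 : Measurable fun t => Real.cos (θ t) := (Real.continuous_cos.comp hθ).measurable
    have h3 : Measurable fun t => Real.sin (θ t) := (Real.continuous_sin.comp hθ).measurable
    have h1 : Measurable fun t => rad F (θ t) := ((continuous_rad hF).comp hθ).measurable
    have hu : ∀ t, u t = ctrl F (θ t) (rad F (θ t) ^ 2 *
        ((u t).1 * Real.sin (θ t) - (u t).2 * Real.cos (θ t))) := fun t =>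
      eq_ctrl_of_dot_eq_one hF (h.dot_eq t)
    refine ⟨fun t => rad F (θ t) ^ 2 * ((u t).1 * Real.sin (θ t) - (u t).2 * Real.cos (θ t)),
      (h1.pow_const 2).mul ((h.measurable.fst.mul h3).sub (h.measurable.snd.mul h2)),
      fun t => (face_iff hF _ _).1 (hu t ▸ h.mem t), fun t => ?_, fun t => ?_⟩
    · have h4 := x.integral_eq 0 t
      rw [h.g_zero, sub_zero] at h4
      rw [← h4]
      exact intervalIntegral.integral_congr fun τ _ => congrArg Prod.fst (hu τ)
    · have h4 := y.integral_eq 0 t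
      rw [h.g_zero, sub_zero] at h4
      rw [← h4]
      exact intervalIntegral.integral_congr fun τ _ => congrArg Prod.snd (hu τ)
  -- Since v̇ = -zẋ/2 + xż/6, the function 3v + xz/2 is a primitive of xż - zẋ.
  · have e1 : (∫ τ in (0 : ℝ)..t, (g τ 0 * deriv (fun t => g t 2) τ - g τ 2 * deriv (fun t => g t 0) τ))
        = 3 * g t 3 + 1 / 2 * (g t 0 * g t 2) := by
      have h6 := ((h.acd_v.const_mul 3).add ((x.mul z).const_mul (1 / 2))).integral_eq 0 t
      simp only [h.g_zero, mul_zero, sub_zero, add_zero] at h6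
      rw [← h6]
      refine intervalIntegral.integral_congr_ae ?_
      filter_upwards [x.2, z.2] with τ hx hz _
      rw [hx.deriv, hz.deriv]; ring
    refine ⟨?_, ?_, ?_⟩
    · rw [hI2]; field_simp; ring
    · rw [e1]; ring
    · rw [one_div, eq_inv_mul_iff_mul_eq₀ (mul_ne_zero three_ne_zero h5)]
      linear_combination (-1 : ℝ) * hI3 t
  · have h4 : P.φ₄ ≠ 0 := fun h4 => hP (by rw [h4, h5]; ring)
    have e1 : (∫ τ in (0 : ℝ)..t, (g τ 1 * deriv (fun t => g t 2) τ - g τ 2 * deriv (fun t => g t 1) τ))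
        = 3 * g t 4 + 1 / 2 * (g t 1 * g t 2) := by
      have h6 := ((h.acd_w.const_mul 3).add ((y.mul z).const_mul (1 / 2))).integral_eq 0 t
      simp only [h.g_zero, mul_zero, sub_zero, add_zero] at h6
      rw [← h6]
      refine intervalIntegral.integral_congr_ae ?_
      filter_upwards [y.2, z.2] with τ hx hz _
      rw [hx.deriv, hz.deriv]; ring
    refine ⟨?_, ?_, ?_⟩
    · rw [hI1, h5]; field_simp; ring
    · rw [one_div, eq_inv_mul_iff_mul_eq₀ (mul_ne_zero three_ne_zero h4)]
      have e2 := hI3 t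
      rw [h5] at e2
      linear_combination (-1 : ℝ) * e2
    · rw [e1]; ring

/-- The chosen values of r' define the control, so the equations for x, y and the angle are
immediate. The formulas for z, v, w are differentiated back; only the two integrated components of
the boundary curve have to be recovered first. -/
lemma GivenByFormulas.exists_traj (hF : IsQuasinorm F) (hP : P.φ₄ ^ 2 + P.φ₅ ^ 2 ≠ 0)
    {g : ℝ → Fin 5 → ℝ} {θ : ℝ → ℝ}
    (h : GivenByFormulas F P (fun t => g t 0) (fun t => g t 1) (fun t => g t 2) (fun t => g t 3)
      (fun t => g t 4) θ) : ∃ u, Traj F P g θ u := by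
  obtain ⟨ρ, hρ, hb, ex, ey⟩ := h.xy_eq
  have hθ : Continuous θ := h.contDiff.continuous
  have hr : ∀ t, rad F (θ t) ≠ 0 := fun t => (rad_pos hF _).ne'
  set u : ℝ → ℝ × ℝ := fun t => ctrl F (θ t) (ρ t) with hu
  have hmu : Measurable u := measurable_ctrl hF hθ hρ
  have hmem : ∀ t, u t ∈ unitBall F := fun t => (face_iff hF _ _).2 (hb t)
  have hdot : ∀ t, dot (bdry F (θ t)) (u t) = 1 := fun t => dot_bdry_ctrl hF _ _
  obtain ⟨C, hC⟩ := exists_unitBall_bound hF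
  have x : ACD (fun t => g t 0) fun t => (u t).1 :=
    (ACD.of_bounded hmu.fst (fun t => (hC _ (hmem t)).1) 0).congr_left ex
  have y : ACD (fun t => g t 1) fun t => (u t).2 :=
    (ACD.of_bounded hmu.snd (fun t => (hC _ (hmem t)).2) 0).congr_left ey
  have hd : ∀ t, HasDerivAt θ (P.hZ (g t) / rad F (θ t) ^ 2) t := fun t => by
    refine ((h.contDiff.differentiable one_ne_zero) t).hasDerivAt.congr_deriv ?_
    have h1 := h.deriv_theta t
    have := hr t
    rw [InitialData.hZ, h1]
    field_simp
  have hhc : Continuous fun t => P.hZ (g t) := by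
    have := x.continuous
    have := y.continuous
    unfold InitialData.hZ; fun_prop
  have hdc : Continuous fun t => P.hZ (g t) / rad F (θ t) ^ 2 :=
    hhc.div (((continuous_rad hF).comp hθ).pow 2) fun t => pow_ne_zero 2 (hr t)
  have hac := fun a b => ac_bdry_comp hF hd hdc a b
  have hvel := ae_bdry_velocity hF hd hdc
  have e : ∀ t, rad F (θ t) ^ 2 * (P.hZ (g t) / rad F (θ t) ^ 2) = P.hZ (g t) := fun t => by
    have := hr t; field_simp
  have b1 : ACD (fun t => (bdry F (θ t)).1) (fun t => -(u t).2 * P.hZ (g t)) :=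
    ⟨fun a b => (hac a b).1, by
      filter_upwards [hvel] with t ht
      have := (ht _ (hmem t) (hdot t)).1
      rwa [e] at this⟩
  have b2 : ACD (fun t => (bdry F (θ t)).2) (fun t => (u t).1 * P.hZ (g t)) :=
    ⟨fun a b => (hac a b).2, by
      filter_upwards [hvel] with t ht
      have := (ht _ (hmem t) (hdot t)).2
      rwa [e] at this⟩
  have x0 : g 0 0 = 0 := by rw [ex]; simp
  have y0 : g 0 1 = 0 := by rw [ey]; simp
  have hinit : bdry F (θ 0) = (P.φ₁, P.φ₂) := Prod.ext h.init_cos h.init_sin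
  have i1 : (bdry F (θ 0)).1 = P.φ₁ := by rw [hinit]
  have i2 : (bdry F (θ 0)).2 = P.φ₂ := by rw [hinit]
  have hid : ACD (fun t : ℝ => t) fun _ => 1 :=
    ACD.of_hasDerivAt (fun t => hasDerivAt_id t) continuous_const
  have key : g 0 2 = 0 ∧ g 0 3 = 0 ∧ g 0 4 = 0 ∧
      (ACD (fun t => g t 2) fun t => (g t 0 * (u t).2 - g t 1 * (u t).1) / 2) ∧
      (ACD (fun t => g t 3) fun t =>
        (u t).1 * (-(g t 2) / 2 - g t 0 * g t 1 / 12) + (u t).2 * (g t 0 ^ 2 / 12)) ∧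
      (ACD (fun t => g t 4) fun t =>
        (u t).1 * (-(g t 1 ^ 2) / 12) + (u t).2 * (g t 0 * g t 1 / 12 - g t 2 / 2)) := by
    by_cases h5 : P.φ₅ = 0
    · have h4 : P.φ₄ ≠ 0 := fun h4 => hP (by rw [h4, h5]; ring)
      have hf := h.zvw_of_eq h5
      have z : ACD (fun t => g t 2) fun t => (g t 0 * (u t).2 - g t 1 * (u t).1) / 2 := by
        refine ((((((ACD.const P.φ₁).sub (y.const_mul P.φ₃)).sub
          ((x.mul y).const_mul (P.φ₄ / 2))).sub b1).const_mul (1 / P.φ₄)).congr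
          (Eventually.of_forall fun t => ?_)).congr_left fun t => ?_
        · simp only [InitialData.hZ, h5]; field_simp; ring
        · rw [(hf t).1]; simp only [bdry]; ring
      have z0 : g 0 2 = 0 := by
        rw [(hf 0).1]; simp only [bdry] at i1; rw [i1, y0]; ring
      -- For φ₅ = 0 the second component does not involve z and integrates from x alone; the first
      -- one is the formula for z, solved for h₁.
      have hI2 : ∀ t, (bdry F (θ t)).2 = P.φ₂ + P.φ₃ * g t 0 + P.φ₄ / 2 * (g t 0 * g t 0) := by
        intro t
        refine b2.ext (((ACD.const P.φ₂).add (x.const_mul P.φ₃)).add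
          ((x.mul x).const_mul (P.φ₄ / 2))) (Eventually.of_forall fun t => ?_) ?_ t
        · simp only [InitialData.hZ, h5]; ring
        · simp [i2, x0]
      have hI1 : ∀ t, (bdry F (θ t)).1
          = P.φ₁ - P.φ₃ * g t 1 - P.φ₄ * (g t 2 + 1 / 2 * (g t 0 * g t 1)) := by
        intro t
        have := (hf t).1
        simp only [bdry] at this ⊢
        rw [this]; field_simp; ring
      have v : ACD (fun t => g t 3) fun t =>
          (u t).1 * (-(g t 2) / 2 - g t 0 * g t 1 / 12) + (u t).2 * (g t 0 ^ 2 / 12) := by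
        refine ((((((hid.sub (x.const_mul P.φ₁)).sub (y.const_mul P.φ₂)).sub
          (z.const_mul (2 * P.φ₃))).sub ((x.mul z).const_mul (P.φ₄ / 2))).const_mul
          (1 / (3 * P.φ₄))).congr (Eventually.of_forall fun t => ?_)).congr_left fun t => ?_
        · have h1 := hdot t
          rw [dot, hI1, hI2] at h1
          rw [one_div, inv_mul_eq_iff_eq_mul₀ (mul_ne_zero three_ne_zero h4)]
          linear_combination (-1 : ℝ) * h1
        · rw [(hf t).2.1]; ring
      have hint : ∀ t, (∫ τ in (0 : ℝ)..t,
          (g τ 1 * deriv (fun t => g t 2) τ - g τ 2 * deriv (fun t => g t 1) τ))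
          = ∫ τ in (0 : ℝ)..t, (g τ 1 * ((g τ 0 * (u τ).2 - g τ 1 * (u τ).1) / 2) - g τ 2 * (u τ).2) := by
        intro t
        refine intervalIntegral.integral_congr_ae ?_
        filter_upwards [y.2, z.2] with τ hx hz _
        rw [hx.deriv, hz.deriv]
      have hI : ACD (fun t => ∫ τ in (0 : ℝ)..t,
          (g τ 1 * ((g τ 0 * (u τ).2 - g τ 1 * (u τ).1) / 2) - g τ 2 * (u τ).2))
          fun τ => (g τ 1 * ((g τ 0 * (u τ).2 - g τ 1 * (u τ).1) / 2) - g τ 2 * (u τ).2) :=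
        ACD.of_intervalIntegrable (fun a b =>
          ((z.intervalIntegrable a b).continuousOn_mul y.continuous.continuousOn).sub
          ((y.intervalIntegrable a b).continuousOn_mul z.continuous.continuousOn)) 0
      have w : ACD (fun t => g t 4) fun t =>
          (u t).1 * (-(g t 1 ^ 2) / 12) + (u t).2 * (g t 0 * g t 1 / 12 - g t 2 / 2) := by
        refine (((hI.const_mul (1 / 3)).sub ((y.mul z).const_mul (1 / 6))).congr
          (Eventually.of_forall fun t => ?_)).congr_left fun t => ?_
        · ring
        · rw [(hf t).2.2, hint]; ring
      refine ⟨z0, ?_, ?_, z, v, w⟩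
      · rw [(hf 0).2.1, x0, y0, z0]; ring
      · rw [(hf 0).2.2, y0]; simp
    · have hf := h.zvw_of_ne h5
      have z : ACD (fun t => g t 2) fun t => (g t 0 * (u t).2 - g t 1 * (u t).1) / 2 := by
        refine (((((((ACD.const P.φ₂).add (x.const_mul P.φ₃)).add
          ((x.mul x).const_mul (P.φ₄ / 2))).add ((x.mul y).const_mul (P.φ₅ / 2))).sub
          b2).const_mul (1 / P.φ₅)).congr
          (Eventually.of_forall fun t => ?_)).congr_left fun t => ?_
        · simp only [InitialData.hZ]; field_simp; ring
        · rw [(hf t).1]; simp only [bdry]; ring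
      have z0 : g 0 2 = 0 := by
        rw [(hf 0).1]; simp only [bdry] at i2; rw [i2, x0]; ring
      have hI1 : ∀ t, (bdry F (θ t)).1 = P.φ₁ - P.φ₃ * g t 1 - P.φ₅ / 2 * (g t 1 * g t 1)
          - P.φ₄ * (g t 2 + 1 / 2 * (g t 0 * g t 1)) := by
        intro t
        refine b1.ext ((((ACD.const P.φ₁).sub (y.const_mul P.φ₃)).sub
          ((y.mul y).const_mul (P.φ₅ / 2))).sub
          ((z.add ((x.mul y).const_mul (1 / 2))).const_mul P.φ₄))
          (Eventually.of_forall fun t => ?_) ?_ t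
        · simp only [InitialData.hZ]; ring
        · simp [x0, y0, z0, i1]
      have hI2 : ∀ t, (bdry F (θ t)).2 = P.φ₂ + P.φ₃ * g t 0 + P.φ₄ / 2 * (g t 0 * g t 0)
          + P.φ₅ * (1 / 2 * (g t 0 * g t 1) - g t 2) := by
        intro t
        have := (hf t).1
        simp only [bdry] at this ⊢
        rw [this]; field_simp; ring
      have hint : ∀ t, (∫ τ in (0 : ℝ)..t,
          (g τ 0 * deriv (fun t => g t 2) τ - g τ 2 * deriv (fun t => g t 0) τ))
          = ∫ τ in (0 : ℝ)..t, (g τ 0 * ((g τ 0 * (u τ).2 - g τ 1 * (u τ).1) / 2) - g τ 2 * (u τ).1) := by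
        intro t
        refine intervalIntegral.integral_congr_ae ?_
        filter_upwards [x.2, z.2] with τ hx hz _
        rw [hx.deriv, hz.deriv]
      have hI : ACD (fun t => ∫ τ in (0 : ℝ)..t,
          (g τ 0 * ((g τ 0 * (u τ).2 - g τ 1 * (u τ).1) / 2) - g τ 2 * (u τ).1))
          fun τ => (g τ 0 * ((g τ 0 * (u τ).2 - g τ 1 * (u τ).1) / 2) - g τ 2 * (u τ).1) :=
        ACD.of_intervalIntegrable (fun a b =>
          ((z.intervalIntegrable a b).continuousOn_mul x.continuous.continuousOn).sub
          ((x.intervalIntegrable a b).continuousOn_mul z.continuous.continuousOn)) 0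
      have v : ACD (fun t => g t 3) fun t =>
          (u t).1 * (-(g t 2) / 2 - g t 0 * g t 1 / 12) + (u t).2 * (g t 0 ^ 2 / 12) := by
        refine (((hI.const_mul (1 / 3)).sub ((x.mul z).const_mul (1 / 6))).congr
          (Eventually.of_forall fun t => ?_)).congr_left fun t => ?_
        · ring
        · rw [(hf t).2.1, hint]; ring
      have w : ACD (fun t => g t 4) fun t =>
          (u t).1 * (-(g t 1 ^ 2) / 12) + (u t).2 * (g t 0 * g t 1 / 12 - g t 2 / 2) := by
        refine ((((((((hid.sub (x.const_mul P.φ₁)).sub (y.const_mul P.φ₂)).sub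
          (z.const_mul (2 * P.φ₃))).sub (v.const_mul (3 * P.φ₄))).sub
          ((x.mul z).const_mul (P.φ₄ / 2))).sub ((y.mul z).const_mul (P.φ₅ / 2))).const_mul
          (1 / (3 * P.φ₅))).congr (Eventually.of_forall fun t => ?_)).congr_left fun t => ?_
        · have h1 := hdot t
          rw [dot, hI1, hI2] at h1
          rw [one_div, inv_mul_eq_iff_eq_mul₀ (mul_ne_zero three_ne_zero h5)]
          linear_combination (-1 : ℝ) * h1
        · rw [(hf t).2.2]; ring
      have v0 : g 0 3 = 0 := by rw [(hf 0).2.1, x0]; simp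
      refine ⟨z0, v0, ?_, z, v, w⟩
      rw [(hf 0).2.2, x0, y0, z0, v0]; ring
  obtain ⟨z0, v0, w0, z, v, w⟩ := key
  refine ⟨u, hmu, hmem, hdot, ?_, fun i => ?_, hd, hinit⟩
  · ext i
    fin_cases i <;> simp [x0, y0, z0, v0, w0]
  · fin_cases i
    · simpa [fieldX, fieldY] using x
    · simpa [fieldX, fieldY] using y
    · exact z.congr (Eventually.of_forall fun t => by simp [fieldX, fieldY]; ring)
    · simpa [fieldX, fieldY] using v
    · simpa [fieldX, fieldY] using w

end

section

variable {F : ℝ × ℝ → ℝ} {P : InitialData}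

/-! ### The linear functional `φ₅ h₁ - φ₄ h₂` on the polar figure -/

/-- The vector `(φ₅, -φ₄)`. -/
def InitialData.dir (P : InitialData) : ℝ × ℝ := (P.φ₅, -P.φ₄)

/-- The functional `φ₅ h₁ - φ₄ h₂` along the boundary of the polar figure. -/
def level (F : ℝ × ℝ → ℝ) (P : InitialData) (ξ : ℝ) : ℝ := dot (bdry F ξ) P.dir

lemma level_eq (F : ℝ × ℝ → ℝ) (P : InitialData) (ξ : ℝ) :
    level F P ξ = P.φ₅ * (rad F ξ * Real.cos ξ) - P.φ₄ * (rad F ξ * Real.sin ξ) := by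
  simp [level, dot, bdry, InitialData.dir]; ring

lemma numer_eq (F : ℝ × ℝ → ℝ) (P : InitialData) (ξ : ℝ) :
    numer F P ξ = 2 * (P.casimir - level F P ξ) := by
  rw [level_eq, numer, InitialData.casimir]; ring

lemma dot_dir (h : ℝ × ℝ) (P : InitialData) : dot h P.dir = P.φ₅ * h.1 - P.φ₄ * h.2 := by
  simp [dot, InitialData.dir]; ring

lemma dir_ne_zero (hP : P.φ₄ ^ 2 + P.φ₅ ^ 2 ≠ 0) : P.dir ≠ 0 := by
  intro h
  have h1 : P.φ₅ = 0 := congrArg Prod.fst h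
  have h2 : -P.φ₄ = 0 := congrArg Prod.snd h
  exact hP (by rw [h1, neg_eq_zero.1 h2]; ring)

lemma continuous_level (hF : IsQuasinorm F) (P : InitialData) : Continuous (level F P) := by
  have := continuous_rad hF
  rw [show level F P = _ from funext (level_eq F P)]
  fun_prop

lemma level_add_int_mul_two_pi (F : ℝ × ℝ → ℝ) (P : InitialData) (ξ : ℝ) (k : ℤ) :
    level F P (ξ + 2 * Real.pi * k) = level F P ξ := by
  rw [level, bdry_add_int_mul_two_pi, level]

lemma isCompact_image_polarBall (hF : IsQuasinorm F) (P : InitialData) :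
    IsCompact ((fun h : ℝ × ℝ => P.φ₅ * h.1 - P.φ₄ * h.2) '' polarBall F) :=
  hF.isCompact_polarBall.image (by fun_prop)

lemma image_polarBall_nonempty (hF : IsQuasinorm F) (P : InitialData) :
    ((fun h : ℝ × ℝ => P.φ₅ * h.1 - P.φ₄ * h.2) '' polarBall F).Nonempty :=
  ⟨_, mem_image_of_mem _ hF.isQuasinorm_supportFn.zero_mem_unitBall⟩

lemma isGreatest_casimirMax (hF : IsQuasinorm F) (P : InitialData) :
    IsGreatest ((fun h : ℝ × ℝ => P.φ₅ * h.1 - P.φ₄ * h.2) '' polarBall F) (P.casimirMax F) :=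
  (isCompact_image_polarBall hF P).isGreatest_sSup (image_polarBall_nonempty hF P)

lemma isLeast_casimirMin (hF : IsQuasinorm F) (P : InitialData) :
    IsLeast ((fun h : ℝ × ℝ => P.φ₅ * h.1 - P.φ₄ * h.2) '' polarBall F) (P.casimirMin F) :=
  (isCompact_image_polarBall hF P).isLeast_sInf (image_polarBall_nonempty hF P)

lemma dot_dir_le_casimirMax (hF : IsQuasinorm F) (P : InitialData) {h : ℝ × ℝ}
    (hh : h ∈ polarBall F) : dot h P.dir ≤ P.casimirMax F := by
  rw [dot_dir]; exact (isGreatest_casimirMax hF P).2 ⟨h, hh, rfl⟩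

lemma casimirMin_le_dot_dir (hF : IsQuasinorm F) (P : InitialData) {h : ℝ × ℝ}
    (hh : h ∈ polarBall F) : P.casimirMin F ≤ dot h P.dir := by
  rw [dot_dir]; exact (isLeast_casimirMin hF P).2 ⟨h, hh, rfl⟩

lemma level_le_casimirMax (hF : IsQuasinorm F) (P : InitialData) (ξ : ℝ) :
    level F P ξ ≤ P.casimirMax F := dot_dir_le_casimirMax hF P (bdry_mem_polarBall hF ξ)

lemma casimirMin_le_level (hF : IsQuasinorm F) (P : InitialData) (ξ : ℝ) :
    P.casimirMin F ≤ level F P ξ := casimirMin_le_dot_dir hF P (bdry_mem_polarBall hF ξ)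

lemma dot_dir_dir_pos (hP : P.φ₄ ^ 2 + P.φ₅ ^ 2 ≠ 0) : 0 < dot P.dir P.dir := by
  have : dot P.dir P.dir = P.φ₄ ^ 2 + P.φ₅ ^ 2 := by simp [dot, InitialData.dir]; ring
  rw [this]; positivity

lemma casimirMax_pos (hF : IsQuasinorm F) (hP : P.φ₄ ^ 2 + P.φ₅ ^ 2 ≠ 0) : 0 < P.casimirMax F := by
  obtain ⟨c, hc, hm⟩ := hF.isQuasinorm_supportFn.exists_smul_mem_unitBall P.dir
  have := dot_dir_le_casimirMax hF P hm
  rw [dot_smul_left] at this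
  exact lt_of_lt_of_le (mul_pos hc (dot_dir_dir_pos hP)) this

/-- An extremal value of the functional on the polar figure is attained on the boundary. -/
lemma exists_level_eq (hF : IsQuasinorm F) {h : ℝ × ℝ} (hh : h ∈ polarBall F)
    (h0 : dot h P.dir ≠ 0)
    (hext : ∀ c : ℝ, 1 ≤ c → c • h ∈ polarBall F → c * dot h P.dir = dot h P.dir) :
    ∃ ξ, level F P ξ = dot h P.dir := by
  have hne : h ≠ 0 := by rintro rfl; simp [dot] at h0
  have hH := hF.isQuasinorm_supportFn
  have hp := hH.pos hne
  have hle : supportFn F h ≤ 1 := hh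
  -- Radial projection to the boundary scales by a factor at least 1, which by extremality does not
  -- change the value.
  have h1 : supportFn F ((supportFn F h)⁻¹ • h) = 1 := by
    rw [hH.smul_eq _ _ (inv_nonneg.2 hp.le), inv_mul_cancel₀ hp.ne']
  have h2 := hext _ ((one_le_inv₀ hp).2 hle) h1.le
  obtain ⟨ξ, hξ⟩ := exists_eq_bdry hF h1
  refine ⟨ξ, ?_⟩
  rw [level, ← hξ, dot_smul_left, h2]

lemma exists_level_eq_casimirMax (hF : IsQuasinorm F) (hP : P.φ₄ ^ 2 + P.φ₅ ^ 2 ≠ 0) :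
    ∃ ξ, level F P ξ = P.casimirMax F := by
  obtain ⟨h, hh, e⟩ := (isGreatest_casimirMax hF P).1
  have e' : dot h P.dir = P.casimirMax F := by rw [dot_dir]; exact e
  have hp := casimirMax_pos hF hP
  rw [← e'] at hp ⊢
  refine exists_level_eq hF hh hp.ne' fun c hc hm => le_antisymm ?_ (by nlinarith)
  have := dot_dir_le_casimirMax hF P hm
  rwa [dot_smul_left, ← e'] at this

/-- Any angle can be moved past a given one by a multiple of `2π`. -/
lemma exists_lt_add_int_mul_two_pi (ξ c : ℝ) : ∃ k : ℤ, c < ξ + 2 * Real.pi * k := by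
  obtain ⟨k, hk⟩ := _root_.exists_int_gt ((c - ξ) / (2 * Real.pi))
  refine ⟨k, ?_⟩
  rw [div_lt_iff₀ (by positivity)] at hk
  linarith

lemma exists_add_int_mul_two_pi_lt (ξ c : ℝ) : ∃ k : ℤ, ξ + 2 * Real.pi * k < c := by
  obtain ⟨k, hk⟩ := _root_.exists_int_lt ((c - ξ) / (2 * Real.pi))
  refine ⟨k, ?_⟩
  rw [lt_div_iff₀ (by positivity)] at hk
  linarith

/-- By the bipolar theorem this vector is an admissible control. Being proportional to (φ₅, -φ₄) it
keeps h₃ constant, so it is the control that sustains a pause at the maximal level. -/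
lemma smul_dir_mem_unitBall_max (hF : IsQuasinorm F) (hP : P.φ₄ ^ 2 + P.φ₅ ^ 2 ≠ 0) :
    (P.casimirMax F)⁻¹ • P.dir ∈ unitBall F := by
  have hp := casimirMax_pos hF hP
  refine hF.mem_unitBall_of_dot_le_one fun h hh => ?_
  rw [dot_smul_right, inv_mul_le_iff₀ hp, mul_one]
  exact dot_dir_le_casimirMax hF P hh

/-- The derivative `φ₄ u₁ + φ₅ u₂` of `h₃`. -/
def InitialData.kap (P : InitialData) (u : ℝ × ℝ) : ℝ := P.φ₄ * u.1 + P.φ₅ * u.2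

/-- Vanishing of φ₄u₁ + φ₅u₂ means that `u` is parallel to (φ₅, -φ₄); the pairing with the boundary
point identifies the factor. -/
lemma level_smul_of_kap_eq_zero {ξ : ℝ} {u : ℝ × ℝ} (hd : dot (bdry F ξ) u = 1)
    (hk : P.kap u = 0) : level F P ξ • u = P.dir := by
  simp only [dot] at hd
  simp only [InitialData.kap] at hk
  ext
  · simp only [level, dot, InitialData.dir, Prod.smul_fst, smul_eq_mul]
    linear_combination P.φ₅ * hd - (bdry F ξ).2 * hk
  · simp only [level, dot, InitialData.dir, Prod.smul_snd, smul_eq_mul]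
    linear_combination (-P.φ₄) * hd + (bdry F ξ).1 * hk

lemma level_ne_zero_of_kap_eq_zero (hP : P.φ₄ ^ 2 + P.φ₅ ^ 2 ≠ 0) {ξ : ℝ} {u : ℝ × ℝ}
    (hd : dot (bdry F ξ) u = 1) (hk : P.kap u = 0) : level F P ξ ≠ 0 := fun h => by
  have := level_smul_of_kap_eq_zero hd hk
  rw [h, zero_smul] at this
  exact dir_ne_zero hP this.symm

/-- The derivative of `h₃` vanishes only at an extremal level. -/
lemma level_extremal_of_kap_eq_zero (hF : IsQuasinorm F) (hP : P.φ₄ ^ 2 + P.φ₅ ^ 2 ≠ 0) {ξ : ℝ}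
    {u : ℝ × ℝ} (hu : u ∈ unitBall F) (hd : dot (bdry F ξ) u = 1) (hk : P.kap u = 0) :
    level F P ξ = P.casimirMax F ∨ level F P ξ = P.casimirMin F := by
  have h1 := level_smul_of_kap_eq_zero hd hk
  -- For every `h` in the polar figure the functional is the level times `dot h u`, and `dot h u ≤
  -- 1`. The sign of the level therefore decides whether it is the minimum or the maximum.
  rcases lt_or_gt_of_ne (level_ne_zero_of_kap_eq_zero hP hd hk) with h0 | h0
  · right
    refine le_antisymm ?_ (casimirMin_le_level hF P ξ)
    obtain ⟨h, hh, e⟩ := (isLeast_casimirMin hF P).1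
    rw [← e]
    have h2 := hF.mem_polarBall_iff.1 hh u hu
    have h3 : dot h P.dir = level F P ξ * dot h u := by rw [← h1, dot_smul_right]
    rw [dot_dir] at h3
    simp only
    rw [h3]; nlinarith
  · left
    refine le_antisymm (level_le_casimirMax hF P ξ) ?_
    obtain ⟨h, hh, e⟩ := (isGreatest_casimirMax hF P).1
    rw [← e]
    have h2 := hF.mem_polarBall_iff.1 hh u hu
    have h3 : dot h P.dir = level F P ξ * dot h u := by rw [← h1, dot_smul_right]
    rw [dot_dir] at h3
    simp only
    rw [h3]; nlinarith

lemma casimir_eq {θ₀ : ℝ} (hinit : bdry F θ₀ = (P.φ₁, P.φ₂)) :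
    P.casimir = P.φ₃ ^ 2 / 2 + level F P θ₀ := by
  rw [level, hinit, dot_dir, InitialData.casimir]; ring

/-- The convexity of the polar figure: the maximal level is attained on an arc. -/
lemma level_eq_casimirMax_of_between (hF : IsQuasinorm F) (hP : P.φ₄ ^ 2 + P.φ₅ ^ 2 ≠ 0) {α β ξ : ℝ}
    (hα : level F P α = P.casimirMax F) (hβ : level F P β = P.casimirMax F) (hαβ : β < α + Real.pi)
    (hξ : ξ ∈ Icc α β) : level F P ξ = P.casimirMax F := by
  rcases eq_or_lt_of_le hξ.1 with rfl | h1
  · exact hα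
  have hH := hF.isQuasinorm_supportFn
  have hp := casimirMax_pos hF hP
  have hs : 0 < Real.sin (β - α) := Real.sin_pos_of_pos_of_lt_pi (by linarith [hξ.2]) (by linarith)
  -- The unit vector of angle `ξ` is a nonnegative combination of those of angles `α` and `β`. The
  -- support function is at most the same combination, while the functional is equal to it; the
  -- level at `ξ` cannot then fall below the maximum.
  set a := Real.sin (β - ξ) / Real.sin (β - α) with ha
  set b := Real.sin (ξ - α) / Real.sin (β - α) with hb
  have ha0 : 0 ≤ a := div_nonneg
    (Real.sin_nonneg_of_nonneg_of_le_pi (by linarith [hξ.2]) (by linarith)) hs.le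
  have hb0 : 0 < b := div_pos (Real.sin_pos_of_pos_of_lt_pi (by linarith) (by linarith [hξ.2])) hs
  set e : ℝ → ℝ × ℝ := fun ξ => (Real.cos ξ, Real.sin ξ) with he
  have hcomb : e ξ = a • e α + b • e β := by
    have p1 := Real.sin_sq_add_cos_sq ξ
    have p2 := Real.sin_sq_add_cos_sq α
    have p3 := Real.sin_sq_add_cos_sq β
    have key1 : Real.sin (β - α) * Real.cos ξ
        = Real.sin (β - ξ) * Real.cos α + Real.sin (ξ - α) * Real.cos β := by
      simp only [Real.sin_sub]; ring
    have key2 : Real.sin (β - α) * Real.sin ξ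
        = Real.sin (β - ξ) * Real.sin α + Real.sin (ξ - α) * Real.sin β := by
      simp only [Real.sin_sub]; ring
    ext
    · simp only [he, ha, hb, Prod.fst_add, Prod.smul_fst, smul_eq_mul]
      field_simp; linarith
    · simp only [he, ha, hb, Prod.snd_add, Prod.smul_snd, smul_eq_mul]
      field_simp; linarith
  have hlev : ∀ η, dot (e η) P.dir = level F P η * supportFn F (e η) := fun η => by
    have h0 := supportFn_cos_sin_pos hF η
    rw [level, bdry_eq_smul, dot_smul_left, rad]
    field_simp
    rfl
  have h3 : supportFn F (e ξ) ≤ a * supportFn F (e α) + b * supportFn F (e β) := by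
    rw [hcomb, ← hH.smul_eq _ _ ha0, ← hH.smul_eq _ _ hb0.le]
    exact hH.add_le _ _
  have h4 : dot (e ξ) P.dir = P.casimirMax F * (a * supportFn F (e α) + b * supportFn F (e β)) := by
    rw [hcomb, dot_add_left, dot_smul_left, dot_smul_left, hlev, hlev, hα, hβ]; ring
  rw [hlev] at h4
  refine le_antisymm (level_le_casimirMax hF P ξ) ?_
  have h5 := supportFn_cos_sin_pos hF ξ
  have h6 : P.casimirMax F * supportFn F (e ξ) ≤ level F P ξ * supportFn F (e ξ) := by
    rw [h4]; exact mul_le_mul_of_nonneg_left h3 hp.le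
  exact le_of_mul_le_mul_right h6 h5

/-- On the opposite ray the functional changes sign. This prevents two boundary points at maximal
level from being exactly opposite, the case left open by the convexity argument. -/
lemma level_add_pi_neg_of_max (hF : IsQuasinorm F) (hP : P.φ₄ ^ 2 + P.φ₅ ^ 2 ≠ 0) {α : ℝ}
    (hα : level F P α = P.casimirMax F) : level F P (α + Real.pi) < 0 := by
  have hp := casimirMax_pos hF hP
  rw [← hα, level_eq] at hp
  have h1 : rad F α * (P.φ₅ * Real.cos α - P.φ₄ * Real.sin α) > 0 := by linarith
  have h2 := pos_of_mul_pos_right h1 (rad_pos hF α).le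
  rw [level_eq, Real.cos_add_pi, Real.sin_add_pi]
  have := mul_pos (rad_pos hF (α + Real.pi)) h2
  linarith

end

section

variable {F : ℝ × ℝ → ℝ} {P : InitialData}

/-! ### Intervals of constancy of the polar angle -/

lemma ACD.sub_eq_sub_on {f g f' g' : ℝ → ℝ} (hf : ACD f f') (hg : ACD g g') {a b : ℝ}
    (h : ∀ᵐ t, t ∈ Ioo a b → f' t = g' t) {s t : ℝ} (hs : s ∈ Icc a b) (ht : t ∈ Icc a b) :
    f t - f s = g t - g s := by
  have h1 := hf.sub hg
  have hne : ∀ c : ℝ, ∀ᵐ x : ℝ, x ≠ c := fun c => by simp [ae_iff]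
  obtain ⟨C, hC⟩ := (h1.1 s t).const_of_ae_hasDerivAt_zero (by
    filter_upwards [h1.2, h, hne a, hne b] with τ h2 h3 ha hb hτ
    have h4 : τ ∈ Icc a b := uIcc_subset_Icc hs ht hτ
    rwa [h3 ⟨lt_of_le_of_ne h4.1 ha.symm, lt_of_le_of_ne h4.2 hb⟩, sub_self] at h2)
  have h4 := hC s left_mem_uIcc
  have h5 := hC t right_mem_uIcc
  linarith

namespace Traj

variable {g : ℝ → Fin 5 → ℝ} {θ : ℝ → ℝ} {u : ℝ → ℝ × ℝ} {a b c : ℝ}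

lemma acd_hZ (h : Traj F P g θ u) : ACD (fun t => P.hZ (g t)) fun t => P.kap (u t) :=
  (((ACD.const P.φ₃).add (h.acd_x.const_mul P.φ₄)).add (h.acd_y.const_mul P.φ₅)).congr
    (Eventually.of_forall fun t => by simp [InitialData.kap])

lemma hZ_zero (h : Traj F P g θ u) : P.hZ (g 0) = P.φ₃ := by
  simp [InitialData.hZ, h.g_zero]

lemma hZ_eq_zero_of_const (hF : IsQuasinorm F) (h : Traj F P g θ u) (hab : a < b)
    (hc : ∀ t ∈ Icc a b, θ t = c) {t : ℝ} (ht : t ∈ Icc a b) : P.hZ (g t) = 0 := by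
  have h1 := (h.hasDerivAt_angle t).hasDerivWithinAt (s := Icc a b)
  have h2 : HasDerivWithinAt θ 0 (Icc a b) t :=
    (hasDerivWithinAt_const t (Icc a b) c).congr (fun s hs => hc s hs) (hc t ht)
  have h3 := (uniqueDiffOn_Icc hab t ht).eq_deriv _ h1 h2
  have h4 := rad_pos hF (θ t)
  exact (div_eq_zero_iff.1 h3).resolve_right (by positivity)

lemma level_eq_of_hZ_eq_zero (hF : IsQuasinorm F) (h : Traj F P g θ u) {t : ℝ}
    (ht : P.hZ (g t) = 0) : level F P (θ t) = P.casimir := by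
  have := h.numer_eq_of_init hF t
  rw [ht, numer_eq] at this
  linarith

lemma ae_kap_eq_zero_of_const (hF : IsQuasinorm F) (h : Traj F P g θ u) (hab : a < b)
    (hc : ∀ t ∈ Icc a b, θ t = c) : ∀ᵐ t, t ∈ Ioo a b → P.kap (u t) = 0 := by
  filter_upwards [h.acd_hZ.2] with t ht hm
  have h1 : (fun t => P.hZ (g t)) =ᶠ[𝓝 t] fun _ => 0 := by
    filter_upwards [Icc_mem_nhds hm.1 hm.2] with s hs
    exact h.hZ_eq_zero_of_const hF hab hc hs
  exact ht.unique ((hasDerivAt_const t 0).congr_of_eventuallyEq h1)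

/-- On a pause h₃ vanishes identically, so almost everywhere its derivative does too. The control is
then the multiple of (φ₅, -φ₄) determined by the level 𝓔, which must be extreme and nonzero. -/
lemma ae_control_of_const (hF : IsQuasinorm F) (hP : P.φ₄ ^ 2 + P.φ₅ ^ 2 ≠ 0)
    (h : Traj F P g θ u) (hab : a < b) (hc : ∀ t ∈ Icc a b, θ t = c) :
    P.casimir ≠ 0 ∧ (P.casimir = P.casimirMax F ∨ P.casimir = P.casimirMin F) ∧
      level F P c = P.casimir ∧
      ∀ᵐ t, t ∈ Ioo a b → (u t).1 = P.φ₅ / P.casimir ∧ (u t).2 = -(P.φ₄ / P.casimir) := by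
  have hE : level F P c = P.casimir := by
    have h1 := h.level_eq_of_hZ_eq_zero hF (h.hZ_eq_zero_of_const hF hab hc (left_mem_Icc.2 hab.le))
    rwa [hc a (left_mem_Icc.2 hab.le)] at h1
  have hae := h.ae_kap_eq_zero_of_const hF hab hc
  obtain ⟨t, htm, ht⟩ := (Measure.dense_of_ae hae).exists_mem_open isOpen_Ioo (nonempty_Ioo.2 hab)
  have hd := h.dot_eq t
  rw [hc t (Ioo_subset_Icc_self ht)] at hd
  have hne : P.casimir ≠ 0 := hE ▸ level_ne_zero_of_kap_eq_zero hP hd (htm ht)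
  refine ⟨hne, hE ▸ level_extremal_of_kap_eq_zero hF hP (h.mem t) hd (htm ht), hE, ?_⟩
  filter_upwards [hae] with t ht hm
  have hd := h.dot_eq t
  rw [hc t (Ioo_subset_Icc_self hm)] at hd
  have h1 := level_smul_of_kap_eq_zero hd (ht hm)
  rw [hE, Prod.ext_iff] at h1
  simp only [InitialData.dir, Prod.smul_fst, Prod.smul_snd, smul_eq_mul] at h1
  constructor
  · rw [← h1.1]; field_simp
  · rw [← neg_div, ← h1.2]; field_simp

/-- The trajectory on an interval of constancy of the polar angle. -/
lemma formulas_of_const (hF : IsQuasinorm F) (hP : P.φ₄ ^ 2 + P.φ₅ ^ 2 ≠ 0)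
    (h : Traj F P g θ u) (hab : a < b) (hc : ∀ t ∈ Icc a b, θ t = c) {t₀ t : ℝ}
    (ht₀ : t₀ ∈ Icc a b) (ht : t ∈ Icc a b) :
    g t 0 = g t₀ 0 + P.φ₅ / P.casimir * (t - t₀) ∧
    g t 1 = g t₀ 1 - P.φ₄ / P.casimir * (t - t₀) ∧
    g t 2 = g t₀ 2 + P.φ₃ / (2 * P.casimir) * (t - t₀) ∧
    g t 3 = g t₀ 3 - P.φ₃ * P.φ₅ / (12 * P.casimir ^ 2) * (t - t₀) ^ 2
      + 1 / (12 * P.casimir) * (P.φ₃ * g t₀ 0 - 6 * P.φ₅ * g t₀ 2) * (t - t₀) ∧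
    g t 4 = g t₀ 4 + P.φ₃ * P.φ₄ / (12 * P.casimir ^ 2) * (t - t₀) ^ 2
      + 1 / (12 * P.casimir) * (P.φ₃ * g t₀ 1 + 6 * P.φ₄ * g t₀ 2) * (t - t₀) := by
  obtain ⟨hE, -, -, hu⟩ := h.ae_control_of_const hF hP hab hc
  have hid : ACD (fun t : ℝ => t - t₀) fun _ => 1 :=
    ACD.of_hasDerivAt (fun t => (hasDerivAt_id t).sub_const t₀) continuous_const
  have hz : ∀ t ∈ Icc a b, P.φ₃ + P.φ₄ * g t 0 + P.φ₅ * g t 1 = 0 := fun t ht =>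
    h.hZ_eq_zero_of_const hF hab hc ht
  have X : ∀ t ∈ Icc a b, g t 0 = g t₀ 0 + P.φ₅ / P.casimir * (t - t₀) := fun t ht => by
    have := h.acd_x.sub_eq_sub_on (hid.const_mul (P.φ₅ / P.casimir)) (a := a) (b := b) (by
      filter_upwards [hu] with t h1 h2
      rw [(h1 h2).1, mul_one]) ht₀ ht
    linarith
  have Y : ∀ t ∈ Icc a b, g t 1 = g t₀ 1 - P.φ₄ / P.casimir * (t - t₀) := fun t ht => by
    have := h.acd_y.sub_eq_sub_on (hid.const_mul (-(P.φ₄ / P.casimir))) (a := a) (b := b) (by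
      filter_upwards [hu] with t h1 h2
      rw [(h1 h2).2, mul_one]) ht₀ ht
    linarith
  -- Here ż = -(φ₄x + φ₅y)/(2𝓔), and h₃ = 0 turns the bracket into -φ₃. The same relation removes
  -- the terms of higher degree from the equations for v and w.
  have Z : ∀ t ∈ Icc a b, g t 2 = g t₀ 2 + P.φ₃ / (2 * P.casimir) * (t - t₀) := fun t ht => by
    have := h.acd_z.sub_eq_sub_on (hid.const_mul (P.φ₃ / (2 * P.casimir))) (a := a) (b := b) (by
      filter_upwards [hu] with t h1 h2
      have h3 := hz t (Ioo_subset_Icc_self h2)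
      rw [(h1 h2).1, (h1 h2).2]
      field_simp
      linarith) ht₀ ht
    linarith
  have V : ∀ t ∈ Icc a b, g t 3 = g t₀ 3 - P.φ₃ * P.φ₅ / (12 * P.casimir ^ 2) * (t - t₀) ^ 2
      + 1 / (12 * P.casimir) * (P.φ₃ * g t₀ 0 - 6 * P.φ₅ * g t₀ 2) * (t - t₀) := fun t ht => by
    have := h.acd_v.sub_eq_sub_on (((hid.mul hid).const_mul
      (-(P.φ₃ * P.φ₅ / (12 * P.casimir ^ 2)))).add (hid.const_mul
      (1 / (12 * P.casimir) * (P.φ₃ * g t₀ 0 - 6 * P.φ₅ * g t₀ 2)))) (a := a) (b := b) (by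
      filter_upwards [hu] with t h1 h2
      have h3 := hz t (Ioo_subset_Icc_self h2)
      have h4 : P.φ₅ / P.casimir * (-(g t 2) / 2 - g t 0 * g t 1 / 12)
          + -(P.φ₄ / P.casimir) * (g t 0 ^ 2 / 12)
          = -(P.φ₅ * g t 2) / (2 * P.casimir) + P.φ₃ * g t 0 / (12 * P.casimir) := by
        field_simp
        linear_combination (-2 * g t 0) * h3
      rw [(h1 h2).1, (h1 h2).2, h4, X t (Ioo_subset_Icc_self h2), Z t (Ioo_subset_Icc_self h2)]
      field_simp
      ring) ht₀ ht
    linear_combination this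
  have W : ∀ t ∈ Icc a b, g t 4 = g t₀ 4 + P.φ₃ * P.φ₄ / (12 * P.casimir ^ 2) * (t - t₀) ^ 2
      + 1 / (12 * P.casimir) * (P.φ₃ * g t₀ 1 + 6 * P.φ₄ * g t₀ 2) * (t - t₀) := fun t ht => by
    have := h.acd_w.sub_eq_sub_on (((hid.mul hid).const_mul
      (P.φ₃ * P.φ₄ / (12 * P.casimir ^ 2))).add (hid.const_mul
      (1 / (12 * P.casimir) * (P.φ₃ * g t₀ 1 + 6 * P.φ₄ * g t₀ 2)))) (a := a) (b := b) (by
      filter_upwards [hu] with t h1 h2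
      have h3 := hz t (Ioo_subset_Icc_self h2)
      have h4 : P.φ₅ / P.casimir * (-(g t 1 ^ 2) / 12)
          + -(P.φ₄ / P.casimir) * (g t 0 * g t 1 / 12 - g t 2 / 2)
          = P.φ₄ * g t 2 / (2 * P.casimir) + P.φ₃ * g t 1 / (12 * P.casimir) := by
        field_simp
        linear_combination (-2 * g t 1) * h3
      rw [(h1 h2).1, (h1 h2).2, h4, Y t (Ioo_subset_Icc_self h2), Z t (Ioo_subset_Icc_self h2)]
      field_simp
      ring) ht₀ ht
    linear_combination this
  exact ⟨X t ht, Y t ht, Z t ht, V t ht, W t ht⟩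

lemma pauseFormulas (hF : IsQuasinorm F) (hP : P.φ₄ ^ 2 + P.φ₅ ^ 2 ≠ 0)
    (h : Traj F P g θ u) (hab : a < b) (hc : ∀ t ∈ Icc a b, θ t = c) :
    PauseFormulas P a b (fun t => g t 0) (fun t => g t 1) (fun t => g t 2) (fun t => g t 3)
      (fun t => g t 4) := by
  have hE := (h.ae_control_of_const hF hP hab hc).1
  refine ⟨hE, fun t₀ ht₀ t ht => ?_⟩
  obtain ⟨X, Y, Z, V, W⟩ := h.formulas_of_const hF hP hab hc ht₀ ht
  have hz : ∀ t ∈ Icc a b, P.φ₃ + P.φ₄ * g t 0 + P.φ₅ * g t 1 = 0 := fun t ht =>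
    h.hZ_eq_zero_of_const hF hab hc ht
  have h0 := hz t₀ ht₀
  have h1 := hz t ht
  refine ⟨fun h5 => ?_, fun h5 => ?_⟩
  · have hy : g t₀ 1 = -((P.φ₃ + P.φ₄ * g t₀ 0) / P.φ₅) := by field_simp; linarith
    refine ⟨X, ?_, Z, V, ?_⟩
    · simp only [Y, hy]; ring
    · simp only [W, hy]; field_simp; ring
  · have h4 : P.φ₄ ≠ 0 := fun h4 => hP (by rw [h4, h5]; ring)
    rw [h5] at h0 h1
    refine ⟨?_, Y, Z, ?_, W⟩
    · field_simp; linarith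
    · have hx : g t₀ 0 = -(P.φ₃ / P.φ₄) := by field_simp; linarith
      simp only [V, hx, h5]; field_simp; ring

end Traj

/-! ### Metric straight lines -/

lemma ofReal_integral_le_lintegral {α : Type*} [MeasurableSpace α] {μ : Measure α} {f : α → ℝ}
    (hf : Integrable f μ) : ENNReal.ofReal (∫ x, f x ∂μ) ≤ ∫⁻ x, ENNReal.ofReal (f x) ∂μ := by
  have h1 : ∫ x, f x ∂μ ≤ ∫ x, max (f x) 0 ∂μ :=
    integral_mono hf hf.pos_part fun x => le_max_left _ _
  refine (ENNReal.ofReal_le_ofReal h1).trans ?_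
  rw [ofReal_integral_eq_lintegral_ofReal hf.pos_part
    (Eventually.of_forall fun x => le_max_right _ _)]
  exact lintegral_mono fun x => by simp

lemma isHorizontal_of_linear {v : ℝ × ℝ} {g : ℝ → Fin 5 → ℝ}
    (hg : ∀ t, g t = ![v.1 * t, v.2 * t, 0, 0, 0]) (s T : ℝ) :
    IsHorizontal T (fun _ => v) fun τ => g (s + τ) := by
  have key : ∀ i, ∃ c : ℝ, (∀ τ, HasDerivAt (fun τ => g (s + τ) i) c τ) ∧
      ∀ τ, v.1 * fieldX (g τ) i + v.2 * fieldY (g τ) i = c := by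
    have h1 : ∀ c τ : ℝ, HasDerivAt (fun τ => c * (s + τ)) c τ := fun c τ => by
      simpa using ((hasDerivAt_id τ).const_add s).const_mul c
    intro i
    fin_cases i
    · exact ⟨v.1, fun τ => by simpa [hg] using h1 v.1 τ, fun τ => by simp [fieldX, fieldY]⟩
    · exact ⟨v.2, fun τ => by simpa [hg] using h1 v.2 τ, fun τ => by simp [fieldX, fieldY]⟩
    all_goals
      refine ⟨0, fun τ => by simpa [hg] using hasDerivAt_const τ (0 : ℝ), fun τ => ?_⟩
      simp [fieldX, fieldY, hg]
      ring
  choose c hc hc' using key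
  refine ⟨measurable_const, fun i => ?_, Eventually.of_forall fun τ _ i => ?_⟩
  · exact (ACD.of_hasDerivAt (hc i) continuous_const).1 0 T
  · rw [hc' i]
    exact hc i τ

/-- A one-parameter subgroup in the direction of a horizontal unit vector is a metric straight
line. -/
lemma isMetricLine_of_linear (hF : IsQuasinorm F) {v h : ℝ × ℝ} (hv : F v = 1)
    (hh : supportFn F h = 1) (hd : dot h v = 1) {g : ℝ → Fin 5 → ℝ}
    (hg : ∀ t, g t = ![v.1 * t, v.2 * t, 0, 0, 0]) : IsMetricLine F g := by
  intro s t hst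
  refine le_antisymm ?_ (le_sInf ?_)
  · have hL : ENNReal.ofReal (t - s) = ∫⁻ _ in Icc 0 (t - s), ENNReal.ofReal (F v) := by
      simp [hv]
    exact sInf_le ⟨t - s, fun _ => v, fun τ => g (s + τ), sub_nonneg.2 hst,
      isHorizontal_of_linear hg s (t - s), congrArg g (add_zero s), congrArg g (add_sub_cancel s t), hL⟩
  · rintro L ⟨T, u, k, hT, hk, h0, h1, rfl⟩
    -- Calibration: along any horizontal curve this linear function grows at rate `dot h u ≤ F u`,
    -- and between the given end points it grows by exactly `t - s`.
    set φ : ℝ → ℝ := fun τ => h.1 * k τ 0 + h.2 * k τ 1 with hφ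
    have hac : AbsolutelyContinuousOnInterval φ 0 T :=
      ((hk.absCont 0).const_mul h.1).fun_add ((hk.absCont 1).const_mul h.2)
    have hint := hac.integral_deriv_eq_sub
    have hval : φ T - φ 0 = t - s := by
      simp only [hφ, h0, h1, hg]
      simp only [dot] at hd
      simp
      linear_combination (t - s) * hd
    have hii := hac.intervalIntegrable_deriv
    rw [hval, intervalIntegral.integral_of_le hT] at hint
    rw [← hint, ← restrict_Ioc_eq_restrict_Icc]
    rw [intervalIntegrable_iff_integrableOn_Ioc_of_le hT] at hii
    refine (ofReal_integral_le_lintegral hii).trans (lintegral_mono_ae ?_)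
    refine (ae_restrict_iff' measurableSet_Ioc).2 ?_
    filter_upwards [hk.deriv_eq] with τ h2 h3
    have h4 := h2 (Ioc_subset_Icc_self h3)
    have h5 : HasDerivAt φ (dot h (u τ)) τ := by
      have h6 := ((h4 0).const_mul h.1).fun_add ((h4 1).const_mul h.2)
      refine h6.congr_deriv ?_
      simp [fieldX, fieldY, dot]
    rw [h5.deriv]
    refine ENNReal.ofReal_le_ofReal ?_
    simpa [hh] using hF.dot_le_mul h (u τ)

/-- The trajectories with constant polar angle. -/
lemma Traj.line_of_const (hF : IsQuasinorm F) (hP : P.φ₄ ^ 2 + P.φ₅ ^ 2 ≠ 0)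
    {g : ℝ → Fin 5 → ℝ} {θ : ℝ → ℝ} {u : ℝ → ℝ × ℝ} {c : ℝ}
    (h : Traj F P g θ u) (hc : ∀ t, θ t = c) : IsLineExtremal F P g ∧ IsMetricLine F g := by
  have hφ : P.φ₃ = 0 := by
    rw [← h.hZ_zero]
    exact h.hZ_eq_zero_of_const hF (a := 0) (b := 1) one_pos (fun t _ => hc t) (by simp)
  obtain ⟨hE, -, hlev, hu⟩ := h.ae_control_of_const hF hP (a := 0) (b := 1) one_pos (fun t _ => hc t)
  set v : ℝ × ℝ := (P.φ₅ / P.casimir, -(P.φ₄ / P.casimir)) with hv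
  have hg : ∀ t, g t = ![v.1 * t, v.2 * t, 0, 0, 0] := fun t => by
    have h0 : (0 : ℝ) ∈ Icc (-|t| - 1) (|t| + 1) := by
      constructor <;> linarith [abs_nonneg t]
    have ht : t ∈ Icc (-|t| - 1) (|t| + 1) := by
      constructor <;> linarith [neg_abs_le t, le_abs_self t]
    obtain ⟨X, Y, Z, V, W⟩ := h.formulas_of_const hF hP (a := -|t| - 1) (b := |t| + 1)
      (by linarith [abs_nonneg t]) (fun t _ => hc t) h0 ht
    simp only [h.g_zero, hφ] at X Y Z V W
    ext i
    fin_cases i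
    · simpa [hv] using X
    · simpa [hv] using Y
    · simpa using Z
    · simpa using V
    · simpa using W
  -- One instant at which the actual control equals `v` suffices to place `v` in the ball; the
  -- pairing with the boundary point then gives `F v = 1`.
  obtain ⟨t, htm, ht⟩ := (Measure.dense_of_ae hu).exists_mem_open isOpen_Ioo
    (nonempty_Ioo.2 (one_pos (α := ℝ)))
  have hut : u t = v := Prod.ext (htm ht).1 (htm ht).2
  have hd : dot (bdry F c) v = 1 := by rw [← hut, ← hc t, h.dot_eq]
  have hFv : F v = 1 := by
    refine le_antisymm (hut ▸ h.mem t) ?_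
    have := hF.dot_le_mul (bdry F c) v
    rwa [hd, supportFn_bdry hF, one_mul] at this
  refine ⟨?_, isMetricLine_of_linear hF hFv (supportFn_bdry hF c) hd hg⟩
  -- Homogeneity is available for nonnegative factors only, so the sign of the coefficient is
  -- carried by `s` inside the argument of `F`.
  have key : ∀ (e : ℝ × ℝ) (b : ℝ), b ≠ 0 → v = b • e → ∃ s : ℝ, (s = 1 ∨ s = -1) ∧
      s / F (s • e) = b := by
    intro e b hb hve
    rcases lt_or_gt_of_ne hb with hb | hb
    · refine ⟨-1, Or.inr rfl, ?_⟩
      have h1 : v = (-b) • ((-1 : ℝ) • e) := by rw [hve, smul_smul]; simp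
      have h2 : F v = -b * F ((-1 : ℝ) • e) := by
        rw [h1, hF.smul_eq _ _ (by linarith)]
      rw [hFv] at h2
      have h3 : F ((-1 : ℝ) • e) ≠ 0 := fun h => by rw [h] at h2; simp at h2
      rw [div_eq_iff h3]; linarith
    · refine ⟨1, Or.inl rfl, ?_⟩
      have h2 : F v = b * F ((1 : ℝ) • e) := by
        rw [one_smul, hve, hF.smul_eq _ _ hb.le]
      rw [hFv] at h2
      have h3 : F ((1 : ℝ) • e) ≠ 0 := fun h => by rw [h] at h2; simp at h2
      rw [div_eq_iff h3]; linarith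
  by_cases h5 : P.φ₅ = 0
  · have h4 : P.φ₄ ≠ 0 := fun h4 => hP (by rw [h4, h5]; ring)
    obtain ⟨s, hs, e⟩ := key (0, 1) (-(P.φ₄ / P.casimir)) (neg_ne_zero.2 (div_ne_zero h4 hE))
      (by simp [hv, h5])
    refine ⟨s, hs, fun _ t => ?_, fun h => absurd h h4, fun _ h => absurd h5 h⟩
    simp only [Prod.smul_mk, smul_eq_mul, mul_zero, mul_one] at e
    rw [hg, mul_div_right_comm, e]
    simp [hv, h5]
  · by_cases h4 : P.φ₄ = 0
    · obtain ⟨s, hs, e⟩ := key (1, 0) (P.φ₅ / P.casimir) (div_ne_zero h5 hE)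
        (by simp [hv, h4])
      refine ⟨s, hs, fun h => absurd h h5, fun _ t => ?_, fun h => absurd h4 h⟩
      simp only [Prod.smul_mk, smul_eq_mul, mul_zero, mul_one] at e
      rw [hg, mul_div_right_comm, e]
      simp [hv, h4]
    · obtain ⟨s, hs, e⟩ := key (P.φ₅, -P.φ₄) (1 / P.casimir) (one_div_ne_zero hE)
        (by ext <;> simp [hv] <;> field_simp)
      refine ⟨s, hs, fun h => absurd h h5, fun h => absurd h h4, fun _ _ t => ?_⟩
      simp only [Prod.smul_mk, smul_eq_mul] at e
      have e2 : s * P.φ₅ * t / F (s * P.φ₅, -s * P.φ₄) = P.φ₅ / P.casimir * t := by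
        rw [show -s * P.φ₄ = s * -P.φ₄ by ring,
          show s * P.φ₅ * t / F (s * P.φ₅, s * -P.φ₄) = P.φ₅ * t * (s / F (s * P.φ₅, s * -P.φ₄)) by ring,
          e]
        ring
      rw [hg, e2]
      ext i
      fin_cases i <;> simp [hv]
      field_simp

end

section

/-! ### The equation `|θ'| = f(θ)` on the line -/

/-- `θ` is a solution of the equation `|θ'| = f(θ)`. -/
def IsSol (f θ : ℝ → ℝ) : Prop := ∀ t, ∃ d, HasDerivAt θ d t ∧ |d| = f (θ t)

lemma hasDerivAt_zero_of_dist_le {γ θ : ℝ → ℝ} {t : ℝ} (hθ : HasDerivAt θ 0 t)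
    (h : ∀ s, |γ s - γ t| ≤ |θ s - θ t|) : HasDerivAt γ 0 t := by
  rw [hasDerivAt_iff_isLittleO] at hθ ⊢
  simp only [smul_zero, sub_zero] at hθ ⊢
  exact (Asymptotics.IsBigO.of_bound 1 (Eventually.of_forall fun s => by simpa using h s)).trans_isLittleO hθ

namespace IsSol

variable {f θ : ℝ → ℝ}

lemma continuous (h : IsSol f θ) : Continuous θ :=
  continuous_iff_continuousAt.2 fun t => (h t).choose_spec.1.continuousAt

lemma hasDerivAt (h : IsSol f θ) (t : ℝ) : HasDerivAt θ (deriv θ t) t := by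
  obtain ⟨d, hd, -⟩ := h t
  rwa [hd.deriv]

lemma abs_deriv (h : IsSol f θ) (t : ℝ) : |deriv θ t| = f (θ t) := by
  obtain ⟨d, hd, hd'⟩ := h t
  rwa [hd.deriv]

/-- A countable set of times at which `f(θ) = 0` may be disregarded. -/
lemma of_countable {K : Set ℝ} (hK : K.Countable) (hf : Continuous f) (hθ : Continuous θ)
    (h : ∀ t, t ∉ K → ∃ d, HasDerivAt θ d t ∧ |d| = f (θ t)) (h0 : ∀ t ∈ K, f (θ t) = 0) :
    IsSol f θ := by
  intro t
  by_cases ht : t ∈ K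
  swap
  · exact h t ht
  refine ⟨0, ?_, by rw [abs_zero, h0 t ht]⟩
  rw [hasDerivAt_iff_isLittleO, Asymptotics.isLittleO_iff]
  intro ε hε
  have hc : ContinuousAt (fun s => f (θ s)) t := (hf.comp hθ).continuousAt
  have hev : ∀ᶠ s in 𝓝 t, f (θ s) < ε := by
    refine hc.eventually_lt_const ?_
    simpa only [h0 t ht] using hε
  obtain ⟨δ, hδ, hball⟩ := Metric.eventually_nhds_iff_ball.1 hev
  filter_upwards [Metric.ball_mem_nhds t hδ] with s hs
  have hseg : uIcc t s ⊆ Metric.ball t δ := by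
    rw [← segment_eq_uIcc]
    exact (convex_ball t δ).segment_subset (Metric.mem_ball_self hδ) hs
  have hd : ∀ τ, τ ∉ K → HasDerivAt θ (deriv θ τ) τ ∧ |deriv θ τ| = f (θ τ) := fun τ hτ => by
    obtain ⟨d, hd, hd'⟩ := h τ hτ
    rw [hd.deriv]
    exact ⟨hd, hd'⟩
  have hbd : ∀ᵐ τ, τ ∈ Ι t s → ‖deriv θ τ‖ ≤ ε := by
    filter_upwards [hK.ae_notMem volume] with τ hτ hm
    rw [Real.norm_eq_abs, (hd τ hτ).2]
    exact (hball τ (hseg (uIoc_subset_uIcc hm))).le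
  have hint : IntervalIntegrable (deriv θ) volume t s := by
    rw [intervalIntegrable_iff]
    refine Measure.integrableOn_of_bounded (M := ε) (by simp [uIoc])
      (measurable_deriv θ).aestronglyMeasurable ?_
    rw [ae_restrict_iff' measurableSet_uIoc]
    exact hbd
  -- Near `t` the derivative is smaller than `ε` in absolute value off a countable set. A continuous
  -- function differentiable off such a set is the integral of its derivative, so the increment is
  -- at most `ε` times the length.
  have heq := MeasureTheory.integral_eq_of_hasDerivAt_off_countable θ (deriv θ) hK
    hθ.continuousOn (fun τ hτ => (hd τ hτ.2).1) hint
  simp only [smul_zero, sub_zero]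
  rw [← heq, Real.norm_eq_abs (s - t)]
  exact intervalIntegral.norm_integral_le_of_norm_le_const_ae hbd

lemma comp_neg (h : IsSol f θ) : IsSol f fun t => θ (-t) := by
  intro t
  refine ⟨-deriv θ (-t), ?_, by rw [abs_neg, h.abs_deriv]⟩
  simpa [Function.comp_def] using (h.hasDerivAt (-t)).scomp t (hasDerivAt_neg t)

lemma comp_add_const (h : IsSol f θ) (c : ℝ) : IsSol f fun t => θ (t + c) :=
  fun t => ⟨_, (h.hasDerivAt (t + c)).comp_add_const t c, h.abs_deriv _⟩

lemma neg (h : IsSol f θ) : IsSol (fun ξ => f (-ξ)) fun t => -θ t :=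
  fun t => ⟨_, (h.hasDerivAt t).neg, by simp only [abs_neg, h.abs_deriv, neg_neg]⟩

/-- The absolute value of θ' is continuous. Where it is nonzero, the Darboux property of derivatives
keeps the sign fixed nearby; where it is zero, so is the limit. -/
lemma continuous_deriv (hf : Continuous f) (h : IsSol f θ) : Continuous (deriv θ) := by
  have hfθ : Continuous fun t => |deriv θ t| := by
    simp only [h.abs_deriv]
    exact hf.comp h.continuous
  rw [continuous_iff_continuousAt]
  intro t
  by_cases h0 : deriv θ t = 0
  · rw [ContinuousAt, h0, tendsto_zero_iff_abs_tendsto_zero]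
    simpa [h0, Function.comp_def] using hfθ.tendsto t
  · have hev : ∀ᶠ s in 𝓝 t, deriv θ s ≠ 0 := by
      filter_upwards [hfθ.continuousAt.eventually_ne (abs_ne_zero.2 h0)] with s hs
      exact abs_ne_zero.1 hs
    obtain ⟨δ, hδ, hball⟩ := Metric.eventually_nhds_iff_ball.1 hev
    have hmem := Metric.ball_mem_nhds t hδ
    rcases hasDerivWithinAt_forall_lt_or_forall_gt_of_forall_ne (convex_ball t δ)
      (fun s _ => (h.hasDerivAt s).hasDerivWithinAt) hball with hs | hs
    · refine (hfθ.neg.continuousAt (x := t)).congr ?_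
      filter_upwards [hmem] with s hm
      simp [abs_of_neg (hs s hm)]
    · refine (hfθ.continuousAt (x := t)).congr ?_
      filter_upwards [hmem] with s hm
      rw [abs_of_pos (hs s hm)]

end IsSol

/-- Take the first time with value at least `q`, and then the last earlier time with value at most
`p`. -/
lemma exists_passage {θ : ℝ → ℝ} (hθ : Continuous θ) {s t p q : ℝ} (hst : s < t) (hs : θ s = p)
    (ht : θ t = q) (hpq : p < q) :
    ∃ s' t', s' < t' ∧ θ s' = p ∧ θ t' = q ∧ ∀ τ ∈ Ioo s' t', θ τ ∈ Ioo p q := by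
  obtain ⟨t', ⟨ht'm, ht'⟩, hmin⟩ := (isCompact_Icc.inter_right
    (isClosed_Ici.preimage hθ) : IsCompact (Icc s t ∩ θ ⁻¹' Ici q)).exists_isLeast
    ⟨t, right_mem_Icc.2 hst.le, by simp [ht]⟩
  obtain ⟨s', ⟨hs'm, hs'⟩, hmax⟩ := (isCompact_Icc.inter_right
    (isClosed_Iic.preimage hθ) : IsCompact (Icc s t' ∩ θ ⁻¹' Iic p)).exists_isGreatest
    ⟨s, left_mem_Icc.2 ht'm.1, by simp [hs]⟩
  have hlt : ∀ τ ∈ Ico s t', θ τ < q := fun τ hτ => by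
    by_contra hq
    exact absurd (hmin ⟨⟨hτ.1, hτ.2.le.trans ht'm.2⟩, not_lt.1 hq⟩) (not_le.2 hτ.2)
  have hgt : ∀ τ ∈ Ioc s' t', p < θ τ := fun τ hτ => by
    by_contra hq
    exact absurd (hmax ⟨⟨hs'm.1.trans hτ.1.le, hτ.2⟩, not_lt.1 hq⟩) (not_le.2 hτ.1)
  simp only [mem_preimage, mem_Ici, mem_Iic] at ht' hs'
  have hne : s' < t' := lt_of_le_of_ne hs'm.2 fun h => by rw [h] at hs'; linarith
  refine ⟨s', t', hne, le_antisymm hs' ?_, le_antisymm ?_ ht', fun τ hτ =>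
    ⟨hgt τ ⟨hτ.1, hτ.2.le⟩, hlt τ ⟨hs'm.1.trans hτ.1.le, hτ.2⟩⟩⟩
  · refine ge_of_tendsto ((hθ.tendsto s').mono_left nhdsWithin_le_nhds :
      Tendsto θ (𝓝[>] s') (𝓝 (θ s'))) ?_
    filter_upwards [Ioc_mem_nhdsGT hne] with τ hτ using (hgt τ hτ).le
  · refine le_of_tendsto ((hθ.tendsto t').mono_left nhdsWithin_le_nhds :
      Tendsto θ (𝓝[<] t') (𝓝 (θ t'))) ?_
    filter_upwards [Ico_mem_nhdsLT hne] with τ hτ using (hlt τ ⟨hs'm.1.trans hτ.1, hτ.2⟩).le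

/-- A solution that passes from `p` to `q` does so in finite time. -/
lemma IsSol.intervalIntegrable {f θ : ℝ → ℝ} (h : IsSol f θ) {s t p q : ℝ} (hs : θ s = p)
    (ht : θ t = q) (hpq : p < q) (hf : ∀ ξ ∈ Ioo p q, 0 < f ξ) :
    IntervalIntegrable (fun ξ => 1 / f ξ) volume p q := by
  wlog hst : s < t generalizing θ s t
  · have hne : s ≠ t := fun e => by rw [e, ht] at hs; exact hpq.ne' hs
    exact this h.comp_neg (s := -s) (t := -t) (by simpa using hs) (by simpa using ht)
      (neg_lt_neg (lt_of_le_of_ne (not_lt.1 hst) hne.symm))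
  obtain ⟨s', t', hst', hs', ht', hm⟩ := exists_passage h.continuous hst hs ht hpq
  -- During the passage θ' is nowhere zero, so Rolle's theorem gives injectivity without deciding
  -- the direction of motion.
  have hinj : InjOn θ (Ioo s' t') := by
    have key : ∀ x ∈ Ioo s' t', ∀ y ∈ Ioo s' t', x < y → θ x ≠ θ y := fun x hx y hy hxy e => by
      obtain ⟨c, hc, hc0⟩ := exists_hasDerivAt_eq_zero hxy h.continuous.continuousOn e
        fun τ _ => h.hasDerivAt τ
      have := h.abs_deriv c
      rw [hc0, abs_zero] at this
      exact (hf _ (hm c ⟨hx.1.trans hc.1, hc.2.trans hy.2⟩)).ne this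
    intro x hx y hy e
    by_contra hne
    rcases lt_or_gt_of_ne hne with hxy | hxy
    · exact key x hx y hy hxy e
    · exact key y hy x hx hxy e.symm
  have himg : Ioo p q ⊆ θ '' Ioo s' t' := by
    have := intermediate_value_Ioo hst'.le (h.continuous.continuousOn (s := Icc s' t'))
    rwa [hs', ht'] at this
  rw [intervalIntegrable_iff_integrableOn_Ioo_of_le hpq.le]
  refine IntegrableOn.mono_set ?_ himg
  -- The change of variables ξ = θ(t) turns 1/f into the constant 1 on a bounded time interval.
  rw [integrableOn_image_iff_integrableOn_abs_deriv_smul measurableSet_Ioo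
    (fun x _ => (h.hasDerivAt x).hasDerivWithinAt) hinj]
  refine (integrableOn_const (C := (1 : ℝ)) (by simp)).congr_fun (fun x hx => ?_) measurableSet_Ioo
  rw [h.abs_deriv, smul_eq_mul, mul_one_div_cancel (hf _ (hm x hx)).ne']

/-- A solution cannot cross a segment of zeros of `f`. -/
lemma IsSol.barrier {f θ : ℝ → ℝ} (h : IsSol f θ) {α β : ℝ} (hf : ∀ ξ ∈ Icc α β, f ξ = 0)
    (s t : ℝ) : max α (min β (θ s)) = max α (min β (θ t)) := by
  -- The projection of `θ` to the segment is locally constant outside it; inside, θ' = 0, and the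
  -- projection does not increase distances.
  have key : ∀ t, HasDerivAt (fun s => max α (min β (θ s))) 0 t := by
    intro t
    rcases lt_or_ge (θ t) α with h1 | h1
    · refine (hasDerivAt_const t α).congr_of_eventuallyEq ?_
      filter_upwards [h.continuous.continuousAt.eventually_lt_const h1] with s hs
      exact max_eq_left ((min_le_right _ _).trans hs.le)
    rcases lt_or_ge β (θ t) with h2 | h2
    · refine (hasDerivAt_const t (max α β)).congr_of_eventuallyEq ?_
      filter_upwards [h.continuous.continuousAt.eventually_const_lt h2] with s hs
      rw [min_eq_left hs.le]
    · refine hasDerivAt_zero_of_dist_le (θ := θ) ?_ fun s => ?_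
      · have h3 := h.hasDerivAt t
        rwa [abs_eq_zero.1 ((h.abs_deriv t).trans (hf _ ⟨h1, h2⟩))] at h3
      · refine (abs_max_sub_max_le_max _ _ _ _).trans (max_le (by simp) ?_)
        exact (abs_min_sub_min_le_max _ _ _ _).trans (max_le (by simp) le_rfl)
  exact is_const_of_deriv_eq_zero (fun t => (key t).differentiableAt) (fun t => (key t).deriv) s t

end

section

/-! ### Monotone solutions between two neighbouring zeros -/

lemma hasDerivAt_integral_of_continuousOn {k : ℝ → ℝ} {I : Set ℝ} (hI : IsOpen I)
    (hI' : I.OrdConnected) (hk : ContinuousOn k I) {ξ₀ ξ : ℝ} (h₀ : ξ₀ ∈ I) (h : ξ ∈ I) :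
    HasDerivAt (fun ξ => ∫ x in ξ₀..ξ, k x) (k ξ) ξ :=
  intervalIntegral.integral_hasDerivAt_right
    (hk.mono (hI'.uIcc_subset h₀ h)).intervalIntegrable
    (hk.stronglyMeasurableAtFilter hI ξ h) (hk.continuousAt (hI.mem_nhds h))

/-- `Θ` is a monotone solution of `Θ' = f(Θ)` with values in `[α, β]`. -/
structure Profile (f : ℝ → ℝ) (α β : ℝ) (Θ : ℝ → ℝ) : Prop where
  hasDerivAt : ∀ t, HasDerivAt Θ (f (Θ t)) t
  mem : ∀ t, Θ t ∈ Icc α β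
  monotone : Monotone Θ

lemma Profile.neg {f Θ : ℝ → ℝ} {α β : ℝ} (h : Profile f α β Θ) :
    Profile (fun ξ => f (-ξ)) (-β) (-α) fun t => -Θ (-t) where
  hasDerivAt t := by
    simpa [Function.comp_def] using ((h.hasDerivAt (-t)).scomp t (hasDerivAt_neg t)).fun_neg
  mem t := ⟨neg_le_neg (h.mem _).2, neg_le_neg (h.mem _).1⟩
  monotone _ _ hst := neg_le_neg (h.monotone (neg_le_neg hst))

lemma Profile.continuous {f Θ : ℝ → ℝ} {α β : ℝ} (h : Profile f α β Θ) : Continuous Θ :=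
  continuous_iff_continuousAt.2 fun t => (h.hasDerivAt t).continuousAt

lemma Profile.exists_end {f Θ : ℝ → ℝ} {α β t₀ t₁ : ℝ} (h : Profile f α β Θ) (h₀ : Θ t₀ < β)
    (h₁ : Θ t₁ = β) : ∃ B, t₀ < B ∧ ∀ t, Θ t = β ↔ B ≤ t := by
  have hlt : ∀ t, Θ t = β → t₀ < t := fun t ht => by
    by_contra hle
    exact absurd (h.monotone (not_lt.1 hle)) (by rw [ht]; exact not_le.2 h₀)
  obtain ⟨B, hB, hmin⟩ := (isCompact_Icc.inter_right
    ((isClosed_singleton (x := β)).preimage h.continuous) :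
      IsCompact (Icc t₀ t₁ ∩ Θ ⁻¹' {β})).exists_isLeast ⟨t₁, ⟨(hlt _ h₁).le, le_rfl⟩, h₁⟩
  refine ⟨B, hlt B hB.2, fun t => ⟨fun ht => ?_, fun ht => ?_⟩⟩
  · rcases le_total t t₁ with h2 | h2
    · exact hmin ⟨⟨(hlt t ht).le, h2⟩, ht⟩
    · exact hB.1.2.trans h2
  · refine le_antisymm (h.mem t).2 ?_
    rw [← show Θ B = β from hB.2]
    exact h.monotone ht

/-- The solution is the inverse of the time integral, extended by its end values. Convergence of the
integral at an end means that the end is reached in finite time, after which the solution rests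
there. -/
lemma exists_profile {f : ℝ → ℝ} (hf : Continuous f) {α β ξ₀ : ℝ} (hα : f α = 0) (hβ : f β = 0)
    (hpos : ∀ ξ ∈ Ioo α β, 0 < f ξ) (h₀ : ξ₀ ∈ Ioo α β) :
    ∃ Θ, Profile f α β Θ ∧ Θ 0 = ξ₀ ∧
      (IntervalIntegrable (fun ξ => 1 / f ξ) volume ξ₀ β → ∃ B > 0, ∀ t, Θ t = β ↔ B ≤ t) ∧
      (IntervalIntegrable (fun ξ => 1 / f ξ) volume ξ₀ α → ∃ A < 0, ∀ t, Θ t = α ↔ t ≤ A) := by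
  have hαβ : α < β := h₀.1.trans h₀.2
  set T : ℝ → ℝ := fun ξ => ∫ x in ξ₀..ξ, 1 / f x with hT
  have hk : ContinuousOn (fun ξ => 1 / f ξ) (Ioo α β) :=
    continuousOn_const.div hf.continuousOn fun ξ hξ => (hpos ξ hξ).ne'
  have hTd : ∀ ξ ∈ Ioo α β, HasDerivAt T (1 / f ξ) ξ := fun ξ hξ =>
    hasDerivAt_integral_of_continuousOn isOpen_Ioo ordConnected_Ioo hk h₀ hξ
  have hTm : StrictMonoOn T (Ioo α β) := by
    refine strictMonoOn_of_deriv_pos (convex_Ioo α β)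
      (fun ξ hξ => (hTd ξ hξ).continuousAt.continuousWithinAt) fun ξ hξ => ?_
    rw [interior_Ioo] at hξ
    rw [(hTd ξ hξ).deriv]
    exact one_div_pos.2 (hpos ξ hξ)
  -- A generalized inverse of `T` defined for all times, whether or not `T` is bounded. Adjoining
  -- `α` keeps the set nonempty before the motion starts.
  set S : ℝ → Set ℝ := fun t => insert α {ξ ∈ Ioo α β | T ξ ≤ t} with hS
  have hSle : ∀ t, ∀ ξ ∈ S t, ξ ≤ β := fun t ξ hξ => by
    rcases hξ with rfl | hξ
    · exact hαβ.le
    · exact hξ.1.2.le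
  have hbdd : ∀ t, BddAbove (S t) := fun t => ⟨β, hSle t⟩
  have hne : ∀ t, (S t).Nonempty := fun t => ⟨α, mem_insert _ _⟩
  set Θ : ℝ → ℝ := fun t => sSup (S t) with hΘ
  have hmem : ∀ t, Θ t ∈ Icc α β := fun t =>
    ⟨le_csSup (hbdd t) (mem_insert _ _), csSup_le (hne t) (hSle t)⟩
  have hmono : Monotone Θ := fun s t hst => csSup_le_csSup (hbdd t) (hne s)
    (insert_subset_insert fun ξ hξ => ⟨hξ.1, hξ.2.trans hst⟩)
  have hΘT : ∀ ξ ∈ Ioo α β, Θ (T ξ) = ξ := fun ξ hξ => by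
    refine le_antisymm (csSup_le (hne _) ?_) (le_csSup (hbdd _) (Or.inr ⟨hξ, le_rfl⟩))
    rintro η (rfl | hη)
    · exact hξ.1.le
    · exact (hTm.le_iff_le hη.1 hξ).1 hη.2
  -- A monotone map whose range is dense in the segment has no jumps; the range contains the whole
  -- open interval because `Θ` inverts `T`.
  have hcont : Continuous Θ := by
    have h1 : Continuous fun t => (⟨Θ t, hmem t⟩ : Icc α β) := by
      refine Monotone.continuous_of_denseRange (fun s t hst => hmono hst) ?_
      rw [DenseRange, Subtype.dense_iff]
      refine (closure_Ioo hαβ.ne).symm.subset.trans (closure_mono fun ξ hξ => ?_)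
      exact ⟨⟨ξ, Ioo_subset_Icc_self hξ⟩, ⟨T ξ, Subtype.ext (hΘT ξ hξ)⟩, rfl⟩
    exact continuous_subtype_val.comp h1
  have hTΘ : ∀ t, Θ t ∈ Ioo α β → T (Θ t) = t := by
    intro t ht
    have hc := (hTd _ ht).continuousAt
    refine le_antisymm (not_lt.1 fun hlt => ?_) (not_lt.1 fun hlt => ?_)
    · obtain ⟨η, h1, h2, h3⟩ := (((hc.eventually_const_lt hlt).filter_mono
        (nhdsWithin_le_nhds (s := Iio (Θ t)))).and (Ioo_mem_nhdsLT ht.1)).exists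
      have : Θ t ≤ η := by
        refine csSup_le (hne t) ?_
        rintro ζ (rfl | hζ)
        · exact h2.le
        · exact (hTm.le_iff_le hζ.1 ⟨h2, h3.trans ht.2⟩).1 (hζ.2.trans h1.le)
      exact absurd this (not_le.2 h3)
    · obtain ⟨η, h1, h2⟩ := ((hc.eventually_lt_const hlt).filter_mono
        (nhdsWithin_le_nhds (s := Ioi (Θ t)))).and (Ioo_mem_nhdsGT ht.2) |>.exists
      exact absurd (le_csSup (hbdd t) (Or.inr ⟨⟨ht.1.trans h2.1, h2.2⟩, h1.le⟩))
        (not_le.2 h2.1)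
  have hd : ∀ t, Θ t ∈ Ioo α β → HasDerivAt Θ (f (Θ t)) t := fun t ht => by
    have h1 := HasDerivAt.of_local_left_inverse hcont.continuousAt (hTd _ ht)
      (one_div_pos.2 (hpos _ ht)).ne' (by
        filter_upwards [hcont.continuousAt.eventually (isOpen_Ioo.mem_nhds ht)] with s hs
          using hTΘ s hs)
    simpa using h1
  have hconst : ∀ t, f (Θ t) = 0 → HasDerivAt Θ 0 t ∨ (Θ t = α ∧ ∀ s > t, α < Θ s) ∨
      (Θ t = β ∧ ∀ s < t, Θ s < β) := by
    intro t ht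
    by_contra! hcon
    obtain ⟨h1, h2, h3⟩ := hcon
    rcases eq_endpoints_or_mem_Ioo_of_mem_Icc (hmem t) with h | h | h
    · obtain ⟨s, hs, hs'⟩ := h2 h
      refine h1 ((hasDerivAt_const t α).congr_of_eventuallyEq ?_)
      filter_upwards [Iio_mem_nhds hs] with τ hτ
      exact le_antisymm ((hmono (mem_Iio.1 hτ).le).trans hs') (hmem τ).1
    · obtain ⟨s, hs, hs'⟩ := h3 h
      refine h1 ((hasDerivAt_const t β).congr_of_eventuallyEq ?_)
      filter_upwards [Ioi_mem_nhds hs] with τ hτ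
      exact le_antisymm (hmem τ).2 (hs'.trans (hmono (mem_Ioi.1 hτ).le))
    · exact (hpos _ h).ne' ht
  -- The only instants not yet covered are the departure from `α` and the arrival at `β`, at most
  -- one each, and `f` vanishes there.
  have hsol : IsSol f Θ := by
    refine IsSol.of_countable (K := {t | Θ t = α ∧ ∀ s > t, α < Θ s} ∪
      {t | Θ t = β ∧ ∀ s < t, Θ s < β}) (Countable.union (Subsingleton.countable ?_)
        (Subsingleton.countable ?_)) hf hcont (fun t ht => ?_) fun t ht => ?_
    · rintro s ⟨hs, hs'⟩ t ⟨ht, ht'⟩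
      refine le_antisymm (not_lt.1 fun h => ?_) (not_lt.1 fun h => ?_)
      · exact (ht' s h).ne' hs
      · exact (hs' t h).ne' ht
    · rintro s ⟨hs, hs'⟩ t ⟨ht, ht'⟩
      refine le_antisymm (not_lt.1 fun h => ?_) (not_lt.1 fun h => ?_)
      · exact (hs' t h).ne ht
      · exact (ht' s h).ne hs
    · by_cases h : Θ t ∈ Ioo α β
      · exact ⟨_, hd t h, abs_of_pos (hpos _ h)⟩
      · have h0 : f (Θ t) = 0 := by
          rcases eq_endpoints_or_mem_Ioo_of_mem_Icc (hmem t) with h1 | h1 | h1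
          · rw [h1, hα]
          · rw [h1, hβ]
          · exact absurd h1 h
        rw [mem_union, not_or] at ht
        refine ⟨0, ((hconst t h0).resolve_right ?_), by rw [h0, abs_zero]⟩
        rintro (h1 | h1)
        · exact ht.1 h1
        · exact ht.2 h1
    · rcases ht with ht | ht
      · rw [ht.1, hα]
      · rw [ht.1, hβ]
  have hprof : Profile f α β Θ := by
    refine ⟨fun t => ?_, hmem, hmono⟩
    have h1 := hsol.hasDerivAt t
    rwa [← hsol.abs_deriv t, abs_of_nonneg hmono.deriv_nonneg]
  have hΘ0 : Θ 0 = ξ₀ := by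
    have := hΘT ξ₀ h₀
    rwa [show T ξ₀ = 0 from intervalIntegral.integral_same] at this
  have hnn : ∀ ξ ∈ Icc α β, 0 ≤ 1 / f ξ := fun ξ hξ => by
    rcases eq_endpoints_or_mem_Ioo_of_mem_Icc hξ with h | h | h
    · rw [h, hα, div_zero]
    · rw [h, hβ, div_zero]
    · exact (one_div_pos.2 (hpos ξ h)).le
  have hTi : ∀ ξ ∈ Ioo α β, IntervalIntegrable (fun ξ => 1 / f ξ) volume ξ₀ ξ := fun ξ hξ =>
    (hk.mono (ordConnected_Ioo.uIcc_subset h₀ hξ)).intervalIntegrable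
  refine ⟨Θ, hprof, hΘ0, fun hi => ?_, fun hi => ?_⟩
  · refine hprof.exists_end (t₁ := ∫ x in ξ₀..β, 1 / f x) (by rw [hΘ0]; exact h₀.2) ?_
    refine le_antisymm (hmem _).2 (le_of_forall_lt_imp_le_of_dense fun η hη => ?_)
    have hη' : max η ξ₀ ∈ Ioo α β := ⟨h₀.1.trans_le (le_max_right _ _), max_lt hη h₀.2⟩
    refine (le_max_left η ξ₀).trans (le_csSup (hbdd _) (Or.inr ⟨hη', ?_⟩))
    rw [← sub_nonneg, hT, intervalIntegral.integral_interval_sub_left hi (hTi _ hη')]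
    exact intervalIntegral.integral_nonneg hη'.2.le fun ξ hξ => hnn ξ ⟨hη'.1.le.trans hξ.1, hξ.2⟩
  · obtain ⟨A, hA, hA'⟩ := hprof.neg.exists_end (t₀ := 0) (t₁ := -∫ x in ξ₀..α, 1 / f x)
      (by rw [neg_zero, hΘ0]; exact neg_lt_neg h₀.1) (by
        rw [neg_neg, neg_inj]
        refine le_antisymm (csSup_le (hne _) ?_) (hmem _).1
        rintro ξ (rfl | ⟨hξ, hξ'⟩)
        · exact le_rfl
        obtain ⟨η, h1, h2⟩ := exists_between hξ.1
        have hη : η ∈ Ioo α β := ⟨h1, h2.trans hξ.2⟩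
        have h3 : 0 ≤ T η - ∫ x in ξ₀..α, 1 / f x := by
          rw [hT, intervalIntegral.integral_interval_sub_left (hTi _ hη) hi]
          exact intervalIntegral.integral_nonneg h1.le fun ζ hζ => hnn ζ ⟨hζ.1, hζ.2.trans hη.2.le⟩
        exact absurd (hTm hη hξ h2) (not_lt.2 (hξ'.trans (sub_nonneg.1 h3))))
    refine ⟨-A, neg_lt_zero.2 hA, fun t => ?_⟩
    have := hA' (-t)
    rw [neg_neg, neg_inj] at this
    rw [this]
    exact le_neg

lemma Profile.isSol {f Θ : ℝ → ℝ} {α β : ℝ} (h : Profile f α β Θ) : IsSol f Θ := fun t =>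
  ⟨_, h.hasDerivAt t, abs_of_nonneg (by
    rw [← (h.hasDerivAt t).deriv]
    exact h.monotone.deriv_nonneg)⟩

lemma Profile.strictMonoOn {f Θ : ℝ → ℝ} {α β : ℝ} (h : Profile f α β Θ)
    (hpos : ∀ ξ ∈ Ioo α β, 0 < f ξ) {s : Set ℝ} (hs : Convex ℝ s)
    (hi : ∀ t ∈ interior s, Θ t ∈ Ioo α β) : StrictMonoOn Θ s :=
  strictMonoOn_of_deriv_pos hs h.continuous.continuousOn fun t ht => by
    rw [(h.hasDerivAt t).deriv]
    exact hpos _ (hi t ht)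

/-! ### Solutions with pauses -/

/-- A monotone solution which reaches `β` at the time `B` may stay there for the time `ℓ` and
return. -/
lemma Profile.exists_pause_right {f Θ : ℝ → ℝ} {α β B ℓ : ℝ} (hf : Continuous f)
    (h : Profile f α β Θ) (hβ : f β = 0) (hB : ∀ t, Θ t = β ↔ B ≤ t) (hℓ : 0 ≤ ℓ) :
    ∃ θ, IsSol f θ ∧ (∀ t ≤ B, θ t = Θ t) ∧ ∀ t, θ t = β ↔ t ∈ Icc B (B + ℓ) := by
  have hm : ∀ t, t ≤ B + ℓ / 2 → min t (2 * B + ℓ - t) = t := fun t ht => min_eq_left (by linarith)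
  have hm' : ∀ t, B + ℓ / 2 ≤ t → min t (2 * B + ℓ - t) = 2 * B + ℓ - t :=
    fun t ht => min_eq_right (by linarith)
  -- Time is folded at `B + ℓ / 2`: the profile is followed and then run backwards. The fold lies
  -- where `Θ` rests at `β`, and the rest is cut down to length `ℓ`.
  refine ⟨fun t => Θ (min t (2 * B + ℓ - t)), IsSol.of_countable (K := {B + ℓ / 2})
    (countable_singleton _) hf (h.continuous.comp (by fun_prop)) (fun t ht => ?_) (fun t ht => ?_),
    fun t ht => ?_, fun t => ?_⟩
  · rcases lt_or_gt_of_ne ht with ht | ht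
    · obtain ⟨d, hd, hd'⟩ := h.isSol t
      refine ⟨d, hd.congr_of_eventuallyEq ?_, by rw [hm t ht.le, hd']⟩
      filter_upwards [Iio_mem_nhds ht] with s hs
      rw [hm s (mem_Iio.1 hs).le]
    · obtain ⟨d, hd, hd'⟩ := (h.isSol.comp_neg.comp_add_const (-(2 * B + ℓ))) t
      refine ⟨d, hd.congr_of_eventuallyEq ?_, by rw [hm' t (le_of_lt ht), hd']; ring_nf⟩
      filter_upwards [Ioi_mem_nhds ht] with s hs
      rw [hm' s (mem_Ioi.1 hs).le]
      ring_nf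
  · rw [mem_singleton_iff.1 ht, hm _ le_rfl, (hB _).2 (by linarith), hβ]
  · simp only [hm t (by linarith)]
  · rw [hB, le_min_iff, mem_Icc]
    constructor <;> rintro ⟨h1, h2⟩ <;> constructor <;> linarith

lemma Profile.exists_pause_left {f Θ : ℝ → ℝ} {α β A ℓ : ℝ} (hf : Continuous f)
    (h : Profile f α β Θ) (hα : f α = 0) (hA : ∀ t, Θ t = α ↔ t ≤ A) (hℓ : 0 ≤ ℓ) :
    ∃ θ, IsSol f θ ∧ (∀ t, A ≤ t → θ t = Θ t) ∧ ∀ t, θ t = α ↔ t ∈ Icc (A - ℓ) A := by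
  obtain ⟨θ, h1, h2, h3⟩ := h.neg.exists_pause_right (B := -A) (by fun_prop) (by rwa [neg_neg])
    (fun t => by rw [neg_inj, hA]; exact ⟨fun h => neg_le.1 h, fun h => neg_le.1 h⟩) hℓ
  have h4 := h1.neg.comp_neg
  simp only [neg_neg] at h4
  refine ⟨_, h4, fun t ht => ?_, fun t => ?_⟩
  · simp only [h2 (-t) (neg_le_neg ht), neg_neg]
  · rw [neg_eq_iff_eq_neg, h3, mem_Icc, mem_Icc]
    constructor <;> rintro ⟨h1, h2⟩ <;> constructor <;> linarith

lemma isMaximalPause_of_iff {θ : ℝ → ℝ} {c a b : ℝ} (hab : a ≤ b)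
    (h : ∀ t, θ t = c ↔ t ∈ Icc a b) : IsMaximalPause θ c a b := by
  refine ⟨fun t ht => (h t).2 ht, fun a' b' ha hb hc => ?_⟩
  have h1 := (h a').1 (hc a' ⟨le_rfl, by linarith⟩)
  have h2 := (h b').1 (hc b' ⟨by linarith, le_rfl⟩)
  exact ⟨le_antisymm ha h1.1, le_antisymm h2.2 hb⟩

/-- A solution with a bounded maximal pause may be changed to one which never ends the pause, or
never began it. -/
lemma IsSol.exists_ne_of_pause {f θ : ℝ → ℝ} (hf : Continuous f) (h : IsSol f θ) {c a b : ℝ}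
    (hab : a < b) (hc : IsMaximalPause θ c a b) :
    ∃ θ', IsSol f θ' ∧ θ' ≠ θ ∧ θ' =ᶠ[𝓝 0] θ := by
  have hfc : f c = 0 := by
    have h1 := (h a).choose_spec.1.hasDerivWithinAt (s := Icc a b)
    have h2 : HasDerivWithinAt θ 0 (Icc a b) a := (hasDerivWithinAt_const a (Icc a b) c).congr
      (fun s hs => hc.1 s hs) (hc.1 a (left_mem_Icc.2 hab.le))
    have h3 := (uniqueDiffOn_Icc hab a (left_mem_Icc.2 hab.le)).eq_deriv _ h1 h2
    have h4 := (h a).choose_spec.2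
    rwa [h3, abs_zero, hc.1 a (left_mem_Icc.2 hab.le), eq_comm] at h4
  have hca := hc.1 a (left_mem_Icc.2 hab.le)
  have hcb := hc.1 b (right_mem_Icc.2 hab.le)
  have hcst : ∀ t, ∃ d, HasDerivAt (fun _ : ℝ => c) d t ∧ |d| = f c := fun t =>
    ⟨0, hasDerivAt_const t c, by rw [abs_zero, hfc]⟩
  -- If the pause ends after time 0, the solution is frozen from its end on; otherwise it begins
  -- before time 0 and is frozen up to its beginning. Either way a neighbourhood of 0 is untouched.
  rcases lt_or_ge 0 b with hb | hb
  · have hm : ∀ t, t ≤ b → θ (min t b) = θ t := fun t ht => by rw [min_eq_left ht]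
    have hm' : ∀ t, b ≤ t → θ (min t b) = c := fun t ht => by rw [min_eq_right ht, hcb]
    refine ⟨fun t => θ (min t b), IsSol.of_countable (K := {b}) (countable_singleton _) hf
      (h.continuous.comp (by fun_prop)) (fun t ht => ?_) (fun t ht => ?_), fun heq => ?_, ?_⟩
    · rcases lt_or_gt_of_ne ht with ht | ht
      · obtain ⟨d, hd, hd'⟩ := h t
        refine ⟨d, hd.congr_of_eventuallyEq ?_, by rw [hm t ht.le, hd']⟩
        filter_upwards [Iio_mem_nhds ht] with s hs using hm s (mem_Iio.1 hs).le
      · obtain ⟨d, hd, hd'⟩ := hcst t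
        refine ⟨d, hd.congr_of_eventuallyEq ?_, by rw [hm' t (le_of_lt ht), hd']⟩
        filter_upwards [Ioi_mem_nhds ht] with s hs using hm' s (mem_Ioi.1 hs).le
    · rw [mem_singleton_iff.1 ht, hm' b le_rfl, hfc]
    · have := (hc.2 a (b + 1) le_rfl (by linarith) fun t ht => by
        rcases le_total t b with h1 | h1
        · exact hc.1 t ⟨ht.1, h1⟩
        · rw [← heq]; exact hm' t h1).2
      linarith
    · filter_upwards [Iio_mem_nhds hb] with s hs using hm s (mem_Iio.1 hs).le
  · have ha : a < 0 := hab.trans_le hb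
    have hm : ∀ t, a ≤ t → θ (max t a) = θ t := fun t ht => by rw [max_eq_left ht]
    have hm' : ∀ t, t ≤ a → θ (max t a) = c := fun t ht => by rw [max_eq_right ht, hca]
    refine ⟨fun t => θ (max t a), IsSol.of_countable (K := {a}) (countable_singleton _) hf
      (h.continuous.comp (by fun_prop)) (fun t ht => ?_) (fun t ht => ?_), fun heq => ?_, ?_⟩
    · rcases lt_or_gt_of_ne ht with ht | ht
      · obtain ⟨d, hd, hd'⟩ := hcst t
        refine ⟨d, hd.congr_of_eventuallyEq ?_, by rw [hm' t ht.le, hd']⟩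
        filter_upwards [Iio_mem_nhds ht] with s hs using hm' s (mem_Iio.1 hs).le
      · obtain ⟨d, hd, hd'⟩ := h t
        refine ⟨d, hd.congr_of_eventuallyEq ?_, by rw [hm t (le_of_lt ht), hd']⟩
        filter_upwards [Ioi_mem_nhds ht] with s hs using hm s (mem_Ioi.1 hs).le
    · rw [mem_singleton_iff.1 ht, hm' a le_rfl, hfc]
    · have := (hc.2 (a - 1) b (by linarith) le_rfl fun t ht => by
        rcases le_total a t with h1 | h1
        · exact hc.1 t ⟨h1, ht.2⟩
        · rw [← heq]; exact hm' t h1).1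
      linarith
    · filter_upwards [Ioi_mem_nhds ha] with s hs using hm s (mem_Ioi.1 hs).le

end

section

/-! ### Solutions that follow an itinerary -/

/-- Two-sided partial sums. The common lower bound `D` on the steps gives at least linear growth, so
the points exhaust the line in both directions. -/
lemma exists_int_partition (δ : ℤ → ℝ) {D : ℝ} (hD : 0 < D) (hδ : ∀ n, D ≤ δ n) (a₀ : ℝ) :
    ∃ a : ℤ → ℝ, a 0 = a₀ ∧ (∀ n, a (n + 1) = a n + δ n) ∧ StrictMono a ∧
      Tendsto a atTop atTop ∧ Tendsto a atBot atBot := by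
  set a : ℤ → ℝ := fun n => a₀ + ∑ i ∈ Finset.Ico 0 n, δ i - ∑ i ∈ Finset.Ico n 0, δ i with ha
  have hnext : ∀ n, a (n + 1) = a n + δ n := by
    intro n
    rcases le_or_gt 0 n with hn | hn
    · have h1 : Finset.Ico 0 (n + 1) = insert n (Finset.Ico 0 n) := by
        ext i; simp; omega
      have h2 : Finset.Ico (n + 1) 0 = ∅ := Finset.Ico_eq_empty (by omega)
      have h3 : Finset.Ico n 0 = ∅ := Finset.Ico_eq_empty (by omega)
      simp only [ha, h1, h2, h3]
      rw [Finset.sum_insert (by simp)]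
      simp
      ring
    · have h1 : Finset.Ico n 0 = insert n (Finset.Ico (n + 1) 0) := by
        ext i; simp; omega
      have h2 : Finset.Ico 0 (n + 1) = ∅ := Finset.Ico_eq_empty (by omega)
      have h3 : Finset.Ico 0 n = ∅ := Finset.Ico_eq_empty (by omega)
      simp only [ha, h1, h2, h3]
      rw [Finset.sum_insert (by simp)]
      simp
      ring
  have hmono : StrictMono a := strictMono_int_of_lt_succ fun n => by
    rw [hnext]; linarith [hδ n]
  have hlin : Monotone fun n : ℤ => a n - D * n := monotone_int_of_le_succ fun n => by
    rw [hnext]; push_cast; linarith [hδ n]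
  refine ⟨a, by simp [ha], hnext, hmono, ?_, ?_⟩
  · refine tendsto_atTop_mono' _ ?_
      (tendsto_atTop_add_const_left _ (a 0) (tendsto_intCast_atTop_atTop.const_mul_atTop hD))
    filter_upwards [eventually_ge_atTop 0] with n hn
    have := hlin hn
    simp only [Int.cast_zero, mul_zero, sub_zero] at this
    linarith
  · refine tendsto_atBot_mono' _ ?_
      (tendsto_atBot_add_const_left _ (a 0) (Tendsto.const_mul_atBot hD (tendsto_intCast_atBot_iff (R := ℝ).2 tendsto_id)))
    filter_upwards [eventually_le_atBot 0] with n hn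
    have := hlin hn
    simp only [Int.cast_zero, mul_zero, sub_zero] at this
    show a n ≤ a 0 + D * (n : ℝ)
    linarith

/-- Solutions may be glued at a sequence of times at which they pass through zeros of `f`. -/
lemma IsSol.glue {f : ℝ → ℝ} (hf : Continuous f) {a : ℤ → ℝ} (ha : StrictMono a)
    (htop : Tendsto a atTop atTop) (hbot : Tendsto a atBot atBot) {q : ℤ → ℝ → ℝ}
    (hq : ∀ n, IsSol f (q n)) (hag : ∀ n, q n (a (n + 1)) = q (n + 1) (a (n + 1)))
    (h0 : ∀ n, f (q n (a n)) = 0) :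
    ∃ θ, IsSol f θ ∧ ∀ n, ∀ t ∈ Icc (a n) (a (n + 1)), θ t = q n t := by
  have hex : ∀ t, ∃ n : ℤ, a n ≤ t ∧ t < a (n + 1) := by
    intro t
    obtain ⟨m, hm⟩ := (htop.eventually_gt_atTop t).exists
    obtain ⟨k, hk⟩ := (hbot.eventually_le_atBot t).exists
    obtain ⟨n, hn, hn'⟩ := Int.exists_greatest_of_bdd (P := fun n => a n ≤ t)
      ⟨m, fun z hz => (ha.lt_iff_lt.1 (lt_of_le_of_lt hz hm)).le⟩ ⟨k, hk⟩
    refine ⟨n, hn, lt_of_not_ge fun h => ?_⟩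
    have := hn' _ h
    omega
  choose N hN hN' using hex
  have huniq : ∀ n t, a n ≤ t → t < a (n + 1) → N t = n := fun n t h1 h2 => by
    have h3 := ha.lt_iff_lt.1 ((hN t).trans_lt h2)
    have h4 := ha.lt_iff_lt.1 (h1.trans_lt (hN' t))
    omega
  have hθ : ∀ n, ∀ t ∈ Icc (a n) (a (n + 1)), q (N t) t = q n t := by
    intro n t ht
    rcases eq_or_lt_of_le ht.2 with h | h
    · rw [huniq (n + 1) t h.ge (by rw [h]; exact ha (by omega)), h, hag]
    · rw [huniq n t ht.1 h]
  have hev : ∀ n, ∀ t ∈ Ioo (a n) (a (n + 1)), (fun t => q (N t) t) =ᶠ[𝓝 t] q n := fun n t ht => by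
    filter_upwards [Ioo_mem_nhds ht.1 ht.2] with s hs using hθ n s (Ioo_subset_Icc_self hs)
  -- At the junctions only continuity is checked: they form a countable set on which `f` vanishes,
  -- so differentiability comes for free.
  refine ⟨fun t => q (N t) t, IsSol.of_countable (K := range a) (countable_range a) hf ?_
    (fun t ht => ?_) ?_, hθ⟩
  · refine continuous_iff_continuousAt.2 fun t => ?_
    rcases eq_or_lt_of_le (hN t) with h | h
    · obtain ⟨n, hn⟩ : ∃ n, N t = n + 1 := ⟨N t - 1, by ring⟩
      rw [hn] at h
      have h2 : a n < t := by rw [← h]; exact ha (by omega)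
      rw [continuousAt_iff_continuous_left_right]
      constructor
      · refine (hq n).continuous.continuousWithinAt.congr_of_eventuallyEq ?_
          (hθ n t ⟨h2.le, h.ge⟩)
        filter_upwards [Icc_mem_nhdsLE h2] with s hs using hθ n s ⟨hs.1, by rw [h]; exact hs.2⟩
      · have h3 := hN' t
        rw [hn] at h3
        refine (hq (n + 1)).continuous.continuousWithinAt.congr_of_eventuallyEq ?_
          (hθ (n + 1) t ⟨h.le, h3.le⟩)
        filter_upwards [Icc_mem_nhdsGE h3] with s hs using
          hθ (n + 1) s ⟨by rw [h]; exact hs.1, hs.2⟩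
    · exact (hq (N t)).continuous.continuousAt.congr (hev _ t ⟨h, hN' t⟩).symm
  · have h : a (N t) < t := lt_of_le_of_ne (hN t) fun h => ht ⟨_, h⟩
    obtain ⟨d, hd, hd'⟩ := hq (N t) t
    exact ⟨d, hd.congr_of_eventuallyEq (hev _ t ⟨h, hN' t⟩), hd'⟩
  · rintro _ ⟨n, rfl⟩
    simp only [huniq n (a n) le_rfl (ha (by omega)), h0]

/-- The moves adjoining a pause are injective, so no larger segment can carry the same value. This
holds also for a pause of length zero. -/
lemma FollowsItinerary.isMaximalPause {θ : ℝ → ℝ} {p ℓ a b : ℤ → ℝ}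
    (h : FollowsItinerary θ p ℓ a b) (hℓ : ∀ n, 0 ≤ ℓ n) (n : ℤ) :
    IsMaximalPause θ (p n) (b n) (a (n + 1)) := by
  have hinj : ∀ n, InjOn θ (Icc (a n) (b n)) := fun n => by
    rcases h.move n with h1 | h1
    · exact h1.injOn
    · exact h1.injOn
  have hle : b n ≤ a (n + 1) := by rw [h.next]; linarith [hℓ n]
  refine ⟨h.pause n, fun a' b' ha hb hc => ⟨?_, ?_⟩⟩
  · refine le_antisymm ha (not_lt.1 fun hlt => ?_)
    have h1 := h.lt n
    have h2 := hinj n (x₁ := max a' (a n)) (x₂ := b n) ⟨le_max_right _ _, (max_lt hlt h1).le⟩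
      ⟨h1.le, le_rfl⟩ (by
        rw [hc _ ⟨le_max_left _ _, (max_lt hlt h1).le.trans (hle.trans hb)⟩,
          hc _ ⟨hlt.le, hle.trans hb⟩])
    exact (max_lt hlt h1).ne h2
  · refine le_antisymm (not_lt.1 fun hlt => ?_) hb
    have h1 := h.lt (n + 1)
    have h2 := hinj (n + 1) (x₁ := a (n + 1)) (x₂ := min b' (b (n + 1)))
      ⟨le_rfl, h1.le⟩ ⟨(lt_min hlt h1).le, min_le_right _ _⟩ (by
        rw [hc _ ⟨ha.trans hle, hlt.le⟩,
          hc _ ⟨(ha.trans hle).trans (lt_min hlt h1).le, min_le_left _ _⟩])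
    exact (lt_min hlt h1).ne h2

/-- The step from a zero of `f` to a neighbouring one, after a translation by a period, in one of
the two directions. -/
lemma Profile.exists_transition {f Θ : ℝ → ℝ} {α β D : ℝ}
    (h : Profile f α β Θ) (hpos : ∀ ξ ∈ Ioo α β, 0 < f ξ)
    (hA : ∀ t, Θ t = α ↔ t ≤ 0) (hB : ∀ t, Θ t = β ↔ D ≤ t) {p p' : ℝ}
    (hp : |p' - p| = β - α) (hper : ∀ ξ, f (ξ + (p - α)) = f ξ)
    (hper' : ∀ ξ, f (ξ + (p' - α)) = f ξ) (a : ℝ) :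
    ∃ q, IsSol f q ∧ (∀ t ≤ a, q t = p) ∧ (∀ t, a + D ≤ t → q t = p') ∧
      (StrictMonoOn q (Icc a (a + D)) ∨ StrictAntiOn q (Icc a (a + D))) ∧
      (p < p' → ∀ t, q t = Θ (t - a) + (p - α)) ∧
      (p' < p → ∀ t, q t = Θ (D - (t - a)) + (p' - α)) := by
  have hmono : StrictMonoOn Θ (Icc 0 D) := by
    refine h.strictMonoOn hpos (convex_Icc 0 D) fun t ht => ?_
    rw [interior_Icc] at ht
    exact ⟨lt_of_le_of_ne (h.mem t).1 fun e => absurd ((hA t).1 e.symm) (not_le.2 ht.1),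
      lt_of_le_of_ne (h.mem t).2 fun e => absurd ((hB t).1 e) (not_le.2 ht.2)⟩
  have hsol : ∀ c, (∀ ξ, f (ξ + c) = f ξ) → ∀ {θ}, IsSol f θ → IsSol f fun t => θ t + c :=
    fun c hc θ hθ t => ⟨_, (hθ.hasDerivAt t).add_const c, by rw [hθ.abs_deriv, hc]⟩
  have hαβ : α ≤ β := (h.mem 0).1.trans (h.mem 0).2
  rcases le_or_gt p p' with hlt | hlt
  · rw [abs_of_nonneg (sub_nonneg.2 hlt)] at hp
    refine ⟨fun t => Θ (t + -a) + (p - α), hsol _ hper (h.isSol.comp_add_const (-a)),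
      fun t ht => ?_, fun t ht => ?_, Or.inl fun s hs t ht hst => ?_, fun _ t => rfl,
      fun h => absurd h (not_lt.2 hlt)⟩
    · simp only [(hA _).2 (show t + -a ≤ 0 by linarith)]; ring
    · simp only [(hB _).2 (show D ≤ t + -a by linarith)]; linarith
    · exact add_lt_add_left (hmono ⟨by linarith [hs.1], by linarith [hs.2]⟩
        ⟨by linarith [ht.1], by linarith [ht.2]⟩ (by linarith)) _
  · rw [abs_of_neg (sub_neg.2 hlt)] at hp
    have h1 := hsol _ hper' ((h.isSol.comp_neg).comp_add_const (-(D + a)))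
    have h2 : (fun t => Θ (-(t + -(D + a))) + (p' - α)) = fun t => Θ (D - (t - a)) + (p' - α) := by
      ext t; ring_nf
    rw [h2] at h1
    refine ⟨_, h1, fun t ht => ?_, fun t ht => ?_, Or.inr fun s hs t ht hst => ?_,
      fun h => absurd h (not_lt.2 hlt.le), fun _ t => rfl⟩
    · simp only [(hB _).2 (show D ≤ D - (t - a) by linarith)]; linarith
    · simp only [(hA _).2 (show D - (t - a) ≤ 0 by linarith)]; ring
    · exact add_lt_add_left (hmono ⟨by linarith [ht.2], by linarith [ht.1]⟩
        ⟨by linarith [hs.2], by linarith [hs.1]⟩ (by linarith)) _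

lemma Profile.exists_itinerary {f Θ : ℝ → ℝ} {α β D : ℝ} (hf : Continuous f)
    (h : Profile f α β Θ) (hα : f α = 0) (hαβ : α < β) (hpos : ∀ ξ ∈ Ioo α β, 0 < f ξ)
    (hA : ∀ t, Θ t = α ↔ t ≤ 0) (hB : ∀ t, Θ t = β ↔ D ≤ t) {p ℓ : ℤ → ℝ}
    (hp : ∀ n, |p (n + 1) - p n| = β - α) (hper : ∀ n ξ, f (ξ + (p n - α)) = f ξ)
    (hℓ : ∀ n, 0 ≤ ℓ n) (a₀ : ℝ) :
    ∃ θ a b, IsSol f θ ∧ FollowsItinerary θ p ℓ a b ∧ a 0 = a₀ ∧ b 0 = a₀ + D ∧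
      (p (-1) < p 0 → ∀ t ∈ Icc a₀ (a₀ + D), θ t = Θ (t - a₀) + (p (-1) - α)) ∧
      (p 0 < p (-1) → ∀ t ∈ Icc a₀ (a₀ + D), θ t = Θ (D - (t - a₀)) + (p 0 - α)) := by
  have hD : 0 < D := by
    by_contra hD
    have h1 := (hB 0).2 (not_lt.1 hD)
    rw [(hA 0).2 le_rfl] at h1
    exact hαβ.ne h1
  -- Each stage consists of a move of duration `D` followed by a pause of length `ℓ n`; the duration
  -- of the moves is the uniform lower bound.
  obtain ⟨a, ha0, hnext, hmono, htop, hbot⟩ :=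
    exists_int_partition (fun n => D + ℓ n) hD (fun n => by linarith [hℓ n]) a₀
  -- Stage `n` moves from `p (n - 1)` to `p n` and rests there, so the stages with indices `n` and
  -- `n + 1` agree at the junction.
  choose q hsol hle hge hmove hup hdown using fun n : ℤ =>
    h.exists_transition hpos hA hB (p := p (n - 1)) (p' := p n)
      (by have := hp (n - 1); rwa [sub_add_cancel] at this) (hper _) (hper _) (a n)
  have hle' : ∀ n, a n + D ≤ a (n + 1) := fun n => by rw [hnext]; linarith [hℓ n]
  obtain ⟨θ, hθ, hθq⟩ := IsSol.glue hf hmono htop hbot hsol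
    (fun n => by rw [hge n _ (hle' n), hle (n + 1) _ le_rfl, add_sub_cancel_right])
    (fun n => by
      rw [hle n _ le_rfl]
      have := hper (n - 1) α
      rwa [add_sub_cancel, hα] at this)
  have hmem : ∀ n, ∀ t ∈ Icc (a n) (a n + D), t ∈ Icc (a n) (a (n + 1)) := fun n t ht =>
    ⟨ht.1, ht.2.trans (hle' n)⟩
  refine ⟨θ, a, fun n => a n + D, hθ, ⟨fun n => by linarith, fun n => by rw [hnext]; ring, htop,
    hbot, fun n t ht => ?_, fun n => ?_⟩, ha0, by simp only [ha0], fun hlt t ht => ?_, fun hlt t ht => ?_⟩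
  · rw [hθq n t ⟨by linarith [ht.1], ht.2⟩, hge n t ht.1]
  · refine (hmove n).imp (fun h1 => ?_) fun h1 => ?_
    · exact h1.congr fun t ht => (hθq n t (hmem n t ht)).symm
    · exact h1.congr fun t ht => (hθq n t (hmem n t ht)).symm
  · rw [← ha0] at ht
    rw [hθq 0 t (hmem 0 t ht), hup 0 hlt, ha0, zero_sub]
  · rw [← ha0] at ht
    rw [hθq 0 t (hmem 0 t ht), hdown 0 hlt, ha0]

end

section

variable {F : ℝ × ℝ → ℝ} {P : InitialData}

/-! ### Extremals and solutions of `|θ'| = √N(θ) / r(θ)²` -/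

/-- A function whose square has the derivative `2hk` has the derivative `k`, if `k` is bounded and
vanishes wherever `h` does. -/
lemma ACD.of_sq {h k : ℝ → ℝ} {C : ℝ} (hc : Continuous h)
    (hsq : ACD (fun t => h t ^ 2) fun t => 2 * h t * k t) (hk : ∀ t, |k t| ≤ C)
    (h0 : ∀ t, h t = 0 → k t = 0) : ACD h k := by
  have hC : 0 ≤ C := (abs_nonneg _).trans (hk 0)
  -- The functions √(h² + ε²) regularize |h|. Each is absolutely continuous because h² is, and its
  -- derivative hk/√(h² + ε²) is bounded by `C` uniformly in `ε`; in the limit |h| is Lipschitz.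
  have hε : ∀ ε > 0, ∀ s t, |Real.sqrt (h t ^ 2 + ε ^ 2) - Real.sqrt (h s ^ 2 + ε ^ 2)| ≤
      C * |t - s| := by
    intro ε hε s t
    have hpos : ∀ t, 0 < h t ^ 2 + ε ^ 2 := fun t => by positivity
    have hge : ∀ t, ε ≤ Real.sqrt (h t ^ 2 + ε ^ 2) := fun t => by
      refine Real.le_sqrt_of_sq_le ?_
      linarith [sq_nonneg (h t)]
    have hy : ACD (fun t => Real.sqrt (h t ^ 2 + ε ^ 2))
        fun t => h t * k t / Real.sqrt (h t ^ 2 + ε ^ 2) := by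
      refine hsq.of_dist_le (C := 1 / (2 * ε)) (fun s t => ?_) ?_
      · rw [Real.dist_eq, Real.dist_eq, div_mul_eq_mul_div, one_mul, le_div_iff₀ (by positivity)]
        have h1 : h s ^ 2 - h t ^ 2 = (Real.sqrt (h s ^ 2 + ε ^ 2) - Real.sqrt (h t ^ 2 + ε ^ 2)) *
            (Real.sqrt (h s ^ 2 + ε ^ 2) + Real.sqrt (h t ^ 2 + ε ^ 2)) := by
          linear_combination (-1 : ℝ) * Real.sq_sqrt (hpos s).le + Real.sq_sqrt (hpos t).le
        rw [h1, abs_mul]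
        refine mul_le_mul_of_nonneg_left ?_ (abs_nonneg _)
        rw [abs_of_nonneg (by positivity)]
        linarith [hge s, hge t]
      · filter_upwards [hsq.2] with t ht
        refine ((ht.add_const (ε ^ 2)).sqrt (hpos t).ne').congr_deriv ?_
        field_simp
    rw [← hy.integral_eq s t, ← Real.norm_eq_abs (∫ _ in s..t, _)]
    refine intervalIntegral.norm_integral_le_of_norm_le_const fun τ _ => ?_
    rw [Real.norm_eq_abs, abs_div, abs_mul, abs_of_nonneg (Real.sqrt_nonneg _),
      div_le_iff₀ (Real.sqrt_pos.2 (hpos τ)), mul_comm]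
    refine mul_le_mul (hk τ) (Real.le_sqrt_of_sq_le ?_) (abs_nonneg _) hC
    rw [sq_abs]
    linarith [sq_nonneg ε]
  have habs : ∀ s t, |(|h t| - |h s|)| ≤ C * |t - s| := by
    intro s t
    have h1 : Tendsto (fun ε : ℝ => |Real.sqrt (h t ^ 2 + ε ^ 2) - Real.sqrt (h s ^ 2 + ε ^ 2)|)
        (𝓝[>] 0) (𝓝 |Real.sqrt (h t ^ 2 + 0 ^ 2) - Real.sqrt (h s ^ 2 + 0 ^ 2)|) :=
      (Continuous.tendsto (by fun_prop) 0).mono_left nhdsWithin_le_nhds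
    have h2 := le_of_tendsto h1 (by
      filter_upwards [self_mem_nhdsWithin] with ε h using hε ε h s t)
    simpa [Real.sqrt_sq_eq_abs] using h2
  have hlip : ∀ s t, |h t - h s| ≤ C * |t - s| := by
    intro s t
    by_cases hs : 0 ≤ h s * h t
    · have h1 := habs s t
      rcases le_total 0 (h s) with h2 | h2 <;> rcases le_total 0 (h t) with h3 | h3
      · rwa [abs_of_nonneg h2, abs_of_nonneg h3] at h1
      · rcases mul_eq_zero.1 (le_antisymm (mul_nonpos_of_nonneg_of_nonpos h2 h3) hs) with h4 | h4
        · simpa [h4] using h1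
        · simpa [h4] using h1
      · rcases mul_eq_zero.1 (le_antisymm (mul_nonpos_of_nonpos_of_nonneg h2 h3) hs) with h4 | h4
        · simpa [h4] using h1
        · simpa [h4] using h1
      · rw [abs_of_nonpos h2, abs_of_nonpos h3, ← abs_neg] at h1
        convert h1 using 2; ring
    · have h0 : (0 : ℝ) ∈ uIcc (h s) (h t) := by
        rw [mem_uIcc]
        rcases mul_neg_iff.1 (not_le.1 hs) with h1 | h1
        · exact Or.inr ⟨h1.2.le, h1.1.le⟩
        · exact Or.inl ⟨h1.1.le, h1.2.le⟩
      -- When `h` changes sign between the two times, the estimate for |h| is applied on the two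
      -- sides of an intermediate zero.
      obtain ⟨r, hr, hr0⟩ := intermediate_value_uIcc hc.continuousOn h0
      have h1 := habs r t
      have h2 := habs s r
      rw [hr0, abs_zero, sub_zero, abs_abs] at h1
      rw [hr0, abs_zero, zero_sub, abs_neg, abs_abs] at h2
      have h3 : |t - r| + |r - s| = |t - s| := by
        rcases mem_uIcc.1 hr with ⟨h4, h5⟩ | ⟨h4, h5⟩
        · rw [abs_of_nonneg (sub_nonneg.2 h5), abs_of_nonneg (sub_nonneg.2 h4),
            abs_of_nonneg (by linarith)]; ring
        · rw [abs_of_nonpos (sub_nonpos.2 h4), abs_of_nonpos (sub_nonpos.2 h5),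
            abs_of_nonpos (by linarith)]; ring
      calc |h t - h s| ≤ |h t| + |h s| := abs_sub _ _
        _ ≤ C * (|t - r| + |r - s|) := by linarith
        _ = C * |t - s| := by rw [h3]
  have hid : ACD (fun t : ℝ => t) fun _ => 1 :=
    ACD.of_hasDerivAt (fun t => hasDerivAt_id t) continuous_const
  have hac : ∀ a b, AbsolutelyContinuousOnInterval h a b := fun a b =>
    (hid.1 a b).of_dist_le fun s _ t _ => by
      rw [dist_comm (h s), dist_comm s]; exact hlip s t
  have hac' : ∀ a b, AbsolutelyContinuousOnInterval (fun t => |h t|) a b := fun a b =>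
    (hid.1 a b).of_dist_le fun s _ t _ => by
      rw [dist_comm |h s|, dist_comm s]; exact habs s t
  refine ⟨hac, ?_⟩
  filter_upwards [ae_differentiableAt_of_ac hac, ae_differentiableAt_of_ac hac', hsq.2]
    with t h1 h2 h3
  -- At a zero the square carries no information, but |h| has a minimum there, so its derivative
  -- vanishes and with it that of `h`.
  by_cases ht : h t = 0
  · have h4 := h2.hasDerivAt
    have h5 : deriv (fun t => |h t|) t = 0 :=
      IsLocalMin.hasDerivAt_eq_zero (Eventually.of_forall fun s => by simp [ht]) h4
    rw [h5] at h4
    rw [h0 t ht]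
    exact hasDerivAt_zero_of_dist_le h4 fun s => by simp [ht]
  · have h4 := (h1.hasDerivAt.fun_pow 2).unique h3
    have h5 : deriv h t = k t := by
      have : (2 * h t) * deriv h t = (2 * h t) * k t := by
        rw [← h4]; simp
      exact mul_left_cancel₀ (mul_ne_zero two_ne_zero ht) this
    rw [← h5]
    exact h1.hasDerivAt

/-- The absolute value of `θ'` as a function of `θ`. -/
def speed (F : ℝ × ℝ → ℝ) (P : InitialData) (ξ : ℝ) : ℝ := Real.sqrt (numer F P ξ) / rad F ξ ^ 2

lemma continuous_numer (hF : IsQuasinorm F) (P : InitialData) : Continuous (numer F P) := by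
  rw [show numer F P = _ from funext (numer_eq F P)]
  have := continuous_level hF P
  fun_prop

lemma continuous_speed (hF : IsQuasinorm F) (P : InitialData) : Continuous (speed F P) :=
  (Real.continuous_sqrt.comp (continuous_numer hF P)).div ((continuous_rad hF).pow 2)
    fun ξ => pow_ne_zero 2 (rad_pos hF ξ).ne'

lemma numer_add_int_mul_two_pi (F : ℝ × ℝ → ℝ) (P : InitialData) (ξ : ℝ) (k : ℤ) :
    numer F P (ξ + 2 * Real.pi * k) = numer F P ξ := by
  rw [numer_eq, level_add_int_mul_two_pi, numer_eq]

lemma speed_add_int_mul_two_pi (F : ℝ × ℝ → ℝ) (P : InitialData) (ξ : ℝ) (k : ℤ) :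
    speed F P (ξ + 2 * Real.pi * k) = speed F P ξ := by
  rw [speed, numer_add_int_mul_two_pi, rad_add_int_mul_two_pi, speed]

lemma speed_pos_iff (hF : IsQuasinorm F) {ξ : ℝ} : 0 < speed F P ξ ↔ 0 < numer F P ξ := by
  have := rad_pos hF ξ
  rw [speed, div_pos_iff_of_pos_right (by positivity), Real.sqrt_pos]

lemma speed_eq_zero {ξ : ℝ} (h : numer F P ξ = 0) : speed F P ξ = 0 := by
  rw [speed, h, Real.sqrt_zero, zero_div]

lemma Traj.isSol (hF : IsQuasinorm F) {g : ℝ → Fin 5 → ℝ} {θ : ℝ → ℝ} {u : ℝ → ℝ × ℝ}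
    (h : Traj F P g θ u) : IsSol (speed F P) θ := fun t =>
  ⟨_, h.hasDerivAt_angle t, by
    rw [speed, ← h.numer_eq_of_init hF, Real.sqrt_sq_eq_abs, abs_div, abs_pow,
      abs_of_pos (rad_pos hF _)]⟩

/-- The continuous functions of a control are integrated along the Cartan group. -/
lemma exists_horizontal {u : ℝ → ℝ × ℝ} (hu : Measurable u) {C : ℝ}
    (hC : ∀ t, |(u t).1| ≤ C ∧ |(u t).2| ≤ C) :
    ∃ g : ℝ → Fin 5 → ℝ, g 0 = 0 ∧
      ∀ i, ACD (fun t => g t i) fun t => (u t).1 * fieldX (g t) i + (u t).2 * fieldY (g t) i := by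
  have step : ∀ a b : ℝ → ℝ, Continuous a → Continuous b →
      ∃ k : ℝ → ℝ, k 0 = 0 ∧ ACD k fun t => (u t).1 * a t + (u t).2 * b t := by
    intro a b ha hb
    refine ⟨_, intervalIntegral.integral_same, ACD.of_intervalIntegrable (fun s t => ?_) 0⟩
    exact (((ACD.of_bounded hu.fst (fun t => (hC t).1) 0).intervalIntegrable s t).mul_continuousOn
      ha.continuousOn).add (((ACD.of_bounded hu.snd (fun t => (hC t).2) 0).intervalIntegrable
        s t).mul_continuousOn hb.continuousOn)
  obtain ⟨x, x0, hx⟩ := step (fun _ => 1) (fun _ => 0) continuous_const continuous_const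
  obtain ⟨y, y0, hy⟩ := step (fun _ => 0) (fun _ => 1) continuous_const continuous_const
  have cx := hx.continuous
  have cy := hy.continuous
  obtain ⟨z, z0, hz⟩ := step (fun t => -(y t) / 2) (fun t => x t / 2) (by fun_prop) (by fun_prop)
  have cz := hz.continuous
  obtain ⟨v, v0, hv⟩ := step (fun t => -(z t) / 2 - x t * y t / 12) (fun t => x t ^ 2 / 12)
    (by fun_prop) (by fun_prop)
  obtain ⟨w, w0, hw⟩ := step (fun t => -(y t ^ 2) / 12) (fun t => x t * y t / 12 - z t / 2)
    (by fun_prop) (by fun_prop)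
  refine ⟨fun t => ![x t, y t, z t, v t, w t], ?_, fun i => ?_⟩
  · ext i
    fin_cases i <;> simp [x0, y0, z0, v0, w0]
  · fin_cases i
    · simpa [fieldX, fieldY] using hx
    · simpa [fieldX, fieldY] using hy
    · simpa [fieldX, fieldY] using hz
    · simpa [fieldX, fieldY] using hv
    · simpa [fieldX, fieldY] using hw

/-- The converse that holds at the maximal Casimir value. The candidate r²θ' for h₃ has the square
N(θ), whose derivative is twice the candidate times φ₄u₁ + φ₅u₂. The control is chosen so that the
last factor vanishes at zeros of the candidate, and `ACD.of_sq` removes the square; the candidate is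
then h₃ itself. -/
lemma exists_isNormalExtremal_of_isSol (hF : IsQuasinorm F) (hP : P.φ₄ ^ 2 + P.φ₅ ^ 2 ≠ 0)
    (hE : P.casimir = P.casimirMax F) {θ : ℝ → ℝ} (hθ : IsSol (speed F P) θ)
    (hinit : bdry F (θ 0) = (P.φ₁, P.φ₂)) (hd0 : deriv θ 0 = P.φ₃ / rad F (θ 0) ^ 2) :
    ∃ g, IsNormalExtremal F P g θ := by
  classical
  have hr : ∀ t, 0 < rad F (θ t) := fun t => rad_pos hF _
  have hnn : ∀ ξ, 0 ≤ numer F P ξ := fun ξ => by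
    rw [numer_eq, hE]; linarith [level_le_casimirMax hF P ξ]
  have hpos := casimirMax_pos hF hP
  set h3 : ℝ → ℝ := fun t => rad F (θ t) ^ 2 * deriv θ t with hh3
  have hDc : Continuous (deriv θ) := hθ.continuous_deriv (continuous_speed hF P)
  have hc3 : Continuous h3 := (((continuous_rad hF).comp hθ.continuous).pow 2).mul hDc
  have hsq : ∀ t, h3 t ^ 2 = numer F P (θ t) := fun t => by
    have := (hr t).ne'
    simp only [hh3, mul_pow]
    rw [← sq_abs (deriv θ t), hθ.abs_deriv, speed, div_pow, Real.sq_sqrt (hnn _)]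
    field_simp
  set S : Set ℝ := {t | level F P (θ t) = P.casimirMax F} with hS
  have hSm : MeasurableSet S :=
    (isClosed_singleton.preimage ((continuous_level hF P).comp hθ.continuous)).measurableSet
  -- At maximal level the resting control is forced by hand, since an arbitrary maximizing control
  -- there might give h₃ a nonzero derivative. Elsewhere any measurable maximizing control will do.
  set u : ℝ → ℝ × ℝ := fun t => if t ∈ S then (P.casimirMax F)⁻¹ • P.dir else
    ctrl F (θ t) (radDerivRight F (θ t)) with hu
  have hmu : Measurable u := Measurable.ite hSm measurable_const
    (measurable_ctrl hF hθ.continuous ((measurable_radDerivRight F).comp hθ.continuous.measurable))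
  have hmem : ∀ t, u t ∈ unitBall F := fun t => by
    simp only [hu]
    split_ifs
    · exact smul_dir_mem_unitBall_max hF hP
    · exact ctrl_radDerivRight_mem hF _
  have hdot : ∀ t, dot (bdry F (θ t)) (u t) = 1 := fun t => by
    simp only [hu]
    split_ifs with ht
    · rw [dot_smul_right, show dot (bdry F (θ t)) P.dir = P.casimirMax F from ht,
        inv_mul_cancel₀ hpos.ne']
    · exact dot_bdry_ctrl hF _ _
  have hkap0 : ∀ t, h3 t = 0 → P.kap (u t) = 0 := fun t ht => by
    have h1 := hsq t
    rw [ht, numer_eq, hE] at h1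
    have h2 : t ∈ S := by
      change level F P (θ t) = P.casimirMax F
      linarith
    simp only [hu, if_pos h2, InitialData.kap, InitialData.dir, Prod.smul_fst, Prod.smul_snd,
      smul_eq_mul]
    ring
  obtain ⟨C, hC⟩ := exists_unitBall_bound hF
  have hkapC : ∀ t, |P.kap (u t)| ≤ |P.φ₄| * C + |P.φ₅| * C := fun t => by
    refine (abs_add_le _ _).trans ?_
    rw [abs_mul, abs_mul]
    gcongr
    · exact (hC _ (hmem t)).1
    · exact (hC _ (hmem t)).2
  have hac := fun a b => ac_bdry_comp hF hθ.hasDerivAt hDc a b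
  have hvel := ae_bdry_velocity hF hθ.hasDerivAt hDc
  have b1 : ACD (fun t => (bdry F (θ t)).1) fun t => -(u t).2 * h3 t :=
    ⟨fun a b => (hac a b).1, by filter_upwards [hvel] with t ht using (ht _ (hmem t) (hdot t)).1⟩
  have b2 : ACD (fun t => (bdry F (θ t)).2) fun t => (u t).1 * h3 t :=
    ⟨fun a b => (hac a b).2, by filter_upwards [hvel] with t ht using (ht _ (hmem t) (hdot t)).2⟩
  have hacd : ACD h3 fun t => P.kap (u t) := by
    refine ACD.of_sq hc3 ?_ hkapC hkap0
    refine (((ACD.const (2 * P.casimir)).sub ((b1.const_mul (2 * P.φ₅)).sub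
      (b2.const_mul (2 * P.φ₄)))).congr (Eventually.of_forall fun t => ?_)).congr_left fun t => ?_
    · simp only [InitialData.kap]; ring
    · rw [hsq, numer_eq, level, dot_dir]; ring
  obtain ⟨g, g0, hg⟩ := exists_horizontal hmu fun t => hC _ (hmem t)
  have x : ACD (fun t => g t 0) fun t => (u t).1 := by simpa [fieldX, fieldY] using hg 0
  have y : ACD (fun t => g t 1) fun t => (u t).2 := by simpa [fieldX, fieldY] using hg 1
  have hZ : ∀ t, P.hZ (g t) = h3 t := fun t => by
    refine (((ACD.const P.φ₃).add (x.const_mul P.φ₄)).add (y.const_mul P.φ₅)).ext hacd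
      (Eventually.of_forall fun t => ?_) ?_ t
    · simp only [InitialData.kap]; ring
    · have := (hr 0).ne'
      simp only [g0, hh3, hd0]
      simp
      field_simp
  refine ⟨g, (isNormalExtremal_iff hF).2 ⟨u, hmu, hmem, hdot, g0, hg, fun t => ?_, hinit⟩⟩
  have := (hr t).ne'
  rw [hZ]
  refine (hθ.hasDerivAt t).congr_deriv ?_
  simp only [hh3]
  field_simp

end

section

variable {F : ℝ × ℝ → ℝ} {P : InitialData}

/-! ### The function `t(θ)` -/

lemma numer_of_init {θ₀ : ℝ} (hinit : bdry F θ₀ = (P.φ₁, P.φ₂)) : numer F P θ₀ = P.φ₃ ^ 2 := by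
  rw [numer_eq, casimir_eq hinit]; ring

lemma integrand_eq_abs_div (hφ : P.φ₃ ≠ 0) (ξ : ℝ) :
    integrand F P ξ = |P.φ₃| / P.φ₃ * (1 / speed F P ξ) := by
  have h1 : 1 + 2 * P.φ₄ / P.φ₃ ^ 2 * (rad F ξ * Real.sin ξ - P.φ₂)
      - 2 * P.φ₅ / P.φ₃ ^ 2 * (rad F ξ * Real.cos ξ - P.φ₁) = numer F P ξ / P.φ₃ ^ 2 := by
    rw [numer]; field_simp
  rw [integrand, h1, Real.sqrt_div' _ (sq_nonneg _), Real.sqrt_sq_eq_abs, speed, one_div_div]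
  have := abs_ne_zero.2 hφ
  -- At a zero of the numerator both sides are 0, since division by zero has the value 0.
  by_cases h0 : Real.sqrt (numer F P ξ) = 0
  · simp [h0]
  · field_simp

lemma integrand_of_pos (hφ : 0 < P.φ₃) : integrand F P = fun ξ => 1 / speed F P ξ := by
  funext ξ
  rw [integrand_eq_abs_div hφ.ne', abs_of_pos hφ, div_self hφ.ne', one_mul]

lemma integrand_of_neg (hφ : P.φ₃ < 0) : integrand F P = fun ξ => -(1 / speed F P ξ) := by
  funext ξ
  rw [integrand_eq_abs_div hφ.ne, abs_of_neg hφ, neg_div, div_self hφ.ne, neg_one_mul]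

lemma integrand₀_eq (hφ : P.φ₃ = 0) : integrand₀ F P = fun ξ => 1 / speed F P ξ := by
  funext ξ
  rw [integrand₀, speed, one_div_div, numer, hφ]
  congr 2
  ring

lemma finiteIntegral_integrand_iff (hφ : P.φ₃ ≠ 0) {a b : ℝ} :
    FiniteIntegral (integrand F P) a b ↔
      IntervalIntegrable (fun ξ => 1 / speed F P ξ) volume a b := by
  rw [FiniteIntegral]
  rcases lt_or_gt_of_ne hφ with h | h
  · rw [integrand_of_neg h]
    exact ⟨fun h => by simpa [Pi.neg_def] using h.neg, fun h => h.neg⟩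
  · rw [integrand_of_pos h]

lemma finiteIntegral_integrand₀_iff (hφ : P.φ₃ = 0) {a b : ℝ} :
    FiniteIntegral (integrand₀ F P) a b ↔
      IntervalIntegrable (fun ξ => 1 / speed F P ξ) volume a b := by
  rw [FiniteIntegral, integrand₀_eq hφ]

lemma strictMonoOn_integral {k : ℝ → ℝ} {I : Set ℝ} (hI : IsOpen I)
    (hI' : Convex ℝ I) (hk : ContinuousOn k I) (hpos : ∀ ξ ∈ I, 0 < k ξ) {ξ₀ : ℝ} (h₀ : ξ₀ ∈ I) :
    StrictMonoOn (fun ξ => ∫ x in ξ₀..ξ, k x) I := by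
  have hd := fun ξ (hξ : ξ ∈ I) =>
    hasDerivAt_integral_of_continuousOn hI hI'.ordConnected hk h₀ hξ
  refine strictMonoOn_of_deriv_pos hI' (fun ξ hξ => (hd ξ hξ).continuousAt.continuousWithinAt)
    fun ξ hξ => ?_
  rw [hI.interior_eq] at hξ
  rw [(hd ξ hξ).deriv]
  exact hpos ξ hξ

/-- The solutions of `θ' = f(θ)` are the inverse functions of the integrals of `1 / f`. -/
lemma integral_inverse {f θ : ℝ → ℝ} {I : Set ℝ} (hI : IsOpen I) (hI' : Convex ℝ I)
    (hf : Continuous f) (hpos : ∀ ξ ∈ I, 0 < f ξ) (hmem : ∀ t, θ t ∈ I)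
    (hd : ∀ t, HasDerivAt θ (f (θ t)) t) :
    (∀ t, ∫ ξ in θ 0..θ t, 1 / f ξ = t) ∧ ∀ ξ ∈ I, θ (∫ ξ in θ 0..ξ, 1 / f ξ) = ξ := by
  have hk : ContinuousOn (fun ξ => 1 / f ξ) I :=
    continuousOn_const.div hf.continuousOn fun ξ hξ => (hpos ξ hξ).ne'
  have hT := fun ξ (hξ : ξ ∈ I) =>
    hasDerivAt_integral_of_continuousOn hI hI'.ordConnected hk (hmem 0) hξ
  have key : ∀ t, ∫ ξ in θ 0..θ t, 1 / f ξ = t := by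
    have h1 : ∀ t, HasDerivAt (fun t => (∫ ξ in θ 0..θ t, 1 / f ξ) - t) 0 t := fun t => by
      refine (((hT _ (hmem t)).comp t (hd t)).fun_sub (hasDerivAt_id t)).congr_deriv ?_
      rw [one_div_mul_cancel (hpos _ (hmem t)).ne', sub_self]
    intro t
    have := is_const_of_deriv_eq_zero (fun t => (h1 t).differentiableAt) (fun t => (h1 t).deriv) t 0
    simp only [intervalIntegral.integral_same, sub_zero] at this
    linarith
  refine ⟨key, fun ξ hξ => ?_⟩
  exact (strictMonoOn_integral hI hI' hk (fun ξ hξ => one_div_pos.2 (hpos ξ hξ))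
    (hmem 0)).injOn (hmem _) hξ (key _)

lemma Traj.hasDerivAt_of_pos (hF : IsQuasinorm F) {g : ℝ → Fin 5 → ℝ} {θ : ℝ → ℝ} {u : ℝ → ℝ × ℝ}
    (h : Traj F P g θ u) {t : ℝ} (ht : 0 ≤ P.hZ (g t)) : HasDerivAt θ (speed F P (θ t)) t := by
  rw [speed, ← h.numer_eq_of_init hF, Real.sqrt_sq ht]
  exact h.hasDerivAt_angle t

lemma Traj.hasDerivAt_of_neg (hF : IsQuasinorm F) {g : ℝ → Fin 5 → ℝ} {θ : ℝ → ℝ} {u : ℝ → ℝ × ℝ}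
    (h : Traj F P g θ u) {t : ℝ} (ht : P.hZ (g t) ≤ 0) : HasDerivAt θ (-speed F P (θ t)) t := by
  rw [speed, ← h.numer_eq_of_init hF, Real.sqrt_sq_eq_abs, abs_of_nonpos ht, neg_div, neg_neg]
  exact h.hasDerivAt_angle t

/-- As N is positive on the range of `θ`, h₃ keeps the sign of φ₃. For negative sign the
inverse-function argument is applied to the time-reversed angle, matching the sign in the integrand.
-/
lemma Traj.timeFn_inverse (hF : IsQuasinorm F) {g : ℝ → Fin 5 → ℝ} {θ : ℝ → ℝ} {u : ℝ → ℝ × ℝ}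
    (h : Traj F P g θ u) (hφ : P.φ₃ ≠ 0) {I : Set ℝ} (hI : IsOpen I) (hI' : Convex ℝ I)
    (hpos : ∀ ξ ∈ I, 0 < numer F P ξ) (hmem : ∀ t, θ t ∈ I) :
    (∀ t, timeFn F P (θ 0) (θ t) = t) ∧ ∀ ξ ∈ I, θ (timeFn F P (θ 0) ξ) = ξ := by
  have hne : ∀ t, P.hZ (g t) ≠ 0 := fun t h0 => by
    have := hpos _ (hmem t)
    rw [← h.numer_eq_of_init hF, h0] at this
    simp at this
  have hpos' : ∀ ξ ∈ I, 0 < speed F P ξ := fun ξ hξ => (speed_pos_iff hF).2 (hpos ξ hξ)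
  rcases lt_or_gt_of_ne hφ with hφ | hφ
  · have hneg : ∀ t, P.hZ (g t) < 0 := fun t => by
      by_contra hcon
      obtain ⟨s, hs⟩ := intermediate_value_univ 0 t h.continuous_hZ
        ⟨by rw [h.hZ_zero]; exact hφ.le, not_lt.1 hcon⟩
      exact hne s hs
    have h1 := integral_inverse (θ := fun t => θ (-t)) hI hI' (continuous_speed hF P) hpos'
      (fun t => hmem _) fun t => by
        simpa [Function.comp_def] using
          (h.hasDerivAt_of_neg hF (hneg (-t)).le).scomp t (hasDerivAt_neg t)
    simp only [timeFn, integrand_of_neg hφ, intervalIntegral.integral_neg]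
    simp only [neg_zero] at h1
    refine ⟨fun t => ?_, h1.2⟩
    have := h1.1 (-t)
    rw [neg_neg] at this
    rw [this, neg_neg]
  · have hneg : ∀ t, 0 < P.hZ (g t) := fun t => by
      by_contra hcon
      obtain ⟨s, hs⟩ := intermediate_value_univ t 0 h.continuous_hZ
        ⟨not_lt.1 hcon, by rw [h.hZ_zero]; exact hφ.le⟩
      exact hne s hs
    simp only [timeFn, integrand_of_pos hφ]
    exact integral_inverse hI hI' (continuous_speed hF P) hpos' hmem fun t =>
      h.hasDerivAt_of_pos hF (hneg t).le

/-! ### Monotone and constant angles -/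

lemma theta_inverse_of_casimirMax_lt (hF : IsQuasinorm F) (hφ : P.φ₃ ≠ 0)
    (hE : P.casimirMax F < P.casimir) {g : ℝ → Fin 5 → ℝ} {θ : ℝ → ℝ}
    (h : IsNormalExtremal F P g θ) :
    (∀ t, timeFn F P (θ 0) (θ t) = t) ∧ ∀ ξ, θ (timeFn F P (θ 0) ξ) = ξ := by
  obtain ⟨u, hu⟩ := (isNormalExtremal_iff hF).1 h
  have := hu.timeFn_inverse hF hφ isOpen_univ convex_univ (fun ξ _ => by
    rw [numer_eq]; linarith [level_le_casimirMax hF P ξ]) (fun t => mem_univ _)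
  exact ⟨this.1, fun ξ => this.2 ξ (mem_univ ξ)⟩

lemma line_of_casimirMin (hF : IsQuasinorm F) (hP : P.φ₄ ^ 2 + P.φ₅ ^ 2 ≠ 0)
    (hE : P.casimir = P.casimirMin F) {g : ℝ → Fin 5 → ℝ} {θ : ℝ → ℝ}
    (h : IsNormalExtremal F P g θ) :
    (∀ t, θ t = θ 0) ∧ IsLineExtremal F P g ∧ IsMetricLine F g := by
  obtain ⟨u, hu⟩ := (isNormalExtremal_iff hF).1 h
  have h0 : ∀ t, P.hZ (g t) = 0 := fun t => by
    have h1 := hu.numer_eq_of_init hF t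
    rw [numer_eq, hE] at h1
    exact pow_eq_zero_iff two_ne_zero |>.1
      (le_antisymm (by linarith [casimirMin_le_level hF P (θ t)]) (sq_nonneg _))
  have hc : ∀ t, θ t = θ 0 := fun t =>
    is_const_of_deriv_eq_zero (fun t => (hu.hasDerivAt_angle t).differentiableAt)
      (fun t => by rw [hu.deriv_eq, h0, zero_div]) t 0
  exact ⟨hc, hu.line_of_const hF hP hc⟩

/-! ### Transversality -/

lemma continuous_kap (P : InitialData) : Continuous P.kap := by
  unfold InitialData.kap
  fun_prop

/-- Transversality. At a non-extreme level φ₄u₁ + φ₅u₂ vanishes nowhere on the dual face; the face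
being convex and compact, it has a constant sign and a positive lower bound in absolute value. Half
of that bound persists for the faces at nearby angles. -/
lemma exists_kap_bound (hF : IsQuasinorm F) (hP : P.φ₄ ^ 2 + P.φ₅ ^ 2 ≠ 0) {ξ₀ : ℝ}
    (hmin : P.casimirMin F < level F P ξ₀) (hmax : level F P ξ₀ < P.casimirMax F) :
    ∃ σ c : ℝ, (σ = 1 ∨ σ = -1) ∧ 0 < c ∧
      ∀ᶠ ξ in 𝓝 ξ₀, ∀ u ∈ unitBall F, dot (bdry F ξ) u = 1 → c ≤ σ * P.kap u := by
  have hkc := continuous_kap P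
  have hdc : Continuous fun u => dot (bdry F ξ₀) u := by unfold dot; fun_prop
  set A : Set (ℝ × ℝ) := {u ∈ unitBall F | dot (bdry F ξ₀) u = 1} with hA
  have hAc : IsCompact A := hF.isCompact_unitBall.inter_right (isClosed_singleton.preimage hdc)
  have hAconv : Convex ℝ A := fun u hu v hv a b ha hb hab =>
    ⟨hF.convex_unitBall hu.1 hv.1 ha hb hab, by
      rw [show dot (bdry F ξ₀) (a • u + b • v) = a * dot (bdry F ξ₀) u + b * dot (bdry F ξ₀) v by
        simp [dot]; ring, hu.2, hv.2, mul_one, mul_one, hab]⟩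
  have hne : ∀ u ∈ A, P.kap u ≠ 0 := fun u hu h0 => by
    rcases level_extremal_of_kap_eq_zero hF hP hu.1 hu.2 h0 with h | h
    · exact hmax.ne h
    · exact hmin.ne' h
  set u₀ := ctrl F ξ₀ (radDerivRight F ξ₀)
  have hu₀ : u₀ ∈ A := ⟨ctrl_radDerivRight_mem hF _, dot_bdry_ctrl hF _ _⟩
  obtain ⟨σ, hσ, hσ0⟩ : ∃ σ : ℝ, (σ = 1 ∨ σ = -1) ∧ 0 < σ * P.kap u₀ := by
    rcases lt_or_gt_of_ne (hne _ hu₀) with h | h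
    · exact ⟨-1, Or.inr rfl, by linarith⟩
    · exact ⟨1, Or.inl rfl, by linarith⟩
  have hσne : σ ≠ 0 := by rcases hσ with rfl | rfl <;> norm_num
  have hσA : ∀ u ∈ A, 0 < σ * P.kap u := fun u hu => by
    by_contra hcon
    obtain ⟨v, hv, hv0⟩ := hAconv.isPreconnected.intermediate_value hu hu₀
      (f := fun u => σ * P.kap u) (by fun_prop) ⟨not_lt.1 hcon, hσ0.le⟩
    exact hne v hv ((mul_eq_zero.1 hv0).resolve_left hσne)
  obtain ⟨w, hw, hwmin⟩ := hAc.exists_isMinOn ⟨u₀, hu₀⟩ (f := fun u => σ * P.kap u) (by fun_prop)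
  have hw0 := hσA w hw
  refine ⟨σ, σ * P.kap w / 2, hσ, half_pos hw0, ?_⟩
  -- The controls violating the halved bound form a compact set disjoint from the face at `ξ₀`.
  -- Their pairing with the boundary point is below 1, and by compactness this remains so for all of
  -- them at nearby angles.
  have hK : IsCompact (unitBall F ∩ {u | σ * P.kap u ≤ σ * P.kap w / 2}) :=
    hF.isCompact_unitBall.inter_right (isClosed_le (by fun_prop) continuous_const)
  have hev : ∀ᶠ ξ in 𝓝 ξ₀, ∀ u ∈ unitBall F ∩ {u | σ * P.kap u ≤ σ * P.kap w / 2},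
      dot (bdry F ξ) u < 1 := by
    refine hK.eventually_forall_of_forall_eventually fun u hu => ?_
    have hc : Continuous fun z : ℝ × (ℝ × ℝ) => dot (bdry F z.1) z.2 := by
      have h1 := (continuous_bdry hF).comp (continuous_fst (X := ℝ) (Y := ℝ × ℝ))
      exact (h1.fst.mul (continuous_fst.comp continuous_snd)).add
        (h1.snd.mul (continuous_snd.comp continuous_snd))
    refine hc.continuousAt.eventually_lt_const (lt_of_le_of_ne (dot_bdry_le_one hF _ hu.1) ?_)
    intro h1
    have h2 : σ * P.kap w ≤ σ * P.kap u := hwmin (show u ∈ A from ⟨hu.1, h1⟩)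
    have h3 : σ * P.kap u ≤ σ * P.kap w / 2 := hu.2
    linarith
  filter_upwards [hev] with ξ hξ u hu hd
  by_contra hcon
  exact (hξ u ⟨hu, (not_le.1 hcon).le⟩).ne hd

/-- The numerator has simple zeros if `𝓔` lies strictly between its extreme values. -/
lemma exists_numer_bound (hF : IsQuasinorm F) (hP : P.φ₄ ^ 2 + P.φ₅ ^ 2 ≠ 0) {ξ₀ : ℝ}
    (hmin : P.casimirMin F < level F P ξ₀) (hmax : level F P ξ₀ < P.casimirMax F) :
    ∃ σ c δ : ℝ, (σ = 1 ∨ σ = -1) ∧ 0 < c ∧ 0 < δ ∧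
      ∀ ξ₁ ξ₂, ξ₀ - δ < ξ₁ → ξ₁ ≤ ξ₂ → ξ₂ < ξ₀ + δ →
        c * (ξ₂ - ξ₁) ≤ σ * (numer F P ξ₂ - numer F P ξ₁) := by
  obtain ⟨σ, c, hσ, hc, hev⟩ := exists_kap_bound hF hP hmin hmax
  obtain ⟨δ, hδ, hball⟩ := Metric.eventually_nhds_iff_ball.1 hev
  obtain ⟨r, hr, R, -, hrR⟩ := exists_rad_bounds hF
  -- The velocity formula is applied to the motion θ(t) = t. It shows that N is absolutely
  -- continuous in the angle, with derivative 2r²(φ₄u₁ + φ₅u₂); hence the constant `2 * r ^ 2 * c`.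
  have hid : ∀ t : ℝ, HasDerivAt (fun t : ℝ => t) 1 t := fun t => hasDerivAt_id t
  have hac := fun a b => ac_bdry_comp hF hid continuous_const a b
  have hvel := ae_bdry_velocity hF hid continuous_const
  set u : ℝ → ℝ × ℝ := fun ξ => ctrl F ξ (radDerivRight F ξ) with hu
  have hmem : ∀ ξ, u ξ ∈ unitBall F := fun ξ => ctrl_radDerivRight_mem hF ξ
  have hdot : ∀ ξ, dot (bdry F ξ) (u ξ) = 1 := fun ξ => dot_bdry_ctrl hF _ _
  have b1 : ACD (fun t => (bdry F t).1) fun t => -(u t).2 * (rad F t ^ 2 * 1) :=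
    ⟨fun a b => (hac a b).1, by filter_upwards [hvel] with t ht using (ht _ (hmem t) (hdot t)).1⟩
  have b2 : ACD (fun t => (bdry F t).2) fun t => (u t).1 * (rad F t ^ 2 * 1) :=
    ⟨fun a b => (hac a b).2, by filter_upwards [hvel] with t ht using (ht _ (hmem t) (hdot t)).2⟩
  have hN : ACD (fun t => σ * numer F P t) fun t => σ * (2 * rad F t ^ 2 * P.kap (u t)) := by
    refine ((((ACD.const (2 * P.casimir)).sub ((b1.const_mul (2 * P.φ₅)).sub
      (b2.const_mul (2 * P.φ₄)))).congr (Eventually.of_forall fun t => ?_)).congr_left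
        fun t => ?_).const_mul σ
    · simp only [InitialData.kap]; ring
    · rw [numer_eq, level, dot_dir]; ring
  refine ⟨σ, 2 * r ^ 2 * c, δ, hσ, by positivity, hδ, fun ξ₁ ξ₂ h1 h12 h2 => ?_⟩
  have h3 : ∫ t in ξ₁..ξ₂, (2 * r ^ 2 * c : ℝ) ≤
      ∫ t in ξ₁..ξ₂, σ * (2 * rad F t ^ 2 * P.kap (u t)) := by
    refine intervalIntegral.integral_mono_on h12 intervalIntegrable_const
      (hN.intervalIntegrable _ _) fun t ht => ?_
    have h4 : c ≤ σ * P.kap (u t) := hball t (by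
      rw [Metric.mem_ball, Real.dist_eq, abs_lt]
      constructor <;> linarith [ht.1, ht.2]) _ (hmem t) (hdot t)
    have h5 : r ^ 2 ≤ rad F t ^ 2 := pow_le_pow_left₀ hr.le (hrR t).1 2
    calc 2 * r ^ 2 * c ≤ 2 * rad F t ^ 2 * (σ * P.kap (u t)) := by gcongr
      _ = _ := by ring
  rw [hN.integral_eq, intervalIntegral.integral_const, smul_eq_mul] at h3
  linarith

end

section

variable {F : ℝ × ℝ → ℝ} {P : InitialData}

/-! ### Simple zeros of the numerator -/

lemma exists_nearest_zeros {N : ℝ → ℝ} (hN : Continuous N) {c l r : ℝ} (hc : 0 < N c) (hl : l < c)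
    (hl0 : N l ≤ 0) (hr : c < r) (hr0 : N r ≤ 0) :
    ∃ a b, a < c ∧ c < b ∧ N a = 0 ∧ N b = 0 ∧ ∀ ξ ∈ Ioo a b, 0 < N ξ := by
  obtain ⟨a, ⟨ham, ha⟩, hmax⟩ := (isCompact_Icc.inter_right
    (isClosed_Iic.preimage hN) : IsCompact (Icc l c ∩ N ⁻¹' Iic 0)).exists_isGreatest
    ⟨l, left_mem_Icc.2 hl.le, hl0⟩
  obtain ⟨b, ⟨hbm, hb⟩, hmin⟩ := (isCompact_Icc.inter_right
    (isClosed_Iic.preimage hN) : IsCompact (Icc c r ∩ N ⁻¹' Iic 0)).exists_isLeast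
    ⟨r, right_mem_Icc.2 hr.le, hr0⟩
  simp only [mem_preimage, mem_Iic] at ha hb
  have hac : a < c := lt_of_le_of_ne ham.2 fun h => by rw [h] at ha; linarith
  have hcb : c < b := lt_of_le_of_ne hbm.1 fun h => by rw [← h] at hb; linarith
  have hpos : ∀ ξ ∈ Ioo a b, 0 < N ξ := fun ξ hξ => by
    by_contra hcon
    rcases le_total ξ c with h | h
    · exact absurd (hmax ⟨⟨ham.1.trans hξ.1.le, h⟩, not_lt.1 hcon⟩) (not_le.2 hξ.1)
    · exact absurd (hmin ⟨⟨h, hξ.2.le.trans hbm.2⟩, not_lt.1 hcon⟩) (not_le.2 hξ.2)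
  refine ⟨a, b, hac, hcb, le_antisymm ha ?_, le_antisymm hb ?_, hpos⟩
  · refine ge_of_tendsto ((hN.tendsto a).mono_left nhdsWithin_le_nhds :
      Tendsto N (𝓝[>] a) (𝓝 (N a))) ?_
    filter_upwards [Ioo_mem_nhdsGT (hac.trans hcb)] with ξ hξ using (hpos ξ hξ).le
  · refine ge_of_tendsto ((hN.tendsto b).mono_left nhdsWithin_le_nhds :
      Tendsto N (𝓝[<] b) (𝓝 (N b))) ?_
    filter_upwards [Ioo_mem_nhdsLT (hac.trans hcb)] with ξ hξ using (hpos ξ hξ).le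

lemma exists_numer_nonpos (hF : IsQuasinorm F) (hP : P.φ₄ ^ 2 + P.φ₅ ^ 2 ≠ 0)
    (hE : P.casimir ≤ P.casimirMax F) (c : ℝ) :
    (∃ l < c, numer F P l ≤ 0) ∧ ∃ r > c, numer F P r ≤ 0 := by
  obtain ⟨ξ, hξ⟩ := exists_level_eq_casimirMax hF hP
  have h : ∀ k : ℤ, numer F P (ξ + 2 * Real.pi * k) ≤ 0 := fun k => by
    rw [numer_eq, level_add_int_mul_two_pi, hξ]; linarith
  obtain ⟨k, hk⟩ := exists_add_int_mul_two_pi_lt ξ c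
  obtain ⟨m, hm⟩ := exists_lt_add_int_mul_two_pi ξ c
  exact ⟨⟨_, hk, h k⟩, _, hm, h m⟩

lemma level_eq_of_numer_eq_zero {ξ : ℝ} (h : numer F P ξ = 0) : level F P ξ = P.casimir := by
  rw [numer_eq] at h; linarith

/-- Positivity on one side fixes the sign in `exists_numer_bound`. The linear lower bound serves for
integrability, and the negativity beyond the zero confines trajectories, along which N(θ) = h₃². -/
lemma numer_bounds_right (hF : IsQuasinorm F) (hP : P.φ₄ ^ 2 + P.φ₅ ^ 2 ≠ 0)
    (hmin : P.casimirMin F < P.casimir) (hmax : P.casimir < P.casimirMax F) {a e : ℝ} (hae : a < e)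
    (ha : numer F P a = 0) (hpos : ∀ ξ ∈ Ioo a e, 0 < numer F P ξ) :
    ∃ c > 0, ∃ δ > 0, (∀ ξ ∈ Ioo a (a + δ), c * (ξ - a) ≤ numer F P ξ) ∧
      ∀ ξ ∈ Ioo (a - δ) a, numer F P ξ < 0 := by
  have hl := level_eq_of_numer_eq_zero ha
  obtain ⟨σ, c, δ, hσ, hc, hδ, h⟩ := exists_numer_bound hF hP (hl ▸ hmin) (hl ▸ hmax)
  have hσ1 : σ = 1 := by
    refine hσ.resolve_right fun hσ => ?_
    obtain ⟨ξ, h1, h2⟩ := exists_between (lt_min hae (lt_add_of_pos_right a hδ))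
    have h3 := h a ξ (by linarith) h1.le (h2.trans_le (min_le_right _ _))
    have h4 := hpos ξ ⟨h1, h2.trans_le (min_le_left _ _)⟩
    rw [ha, hσ] at h3
    nlinarith [mul_pos hc (sub_pos.2 h1)]
  rw [hσ1] at h
  refine ⟨c, hc, δ, hδ, fun ξ hξ => ?_, fun ξ hξ => ?_⟩
  · have := h a ξ (by linarith) hξ.1.le hξ.2
    linarith
  · have := h ξ a hξ.1 hξ.2.le (by linarith)
    have := mul_pos hc (sub_pos.2 hξ.2)
    linarith

lemma numer_bounds_left (hF : IsQuasinorm F) (hP : P.φ₄ ^ 2 + P.φ₅ ^ 2 ≠ 0)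
    (hmin : P.casimirMin F < P.casimir) (hmax : P.casimir < P.casimirMax F) {b e : ℝ} (hbe : e < b)
    (hb : numer F P b = 0) (hpos : ∀ ξ ∈ Ioo e b, 0 < numer F P ξ) :
    ∃ c > 0, ∃ δ > 0, (∀ ξ ∈ Ioo (b - δ) b, c * (b - ξ) ≤ numer F P ξ) ∧
      ∀ ξ ∈ Ioo b (b + δ), numer F P ξ < 0 := by
  have hl := level_eq_of_numer_eq_zero hb
  obtain ⟨σ, c, δ, hσ, hc, hδ, h⟩ := exists_numer_bound hF hP (hl ▸ hmin) (hl ▸ hmax)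
  have hσ1 : σ = -1 := by
    refine hσ.resolve_left fun hσ => ?_
    obtain ⟨ξ, h1, h2⟩ := exists_between (max_lt hbe (sub_lt_self b hδ))
    have h3 := h ξ b ((le_max_right _ _).trans_lt h1) h2.le (by linarith)
    have h4 := hpos ξ ⟨(le_max_left _ _).trans_lt h1, h2⟩
    rw [hb, hσ] at h3
    nlinarith [mul_pos hc (sub_pos.2 h2)]
  rw [hσ1] at h
  refine ⟨c, hc, δ, hδ, fun ξ hξ => ?_, fun ξ hξ => ?_⟩
  · have := h ξ b hξ.1 hξ.2.le (by linarith)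
    linarith
  · have := h b ξ (by linarith) hξ.1.le hξ.2
    have := mul_pos hc (sub_pos.2 hξ.1)
    linarith

lemma intervalIntegrable_of_le_one_div_sqrt {k : ℝ → ℝ} {a e K : ℝ} (hae : a ≤ e)
    (hk : Measurable k) (h : ∀ ξ ∈ Ioc a e, |k ξ| ≤ K * (1 / Real.sqrt (ξ - a))) :
    IntervalIntegrable k volume a e := by
  have h1 : IntervalIntegrable (fun ξ : ℝ => K * (ξ - a) ^ (-(1 / 2) : ℝ)) volume a e := by
    have := ((intervalIntegral.intervalIntegrable_rpow' (r := -(1 / 2)) (by norm_num)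
      (a := 0) (b := e - a)).comp_sub_right a).const_mul K
    simpa using this
  refine h1.mono_fun' hk.aestronglyMeasurable ?_
  rw [uIoc_of_le hae]
  refine (ae_restrict_iff' measurableSet_Ioc).2 (Eventually.of_forall fun ξ hξ => ?_)
  change |k ξ| ≤ K * (ξ - a) ^ (-(1 / 2) : ℝ)
  rw [Real.rpow_neg (by linarith [hξ.1]), ← Real.sqrt_eq_rpow, ← one_div]
  exact h ξ hξ

lemma one_div_speed_le (hF : IsQuasinorm F) : ∃ M > 0, ∀ c > 0, ∀ s > 0, ∀ ξ,
    c * s ≤ numer F P ξ → |1 / speed F P ξ| ≤ M / Real.sqrt c * (1 / Real.sqrt s) := by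
  obtain ⟨r, -, R, hR, hrR⟩ := exists_rad_bounds hF
  refine ⟨R ^ 2, by positivity, fun c hc s hs ξ h => ?_⟩
  have hr := rad_pos hF ξ
  have h1 : 0 < Real.sqrt (c * s) := Real.sqrt_pos.2 (mul_pos hc hs)
  have h2 : Real.sqrt (c * s) ≤ Real.sqrt (numer F P ξ) := Real.sqrt_le_sqrt h
  have h3 : rad F ξ ^ 2 ≤ R ^ 2 := pow_le_pow_left₀ hr.le (hrR ξ).2 2
  rw [speed, one_div_div, abs_of_nonneg (by positivity), div_mul_div_comm, mul_one,
    ← Real.sqrt_mul hc.le]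
  exact div_le_div₀ (by positivity) h3 h1 h2

lemma measurable_one_div_speed (hF : IsQuasinorm F) (P : InitialData) :
    Measurable fun ξ => 1 / speed F P ξ :=
  measurable_const.div (continuous_speed hF P).measurable

lemma continuousOn_one_div_speed (hF : IsQuasinorm F) {s : Set ℝ}
    (hpos : ∀ ξ ∈ s, 0 < numer F P ξ) : ContinuousOn (fun ξ => 1 / speed F P ξ) s :=
  continuousOn_const.div (continuous_speed hF P).continuousOn fun ξ hξ =>
    ((speed_pos_iff hF).2 (hpos ξ hξ)).ne'

/-- At a simple zero the integrand is bounded by a multiple of the inverse square root of the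
distance to it; away from the two ends it is continuous. -/
lemma intervalIntegrable_one_div_speed (hF : IsQuasinorm F) (hP : P.φ₄ ^ 2 + P.φ₅ ^ 2 ≠ 0)
    (hmin : P.casimirMin F < P.casimir) (hmax : P.casimir < P.casimirMax F) {a b : ℝ} (hab : a < b)
    (ha : numer F P a = 0) (hb : numer F P b = 0) (hpos : ∀ ξ ∈ Ioo a b, 0 < numer F P ξ) :
    IntervalIntegrable (fun ξ => 1 / speed F P ξ) volume a b := by
  obtain ⟨M, hM, hbound⟩ := one_div_speed_le (P := P) hF
  have hmeas := measurable_one_div_speed hF P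
  obtain ⟨c, hc, δ, hδ, h1, -⟩ := numer_bounds_right hF hP hmin hmax hab ha hpos
  obtain ⟨c', hc', δ', hδ', h1', -⟩ := numer_bounds_left hF hP hmin hmax hab hb hpos
  obtain ⟨p, hp, hp'⟩ := exists_between (lt_min hab (lt_add_of_pos_right a hδ))
  obtain ⟨q, hq, hq'⟩ := exists_between (max_lt hab (sub_lt_self b hδ'))
  have e1 : IntervalIntegrable (fun ξ => 1 / speed F P ξ) volume a p :=
    intervalIntegrable_of_le_one_div_sqrt hp.le hmeas fun ξ hξ => hbound c hc _ (sub_pos.2 hξ.1) ξ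
      (h1 ξ ⟨hξ.1, hξ.2.trans_lt (hp'.trans_le (min_le_right _ _))⟩)
  have e2 : IntervalIntegrable (fun ξ => 1 / speed F P ξ) volume q b := by
    rw [IntervalIntegrable.iff_comp_neg]
    refine (intervalIntegrable_of_le_one_div_sqrt (K := M / Real.sqrt c') (neg_le_neg hq'.le)
      (hmeas.comp measurable_neg) fun ξ hξ => ?_).symm
    have h2 : (0 : ℝ) < b - -ξ := by linarith [hξ.1]
    rw [show ξ - -b = b - -ξ by ring]
    exact hbound c' hc' _ h2 (-ξ) (h1' (-ξ)
      ⟨by linarith [hξ.2, le_max_right a (b - δ')], by linarith [hξ.1]⟩)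
  have e3 : IntervalIntegrable (fun ξ => 1 / speed F P ξ) volume p q := by
    refine ((continuousOn_one_div_speed hF hpos).mono ?_).intervalIntegrable
    exact ordConnected_Ioo.uIcc_subset ⟨hp, hp'.trans_le (min_le_left _ _)⟩
      ⟨(le_max_left _ _).trans_lt hq, hq'⟩
  exact (e1.trans e3).trans e2

/-! ### Oscillation -/

lemma eq_of_hasDerivAt_zero_off_countable {f : ℝ → ℝ} {K : Set ℝ} (hK : K.Countable)
    (hf : Continuous f) (h : ∀ t, t ∉ K → HasDerivAt f 0 t) (s t : ℝ) : f t = f s := by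
  have := MeasureTheory.integral_eq_of_hasDerivAt_off_countable f (fun _ => 0) (a := s) (b := t) hK
    hf.continuousOn (fun τ hτ => h τ hτ.2) intervalIntegrable_const
  simp only [intervalIntegral.integral_zero] at this
  linarith

/-- The pair (c, S) satisfies the equations of uniform rotation, so its coordinates in the
co-rotating frame have zero derivative off a countable set and are constant by continuity. -/
lemma rotation_eq {c S : ℝ → ℝ} {ω : ℝ} {K : Set ℝ} (hK : K.Countable) (hc : Continuous c)
    (hS : Continuous S) (hc' : ∀ t, t ∉ K → HasDerivAt c (-(ω * S t)) t)
    (hS' : ∀ t, t ∉ K → HasDerivAt S (ω * c t) t) (t : ℝ) :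
    c t = c 0 * Real.cos (ω * t) - S 0 * Real.sin (ω * t) := by
  have hcos : ∀ t, HasDerivAt (fun t => Real.cos (ω * t)) (-Real.sin (ω * t) * ω) t := fun t => by
    simpa using ((hasDerivAt_id t).const_mul ω).cos
  have hsin : ∀ t, HasDerivAt (fun t => Real.sin (ω * t)) (Real.cos (ω * t) * ω) t := fun t => by
    simpa using ((hasDerivAt_id t).const_mul ω).sin
  have h1 := eq_of_hasDerivAt_zero_off_countable
    (f := fun t => c t * Real.cos (ω * t) + S t * Real.sin (ω * t)) hK (by fun_prop) (fun t ht => by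
      refine (((hc' t ht).fun_mul (hcos t)).fun_add ((hS' t ht).fun_mul (hsin t))).congr_deriv ?_
      ring) 0 t
  have h2 := eq_of_hasDerivAt_zero_off_countable
    (f := fun t => S t * Real.cos (ω * t) - c t * Real.sin (ω * t)) hK (by fun_prop) (fun t ht => by
      refine (((hS' t ht).fun_mul (hcos t)).fun_sub ((hc' t ht).fun_mul (hsin t))).congr_deriv ?_
      ring) 0 t
  simp only [mul_zero, Real.cos_zero, Real.sin_zero, mul_one, add_zero, sub_zero] at h1 h2
  rw [← h1, ← h2]
  linear_combination (-c t) * Real.sin_sq_add_cos_sq (ω * t)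

/-- After a zero of h₃ its derivative has a fixed sign and is bounded away from zero for some time,
so h₃ does not vanish again there. A set all of whose points are isolated from the right is
countable. -/
lemma Traj.countable_hZ_eq_zero (hF : IsQuasinorm F) (hP : P.φ₄ ^ 2 + P.φ₅ ^ 2 ≠ 0)
    (hmin : P.casimirMin F < P.casimir) (hmax : P.casimir < P.casimirMax F)
    {g : ℝ → Fin 5 → ℝ} {θ : ℝ → ℝ} {u : ℝ → ℝ × ℝ} (h : Traj F P g θ u) :
    {t | P.hZ (g t) = 0}.Countable := by
  refine (countable_setOfPred_isolated_right_within (s := {t | P.hZ (g t) = 0})).mono fun t₀ (ht₀ : P.hZ (g t₀) = 0) => ?_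
  refine ⟨ht₀, ?_⟩
  have hl := h.level_eq_of_hZ_eq_zero hF ht₀
  obtain ⟨σ, c, hσ, hc, hev⟩ := exists_kap_bound hF hP (hl ▸ hmin) (hl ▸ hmax)
  obtain ⟨δ, hδ, hball⟩ := Metric.eventually_nhds_iff_ball.1
    (h.continuous_angle.continuousAt.eventually hev)
  rw [← empty_mem_iff_bot]
  filter_upwards [mem_nhdsWithin_of_mem_nhds (Metric.ball_mem_nhds t₀ hδ), self_mem_nhdsWithin]
    with t ht hts
  have hlt : t₀ < t := hts.2
  have h1 := (h.acd_hZ.const_mul σ).integral_eq t₀ t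
  rw [ht₀, show P.hZ (g t) = 0 from hts.1, sub_self] at h1
  have h2 : ∫ _ in t₀..t, c ≤ ∫ τ in t₀..t, σ * P.kap (u τ) := by
    refine intervalIntegral.integral_mono_on hlt.le intervalIntegrable_const
      ((h.acd_hZ.const_mul σ).intervalIntegrable _ _) fun τ hτ => ?_
    refine hball τ ?_ _ (h.mem τ) (h.dot_eq τ)
    rw [Metric.mem_ball, Real.dist_eq, abs_lt] at ht ⊢
    constructor <;> linarith [hτ.1, hτ.2]
  rw [h1, intervalIntegral.integral_const, smul_eq_mul] at h2
  exact absurd h2 (not_le.2 (mul_pos (sub_pos.2 hlt) hc))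

/-- The phase π/D times T(θ) stays in [0, π], where the cosine is injective, so θ is a function of
cos(πt/D + κ). Every symmetry of that cosine, even about the zeros of the sine and of period 2D,
passes to θ. -/
lemma oscillates_of_cos_eq {θ T : ℝ → ℝ} {s : Set ℝ} {D κ t₁ : ℝ} (hD : 0 < D) (hmem : ∀ t, θ t ∈ s)
    (hT : InjOn T s) (hT0 : ∀ ξ ∈ s, T ξ ∈ Icc 0 D)
    (hcos : ∀ t, Real.cos (Real.pi / D * T (θ t)) = Real.cos (Real.pi / D * t + κ))
    (h1 : Real.sin (Real.pi / D * t₁ + κ) = 0) : Oscillates θ t₁ (t₁ + D) := by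
  have hπ := Real.pi_pos
  have key : ∀ x y, Real.cos (Real.pi / D * x + κ) = Real.cos (Real.pi / D * y + κ) →
      θ x = θ y := fun x y hxy => by
    have hm : ∀ t, Real.pi / D * T (θ t) ∈ Icc 0 Real.pi := fun t => by
      have h2 := hT0 _ (hmem t)
      refine ⟨mul_nonneg (by positivity) h2.1, ?_⟩
      rw [div_mul_eq_mul_div, div_le_iff₀ hD]
      exact mul_le_mul_of_nonneg_left h2.2 hπ.le
    have h3 := Real.injOn_cos (hm x) (hm y) (by rw [hcos, hcos, hxy])
    exact hT (hmem x) (hmem y) (mul_left_cancel₀ (by positivity) h3)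
  have heven : ∀ t₁, Real.sin (Real.pi / D * t₁ + κ) = 0 → ∀ t, θ (t₁ + t) = θ (t₁ - t) :=
    fun t₁ h1 t => key _ _ (by
      rw [show Real.pi / D * (t₁ + t) + κ = (Real.pi / D * t₁ + κ) + Real.pi / D * t by ring,
        show Real.pi / D * (t₁ - t) + κ = (Real.pi / D * t₁ + κ) - Real.pi / D * t by ring,
        Real.cos_add, Real.cos_sub, h1]
      ring)
  have hderiv : ∀ t₁, (∀ t, θ (t₁ + t) = θ (t₁ - t)) →
      ∀ t, deriv θ (t₁ + t) = -deriv θ (t₁ - t) := fun t₁ h t => by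
    have h2 := congrArg (fun f => deriv f t) (funext h)
    simpa only [deriv_comp_const_add, deriv_comp_const_sub] using h2
  have h2 : Real.sin (Real.pi / D * (t₁ + D) + κ) = 0 := by
    rw [show Real.pi / D * (t₁ + D) + κ = (Real.pi / D * t₁ + κ) + Real.pi by field_simp; ring,
      Real.sin_add_pi, h1, neg_zero]
  have e1 := heven t₁ h1
  have e2 := heven (t₁ + D) h2
  refine ⟨by linarith, fun t => ⟨fun k => key _ _ ?_, hderiv t₁ e1 t, hderiv _ e2 t, e1 t, e2 t⟩⟩
  rw [show Real.pi / D * (t + 2 * k * (t₁ + D - t₁)) + κ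
      = (Real.pi / D * t + κ) + k * (2 * Real.pi) by field_simp; ring, Real.cos_add_int_mul_two_pi]

lemma Traj.mem_Icc (hF : IsQuasinorm F) (hP : P.φ₄ ^ 2 + P.φ₅ ^ 2 ≠ 0)
    (hmin : P.casimirMin F < P.casimir) (hmax : P.casimir < P.casimirMax F)
    {g : ℝ → Fin 5 → ℝ} {θ : ℝ → ℝ} {u : ℝ → ℝ × ℝ} (h : Traj F P g θ u) {a b : ℝ} (hab : a < b)
    (ha : numer F P a = 0) (hb : numer F P b = 0) (hpos : ∀ ξ ∈ Ioo a b, 0 < numer F P ξ)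
    (h0 : θ 0 ∈ Icc a b) (t : ℝ) : θ t ∈ Icc a b := by
  have hnn : ∀ t, 0 ≤ numer F P (θ t) := fun t => by
    rw [← h.numer_eq_of_init hF]; exact sq_nonneg _
  obtain ⟨c, hc, δ, hδ, -, h1⟩ := numer_bounds_right hF hP hmin hmax hab ha hpos
  obtain ⟨c', hc', δ', hδ', -, h1'⟩ := numer_bounds_left hF hP hmin hmax hab hb hpos
  refine ⟨not_lt.1 fun hlt => ?_, not_lt.1 fun hlt => ?_⟩
  · obtain ⟨ξ, h2, h3⟩ := exists_between (max_lt hlt (sub_lt_self a hδ))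
    obtain ⟨τ, hτ⟩ := intermediate_value_univ t 0 h.continuous_angle
      ⟨((le_max_left _ _).trans_lt h2).le, h3.le.trans h0.1⟩
    have := h1 ξ ⟨(le_max_right _ _).trans_lt h2, h3⟩
    exact absurd (hnn τ) (by rw [hτ]; exact not_le.2 this)
  · obtain ⟨ξ, h2, h3⟩ := exists_between (lt_min hlt (lt_add_of_pos_right b hδ'))
    obtain ⟨τ, hτ⟩ := intermediate_value_univ 0 t h.continuous_angle
      ⟨h0.2.trans h2.le, (h3.trans_le (min_le_left _ _)).le⟩
    have := h1' ξ ⟨h2, h3.trans_le (min_le_right _ _)⟩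
    exact absurd (hnn τ) (by rw [hτ]; exact not_le.2 this)

/-- The cosine of the phase and sign(h₃) times its sine rotate uniformly, which avoids following the
motion from one turning point to the next. The number `s` is the sign of φ₃; when φ₃ = 0 the start
is an end point, the sine vanishes and either sign satisfies `hs0`. -/
lemma Traj.oscillates (hF : IsQuasinorm F) (hP : P.φ₄ ^ 2 + P.φ₅ ^ 2 ≠ 0)
    (hmin : P.casimirMin F < P.casimir) (hmax : P.casimir < P.casimirMax F)
    {g : ℝ → Fin 5 → ℝ} {θ : ℝ → ℝ} {u : ℝ → ℝ × ℝ} (h : Traj F P g θ u) {a b : ℝ} (hab : a < b)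
    (ha : numer F P a = 0) (hb : numer F P b = 0) (hpos : ∀ ξ ∈ Ioo a b, 0 < numer F P ξ)
    (h0 : θ 0 ∈ Icc a b) {T : ℝ → ℝ} {D : ℝ} (hT : T = fun ξ => ∫ x in a..ξ, 1 / speed F P x)
    (hD : D = T b) {s : ℝ} (hs : s = 1 ∨ s = -1)
    (hs0 : Real.sign P.φ₃ * Real.sin (Real.pi / D * T (θ 0))
      = s * Real.sin (Real.pi / D * T (θ 0))) :
    (0 < D ∧ StrictMonoOn T (Icc a b)) ∧
    ∀ t₁, Real.sin (Real.pi / D * t₁ + s * (Real.pi / D * T (θ 0))) = 0 →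
      Oscillates θ t₁ (t₁ + D) := by
  have hint := intervalIntegrable_one_div_speed hF hP hmin hmax hab ha hb hpos
  have hmem := h.mem_Icc hF hP hmin hmax hab ha hb hpos h0
  have hk := continuousOn_one_div_speed hF hpos
  have hkpos : ∀ ξ ∈ Ioo a b, 0 < 1 / speed F P ξ := fun ξ hξ =>
    one_div_pos.2 ((speed_pos_iff hF).2 (hpos ξ hξ))
  have hTc : ContinuousOn T (Icc a b) := by
    rw [hT, ← uIcc_of_le hab.le]
    exact intervalIntegral.continuousOn_primitive_interval' hint left_mem_uIcc
  have hTd : ∀ ξ ∈ Ioo a b, HasDerivAt T (1 / speed F P ξ) ξ := fun ξ hξ => by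
    rw [hT]
    exact intervalIntegral.integral_hasDerivAt_right
      (hint.mono_set (uIcc_subset_uIcc left_mem_uIcc
        (uIcc_of_le hab.le ▸ Ioo_subset_Icc_self hξ)))
      (hk.stronglyMeasurableAtFilter isOpen_Ioo ξ hξ) (hk.continuousAt (Ioo_mem_nhds hξ.1 hξ.2))
  have hTm : StrictMonoOn T (Icc a b) := strictMonoOn_of_deriv_pos (convex_Icc a b) hTc
    fun ξ hξ => by
      rw [interior_Icc] at hξ
      rw [(hTd ξ hξ).deriv]
      exact hkpos ξ hξ
  have hTa : T a = 0 := by rw [hT]; exact intervalIntegral.integral_same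
  have hla := left_mem_Icc.2 hab.le
  have hlb := right_mem_Icc.2 hab.le
  have hDpos : 0 < D := by rw [hD, ← hTa]; exact hTm hla hlb hab
  refine ⟨⟨hDpos, hTm⟩, ?_⟩
  have hT0 : ∀ ξ ∈ Icc a b, T ξ ∈ Icc 0 D := fun ξ hξ => by
    rw [← hTa, hD]
    exact ⟨hTm.monotoneOn hla hξ hξ.1, hTm.monotoneOn hξ hlb hξ.2⟩
  set ω := Real.pi / D with hω
  have hωD : ω * D = Real.pi := by rw [hω]; field_simp
  set Z := {t | P.hZ (g t) = 0} with hZ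
  have hZc : Z.Countable := h.countable_hZ_eq_zero hF hP hmin hmax
  have hTθ : Continuous fun t => T (θ t) := by
    rw [← continuousOn_univ]
    exact hTc.comp h.continuous_angle.continuousOn fun t _ => hmem t
  have hsc : Continuous fun t => Real.sin (ω * T (θ t)) :=
    Real.continuous_sin.comp (continuous_const.mul hTθ)
  have hsin0 : ∀ t, P.hZ (g t) = 0 → Real.sin (ω * T (θ t)) = 0 := fun t ht => by
    have h1 := h.numer_eq_of_init hF t
    rw [ht] at h1
    rcases eq_endpoints_or_mem_Ioo_of_mem_Icc (hmem t) with h2 | h2 | h2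
    · rw [h2, hTa, mul_zero, Real.sin_zero]
    · rw [h2, ← hD, hωD, Real.sin_pi]
    · have := hpos _ h2
      simp [← h1] at this
  have hIoo : ∀ t, P.hZ (g t) ≠ 0 → θ t ∈ Ioo a b := fun t ht => by
    have h1 := h.numer_eq_of_init hF t
    rcases eq_endpoints_or_mem_Ioo_of_mem_Icc (hmem t) with h2 | h2 | h2
    · rw [h2, ha] at h1; exact absurd (pow_eq_zero_iff two_ne_zero |>.1 h1) ht
    · rw [h2, hb] at h1; exact absurd (pow_eq_zero_iff two_ne_zero |>.1 h1) ht
    · exact h2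
  have hsign : ∀ t, P.hZ (g t) ≠ 0 → ∃ σ : ℝ, σ * σ = 1 ∧
      (∀ᶠ τ in 𝓝 t, Real.sign (P.hZ (g τ)) = σ) ∧
      HasDerivAt θ (σ * speed F P (θ t)) t := fun t ht => by
    rcases lt_or_gt_of_ne ht with h1 | h1
    · refine ⟨-1, by norm_num, ?_, by simpa using h.hasDerivAt_of_neg hF h1.le⟩
      filter_upwards [h.continuous_hZ.continuousAt.eventually_lt_const h1] with τ hτ
        using Real.sign_of_neg hτ
    · refine ⟨1, by norm_num, ?_, by simpa using h.hasDerivAt_of_pos hF h1.le⟩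
      filter_upwards [h.continuous_hZ.continuousAt.eventually_const_lt h1] with τ hτ
        using Real.sign_of_pos hτ
  set S : ℝ → ℝ := fun t => Real.sign (P.hZ (g t)) * Real.sin (ω * T (θ t)) with hS
  -- The sign jumps only where h₃ vanishes. There θ is at an end of the interval and the sine of the
  -- phase is zero, so the product remains continuous.
  have hSc : Continuous S := by
    refine continuous_iff_continuousAt.2 fun t => ?_
    by_cases ht : P.hZ (g t) = 0
    · have h1 : S t = 0 := by simp only [hS, hsin0 t ht, mul_zero]
      rw [ContinuousAt, h1]
      have h2 : Tendsto (fun t => |Real.sin (ω * T (θ t))|) (𝓝 t) (𝓝 0) := by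
        simpa [hsin0 t ht] using hsc.abs.tendsto t
      refine squeeze_zero_norm (fun τ => ?_) h2
      rw [Real.norm_eq_abs, abs_mul]
      refine mul_le_of_le_one_left (abs_nonneg _) ?_
      rcases Real.sign_apply_eq (P.hZ (g τ)) with h | h | h <;> rw [h] <;> norm_num
    · obtain ⟨σ, -, hσ, -⟩ := hsign t ht
      refine ContinuousAt.congr (f := fun τ => σ * Real.sin (ω * T (θ τ)))
        (continuous_const.mul hsc).continuousAt ?_
      filter_upwards [hσ] with τ hτ
      simp only [hS, hτ]
  have hφ : ∀ t, t ∉ Z → ∃ σ : ℝ, σ * σ = 1 ∧ (∀ᶠ τ in 𝓝 t, Real.sign (P.hZ (g τ)) = σ) ∧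
      HasDerivAt (fun t => ω * T (θ t)) (ω * σ) t := fun t ht => by
    obtain ⟨σ, h1, h2, h3⟩ := hsign t ht
    refine ⟨σ, h1, h2, (((hTd _ (hIoo t ht)).comp t h3).const_mul ω).congr_deriv ?_⟩
    have := ((speed_pos_iff hF).2 (hpos _ (hIoo t ht))).ne'
    field_simp
  have hrot := rotation_eq (c := fun t => Real.cos (ω * T (θ t))) (S := S) (ω := ω) hZc
    (Real.continuous_cos.comp (continuous_const.mul hTθ)) hSc (fun t ht => by
      obtain ⟨σ, h1, h2, h3⟩ := hφ t ht
      refine h3.cos.congr_deriv ?_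
      simp only [hS, h2.self_of_nhds]
      ring) (fun t ht => by
      obtain ⟨σ, h1, h2, h3⟩ := hφ t ht
      have h4 : HasDerivAt (fun τ => σ * Real.sin (ω * T (θ τ))) (ω * Real.cos (ω * T (θ t))) t :=
        (h3.sin.const_mul σ).congr_deriv (by
          linear_combination (Real.cos (ω * T (θ t)) * ω) * h1)
      refine h4.congr_of_eventuallyEq ?_
      filter_upwards [h2] with τ hτ
      simp only [hS, hτ])
  have hcos : ∀ t, Real.cos (ω * T (θ t)) = Real.cos (ω * t + s * (ω * T (θ 0))) := fun t => by
    rw [hrot t]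
    simp only [hS, h.hZ_zero, hs0]
    rw [Real.cos_add]
    rcases hs with rfl | rfl
    · simp only [one_mul]; ring
    · simp only [neg_mul, one_mul, Real.cos_neg, Real.sin_neg]; ring
  exact fun t₁ ht₁ => oscillates_of_cos_eq hDpos hmem hTm.injOn hT0 hcos ht₁

end

section

variable {F : ℝ × ℝ → ℝ} {P : InitialData}

/-! ### Oscillating angles: the turning times -/

lemma rhs_eq_zero_iff (hF : IsQuasinorm F) {ξ : ℝ} : rhs F P ξ = 0 ↔ numer F P ξ = 0 := by
  rw [rhs, div_eq_zero_iff, or_iff_left (pow_ne_zero 4 (rad_pos hF ξ).ne')]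

lemma exists_zeros_of_ne (hF : IsQuasinorm F) (hP : P.φ₄ ^ 2 + P.φ₅ ^ 2 ≠ 0) (hφ : P.φ₃ ≠ 0)
    (hE : P.casimir ≤ P.casimirMax F) {θ₀ : ℝ} (hinit : bdry F θ₀ = (P.φ₁, P.φ₂)) :
    ∃ a b, a < θ₀ ∧ θ₀ < b ∧ numer F P a = 0 ∧ numer F P b = 0 ∧
      ∀ ξ ∈ Ioo a b, 0 < numer F P ξ := by
  obtain ⟨⟨l, hl, hl0⟩, r, hr, hr0⟩ := exists_numer_nonpos hF hP hE θ₀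
  exact exists_nearest_zeros (continuous_numer hF P) (by rw [numer_of_init hinit]; positivity)
    hl hl0 hr hr0

lemma oscillates_of_ne (hF : IsQuasinorm F) (hP : P.φ₄ ^ 2 + P.φ₅ ^ 2 ≠ 0)
    (hmin : P.casimirMin F < P.casimir) (hmax : P.casimir < P.casimirMax F) (hφ : P.φ₃ ≠ 0) {θ₀ : ℝ}
    (hinit : bdry F θ₀ = (P.φ₁, P.φ₂)) :
    ∃ θ₁ θ₂ : ℝ, 0 < P.φ₃ * (θ₂ - θ₁) ∧
      θ₀ ∈ Ioo (min θ₁ θ₂) (max θ₁ θ₂) ∧ rhs F P θ₁ = 0 ∧ rhs F P θ₂ = 0 ∧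
      (∀ ξ ∈ Ioo (min θ₁ θ₂) (max θ₁ θ₂), rhs F P ξ ≠ 0) ∧
      FiniteIntegral (integrand F P) θ₀ θ₁ ∧ FiniteIntegral (integrand F P) θ₀ θ₂ ∧
      ∀ g θ, IsNormalExtremal F P g θ → θ 0 = θ₀ →
        Oscillates θ (timeFn F P θ₀ θ₁) (timeFn F P θ₀ θ₂) := by
  obtain ⟨a, b, ha, hb, ha0, hb0, hpos⟩ := exists_zeros_of_ne hF hP hφ hmax.le hinit
  have hab := ha.trans hb
  have hint := intervalIntegrable_one_div_speed hF hP hmin hmax hab ha0 hb0 hpos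
  have hm : θ₀ ∈ uIcc a b := by rw [uIcc_of_le hab.le]; exact ⟨ha.le, hb.le⟩
  have ia := hint.mono_set (uIcc_subset_uIcc hm left_mem_uIcc)
  have ib := hint.mono_set (uIcc_subset_uIcc hm right_mem_uIcc)
  have hne : ∀ ξ ∈ Ioo a b, rhs F P ξ ≠ 0 := fun ξ hξ h0 =>
    (hpos ξ hξ).ne' ((rhs_eq_zero_iff hF).1 h0)
  have hadd : (∫ x in a..θ₀, 1 / speed F P x) + ∫ x in θ₀..b, 1 / speed F P x
      = ∫ x in a..b, 1 / speed F P x := intervalIntegral.integral_add_adjacent_intervals ia.symm ib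
  have hsym : ∫ x in θ₀..a, 1 / speed F P x = -∫ x in a..θ₀, 1 / speed F P x :=
    intervalIntegral.integral_symm _ _
  -- The point θ₁ is the turning point behind the motion and θ₂ the one ahead, so their order along
  -- the line follows the sign of φ₃.
  rcases lt_or_gt_of_ne hφ with hφ' | hφ'
  · refine ⟨b, a, by nlinarith, ?_, (rhs_eq_zero_iff hF).2 hb0, (rhs_eq_zero_iff hF).2 ha0, ?_,
      (finiteIntegral_integrand_iff hφ).2 ib, (finiteIntegral_integrand_iff hφ).2 ia, ?_⟩
    · rw [min_eq_right hab.le, max_eq_left hab.le]; exact ⟨ha, hb⟩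
    · rwa [min_eq_right hab.le, max_eq_left hab.le]
    · intro g θ h h0
      obtain ⟨u, hu⟩ := (isNormalExtremal_iff hF).1 h
      have := (hu.oscillates hF hP hmin hmax hab ha0 hb0 hpos (by rw [h0]; exact ⟨ha.le, hb.le⟩) rfl
        rfl (Or.inr rfl) (by rw [Real.sign_of_neg hφ']))
      obtain ⟨⟨hD, -⟩, h1⟩ := this
      simp only [h0] at h1
      have h2 := h1 (timeFn F P θ₀ b) (by
        rw [timeFn, integrand_of_neg hφ', intervalIntegral.integral_neg, ← hadd]
        rw [← hadd] at hD
        rw [show ∀ p q : ℝ, Real.pi / (p + q) * -q + -1 * (Real.pi / (p + q) * p)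
          = -(Real.pi / (p + q) * (p + q)) by intros; ring, div_mul_cancel₀ _ hD.ne', Real.sin_neg,
          Real.sin_pi, neg_zero])
      convert h2 using 1
      rw [timeFn, timeFn, integrand_of_neg hφ', intervalIntegral.integral_neg,
        intervalIntegral.integral_neg, ← hadd, hsym]
      ring
  · refine ⟨a, b, by nlinarith, ?_, (rhs_eq_zero_iff hF).2 ha0, (rhs_eq_zero_iff hF).2 hb0, ?_,
      (finiteIntegral_integrand_iff hφ).2 ia, (finiteIntegral_integrand_iff hφ).2 ib, ?_⟩
    · rw [min_eq_left hab.le, max_eq_right hab.le]; exact ⟨ha, hb⟩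
    · rwa [min_eq_left hab.le, max_eq_right hab.le]
    · intro g θ h h0
      obtain ⟨u, hu⟩ := (isNormalExtremal_iff hF).1 h
      obtain ⟨-, h1⟩ := hu.oscillates hF hP hmin hmax hab ha0 hb0 hpos
        (by rw [h0]; exact ⟨ha.le, hb.le⟩) rfl rfl (Or.inl rfl) (by rw [Real.sign_of_pos hφ'])
      simp only [h0] at h1
      have h2 := h1 (timeFn F P θ₀ a) (by
        rw [timeFn, integrand_of_pos hφ', hsym]
        simp)
      convert h2 using 1
      rw [timeFn, timeFn, integrand_of_pos hφ', ← hadd, hsym]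
      ring

lemma oscillates_of_eq_zero (hF : IsQuasinorm F) (hP : P.φ₄ ^ 2 + P.φ₅ ^ 2 ≠ 0)
    (hmin : P.casimirMin F < P.casimir) (hmax : P.casimir < P.casimirMax F) (hφ : P.φ₃ = 0) {θ₀ : ℝ}
    (hinit : bdry F θ₀ = (P.φ₁, P.φ₂)) :
    ∃ θ₂ : ℝ, θ₂ ≠ θ₀ ∧
      (∀ ξ ∈ uIcc θ₀ θ₂,
        P.φ₅ * (rad F ξ * Real.cos ξ - rad F θ₀ * Real.cos θ₀)
          ≤ P.φ₄ * (rad F ξ * Real.sin ξ - rad F θ₀ * Real.sin θ₀) ∧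
        (P.φ₄ * (rad F ξ * Real.sin ξ - rad F θ₀ * Real.sin θ₀)
          = P.φ₅ * (rad F ξ * Real.cos ξ - rad F θ₀ * Real.cos θ₀) ↔ ξ = θ₀ ∨ ξ = θ₂)) ∧
      FiniteIntegral (integrand₀ F P) θ₀ θ₂ ∧
      ∀ g θ, IsNormalExtremal F P g θ → θ 0 = θ₀ →
        Oscillates θ 0 (timeFn₀ F P θ₀ θ₂) := by
  have h00 : numer F P θ₀ = 0 := by rw [numer_of_init hinit, hφ]; ring
  have hl := level_eq_of_numer_eq_zero h00
  have hnum : ∀ ξ, numer F P ξ = 2 * (P.φ₄ * (rad F ξ * Real.sin ξ - rad F θ₀ * Real.sin θ₀)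
      - P.φ₅ * (rad F ξ * Real.cos ξ - rad F θ₀ * Real.cos θ₀)) := fun ξ => by
    rw [numer_eq, ← hl, level_eq, level_eq]; ring
  have hends : ∀ a b, numer F P a = 0 → numer F P b = 0 → (∀ ξ ∈ Ioo a b, 0 < numer F P ξ) →
      ∀ ξ ∈ Icc a b, 0 ≤ numer F P ξ ∧ (numer F P ξ = 0 ↔ ξ = a ∨ ξ = b) := by
    intro a b ha hb hpos ξ hξ
    rcases eq_endpoints_or_mem_Ioo_of_mem_Icc hξ with h | h | h
    · rw [h, ha]; simp
    · rw [h, hb]; simp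
    · exact ⟨(hpos ξ h).le, fun h1 => absurd h1 (hpos ξ h).ne', fun h1 => by
        rcases h1 with rfl | rfl
        · exact ha
        · exact hb⟩
  obtain ⟨σ, c, δ, hσ, hc, hδ, hb⟩ := exists_numer_bound hF hP (hl ▸ hmin) (hl ▸ hmax)
  -- The start is itself a simple zero, and the sign tells on which side N is positive. A point
  -- taken on that side within distance `δ` has the start as its nearest zero in one direction and
  -- the turning point in the other.
  rcases hσ with rfl | rfl
  · have hright : ∀ ξ ∈ Ioo θ₀ (θ₀ + δ), 0 < numer F P ξ := fun ξ hξ => by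
      have := hb θ₀ ξ (by linarith) hξ.1.le hξ.2
      rw [h00] at this
      linarith [mul_pos hc (sub_pos.2 hξ.1)]
    have hmid : θ₀ + δ / 2 ∈ Ioo θ₀ (θ₀ + δ) := ⟨by linarith, by linarith⟩
    obtain ⟨-, r, hr, hr0⟩ := exists_numer_nonpos hF hP hmax.le (θ₀ + δ / 2)
    obtain ⟨a, b, ha, hbm, ha0, hb0, hpos⟩ := exists_nearest_zeros (continuous_numer hF P)
      (hright _ hmid) hmid.1 h00.le hr hr0
    obtain rfl : a = θ₀ := by
      refine le_antisymm (not_lt.1 fun h => ?_) (not_lt.1 fun h => ?_)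
      · exact (hright a ⟨h, ha.trans hmid.2⟩).ne' ha0
      · exact (hpos θ₀ ⟨h, hmid.1.trans hbm⟩).ne' h00
    have hab := ha.trans hbm
    have hint := intervalIntegrable_one_div_speed hF hP hmin hmax hab ha0 hb0 hpos
    refine ⟨b, hab.ne', fun ξ hξ => ?_, (finiteIntegral_integrand₀_iff hφ).2 hint, ?_⟩
    · rw [uIcc_of_le hab.le] at hξ
      have h1 := hends a b ha0 hb0 hpos ξ hξ
      rw [hnum] at h1
      exact ⟨by linarith [h1.1], by rw [← h1.2]; constructor <;> intro h <;> linarith⟩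
    · intro g θ h h0
      obtain ⟨u, hu⟩ := (isNormalExtremal_iff hF).1 h
      obtain ⟨-, h1⟩ := hu.oscillates hF hP hmin hmax hab ha0 hb0 hpos
        (by rw [h0]; exact ⟨le_rfl, hab.le⟩) rfl rfl (Or.inl rfl) (by simp [h0])
      have h2 := h1 0 (by simp [h0])
      rwa [zero_add, show (∫ x in a..b, 1 / speed F P x) = timeFn₀ F P a b by
        rw [timeFn₀, if_pos hab, one_mul, integrand₀_eq hφ] ] at h2
  · have hleft : ∀ ξ ∈ Ioo (θ₀ - δ) θ₀, 0 < numer F P ξ := fun ξ hξ => by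
      have := hb ξ θ₀ hξ.1 hξ.2.le (by linarith)
      rw [h00] at this
      linarith [mul_pos hc (sub_pos.2 hξ.2)]
    have hmid : θ₀ - δ / 2 ∈ Ioo (θ₀ - δ) θ₀ := ⟨by linarith, by linarith⟩
    obtain ⟨⟨l, hl', hl0⟩, -⟩ := exists_numer_nonpos hF hP hmax.le (θ₀ - δ / 2)
    obtain ⟨a, b, ha, hbm, ha0, hb0, hpos⟩ := exists_nearest_zeros (continuous_numer hF P)
      (hleft _ hmid) hl' hl0 hmid.2 h00.le
    obtain rfl : b = θ₀ := by
      refine le_antisymm (not_lt.1 fun h => ?_) (not_lt.1 fun h => ?_)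
      · exact (hpos θ₀ ⟨ha.trans hmid.2, h⟩).ne' h00
      · exact (hleft b ⟨hmid.1.trans hbm, h⟩).ne' hb0
    have hab := ha.trans hbm
    have hint := intervalIntegrable_one_div_speed hF hP hmin hmax hab ha0 hb0 hpos
    refine ⟨a, hab.ne, fun ξ hξ => ?_, (finiteIntegral_integrand₀_iff hφ).2 hint.symm, ?_⟩
    · rw [uIcc_of_ge hab.le] at hξ
      have h1 := hends a b ha0 hb0 hpos ξ hξ
      rw [hnum] at h1
      exact ⟨by linarith [h1.1], by rw [or_comm, ← h1.2]; constructor <;> intro h <;> linarith⟩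
    · intro g θ h h0
      obtain ⟨u, hu⟩ := (isNormalExtremal_iff hF).1 h
      have hsin : ∀ D : ℝ, Real.sin (Real.pi / D * D) = 0 := fun D => by
        rcases eq_or_ne D 0 with rfl | hD
        · simp
        · rw [div_mul_cancel₀ _ hD, Real.sin_pi]
      obtain ⟨-, h1⟩ := hu.oscillates hF hP hmin hmax hab ha0 hb0 hpos
        (by rw [h0]; exact ⟨hab.le, le_rfl⟩) rfl rfl (Or.inl rfl) (by
          simp only [h0, hsin, mul_zero])
      have h2 := h1 0 (by simp only [h0, mul_zero, zero_add, one_mul, hsin])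
      rwa [zero_add, show (∫ x in a..b, 1 / speed F P x) = timeFn₀ F P b a by
        rw [timeFn₀, if_neg (not_lt.2 hab.le), integrand₀_eq hφ, intervalIntegral.integral_symm a b]
        ring] at h2

end

section

/-! ### Pauses of solutions between two neighbouring zeros -/

section Generic

variable {f : ℝ → ℝ} {a b ξ₀ ℓ : ℝ}

/-- The derivative at time 0 is recorded because it must match φ₃ later. The last clause provides an
instant at the opposite end, from which the solution can be restarted. -/
lemma exists_isSol_pause_right (hf : Continuous f) (ha : f a = 0) (hb : f b = 0)
    (hpos : ∀ ξ ∈ Ioo a b, 0 < f ξ) (h₀ : ξ₀ ∈ Ioo a b)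
    (hi : IntervalIntegrable (fun ξ => 1 / f ξ) volume ξ₀ b) (hℓ : 0 ≤ ℓ) :
    ∃ θ, IsSol f θ ∧ θ 0 = ξ₀ ∧ deriv θ 0 = f ξ₀ ∧ (∃ p, ∀ t, θ t = b ↔ t ∈ Icc p (p + ℓ)) ∧
      (IntervalIntegrable (fun ξ => 1 / f ξ) volume ξ₀ a → ∃ s, θ s = a) := by
  obtain ⟨Θ, hΘ, hΘ0, hr, hl⟩ := exists_profile hf ha hb hpos h₀
  obtain ⟨B, hB, hB'⟩ := hr hi
  obtain ⟨θ, h1, h2, h3⟩ := hΘ.exists_pause_right hf hb hB' hℓ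
  refine ⟨θ, h1, by rw [h2 0 hB.le, hΘ0], ?_, ⟨B, h3⟩, fun hi' => ?_⟩
  · have h4 : θ =ᶠ[𝓝 0] Θ := by
      filter_upwards [Iio_mem_nhds hB] with t ht using h2 t (mem_Iio.1 ht).le
    rw [h4.deriv_eq, (hΘ.hasDerivAt 0).deriv, hΘ0]
  · obtain ⟨A, hA, hA'⟩ := hl hi'
    exact ⟨A, by rw [h2 A (hA.trans hB).le, (hA' A).2 le_rfl]⟩

lemma exists_isSol_pause_left (hf : Continuous f) (ha : f a = 0) (hb : f b = 0)
    (hpos : ∀ ξ ∈ Ioo a b, 0 < f ξ) (h₀ : ξ₀ ∈ Ioo a b)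
    (hi : IntervalIntegrable (fun ξ => 1 / f ξ) volume ξ₀ a) (hℓ : 0 ≤ ℓ) :
    ∃ θ, IsSol f θ ∧ θ 0 = ξ₀ ∧ deriv θ 0 = f ξ₀ ∧ (∃ p, ∀ t, θ t = a ↔ t ∈ Icc p (p + ℓ)) ∧
      (IntervalIntegrable (fun ξ => 1 / f ξ) volume ξ₀ b → ∃ s, θ s = b) := by
  obtain ⟨Θ, hΘ, hΘ0, hr, hl⟩ := exists_profile hf ha hb hpos h₀
  obtain ⟨A, hA, hA'⟩ := hl hi
  obtain ⟨θ, h1, h2, h3⟩ := hΘ.exists_pause_left hf ha hA' hℓ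
  refine ⟨θ, h1, by rw [h2 0 hA.le, hΘ0], ?_, ⟨A - ℓ, by simpa using h3⟩, fun hi' => ?_⟩
  · have h4 : θ =ᶠ[𝓝 0] Θ := by
      filter_upwards [Ioi_mem_nhds hA] with t ht using h2 t (mem_Ioi.1 ht).le
    rw [h4.deriv_eq, (hΘ.hasDerivAt 0).deriv, hΘ0]
  · obtain ⟨B, hB, hB'⟩ := hr hi'
    exact ⟨B, by rw [h2 B (hA.trans hB).le, (hB' B).2 le_rfl]⟩

lemma IsSol.exists_shift {θ : ℝ → ℝ} (h : IsSol f θ) {c d s : ℝ} (hs : θ s = d)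
    (hp : ∃ p, ∀ t, θ t = c ↔ t ∈ Icc p (p + ℓ)) :
    ∃ θ, IsSol f θ ∧ θ 0 = d ∧ ∃ p, ∀ t, θ t = c ↔ t ∈ Icc p (p + ℓ) := by
  obtain ⟨p, hp⟩ := hp
  refine ⟨_, h.comp_add_const s, by simpa using hs, p - s, fun t => ?_⟩
  rw [hp, mem_Icc, mem_Icc]
  constructor <;> rintro ⟨h1, h2⟩ <;> constructor <;> linarith

/-- A solution that starts at the zero `a`, from which it may leave, in a pause. -/
lemma exists_isSol_pause_start_left (hf : Continuous f) (ha : f a = 0) (hb : f b = 0)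
    (hpos : ∀ ξ ∈ Ioo a b, 0 < f ξ) (hab : a < b)
    (hi : ∃ η > a, IntervalIntegrable (fun ξ => 1 / f ξ) volume a η) (hℓ : 0 ≤ ℓ) :
    ∃ θ, IsSol f θ ∧ θ 0 = a ∧ ∃ p, ∀ t, θ t = a ↔ t ∈ Icc p (p + ℓ) := by
  obtain ⟨η, hη, hi⟩ := hi
  obtain ⟨ξ, h1, h2⟩ := exists_between (lt_min hη hab)
  have hi' := hi.mono_set (uIcc_subset_uIcc left_mem_uIcc
    (show ξ ∈ uIcc a η by
      rw [uIcc_of_le hη.le]; exact ⟨h1.le, (h2.trans_le (min_le_left _ _)).le⟩))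
  obtain ⟨θ, h3, -, -, ⟨p, hp⟩, -⟩ := exists_isSol_pause_left hf ha hb hpos
    ⟨h1, h2.trans_le (min_le_right _ _)⟩ hi'.symm hℓ
  exact h3.exists_shift ((hp p).2 ⟨le_rfl, by linarith⟩) ⟨p, hp⟩

lemma exists_isSol_pause_start_right (hf : Continuous f) (ha : f a = 0) (hb : f b = 0)
    (hpos : ∀ ξ ∈ Ioo a b, 0 < f ξ) (hab : a < b)
    (hi : ∃ η < b, IntervalIntegrable (fun ξ => 1 / f ξ) volume η b) (hℓ : 0 ≤ ℓ) :
    ∃ θ, IsSol f θ ∧ θ 0 = b ∧ ∃ p, ∀ t, θ t = b ↔ t ∈ Icc p (p + ℓ) := by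
  obtain ⟨η, hη, hi⟩ := hi
  obtain ⟨ξ, h1, h2⟩ := exists_between (max_lt hη hab)
  have hi' := hi.mono_set (uIcc_subset_uIcc (show ξ ∈ uIcc η b by
      rw [uIcc_of_le hη.le]; exact ⟨((le_max_left _ _).trans_lt h1).le, h2.le⟩) right_mem_uIcc)
  obtain ⟨θ, h3, -, -, ⟨p, hp⟩, -⟩ := exists_isSol_pause_right hf ha hb hpos
    ⟨(le_max_right _ _).trans_lt h1, h2⟩ hi' hℓ
  exact h3.exists_shift ((hp p).2 ⟨le_rfl, by linarith⟩) ⟨p, hp⟩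

lemma exists_isSol_left_pause_right (hf : Continuous f) (ha : f a = 0) (hb : f b = 0)
    (hpos : ∀ ξ ∈ Ioo a b, 0 < f ξ) (hab : a < b)
    (hi : IntervalIntegrable (fun ξ => 1 / f ξ) volume a b) (hℓ : 0 ≤ ℓ) :
    ∃ θ, IsSol f θ ∧ θ 0 = a ∧ ∃ p, ∀ t, θ t = b ↔ t ∈ Icc p (p + ℓ) := by
  obtain ⟨ξ, h1, h2⟩ := exists_between hab
  have hm : ξ ∈ uIcc a b := by rw [uIcc_of_le hab.le]; exact ⟨h1.le, h2.le⟩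
  obtain ⟨θ, h3, -, -, hp, hs⟩ := exists_isSol_pause_right hf ha hb hpos ⟨h1, h2⟩
    (hi.mono_set (uIcc_subset_uIcc hm right_mem_uIcc)) hℓ
  obtain ⟨s, hs⟩ := hs (hi.mono_set (uIcc_subset_uIcc hm left_mem_uIcc))
  exact h3.exists_shift hs hp

lemma exists_isSol_right_pause_left (hf : Continuous f) (ha : f a = 0) (hb : f b = 0)
    (hpos : ∀ ξ ∈ Ioo a b, 0 < f ξ) (hab : a < b)
    (hi : IntervalIntegrable (fun ξ => 1 / f ξ) volume a b) (hℓ : 0 ≤ ℓ) :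
    ∃ θ, IsSol f θ ∧ θ 0 = b ∧ ∃ p, ∀ t, θ t = a ↔ t ∈ Icc p (p + ℓ) := by
  obtain ⟨ξ, h1, h2⟩ := exists_between hab
  have hm : ξ ∈ uIcc a b := by rw [uIcc_of_le hab.le]; exact ⟨h1.le, h2.le⟩
  obtain ⟨θ, h3, -, -, hp, hs⟩ := exists_isSol_pause_left hf ha hb hpos ⟨h1, h2⟩
    (hi.mono_set (uIcc_subset_uIcc hm left_mem_uIcc)) hℓ
  obtain ⟨s, hs⟩ := hs (hi.mono_set (uIcc_subset_uIcc hm right_mem_uIcc))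
  exact h3.exists_shift hs hp

lemma IsSol.le_of_barrier {θ : ℝ → ℝ} (h : IsSol f θ) (hab : a < b) (hf : ∀ ξ ∈ Icc a b, f ξ = 0)
    {s : ℝ} (hs : θ s ≤ a) (t : ℝ) : θ t ≤ a := by
  have h1 := h.barrier hf s t
  rw [max_eq_left ((min_le_right _ _).trans hs)] at h1
  have h2 : min b (θ t) ≤ a := by rw [h1]; exact le_max_right _ _
  exact (min_le_iff.1 h2).resolve_left (not_le.2 hab)

lemma IsSol.ge_of_barrier {θ : ℝ → ℝ} (h : IsSol f θ) (hab : a < b) (hf : ∀ ξ ∈ Icc a b, f ξ = 0)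
    {s : ℝ} (hs : b ≤ θ s) (t : ℝ) : b ≤ θ t := by
  have h1 := h.barrier hf s t
  rw [min_eq_left hs, max_eq_right hab.le] at h1
  have h2 : b ≤ max a (min b (θ t)) := h1.le
  exact ((le_max_iff.1 h2).resolve_left (not_le.2 hab)).trans (min_le_right _ _)

/-- A solution that gets from `ξ₀` to or beyond `q` passes from `p` to `q`, for `p` in between. -/
lemma IsSol.integrable_of_le {θ : ℝ → ℝ} (h : IsSol f θ) {p q s t : ℝ} (hs : θ s ≤ p)
    (ht : q ≤ θ t) (hpq : p < q) (hf : ∀ ξ ∈ Ioo p q, 0 < f ξ) :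
    IntervalIntegrable (fun ξ => 1 / f ξ) volume p q := by
  obtain ⟨s', hs'⟩ := intermediate_value_univ s t h.continuous ⟨hs, hpq.le.trans ht⟩
  obtain ⟨t', ht'⟩ := intermediate_value_univ s t h.continuous ⟨hs.trans hpq.le, ht⟩
  exact h.intervalIntegrable hs' ht' hpq hf

lemma IsSol.integrable_of_ge {θ : ℝ → ℝ} (h : IsSol f θ) {p q s t : ℝ} (hs : q ≤ θ s)
    (ht : θ t ≤ p) (hpq : p < q) (hf : ∀ ξ ∈ Ioo p q, 0 < f ξ) :
    IntervalIntegrable (fun ξ => 1 / f ξ) volume p q :=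
  h.integrable_of_le ht hs hpq hf

/-- If the zeros of the periodic function `f` are the points `a + wk`, the solution follows
any itinerary. -/
lemma exists_isSol_itinerary (hf : Continuous f) (ha : f a = 0)
    (hper : ∀ (ξ : ℝ) (k : ℤ), f (ξ + 2 * Real.pi * k) = f ξ)
    (hpos : ∀ ξ ∈ Ioo a (a + 2 * Real.pi), 0 < f ξ) (h₀ : ξ₀ ∈ Ioo a (a + 2 * Real.pi))
    (hi : IntervalIntegrable (fun ξ => 1 / f ξ) volume a (a + 2 * Real.pi)) {p l : ℤ → ℝ}
    (hp : ∀ n, |p (n + 1) - p n| = 2 * Real.pi) (hp0 : ∃ k : ℤ, p 0 = a + 2 * Real.pi * k)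
    (hl : ∀ n, 0 ≤ l n) :
    ∃ A D : ℝ, A < 0 ∧ 0 < A + D ∧ ∀ a₀, ∃ θ α β, IsSol f θ ∧ FollowsItinerary θ p l α β ∧
      α 0 = a₀ ∧ β 0 = a₀ + D ∧
      (a₀ = A → p (-1) = a → p 0 = a + 2 * Real.pi → θ 0 = ξ₀ ∧ deriv θ 0 = f ξ₀) ∧
      (a₀ = -(A + D) → p (-1) = a + 2 * Real.pi → p 0 = a → θ 0 = ξ₀ ∧ deriv θ 0 = -f ξ₀) := by
  have hπ := Real.pi_pos
  have hb : f (a + 2 * Real.pi) = 0 := by simpa [ha] using hper a 1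
  have hab : a < a + 2 * Real.pi := by linarith
  have hm : ξ₀ ∈ uIcc a (a + 2 * Real.pi) := by
    rw [uIcc_of_le hab.le]; exact ⟨h₀.1.le, h₀.2.le⟩
  obtain ⟨Θ, hΘ, hΘ0, hr, hl'⟩ := exists_profile hf ha hb hpos h₀
  obtain ⟨B, hB, hB'⟩ := hr (hi.mono_set (uIcc_subset_uIcc hm right_mem_uIcc))
  obtain ⟨A, hA, hA'⟩ := hl' (hi.mono_set (uIcc_subset_uIcc hm left_mem_uIcc))
  -- One value of the itinerary is a translate of `a` by a multiple of 2π, and the step condition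
  -- propagates this in both directions.
  have hpk : ∀ n, ∃ k : ℤ, p n = a + 2 * Real.pi * k := by
    intro n
    induction n using Int.induction_on with
    | zero => exact hp0
    | succ n ih =>
      obtain ⟨k, hk⟩ := ih
      rcases (abs_eq (by linarith)).1 (hp n) with h | h
      · exact ⟨k + 1, by push_cast; linarith⟩
      · exact ⟨k - 1, by push_cast; linarith⟩
    | pred n ih =>
      obtain ⟨k, hk⟩ := ih
      have := hp (-n - 1)
      rw [sub_add_cancel] at this
      rcases (abs_eq (by linarith)).1 this with h | h
      · exact ⟨k - 1, by push_cast; linarith⟩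
      · exact ⟨k + 1, by push_cast; linarith⟩
  -- The clock is shifted so that the profile leaves `a` at time 0 and arrives at time `B - A`. The
  -- start times `A` and `-(A + D)` then bring `ξ₀` to time 0 in the rising and the falling move.
  have hΘ' : Profile f a (a + 2 * Real.pi) fun t => Θ (t + A) :=
    ⟨fun t => (hΘ.hasDerivAt (t + A)).comp_add_const t A, fun t => hΘ.mem _,
      fun s t hst => hΘ.monotone (by linarith)⟩
  refine ⟨A, B - A, hA, by linarith, fun a₀ => ?_⟩
  obtain ⟨θ, α, β, h1, h2, h3, h4, h5, h6⟩ := hΘ'.exists_itinerary (D := B - A) hf ha hab hpos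
    (fun t => by rw [hA']; constructor <;> intro h <;> linarith)
    (fun t => by rw [hB']; constructor <;> intro h <;> linarith)
    (p := p) (ℓ := l) (fun n => by rw [hp]; ring) (fun n ξ => by
      obtain ⟨k, hk⟩ := hpk n
      rw [hk, add_sub_cancel_left, hper]) hl a₀
  refine ⟨θ, α, β, h1, h2, h3, h4, fun ha₀ e1 e2 => ?_, fun ha₀ e1 e2 => ?_⟩
  · have h7 : θ =ᶠ[𝓝 0] Θ := by
      filter_upwards [Ioo_mem_nhds hA hB] with t ht
      rw [h5 (by linarith) t ⟨by rw [ha₀]; exact ht.1.le, by linarith [ht.2]⟩, e1, ha₀]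
      ring_nf
    rw [h7.deriv_eq, h7.self_of_nhds, hΘ0, (hΘ.hasDerivAt 0).deriv, hΘ0]
    exact ⟨rfl, rfl⟩
  · have h7 : θ =ᶠ[𝓝 0] fun t => Θ (-t) := by
      filter_upwards [Ioo_mem_nhds (neg_lt_zero.2 hB) (neg_pos.2 hA)] with t ht
      rw [h6 (by linarith) t ⟨by rw [ha₀]; linarith [ht.1], by linarith [ht.2]⟩, e2, ha₀]
      ring_nf
    have h8 : HasDerivAt (fun t => Θ (-t)) (-f ξ₀) 0 := by
      have := (hΘ.hasDerivAt (-0)).scomp (0 : ℝ) (hasDerivAt_neg 0)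
      simpa [Function.comp_def, hΘ0] using this
    rw [h7.deriv_eq, h7.self_of_nhds, h8.deriv]; simp [hΘ0]

end Generic

end

section

variable {F : ℝ × ℝ → ℝ} {P : InitialData}

/-! ### Zeros of the speed that a solution reaches -/

section Generic

variable {f θ : ℝ → ℝ} {a b θ₀ : ℝ}

lemma intervalIntegrable_one_div_of_ends (hf : Continuous f) (hpos : ∀ ξ ∈ Ioo a b, 0 < f ξ)
    (hab : a < b) (hr : ∃ η > a, IntervalIntegrable (fun ξ => 1 / f ξ) volume a η)
    (hl : ∃ η < b, IntervalIntegrable (fun ξ => 1 / f ξ) volume η b) :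
    IntervalIntegrable (fun ξ => 1 / f ξ) volume a b := by
  obtain ⟨η, hη, hi⟩ := hr
  obtain ⟨η', hη', hi'⟩ := hl
  obtain ⟨x, hx1, hx2⟩ := exists_between (lt_min hη hab)
  obtain ⟨y, hy1, hy2⟩ := exists_between (max_lt hη' hab)
  rw [lt_min_iff] at hx2
  rw [max_lt_iff] at hy1
  have h1 : IntervalIntegrable (fun ξ => 1 / f ξ) volume a x :=
    hi.mono_set (by rw [uIcc_of_le hη.le, uIcc_of_le hx1.le]; exact Icc_subset_Icc_right hx2.1.le)
  have h3 : IntervalIntegrable (fun ξ => 1 / f ξ) volume y b :=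
    hi'.mono_set (by rw [uIcc_of_le hη'.le, uIcc_of_le hy2.le]; exact Icc_subset_Icc_left hy1.1.le)
  have h2 : IntervalIntegrable (fun ξ => 1 / f ξ) volume x y := by
    refine ContinuousOn.intervalIntegrable (continuousOn_const.div hf.continuousOn fun ξ hξ => ?_)
    exact (hpos ξ ⟨(lt_min hx1 hy1.2).trans_le hξ.1, hξ.2.trans_lt (max_lt hx2.2 hy2)⟩).ne'
  exact (h1.trans h2).trans h3

lemma intervalIntegrable_one_div_of_period (hper : ∀ (ξ : ℝ) (k : ℤ), f (ξ + 2 * Real.pi * k) = f ξ)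
    (hi : IntervalIntegrable (fun ξ => 1 / f ξ) volume a (a + 2 * Real.pi)) (x y : ℝ) :
    IntervalIntegrable (fun ξ => 1 / f ξ) volume x y := by
  have hp : Function.Periodic (fun ξ => 1 / f ξ) (2 * Real.pi) := fun ξ => by
    have := hper ξ 1
    simp only [Int.cast_one, mul_one] at this
    simp only [this]
  exact hp.intervalIntegrable Real.two_pi_pos.ne' hi x y

lemma pos_add_two_pi (hper : ∀ (ξ : ℝ) (k : ℤ), f (ξ + 2 * Real.pi * k) = f ξ)
    (hpos : ∀ ξ ∈ Ioo a b, 0 < f ξ) {ξ : ℝ}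
    (hξ : ξ ∈ Ioo (a + 2 * Real.pi) (b + 2 * Real.pi)) : 0 < f ξ := by
  have h := hpos (ξ - 2 * Real.pi) ⟨by linarith [hξ.1], by linarith [hξ.2]⟩
  have := hper (ξ - 2 * Real.pi) 1
  simp only [Int.cast_one, mul_one, sub_add_cancel] at this
  rwa [this]

lemma pos_sub_two_pi (hper : ∀ (ξ : ℝ) (k : ℤ), f (ξ + 2 * Real.pi * k) = f ξ)
    (hpos : ∀ ξ ∈ Ioo a b, 0 < f ξ) {ξ : ℝ}
    (hξ : ξ ∈ Ioo (a - 2 * Real.pi) (b - 2 * Real.pi)) : 0 < f ξ := by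
  have h := hpos (ξ + 2 * Real.pi) ⟨by linarith [hξ.1], by linarith [hξ.2]⟩
  have := hper ξ 1
  simp only [Int.cast_one, mul_one] at this
  rwa [← this]

lemma zero_add_two_pi (hper : ∀ (ξ : ℝ) (k : ℤ), f (ξ + 2 * Real.pi * k) = f ξ)
    (h0 : ∀ ξ ∈ Icc a b, f ξ = 0) {ξ : ℝ}
    (hξ : ξ ∈ Icc (a + 2 * Real.pi) (b + 2 * Real.pi)) : f ξ = 0 := by
  have h := h0 (ξ - 2 * Real.pi) ⟨by linarith [hξ.1], by linarith [hξ.2]⟩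
  have := hper (ξ - 2 * Real.pi) 1
  simp only [Int.cast_one, mul_one, sub_add_cancel] at this
  rwa [this]

lemma zero_sub_two_pi (hper : ∀ (ξ : ℝ) (k : ℤ), f (ξ + 2 * Real.pi * k) = f ξ)
    (h0 : ∀ ξ ∈ Icc a b, f ξ = 0) {ξ : ℝ}
    (hξ : ξ ∈ Icc (a - 2 * Real.pi) (b - 2 * Real.pi)) : f ξ = 0 := by
  have h := h0 (ξ + 2 * Real.pi) ⟨by linarith [hξ.1], by linarith [hξ.2]⟩
  have := hper ξ 1
  simp only [Int.cast_one, mul_one] at this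
  rwa [← this]

lemma exists_eq_add_int_mul_of_zero (hper : ∀ (ξ : ℝ) (k : ℤ), f (ξ + 2 * Real.pi * k) = f ξ)
    (hpos : ∀ ξ ∈ Ioo a (a + 2 * Real.pi), 0 < f ξ) {c : ℝ} (hc : f c = 0) :
    ∃ k : ℤ, c = a + 2 * Real.pi * k := by
  obtain ⟨k, hk, -⟩ := existsUnique_sub_zsmul_mem_Ico Real.two_pi_pos c a
  rw [zsmul_eq_mul] at hk
  refine ⟨k, ?_⟩
  rcases hk.1.eq_or_lt with h | h
  · linarith
  · have h1 := hpos _ ⟨h, hk.2⟩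
    have h2 := hper (c - k * (2 * Real.pi)) k
    rw [show c - k * (2 * Real.pi) + 2 * Real.pi * k = c by ring, hc] at h2
    exact absurd h2 h1.ne

/-- A solution stays between two zeros that take infinite time to reach. -/
lemma IsSol.mem_Ioo_of_not_integrable (h : IsSol f θ) (hpos : ∀ ξ ∈ Ioo a b, 0 < f ξ)
    (h₀ : θ 0 ∈ Ioo a b) (hl : ¬ IntervalIntegrable (fun ξ => 1 / f ξ) volume (θ 0) a)
    (hr : ¬ IntervalIntegrable (fun ξ => 1 / f ξ) volume (θ 0) b) (t : ℝ) : θ t ∈ Ioo a b := by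
  constructor
  · by_contra! hc
    exact hl (h.integrable_of_ge le_rfl hc h₀.1 fun ξ hξ =>
      hpos ξ ⟨hξ.1, hξ.2.trans h₀.2⟩).symm
  · by_contra! hc
    exact hr (h.integrable_of_le le_rfl hc h₀.2 fun ξ hξ => hpos ξ ⟨h₀.1.trans hξ.1, hξ.2⟩)

/-- The zeros of `f` that a solution reaches from the interval between two neighbouring zeros. -/
lemma IsSol.zero_reached (h : IsSol f θ) (hper : ∀ (ξ : ℝ) (k : ℤ), f (ξ + 2 * Real.pi * k) = f ξ)
    (hpos : ∀ ξ ∈ Ioo a b, 0 < f ξ) (h₀ : θ 0 ∈ Ioo a b) (hab : b ≤ a + 2 * Real.pi)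
    (harc : b < a + 2 * Real.pi → ∀ ξ ∈ Icc b (a + 2 * Real.pi), f ξ = 0)
    (hnot : ¬ (IntervalIntegrable (fun ξ => 1 / f ξ) volume (θ 0) a ∧
      IntervalIntegrable (fun ξ => 1 / f ξ) volume (θ 0) b ∧ b = a + 2 * Real.pi))
    {t : ℝ} (ht : f (θ t) = 0) :
    (IntervalIntegrable (fun ξ => 1 / f ξ) volume (θ 0) a ∧ θ t = a) ∨
      (IntervalIntegrable (fun ξ => 1 / f ξ) volume (θ 0) b ∧ θ t = b) := by
  have hπ := Real.two_pi_pos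
  rcases le_or_gt (θ t) a with h1 | h1
  · refine Or.inl ⟨(h.integrable_of_ge le_rfl h1 h₀.1 fun ξ hξ =>
      hpos ξ ⟨hξ.1, hξ.2.trans h₀.2⟩).symm, ?_⟩
    -- If the zeros form non-degenerate arcs, the arc ending at `a` is a barrier. If they are single
    -- points, going beyond `a` means covering a full period in finite time, which makes every
    -- integral finite and is excluded by `hnot`.
    rcases hab.lt_or_eq with h2 | h2
    · refine le_antisymm h1 (h.ge_of_barrier (a := b - 2 * Real.pi) (by linarith) (fun ξ hξ => ?_)
        h₀.1.le t)
      exact zero_sub_two_pi hper (harc h2) ⟨hξ.1, by linarith [hξ.2]⟩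
    · by_contra hne
      have h3 : θ t ≤ a - 2 * Real.pi := by
        by_contra! h4
        exact absurd ht (pos_sub_two_pi hper hpos ⟨h4, by
          rw [h2]; linarith [lt_of_le_of_ne h1 hne]⟩).ne'
      have h4 := h.integrable_of_ge h₀.1.le h3 (by linarith) fun ξ hξ =>
        pos_sub_two_pi hper hpos ⟨hξ.1, by linarith [hξ.2]⟩
      have h5 := intervalIntegrable_one_div_of_period (a := a - 2 * Real.pi) hper
        (by rwa [sub_add_cancel])
      exact hnot ⟨h5 _ _, h5 _ _, h2⟩
  rcases lt_or_ge (θ t) b with h2 | h2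
  · exact absurd ht (hpos _ ⟨h1, h2⟩).ne'
  · refine Or.inr ⟨h.integrable_of_le le_rfl h2 h₀.2 fun ξ hξ =>
      hpos ξ ⟨h₀.1.trans hξ.1, hξ.2⟩, ?_⟩
    rcases hab.lt_or_eq with h3 | h3
    · exact le_antisymm (h.le_of_barrier h3 (harc h3) h₀.2.le t) h2
    · by_contra hne
      have h5 : b + 2 * Real.pi ≤ θ t := by
        by_contra! h4
        exact absurd ht (pos_add_two_pi hper hpos ⟨by
          rw [← h3]; exact lt_of_le_of_ne h2 (Ne.symm hne), h4⟩).ne'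
      have h4 := h.integrable_of_le h₀.2.le h5 (by linarith) fun ξ hξ =>
        pos_add_two_pi hper hpos ⟨by linarith [hξ.1], hξ.2⟩
      have h6 := intervalIntegrable_one_div_of_period hper h4
      exact hnot ⟨h6 _ _, h6 _ _, h3⟩

/-- A solution starting at an end of a segment of zeros does not leave it if that takes infinite
time. -/
lemma IsSol.le_of_not_integrable (h : IsSol f θ) {q : ℝ} (hbq : b < q)
    (hpos : ∀ ξ ∈ Ioo b q, 0 < f ξ) (h₀ : θ 0 = b)
    (hr : ¬ ∃ η > b, IntervalIntegrable (fun ξ => 1 / f ξ) volume b η) (t : ℝ) : θ t ≤ b := by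
  by_contra! hc
  exact hr ⟨min (θ t) q, lt_min hc hbq, h.integrable_of_le h₀.le (min_le_left _ _) (lt_min hc hbq)
    fun ξ hξ => hpos ξ ⟨hξ.1, hξ.2.trans_le (min_le_right _ _)⟩⟩

lemma IsSol.ge_of_not_integrable (h : IsSol f θ) {q : ℝ} (hqa : q < a)
    (hpos : ∀ ξ ∈ Ioo q a, 0 < f ξ) (h₀ : θ 0 = a)
    (hl : ¬ ∃ η < a, IntervalIntegrable (fun ξ => 1 / f ξ) volume η a) (t : ℝ) : a ≤ θ t := by
  by_contra! hc
  exact hl ⟨max (θ t) q, max_lt hc hqa, h.integrable_of_ge h₀.ge (le_max_left _ _) (max_lt hc hqa)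
    fun ξ hξ => hpos ξ ⟨(le_max_right _ _).trans_lt hξ.1, hξ.2⟩⟩

/-- The cases in which a solution cannot leave a segment of zeros. -/
lemma IsSol.const_of_rigid (h : IsSol f θ) (h0 : ∀ ξ ∈ Icc a b, f ξ = 0) {p q : ℝ}
    (hpa : p < a) (hbq : b < q) (hl : ∀ ξ ∈ Ioo p a, 0 < f ξ) (hr : ∀ ξ ∈ Ioo b q, 0 < f ξ)
    (hrigid : (a = θ 0 ∧ θ 0 = b ∧
        ¬ (∃ η < θ 0, IntervalIntegrable (fun ξ => 1 / f ξ) volume η (θ 0)) ∧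
        ¬ ∃ η > θ 0, IntervalIntegrable (fun ξ => 1 / f ξ) volume (θ 0) η) ∨
      (a < θ 0 ∧ θ 0 < b) ∨
      (θ 0 = a ∧ a < b ∧ ¬ ∃ η < θ 0, IntervalIntegrable (fun ξ => 1 / f ξ) volume η (θ 0)) ∨
      (θ 0 = b ∧ a < b ∧ ¬ ∃ η > θ 0, IntervalIntegrable (fun ξ => 1 / f ξ) volume (θ 0) η))
    (t : ℝ) : θ t = θ 0 := by
  rcases hrigid with ⟨h1, h2, h3, h4⟩ | ⟨h1, h2⟩ | ⟨h1, h2, h3⟩ | ⟨h1, h2, h3⟩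
  · refine le_antisymm ?_ ?_
    · rw [h2] at h4
      exact (h.le_of_not_integrable hbq hr h2 h4 t).trans h2.ge
    · rw [← h1] at h3
      exact h1.symm.le.trans (h.ge_of_not_integrable hpa hl h1.symm h3 t)
  · have h3 := h.barrier h0 0 t
    rw [min_eq_right h2.le, max_eq_right h1.le] at h3
    rcases max_choice a (min b (θ t)) with h4 | h4
    · rw [h4] at h3; linarith
    · rw [h4] at h3
      rcases min_choice b (θ t) with h5 | h5
      · rw [h5] at h3; linarith
      · rw [h5] at h3; exact h3.symm
  · rw [h1] at h3 ⊢
    exact le_antisymm (h.le_of_barrier h2 h0 h1.le t) (h.ge_of_not_integrable hpa hl h1 h3 t)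
  · rw [h1] at h3 ⊢
    exact le_antisymm (h.le_of_not_integrable hbq hr h1 h3 t) (h.ge_of_barrier h2 h0 h1.ge t)

end Generic

/-! ### The numerator and its pauses at the maximal Casimir value -/

section Maximal

lemma numer_nonneg (hF : IsQuasinorm F) (hE : P.casimir = P.casimirMax F) (ξ : ℝ) :
    0 ≤ numer F P ξ := by
  rw [numer_eq, hE]
  linarith [level_le_casimirMax hF P ξ]

lemma numer_eq_zero_iff_level (hE : P.casimir = P.casimirMax F) {ξ : ℝ} :
    numer F P ξ = 0 ↔ level F P ξ = P.casimirMax F := by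
  rw [numer_eq, hE]
  constructor <;> intro h <;> linarith

lemma numer_eq_zero_of_between (hF : IsQuasinorm F) (hP : P.φ₄ ^ 2 + P.φ₅ ^ 2 ≠ 0)
    (hE : P.casimir = P.casimirMax F) {α β ξ : ℝ} (hα : numer F P α = 0) (hβ : numer F P β = 0)
    (hαβ : β < α + Real.pi) (hξ : ξ ∈ Icc α β) : numer F P ξ = 0 := by
  rw [numer_eq_zero_iff_level hE] at *
  exact level_eq_casimirMax_of_between hF hP hα hβ hαβ hξ

lemma numer_add_pi_ne_zero (hF : IsQuasinorm F) (hP : P.φ₄ ^ 2 + P.φ₅ ^ 2 ≠ 0)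
    (hE : P.casimir = P.casimirMax F) {α : ℝ} (hα : numer F P α = 0) :
    numer F P (α + Real.pi) ≠ 0 := by
  rw [Ne, numer_eq_zero_iff_level hE]
  rw [numer_eq_zero_iff_level hE] at hα
  linarith [level_add_pi_neg_of_max hF hP hα, casimirMax_pos hF hP]

lemma speed_of_init {θ₀ : ℝ} (hinit : bdry F θ₀ = (P.φ₁, P.φ₂)) :
    speed F P θ₀ = |P.φ₃| / rad F θ₀ ^ 2 := by
  rw [speed, numer_of_init hinit, Real.sqrt_sq_eq_abs]

/-- The three claims are reduced to scalar solutions: a pause can occur only at a zero of the speed,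
and one pause already produces a second angle by freezing it, with the same germ at time 0 and hence
the same initial data. -/
lemma nonUniqueWithPauses_of (hF : IsQuasinorm F) (hP : P.φ₄ ^ 2 + P.φ₅ ^ 2 ≠ 0)
    (hE : P.casimir = P.casimirMax F) {θ₀ : ℝ} (hinit : bdry F θ₀ = (P.φ₁, P.φ₂)) {S : Set ℝ}
    (hS : S.Nonempty)
    (hconst : ∀ θ, IsSol (speed F P) θ → θ 0 = θ₀ → ∀ t, speed F P (θ t) = 0 → θ t ∈ S)
    (hpause : ∀ c ∈ S, ∀ ℓ : ℝ, 0 < ℓ → ∃ g θ, IsNormalExtremal F P g θ ∧ θ 0 = θ₀ ∧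
      ∃ a, IsMaximalPause θ c a (a + ℓ)) : NonUniqueWithPauses F P θ₀ S := by
  refine ⟨?_, ?_, hpause⟩
  · obtain ⟨c, hc⟩ := hS
    obtain ⟨g, θ, h, h0, a, ha⟩ := hpause c hc 1 one_pos
    obtain ⟨u, hu⟩ := (isNormalExtremal_iff hF).1 h
    obtain ⟨θ', h1, h2, h3⟩ := (hu.isSol hF).exists_ne_of_pause (continuous_speed hF P)
      (by linarith) ha
    have h4 : θ' 0 = θ 0 := h3.self_of_nhds
    obtain ⟨g', h'⟩ := exists_isNormalExtremal_of_isSol hF hP hE h1 (by rw [h4, h0, hinit])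
      (by rw [h3.deriv_eq, (hu.hasDerivAt_angle 0).deriv, hu.hZ_zero, h4])
    exact ⟨g, g', θ, θ', h, h', h0, h4.trans h0, h2.symm⟩
  · intro g θ h h0 a b c hab hc
    obtain ⟨u, hu⟩ := (isNormalExtremal_iff hF).1 h
    have ha := left_mem_Icc.2 hab.le
    refine ⟨?_, hu.pauseFormulas hF hP hab hc⟩
    rw [← hc a ha]
    refine hconst θ (hu.isSol hF) h0 a (speed_eq_zero ?_)
    rw [numer_eq, hu.level_eq_of_hZ_eq_zero hF (hu.hZ_eq_zero_of_const hF hab hc ha)]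
    ring

lemma exists_pause_of_ne (hF : IsQuasinorm F) (hP : P.φ₄ ^ 2 + P.φ₅ ^ 2 ≠ 0)
    (hE : P.casimir = P.casimirMax F) {θ₀ c ℓ : ℝ} (hinit : bdry F θ₀ = (P.φ₁, P.φ₂))
    (hφ : P.φ₃ ≠ 0) (hℓ : 0 ≤ ℓ)
    (h : ∃ θ, IsSol (speed F P) θ ∧ θ 0 = θ₀ ∧ deriv θ 0 = speed F P θ₀ ∧
      ∃ p, ∀ t, θ t = c ↔ t ∈ Icc p (p + ℓ)) :
    ∃ g θ, IsNormalExtremal F P g θ ∧ θ 0 = θ₀ ∧ ∃ a, IsMaximalPause θ c a (a + ℓ) := by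
  obtain ⟨θ, h1, h2, h3, p, hp⟩ := h
  rw [speed_of_init hinit] at h3
  -- The scalar solution starts with positive velocity. For φ₃ < 0 it is run backwards in time, and
  -- the pause is reflected accordingly.
  rcases hφ.lt_or_gt with h4 | h4
  · obtain ⟨g, hg⟩ := exists_isNormalExtremal_of_isSol hF hP hE h1.comp_neg (by simp [h2, hinit])
      (by rw [deriv_comp_neg, neg_zero, h2, h3, abs_of_neg h4]; ring)
    refine ⟨g, _, hg, by simp [h2], -p - ℓ, isMaximalPause_of_iff (by linarith) fun t => ?_⟩
    rw [hp, mem_Icc, mem_Icc]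
    constructor <;> rintro ⟨h5, h6⟩ <;> constructor <;> linarith
  · obtain ⟨g, hg⟩ := exists_isNormalExtremal_of_isSol hF hP hE h1 (by rw [h2, hinit])
      (by rw [h3, h2, abs_of_pos h4])
    exact ⟨g, θ, hg, h2, p, isMaximalPause_of_iff (by linarith) hp⟩

lemma IsSol.exists_isNormalExtremal_of_eq_zero (hF : IsQuasinorm F) (hP : P.φ₄ ^ 2 + P.φ₅ ^ 2 ≠ 0)
    (hE : P.casimir = P.casimirMax F) {θ₀ : ℝ} (hinit : bdry F θ₀ = (P.φ₁, P.φ₂))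
    (hφ : P.φ₃ = 0) {θ : ℝ → ℝ} (h : IsSol (speed F P) θ) (h0 : θ 0 = θ₀) :
    ∃ g, IsNormalExtremal F P g θ := by
  refine exists_isNormalExtremal_of_isSol hF hP hE h (by rw [h0, hinit]) ?_
  rw [hφ, zero_div, ← abs_eq_zero, h.abs_deriv, h0, speed_of_init hinit, hφ, abs_zero, zero_div]

lemma exists_pause_of_eq_zero (hF : IsQuasinorm F) (hP : P.φ₄ ^ 2 + P.φ₅ ^ 2 ≠ 0)
    (hE : P.casimir = P.casimirMax F) {θ₀ c ℓ : ℝ} (hinit : bdry F θ₀ = (P.φ₁, P.φ₂))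
    (hφ : P.φ₃ = 0) (hℓ : 0 ≤ ℓ)
    (h : ∃ θ, IsSol (speed F P) θ ∧ θ 0 = θ₀ ∧ ∃ p, ∀ t, θ t = c ↔ t ∈ Icc p (p + ℓ)) :
    ∃ g θ, IsNormalExtremal F P g θ ∧ θ 0 = θ₀ ∧ ∃ a, IsMaximalPause θ c a (a + ℓ) := by
  obtain ⟨θ, h1, h2, p, hp⟩ := h
  obtain ⟨g, hg⟩ := h1.exists_isNormalExtremal_of_eq_zero hF hP hE hinit hφ h2
  exact ⟨g, θ, hg, h2, p, isMaximalPause_of_iff (by linarith) hp⟩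

end Maximal

end

section

variable {F : ℝ × ℝ → ℝ} {P : InitialData}

/-! ### Extremals with `𝓔 = 𝓔₀` and a moving start -/

lemma exists_itinerary_of_ne (hF : IsQuasinorm F) (hP : P.φ₄ ^ 2 + P.φ₅ ^ 2 ≠ 0)
    (hE : P.casimir = P.casimirMax F) {θ₀ a : ℝ} (hinit : bdry F θ₀ = (P.φ₁, P.φ₂))
    (hφ : P.φ₃ ≠ 0) (ha : speed F P a = 0) (hpos : ∀ ξ ∈ Ioo a (a + 2 * Real.pi), 0 < speed F P ξ)
    (h₀ : θ₀ ∈ Ioo a (a + 2 * Real.pi))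
    (hi : IntervalIntegrable (fun ξ => 1 / speed F P ξ) volume a (a + 2 * Real.pi)) {p ℓ : ℤ → ℝ}
    (hp : ∀ n, |p (n + 1) - p n| = 2 * Real.pi) (hℓ : ∀ n, 0 ≤ ℓ n)
    (hup : 0 < P.φ₃ → p (-1) = a ∧ p 0 = a + 2 * Real.pi)
    (hdown : P.φ₃ < 0 → p (-1) = a + 2 * Real.pi ∧ p 0 = a) :
    ∃ g θ α β, IsNormalExtremal F P g θ ∧ θ 0 = θ₀ ∧ FollowsItinerary θ p ℓ α β ∧
      (0 : ℝ) ∈ Ioo (α 0) (β 0) := by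
  have hs := speed_of_init hinit
  have hp0 : ∃ k : ℤ, p 0 = a + 2 * Real.pi * k := by
    rcases hφ.lt_or_gt with h | h
    · exact ⟨0, by simp [(hdown h).2]⟩
    · exact ⟨1, by simp [(hup h).2]⟩
  obtain ⟨A, D, hA, hAD, key⟩ := exists_isSol_itinerary (continuous_speed hF P) ha
    (speed_add_int_mul_two_pi F P) hpos h₀ hi hp hp0 hℓ
  rcases hφ.lt_or_gt with h | h
  · obtain ⟨θ, α, β, h1, h2, h3, h4, -, h5⟩ := key (-(A + D))
    obtain ⟨h6, h7⟩ := h5 rfl (hdown h).1 (hdown h).2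
    obtain ⟨g, hg⟩ := exists_isNormalExtremal_of_isSol hF hP hE h1 (by rw [h6, hinit])
      (by rw [h7, h6, hs, abs_of_neg h]; ring)
    exact ⟨g, θ, α, β, hg, h6, h2, by rw [h3]; linarith, by rw [h4]; linarith⟩
  · obtain ⟨θ, α, β, h1, h2, h3, h4, h5, -⟩ := key A
    obtain ⟨h6, h7⟩ := h5 rfl (hup h).1 (hup h).2
    obtain ⟨g, hg⟩ := exists_isNormalExtremal_of_isSol hF hP hE h1 (by rw [h6, hinit])
      (by rw [h7, h6, hs, abs_of_pos h])
    exact ⟨g, θ, α, β, hg, h6, h2, by rw [h3]; linarith, by rw [h4]; linarith⟩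

lemma nonUniqueWithPauses_period_of_ne (hF : IsQuasinorm F) (hP : P.φ₄ ^ 2 + P.φ₅ ^ 2 ≠ 0)
    (hE : P.casimir = P.casimirMax F) {θ₀ a : ℝ} (hinit : bdry F θ₀ = (P.φ₁, P.φ₂))
    (hφ : P.φ₃ ≠ 0) (ha : speed F P a = 0) (hpos : ∀ ξ ∈ Ioo a (a + 2 * Real.pi), 0 < speed F P ξ)
    (h₀ : θ₀ ∈ Ioo a (a + 2 * Real.pi))
    (hi : IntervalIntegrable (fun ξ => 1 / speed F P ξ) volume a (a + 2 * Real.pi)) :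
    NonUniqueWithPauses F P θ₀ {c | ∃ k : ℤ, c = a + 2 * Real.pi * k} := by
  refine nonUniqueWithPauses_of hF hP hE hinit ⟨_, 0, rfl⟩ (fun θ _ _ t ht =>
    exists_eq_add_int_mul_of_zero (speed_add_int_mul_two_pi F P) hpos ht) ?_
  rintro c ⟨k, rfl⟩ l hl
  have h2π := Real.two_pi_pos
  rcases hφ.lt_or_gt with h | h
  -- A monotone itinerary with equal pauses visits all translates of `a`, so one extremal serves
  -- every prescribed value.
  · obtain ⟨g, θ, α, β, hg, h0, hθ, -⟩ := exists_itinerary_of_ne hF hP hE hinit hφ ha hpos h₀ hi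
      (p := fun n => a - 2 * Real.pi * n) (ℓ := fun _ => l) (fun n => by
        push_cast; rw [show a - 2 * Real.pi * (n + 1) - (a - 2 * Real.pi * n) = -(2 * Real.pi) by
          ring, abs_neg, abs_of_pos h2π]) (fun _ => hl.le) (fun h' => absurd h h'.not_gt)
      fun _ => ⟨by push_cast; ring, by simp⟩
    refine ⟨g, θ, hg, h0, β (-k), ?_⟩
    have := hθ.isMaximalPause (fun _ => hl.le) (-k)
    rw [hθ.next] at this
    simpa using this
  · obtain ⟨g, θ, α, β, hg, h0, hθ, -⟩ := exists_itinerary_of_ne hF hP hE hinit hφ ha hpos h₀ hi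
      (p := fun n => a + 2 * Real.pi * (n + 1)) (ℓ := fun _ => l) (fun n => by
        push_cast; rw [show a + 2 * Real.pi * (n + 1 + 1) - (a + 2 * Real.pi * (n + 1))
          = 2 * Real.pi by ring, abs_of_pos h2π]) (fun _ => hl.le)
      (fun _ => ⟨by push_cast; ring, by simp⟩) fun h' => absurd h h'.not_gt
    refine ⟨g, θ, hg, h0, β (k - 1), ?_⟩
    have := hθ.isMaximalPause (fun _ => hl.le) (k - 1)
    rw [hθ.next] at this
    simpa using this

lemma casimirMax_of_ne (hF : IsQuasinorm F) (hP : P.φ₄ ^ 2 + P.φ₅ ^ 2 ≠ 0) (hφ : P.φ₃ ≠ 0)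
    (hE : P.casimir = P.casimirMax F) {θ₀ : ℝ} (hinit : bdry F θ₀ = (P.φ₁, P.φ₂)) :
    ∃ θ₁ θ₂ : ℝ, θ₁ < θ₀ ∧ θ₀ < θ₂ ∧ rhs F P θ₁ = 0 ∧ rhs F P θ₂ = 0 ∧
      (∀ ξ ∈ Ioo θ₁ θ₂, rhs F P ξ ≠ 0) ∧
      (¬ FiniteIntegral (integrand F P) θ₀ θ₁ → ¬ FiniteIntegral (integrand F P) θ₀ θ₂ →
        ∀ g θ, IsNormalExtremal F P g θ → θ 0 = θ₀ →
          (∀ t, θ t ∈ Ioo θ₁ θ₂ ∧ timeFn F P θ₀ (θ t) = t) ∧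
          ∀ ξ ∈ Ioo θ₁ θ₂, θ (timeFn F P θ₀ ξ) = ξ) ∧
      (FiniteIntegral (integrand F P) θ₀ θ₁ → FiniteIntegral (integrand F P) θ₀ θ₂ →
        θ₂ = θ₁ + 2 * Real.pi →
        NonUniqueWithPauses F P θ₀ {c | ∃ k : ℤ, c = θ₁ + 2 * Real.pi * k} ∧
        ∀ p ℓ : ℤ → ℝ, (∀ n, |p (n + 1) - p n| = 2 * Real.pi) → (∀ n, 0 ≤ ℓ n) →
          (0 < P.φ₃ → p (-1) = θ₁ ∧ p 0 = θ₂) → (P.φ₃ < 0 → p (-1) = θ₂ ∧ p 0 = θ₁) →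
          ∃ g θ a b, IsNormalExtremal F P g θ ∧ θ 0 = θ₀ ∧ FollowsItinerary θ p ℓ a b ∧
            (0 : ℝ) ∈ Ioo (a 0) (b 0)) ∧
      (FiniteIntegral (integrand F P) θ₀ θ₁ ∨ FiniteIntegral (integrand F P) θ₀ θ₂ →
        ¬ (FiniteIntegral (integrand F P) θ₀ θ₁ ∧ FiniteIntegral (integrand F P) θ₀ θ₂ ∧
          θ₂ = θ₁ + 2 * Real.pi) →
        NonUniqueWithPauses F P θ₀
          {c | (FiniteIntegral (integrand F P) θ₀ θ₁ ∧ c = θ₁) ∨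
            (FiniteIntegral (integrand F P) θ₀ θ₂ ∧ c = θ₂)}) := by
  obtain ⟨a, b, ha, hb, hna, hnb, hnpos⟩ := exists_zeros_of_ne hF hP hφ hE.le hinit
  have hfa := speed_eq_zero hna
  have hfb := speed_eq_zero hnb
  have hpos : ∀ ξ ∈ Ioo a b, 0 < speed F P ξ := fun ξ hξ => (speed_pos_iff hF).2 (hnpos ξ hξ)
  have hper := speed_add_int_mul_two_pi F P
  have hcont := continuous_speed hF P
  simp only [finiteIntegral_integrand_iff hφ]
  refine ⟨a, b, ha, hb, (rhs_eq_zero_iff hF).2 hna, (rhs_eq_zero_iff hF).2 hnb,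
    fun ξ hξ h => (hnpos ξ hξ).ne' ((rhs_eq_zero_iff hF).1 h), ?_, ?_, ?_⟩
  · intro hl hr g θ h h0
    obtain ⟨u, hu⟩ := (isNormalExtremal_iff hF).1 h
    subst h0
    have hmem := (hu.isSol hF).mem_Ioo_of_not_integrable hpos ⟨ha, hb⟩ hl hr
    have h1 := hu.timeFn_inverse hF hφ isOpen_Ioo (convex_Ioo a b) hnpos hmem
    exact ⟨fun t => ⟨hmem t, h1.1 t⟩, h1.2⟩
  · rintro hl hr rfl
    have hi := hl.symm.trans hr
    exact ⟨nonUniqueWithPauses_period_of_ne hF hP hE hinit hφ hfa hpos ⟨ha, hb⟩ hi,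
      fun p ℓ hp hℓ hup hdown =>
        exists_itinerary_of_ne hF hP hE hinit hφ hfa hpos ⟨ha, hb⟩ hi hp hℓ hup hdown⟩
  · intro hor hnot
    refine nonUniqueWithPauses_of hF hP hE hinit ?_ ?_ ?_
    · rcases hor with h | h
      · exact ⟨a, Or.inl ⟨h, rfl⟩⟩
      · exact ⟨b, Or.inr ⟨h, rfl⟩⟩
    · rintro θ hθ rfl t ht
      have hna' : numer F P (a + 2 * Real.pi) = 0 := by
        have := numer_add_int_mul_two_pi F P a 1
        rw [Int.cast_one, mul_one] at this
        rw [this, hna]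
      have hle : b ≤ a + 2 * Real.pi := by
        by_contra! h
        exact (hnpos _ ⟨by linarith [Real.pi_pos], h⟩).ne' hna'
      -- By convexity, two zeros less than π apart would enclose only zeros, and zeros exactly π
      -- apart do not exist. Hence the remaining arc from `b` to `a + 2π` is shorter than π and
      -- consists of zeros.
      have hgt : a + Real.pi < b := by
        by_contra! h
        rcases h.lt_or_eq with h | h
        · exact (hnpos _ ⟨ha, hb⟩).ne'
            (numer_eq_zero_of_between hF hP hE hna hnb h ⟨ha.le, hb.le⟩)
        · exact numer_add_pi_ne_zero hF hP hE hna (h ▸ hnb)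
      exact hθ.zero_reached hper hpos ⟨ha, hb⟩ hle (fun _ ξ hξ => speed_eq_zero
        (numer_eq_zero_of_between hF hP hE hnb hna' (by linarith) hξ)) hnot ht
    · rintro c (⟨h, rfl⟩ | ⟨h, rfl⟩) l hl
      · obtain ⟨θ, h1, h2, h3, h4, -⟩ :=
          exists_isSol_pause_left hcont hfa hfb hpos ⟨ha, hb⟩ h hl.le
        exact exists_pause_of_ne hF hP hE hinit hφ hl.le ⟨θ, h1, h2, h3, h4⟩
      · obtain ⟨θ, h1, h2, h3, h4, -⟩ :=
          exists_isSol_pause_right hcont hfa hfb hpos ⟨ha, hb⟩ h hl.le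
        exact exists_pause_of_ne hF hP hE hinit hφ hl.le ⟨θ, h1, h2, h3, h4⟩

/-- The largest segment around a zero of `numer` on which `numer` vanishes. -/
lemma exists_zero_segment (hF : IsQuasinorm F) (hP : P.φ₄ ^ 2 + P.φ₅ ^ 2 ≠ 0)
    (hE : P.casimir = P.casimirMax F) {θ₀ : ℝ} (h₀ : numer F P θ₀ = 0) :
    ∃ a b, a ≤ θ₀ ∧ θ₀ ≤ b ∧ b < a + 2 * Real.pi ∧ (∀ ξ ∈ Icc a b, numer F P ξ = 0) ∧
      ∀ ξ ∈ Ioo b (a + 2 * Real.pi), 0 < numer F P ξ := by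
  have hπ := Real.pi_pos
  have hc : IsClosed {ξ | numer F P ξ = 0} := isClosed_eq (continuous_numer hF P) continuous_const
  -- The ends are the extreme zeros in the two windows of length π around `θ₀`. The far ends of the
  -- windows are not reached, since no two zeros are π apart, and convexity fills the gaps.
  obtain ⟨b, ⟨hb, hnb⟩, hbmax⟩ := (isCompact_Icc.inter_right hc :
    IsCompact (Icc θ₀ (θ₀ + Real.pi) ∩ _)).exists_isGreatest ⟨θ₀, ⟨le_rfl, by linarith⟩, h₀⟩
  obtain ⟨a, ⟨ha, hna⟩, hamin⟩ := (isCompact_Icc.inter_right hc :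
    IsCompact (Icc (θ₀ - Real.pi) θ₀ ∩ _)).exists_isLeast ⟨θ₀, ⟨by linarith, le_rfl⟩, h₀⟩
  have hb' : b < θ₀ + Real.pi := lt_of_le_of_ne hb.2 fun h =>
    numer_add_pi_ne_zero hF hP hE h₀ (h ▸ hnb)
  have ha' : θ₀ - Real.pi < a := lt_of_le_of_ne ha.1 fun h =>
    numer_add_pi_ne_zero hF hP hE hna (by rw [← h, sub_add_cancel, h₀])
  refine ⟨a, b, ha.2, hb.1, by linarith, fun ξ hξ => ?_, fun ξ hξ => ?_⟩
  · rcases le_total ξ θ₀ with h | h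
    · exact numer_eq_zero_of_between hF hP hE hna h₀ (by linarith) ⟨hξ.1, h⟩
    · exact numer_eq_zero_of_between hF hP hE h₀ hnb hb' ⟨h, hξ.2⟩
  · refine (numer_nonneg hF hE ξ).lt_of_ne' fun h => ?_
    rcases le_or_gt ξ (θ₀ + Real.pi) with h1 | h1
    · exact absurd (hbmax ⟨⟨hb.1.trans hξ.1.le, h1⟩, h⟩) hξ.1.not_ge
    -- A zero beyond the right window is moved back by 2π into the left one, where it would lie
    -- below the least zero `a`.
    · have h2 := numer_add_int_mul_two_pi F P (ξ - 2 * Real.pi) 1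
      rw [Int.cast_one, mul_one, sub_add_cancel, h] at h2
      have h3 := hamin ⟨⟨by linarith, by linarith [hξ.2, ha.2]⟩, h2.symm⟩
      linarith [hξ.2]

end

section

variable {F : ℝ × ℝ → ℝ} {P : InitialData}

/-! ### Extremals with `𝓔 = 𝓔₀` and a start at rest -/

section Generic

variable {f θ : ℝ → ℝ} {a b : ℝ}

lemma intervalIntegrable_one_div_of_single_zero
    (hper : ∀ (ξ : ℝ) (k : ℤ), f (ξ + 2 * Real.pi * k) = f ξ) (hf : Continuous f)
    (hpos : ∀ ξ ∈ Ioo a (a + 2 * Real.pi), 0 < f ξ)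
    (hl : ∃ η < a, IntervalIntegrable (fun ξ => 1 / f ξ) volume η a)
    (hr : ∃ η > a, IntervalIntegrable (fun ξ => 1 / f ξ) volume a η) :
    IntervalIntegrable (fun ξ => 1 / f ξ) volume a (a + 2 * Real.pi) := by
  refine intervalIntegrable_one_div_of_ends hf hpos (by linarith [Real.two_pi_pos]) hr ?_
  obtain ⟨η, hη, hi⟩ := hl
  refine ⟨η + 2 * Real.pi, by linarith, ?_⟩
  have h := hi.comp_sub_right (2 * Real.pi)
  refine h.congr fun ξ _ => ?_
  have := hper (ξ - 2 * Real.pi) 1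
  rw [Int.cast_one, mul_one, sub_add_cancel] at this
  simp only [this]

/-- A solution that leaves an isolated zero and arrives at another one. -/
lemma IsSol.integrable_of_single_zero (h : IsSol f θ)
    (hper : ∀ (ξ : ℝ) (k : ℤ), f (ξ + 2 * Real.pi * k) = f ξ)
    (hpos : ∀ ξ ∈ Ioo a (a + 2 * Real.pi), 0 < f ξ) (h₀ : θ 0 = a) {t : ℝ} (ht : f (θ t) = 0)
    (hne : θ t ≠ a) (x y : ℝ) : IntervalIntegrable (fun ξ => 1 / f ξ) volume x y := by
  have hπ := Real.two_pi_pos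
  have hpos' : ∀ ξ ∈ Ioo (a - 2 * Real.pi) a, 0 < f ξ := fun ξ hξ =>
    pos_sub_two_pi hper hpos ⟨hξ.1, by linarith [hξ.2]⟩
  rcases hne.lt_or_gt with h1 | h1
  · have h2 : θ t ≤ a - 2 * Real.pi := by
      by_contra! h2
      exact (hpos' _ ⟨h2, h1⟩).ne' ht
    refine intervalIntegrable_one_div_of_period (a := a - 2 * Real.pi) hper ?_ x y
    rw [sub_add_cancel]
    exact h.integrable_of_ge h₀.ge h2 (by linarith) hpos'
  · have h2 : a + 2 * Real.pi ≤ θ t := by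
      by_contra! h2
      exact (hpos _ ⟨h1, h2⟩).ne' ht
    exact intervalIntegrable_one_div_of_period hper
      (h.integrable_of_le h₀.le h2 (by linarith) hpos) x y

end Generic

/-- A largest segment of zeros of `numer`, followed by an interval where it is positive. -/
structure ZeroSegment (F : ℝ × ℝ → ℝ) (P : InitialData) (a b : ℝ) : Prop where
  le : a ≤ b
  lt : b < a + 2 * Real.pi
  zero : ∀ ξ ∈ Icc a b, speed F P ξ = 0
  pos : ∀ ξ ∈ Ioo b (a + 2 * Real.pi), 0 < speed F P ξ

namespace ZeroSegment

variable {a b θ₀ : ℝ} {θ : ℝ → ℝ}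

lemma pos_left (h : ZeroSegment F P a b) {ξ : ℝ} (hξ : ξ ∈ Ioo (b - 2 * Real.pi) a) :
    0 < speed F P ξ :=
  pos_sub_two_pi (speed_add_int_mul_two_pi F P) h.pos ⟨hξ.1, by linarith [hξ.2]⟩

lemma zero_right (h : ZeroSegment F P a b) {ξ : ℝ}
    (hξ : ξ ∈ Icc (a + 2 * Real.pi) (b + 2 * Real.pi)) : speed F P ξ = 0 :=
  zero_add_two_pi (speed_add_int_mul_two_pi F P) h.zero hξ

lemma zero_left (h : ZeroSegment F P a b) {ξ : ℝ}
    (hξ : ξ ∈ Icc (a - 2 * Real.pi) (b - 2 * Real.pi)) : speed F P ξ = 0 :=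
  zero_sub_two_pi (speed_add_int_mul_two_pi F P) h.zero hξ

lemma speed_left_eq_zero (h : ZeroSegment F P a b) : speed F P a = 0 :=
  h.zero a (left_mem_Icc.2 h.le)

lemma speed_right_eq_zero (h : ZeroSegment F P a b) : speed F P b = 0 :=
  h.zero b (right_mem_Icc.2 h.le)

lemma speed_next_eq_zero (h : ZeroSegment F P a b) : speed F P (a + 2 * Real.pi) = 0 :=
  h.zero_right (left_mem_Icc.2 (by linarith [h.le]))

lemma speed_prev_eq_zero (h : ZeroSegment F P a b) : speed F P (b - 2 * Real.pi) = 0 :=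
  h.zero_left (right_mem_Icc.2 (by linarith [h.le]))

lemma maximal (h : ZeroSegment F P a b) (h₀ : θ₀ ∈ Icc a b) {α β : ℝ} (hα : α ≤ θ₀) (hβ : θ₀ ≤ β)
    (hz : ∀ ξ ∈ Icc α β, speed F P ξ = 0) : a ≤ α ∧ β ≤ b := by
  have := h.lt
  constructor
  · by_contra! hc
    obtain ⟨x, h1, h2⟩ := exists_between (max_lt hc (by linarith : b - 2 * Real.pi < a))
    rw [max_lt_iff] at h1
    exact (h.pos_left ⟨h1.2, h2⟩).ne' (hz x ⟨h1.1.le, by linarith [h₀.1]⟩)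
  · by_contra! hc
    obtain ⟨x, h1, h2⟩ := exists_between (lt_min hc h.lt)
    rw [lt_min_iff] at h2
    exact (h.pos x ⟨h1, h2.2⟩).ne' (hz x ⟨by linarith [h₀.2], h2.1.le⟩)

lemma finiteRight_iff (hφ : P.φ₃ = 0) : FiniteRight F P θ₀ ↔
    ∃ η > θ₀, IntervalIntegrable (fun ξ => 1 / speed F P ξ) volume θ₀ η := by
  simp only [FiniteRight, finiteIntegral_integrand₀_iff hφ]

lemma finiteLeft_iff (hφ : P.φ₃ = 0) : FiniteLeft F P θ₀ ↔
    ∃ η < θ₀, IntervalIntegrable (fun ξ => 1 / speed F P ξ) volume η θ₀ := by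
  simp only [FiniteLeft, finiteIntegral_integrand₀_iff hφ]

lemma const_of_rigid (h : ZeroSegment F P a b) (hφ : P.φ₃ = 0) (hr : Rigid F P (θ 0) a b)
    (hθ : IsSol (speed F P) θ) (t : ℝ) : θ t = θ 0 := by
  rw [Rigid, finiteRight_iff hφ, finiteLeft_iff hφ] at hr
  refine hθ.const_of_rigid h.zero (by linarith [h.lt] : b - 2 * Real.pi < a) h.lt
    (fun ξ => h.pos_left) h.pos ?_ t
  rcases hr with h1 | h1 | ⟨h1, h2, h3⟩ | h1
  exacts [Or.inl h1, Or.inr (Or.inl h1), Or.inr (Or.inr (Or.inl ⟨h1, h2, h3⟩)),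
    Or.inr (Or.inr (Or.inr h1))]

lemma exists_pause_start_right (hF : IsQuasinorm F) (h : ZeroSegment F P a b) (hφ : P.φ₃ = 0) (hr : FiniteRight F P b)
    {l : ℝ} (hl : 0 ≤ l) :
    ∃ θ, IsSol (speed F P) θ ∧ θ 0 = b ∧ ∃ p, ∀ t, θ t = b ↔ t ∈ Icc p (p + l) :=
  exists_isSol_pause_start_left (continuous_speed hF P) h.speed_right_eq_zero h.speed_next_eq_zero
    h.pos h.lt ((finiteRight_iff hφ).1 hr) hl

lemma exists_pause_start_left (hF : IsQuasinorm F) (h : ZeroSegment F P a b) (hφ : P.φ₃ = 0) (hr : FiniteLeft F P a)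
    {l : ℝ} (hl : 0 ≤ l) :
    ∃ θ, IsSol (speed F P) θ ∧ θ 0 = a ∧ ∃ p, ∀ t, θ t = a ↔ t ∈ Icc p (p + l) :=
  exists_isSol_pause_start_right (continuous_speed hF P) h.speed_prev_eq_zero h.speed_left_eq_zero
    (fun _ => h.pos_left) (by linarith [h.lt]) ((finiteLeft_iff hφ).1 hr) hl

/-- The segment at the start blocks the motion below, and its translate by 2π blocks it above.
Between them only the two facing ends are zeros. -/
lemma nonUnique_right (hF : IsQuasinorm F) (hP : P.φ₄ ^ 2 + P.φ₅ ^ 2 ≠ 0)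
    (hE : P.casimir = P.casimirMax F) (hinit : bdry F b = (P.φ₁, P.φ₂)) (hφ : P.φ₃ = 0)
    (h : ZeroSegment F P a b) (hab : a < b) (hr : FiniteRight F P b)
    (hi : FiniteIntegral (integrand₀ F P) b (a + 2 * Real.pi)) :
    NonUniqueWithPauses F P b {b, a + 2 * Real.pi} := by
  refine nonUniqueWithPauses_of hF hP hE hinit (insert_nonempty _ _) (fun θ hθ h0 t ht => ?_) ?_
  · have h1 := hθ.ge_of_barrier hab h.zero h0.ge t
    have h2 := hθ.le_of_barrier (by linarith : a + 2 * Real.pi < b + 2 * Real.pi)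
      (fun ξ => h.zero_right) (h0.le.trans h.lt.le) t
    rcases h1.eq_or_lt with h3 | h3
    · exact Or.inl h3.symm
    rcases h2.eq_or_lt with h4 | h4
    · exact Or.inr h4
    · exact absurd ht (h.pos _ ⟨h3, h4⟩).ne'
  · rintro c (rfl | rfl) l hl
    · exact exists_pause_of_eq_zero hF hP hE hinit hφ hl.le
        (exists_pause_start_right hF h hφ hr hl.le)
    · exact exists_pause_of_eq_zero hF hP hE hinit hφ hl.le
        (exists_isSol_left_pause_right (continuous_speed hF P) h.speed_right_eq_zero
          h.speed_next_eq_zero h.pos h.lt ((finiteIntegral_integrand₀_iff hφ).1 hi) hl.le)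

lemma nonUnique_left (hF : IsQuasinorm F) (hP : P.φ₄ ^ 2 + P.φ₅ ^ 2 ≠ 0)
    (hE : P.casimir = P.casimirMax F) (hinit : bdry F a = (P.φ₁, P.φ₂)) (hφ : P.φ₃ = 0)
    (h : ZeroSegment F P a b) (hab : a < b) (hl : FiniteLeft F P a)
    (hi : FiniteIntegral (integrand₀ F P) (b - 2 * Real.pi) a) :
    NonUniqueWithPauses F P a {a, b - 2 * Real.pi} := by
  have hlt : b - 2 * Real.pi < a := by linarith [h.lt]
  refine nonUniqueWithPauses_of hF hP hE hinit (insert_nonempty _ _) (fun θ hθ h0 t ht => ?_) ?_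
  · have h1 := hθ.le_of_barrier hab h.zero h0.le t
    have h2 := hθ.ge_of_barrier (by linarith : a - 2 * Real.pi < b - 2 * Real.pi)
      (fun ξ => h.zero_left) (hlt.le.trans h0.ge) t
    rcases h1.eq_or_lt with h3 | h3
    · exact Or.inl h3
    rcases h2.eq_or_lt with h4 | h4
    · exact Or.inr h4.symm
    · exact absurd ht (h.pos_left ⟨h4, h3⟩).ne'
  · rintro c (rfl | rfl) l hl'
    · exact exists_pause_of_eq_zero hF hP hE hinit hφ hl'.le
        (exists_pause_start_left hF h hφ hl hl'.le)
    · exact exists_pause_of_eq_zero hF hP hE hinit hφ hl'.le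
        (exists_isSol_right_pause_left (continuous_speed hF P) h.speed_prev_eq_zero
          h.speed_left_eq_zero (fun _ => h.pos_left) hlt ((finiteIntegral_integrand₀_iff hφ).1 hi)
          hl'.le)

lemma exists_itinerary (hF : IsQuasinorm F) (hP : P.φ₄ ^ 2 + P.φ₅ ^ 2 ≠ 0)
    (hE : P.casimir = P.casimirMax F) (hinit : bdry F a = (P.φ₁, P.φ₂)) (hφ : P.φ₃ = 0)
    (h : ZeroSegment F P a a) (hl : FiniteLeft F P a) (hr : FiniteRight F P a) {p ℓ : ℤ → ℝ}
    (hp : ∀ n, |p (n + 1) - p n| = 2 * Real.pi) (hℓ : ∀ n, 0 ≤ ℓ n) (hp0 : p 0 = a) :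
    ∃ g θ α β, IsNormalExtremal F P g θ ∧ θ 0 = a ∧ FollowsItinerary θ p ℓ α β ∧
      (0 : ℝ) ∈ Icc (β 0) (α 1) := by
  have hi := intervalIntegrable_one_div_of_single_zero (speed_add_int_mul_two_pi F P)
    (continuous_speed hF P) h.pos ((finiteLeft_iff hφ).1 hl) ((finiteRight_iff hφ).1 hr)
  have hm : a + Real.pi ∈ Ioo a (a + 2 * Real.pi) := by
    constructor <;> linarith [Real.pi_pos]
  obtain ⟨A, D, -, -, key⟩ := exists_isSol_itinerary (continuous_speed hF P) h.speed_left_eq_zero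
    (speed_add_int_mul_two_pi F P) h.pos hm hi hp ⟨0, by simp [hp0]⟩ hℓ
  -- The move with index 0 ends exactly at time 0, where the pause at `p 0` begins. The point `a +
  -- π` is only an auxiliary interior point for the profile.
  obtain ⟨θ, α, β, h1, h2, -, h4, -⟩ := key (-D)
  have hβ : β 0 = 0 := by rw [h4]; ring
  have h0 : (0 : ℝ) ∈ Icc (β 0) (α (0 + 1)) := by
    rw [h2.next, hβ, zero_add]
    exact ⟨le_rfl, hℓ 0⟩
  have hθ : θ 0 = a := by rw [h2.pause 0 0 h0, hp0]
  obtain ⟨g, hg⟩ := h1.exists_isNormalExtremal_of_eq_zero hF hP hE hinit hφ hθ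
  exact ⟨g, θ, α, β, hg, hθ, h2, by simpa using h0⟩

lemma nonUnique_both (hF : IsQuasinorm F) (hP : P.φ₄ ^ 2 + P.φ₅ ^ 2 ≠ 0)
    (hE : P.casimir = P.casimirMax F) (hinit : bdry F a = (P.φ₁, P.φ₂)) (hφ : P.φ₃ = 0)
    (h : ZeroSegment F P a a) (hl : FiniteLeft F P a) (hr : FiniteRight F P a) :
    NonUniqueWithPauses F P a {c | ∃ k : ℤ, c = a + 2 * Real.pi * k} := by
  refine nonUniqueWithPauses_of hF hP hE hinit ⟨_, 0, rfl⟩ (fun θ _ _ t ht =>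
    exists_eq_add_int_mul_of_zero (speed_add_int_mul_two_pi F P) h.pos ht) ?_
  rintro c ⟨k, rfl⟩ l hl'
  obtain ⟨g, θ, α, β, hg, h0, hθ, -⟩ := exists_itinerary hF hP hE hinit hφ h hl hr
    (p := fun n => a + 2 * Real.pi * n) (ℓ := fun _ => l) (fun n => by
      push_cast; rw [show a + 2 * Real.pi * (n + 1) - (a + 2 * Real.pi * n) = 2 * Real.pi by ring,
        abs_of_pos Real.two_pi_pos]) (fun _ => hl'.le) (by simp)
  refine ⟨g, θ, hg, h0, β k, ?_⟩
  have := hθ.isMaximalPause (fun _ => hl'.le) k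
  rwa [hθ.next] at this

/-- Failure of rigidity leaves at least one side on which the start can be left in finite time.
Failure of the other conditions makes the next segment of zeros unreachable, so a later pause can
only be at the start value. -/
lemma nonUnique_single (hF : IsQuasinorm F) (hP : P.φ₄ ^ 2 + P.φ₅ ^ 2 ≠ 0)
    (hE : P.casimir = P.casimirMax F) (hinit : bdry F θ₀ = (P.φ₁, P.φ₂)) (hφ : P.φ₃ = 0)
    (h : ZeroSegment F P a b) (h₀ : θ₀ ∈ Icc a b) (hn : ¬ Rigid F P θ₀ a b)
    (hnr : ¬ ReachesRight F P θ₀ a b) (hnl : ¬ ReachesLeft F P θ₀ a b)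
    (hnb : ¬ ReachesBoth F P θ₀ a b) : NonUniqueWithPauses F P θ₀ {θ₀} := by
  have hlt : b - 2 * Real.pi < a := by linarith [h.lt]
  have hpause : ∀ l : ℝ, 0 ≤ l → (θ₀ = b ∧ FiniteRight F P θ₀ ∨ θ₀ = a ∧ FiniteLeft F P θ₀) →
      ∃ g θ, IsNormalExtremal F P g θ ∧ θ 0 = θ₀ ∧ ∃ p, IsMaximalPause θ θ₀ p (p + l) := by
    rintro l hl (⟨rfl, h1⟩ | ⟨rfl, h1⟩)
    · exact exists_pause_of_eq_zero hF hP hE hinit hφ hl (exists_pause_start_right hF h hφ h1 hl)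
    · exact exists_pause_of_eq_zero hF hP hE hinit hφ hl (exists_pause_start_left hF h hφ h1 hl)
  suffices hs : (θ₀ = b ∧ FiniteRight F P θ₀ ∨ θ₀ = a ∧ FiniteLeft F P θ₀) ∧
      ∀ θ, IsSol (speed F P) θ → θ 0 = θ₀ → ∀ t, speed F P (θ t) = 0 → θ t = θ₀ by
    refine nonUniqueWithPauses_of hF hP hE hinit (singleton_nonempty _) hs.2 ?_
    rintro c rfl l hl
    exact hpause l hl.le hs.1
  rcases h₀.1.eq_or_lt with rfl | ha
  · rcases h.le.eq_or_lt with rfl | hab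
    · have hor : FiniteLeft F P a ∨ FiniteRight F P a := by
        by_contra! hc
        exact hn (Or.inl ⟨rfl, rfl, hc.1, hc.2⟩)
      have hand : ¬ (FiniteLeft F P a ∧ FiniteRight F P a) := fun hc =>
        hnb ⟨rfl, rfl, hc.1, hc.2⟩
      refine ⟨hor.symm.imp (fun h => ⟨rfl, h⟩) fun h => ⟨rfl, h⟩, fun θ hθ h0 t ht => ?_⟩
      by_contra hne
      have hi := hθ.integrable_of_single_zero (speed_add_int_mul_two_pi F P) h.pos h0 ht hne
      exact hand ⟨(finiteLeft_iff hφ).2 ⟨a - 1, by linarith, hi _ _⟩,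
        (finiteRight_iff hφ).2 ⟨a + 1, by linarith, hi _ _⟩⟩
    · have hl : FiniteLeft F P a := by
        by_contra hc
        exact hn (Or.inr (Or.inr (Or.inl ⟨rfl, hab, hc⟩)))
      refine ⟨Or.inr ⟨rfl, hl⟩, fun θ hθ h0 t ht => ?_⟩
      refine (hθ.le_of_barrier hab h.zero h0.le t).antisymm ?_
      by_contra! hc
      have h1 : θ t ≤ b - 2 * Real.pi := by
        by_contra! h1
        exact (h.pos_left ⟨h1, hc⟩).ne' ht
      exact hnl ⟨rfl, hab, hl, (finiteIntegral_integrand₀_iff hφ).2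
        (hθ.integrable_of_ge h0.ge h1 hlt fun ξ => h.pos_left)⟩
  · rcases h₀.2.eq_or_lt with rfl | hb
    · have hr : FiniteRight F P θ₀ := by
        by_contra hc
        exact hn (Or.inr (Or.inr (Or.inr ⟨rfl, ha, hc⟩)))
      refine ⟨Or.inl ⟨rfl, hr⟩, fun θ hθ h0 t ht => ?_⟩
      refine le_antisymm ?_ (hθ.ge_of_barrier ha h.zero h0.ge t)
      by_contra! hc
      have h1 : a + 2 * Real.pi ≤ θ t := by
        by_contra! h1
        exact (h.pos _ ⟨hc, h1⟩).ne' ht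
      exact hnr ⟨ha, rfl, hr, (finiteIntegral_integrand₀_iff hφ).2
        (hθ.integrable_of_le h0.le h1 h.lt h.pos)⟩
    · exact absurd (Or.inr (Or.inl ⟨ha, hb⟩)) hn

end ZeroSegment

lemma casimirMax_of_eq_zero (hF : IsQuasinorm F) (hP : P.φ₄ ^ 2 + P.φ₅ ^ 2 ≠ 0) (hφ : P.φ₃ = 0)
    (hE : P.casimir = P.casimirMax F) {θ₀ : ℝ} (hinit : bdry F θ₀ = (P.φ₁, P.φ₂)) :
    ∃ θ₁ θ₂ : ℝ, θ₁ ≤ θ₀ ∧ θ₀ ≤ θ₂ ∧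
      (∀ ξ ∈ Icc θ₁ θ₂, P.φ₅ * (rad F ξ * Real.cos ξ - P.φ₁)
        = P.φ₄ * (rad F ξ * Real.sin ξ - P.φ₂)) ∧
      (∀ α β : ℝ, α ≤ θ₀ → θ₀ ≤ β →
        (∀ ξ ∈ Icc α β, P.φ₅ * (rad F ξ * Real.cos ξ - P.φ₁)
          = P.φ₄ * (rad F ξ * Real.sin ξ - P.φ₂)) → θ₁ ≤ α ∧ β ≤ θ₂) ∧
      (Rigid F P θ₀ θ₁ θ₂ → ∀ g θ, IsNormalExtremal F P g θ → θ 0 = θ₀ →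
        (∀ t, θ t = θ₀) ∧ IsLineExtremal F P g ∧ IsMetricLine F g) ∧
      (ReachesRight F P θ₀ θ₁ θ₂ → NonUniqueWithPauses F P θ₀ {θ₀, θ₁ + 2 * Real.pi}) ∧
      (ReachesLeft F P θ₀ θ₁ θ₂ → NonUniqueWithPauses F P θ₀ {θ₀, θ₂ - 2 * Real.pi}) ∧
      (ReachesBoth F P θ₀ θ₁ θ₂ →
        NonUniqueWithPauses F P θ₀ {c | ∃ k : ℤ, c = θ₀ + 2 * Real.pi * k} ∧
        ∀ p ℓ : ℤ → ℝ, (∀ n, |p (n + 1) - p n| = 2 * Real.pi) → (∀ n, 0 ≤ ℓ n) → p 0 = θ₀ →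
          ∃ g θ a b, IsNormalExtremal F P g θ ∧ θ 0 = θ₀ ∧ FollowsItinerary θ p ℓ a b ∧
            (0 : ℝ) ∈ Icc (b 0) (a 1)) ∧
      (¬ Rigid F P θ₀ θ₁ θ₂ → ¬ ReachesRight F P θ₀ θ₁ θ₂ → ¬ ReachesLeft F P θ₀ θ₁ θ₂ →
        ¬ ReachesBoth F P θ₀ θ₁ θ₂ → NonUniqueWithPauses F P θ₀ {θ₀}) := by
  obtain ⟨a, b, ha, hb, hlt, hz, hpos⟩ := exists_zero_segment hF hP hE
    (show numer F P θ₀ = 0 by rw [numer_of_init hinit, hφ]; norm_num)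
  have h : ZeroSegment F P a b := ⟨ha.trans hb, hlt, fun ξ hξ => speed_eq_zero (hz ξ hξ),
    fun ξ hξ => (speed_pos_iff hF).2 (hpos ξ hξ)⟩
  have hiff : ∀ ξ, P.φ₅ * (rad F ξ * Real.cos ξ - P.φ₁) = P.φ₄ * (rad F ξ * Real.sin ξ - P.φ₂) ↔
      numer F P ξ = 0 := fun ξ => by
    rw [numer, hφ]
    constructor <;> intro h <;> linarith
  simp only [hiff]
  refine ⟨a, b, ha, hb, hz, fun α β hα hβ hαβ =>
    h.maximal ⟨ha, hb⟩ hα hβ fun ξ hξ => speed_eq_zero (hαβ ξ hξ), ?_, ?_, ?_, ?_,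
    ZeroSegment.nonUnique_single hF hP hE hinit hφ h ⟨ha, hb⟩⟩
  · rintro hr g θ hg rfl
    obtain ⟨u, hu⟩ := (isNormalExtremal_iff hF).1 hg
    have hc := h.const_of_rigid hφ hr (hu.isSol hF)
    exact ⟨hc, hu.line_of_const hF hP hc⟩
  · rintro ⟨h1, rfl, h2, h3⟩
    exact ZeroSegment.nonUnique_right hF hP hE hinit hφ h h1 h2 h3
  · rintro ⟨rfl, h1, h2, h3⟩
    exact ZeroSegment.nonUnique_left hF hP hE hinit hφ h h1 h2 h3
  · rintro ⟨rfl, rfl, h1, h2⟩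
    exact ⟨ZeroSegment.nonUnique_both hF hP hE hinit hφ h h1 h2, fun p ℓ hp hℓ hp0 =>
      ZeroSegment.exists_itinerary hF hP hE hinit hφ h h1 h2 hp hℓ hp0⟩

end

end SubFinslerCartan

end

/-! ### Assembly of the cases -/

theorem theorem2 (F : ℝ × ℝ → ℝ) (hF : IsQuasinorm F) (P : InitialData)
    (hP : P.φ₄ ^ 2 + P.φ₅ ^ 2 ≠ 0) :
    -- every normal extremal from the unit has a continuous polar angle
    (∀ (M : ℝ) (g ψ : ℝ → Fin 5 → ℝ) (u : ℝ → ℝ × ℝ), 0 < M → IsExtremal F M g ψ u → g 0 = 0 →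
      ψ 0 = M • P.toVec → ∃ θ, IsNormalExtremal F P g θ) ∧
    -- the extremals are exactly the curves given by the formulas
    (∀ (g : ℝ → Fin 5 → ℝ) (θ : ℝ → ℝ), IsNormalExtremal F P g θ ↔
      GivenByFormulas F P (fun t => g t 0) (fun t => g t 1) (fun t => g t 2) (fun t => g t 3)
        (fun t => g t 4) θ) ∧
    -- `𝓔₀` and `𝓔₋₁` are a maximum and a minimum
    IsGreatest ((fun h : ℝ × ℝ => P.φ₅ * h.1 - P.φ₄ * h.2) '' polarBall F) (P.casimirMax F) ∧
    IsLeast ((fun h : ℝ × ℝ => P.φ₅ * h.1 - P.φ₄ * h.2) '' polarBall F) (P.casimirMin F) ∧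
    ∀ θ₀ : ℝ, rad F θ₀ * Real.cos θ₀ = P.φ₁ → rad F θ₀ * Real.sin θ₀ = P.φ₂ →
      -- the cases below exhaust all possibilities
      ((P.φ₃ ≠ 0 ∧ P.casimirMax F < P.casimir) ∨
        (P.φ₃ = 0 ∧ P.casimir = P.casimirMin F) ∨
        (P.casimirMin F < P.casimir ∧ P.casimir < P.casimirMax F) ∨
        (P.φ₃ ≠ 0 ∧ P.casimir = P.casimirMax F) ∨
        (P.φ₃ = 0 ∧ P.casimir = P.casimirMax F)) ∧
      -- case 1
      (P.φ₃ ≠ 0 → P.casimirMax F < P.casimir →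
        ∀ g θ, IsNormalExtremal F P g θ → θ 0 = θ₀ →
          (∀ t, timeFn F P θ₀ (θ t) = t) ∧ ∀ ξ, θ (timeFn F P θ₀ ξ) = ξ) ∧
      -- case 2
      (P.φ₃ = 0 → P.casimir = P.casimirMin F →
        ∀ g θ, IsNormalExtremal F P g θ → θ 0 = θ₀ →
          (∀ t, θ t = θ₀) ∧ IsLineExtremal F P g ∧ IsMetricLine F g) ∧
      -- case 3
      (P.casimirMin F < P.casimir → P.casimir < P.casimirMax F →
        (P.φ₃ ≠ 0 → ∃ θ₁ θ₂ : ℝ, 0 < P.φ₃ * (θ₂ - θ₁) ∧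
          θ₀ ∈ Ioo (min θ₁ θ₂) (max θ₁ θ₂) ∧ rhs F P θ₁ = 0 ∧ rhs F P θ₂ = 0 ∧
          (∀ ξ ∈ Ioo (min θ₁ θ₂) (max θ₁ θ₂), rhs F P ξ ≠ 0) ∧
          FiniteIntegral (integrand F P) θ₀ θ₁ ∧ FiniteIntegral (integrand F P) θ₀ θ₂ ∧
          ∀ g θ, IsNormalExtremal F P g θ → θ 0 = θ₀ →
            Oscillates θ (timeFn F P θ₀ θ₁) (timeFn F P θ₀ θ₂)) ∧
        (P.φ₃ = 0 → ∃ θ₂ : ℝ, θ₂ ≠ θ₀ ∧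
          (∀ ξ ∈ uIcc θ₀ θ₂,
            P.φ₅ * (rad F ξ * Real.cos ξ - rad F θ₀ * Real.cos θ₀)
              ≤ P.φ₄ * (rad F ξ * Real.sin ξ - rad F θ₀ * Real.sin θ₀) ∧
            (P.φ₄ * (rad F ξ * Real.sin ξ - rad F θ₀ * Real.sin θ₀)
              = P.φ₅ * (rad F ξ * Real.cos ξ - rad F θ₀ * Real.cos θ₀) ↔ ξ = θ₀ ∨ ξ = θ₂)) ∧
          FiniteIntegral (integrand₀ F P) θ₀ θ₂ ∧
          ∀ g θ, IsNormalExtremal F P g θ → θ 0 = θ₀ →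
            Oscillates θ 0 (timeFn₀ F P θ₀ θ₂))) ∧
      -- case 4
      (P.φ₃ ≠ 0 → P.casimir = P.casimirMax F →
        ∃ θ₁ θ₂ : ℝ, θ₁ < θ₀ ∧ θ₀ < θ₂ ∧ rhs F P θ₁ = 0 ∧ rhs F P θ₂ = 0 ∧
          (∀ ξ ∈ Ioo θ₁ θ₂, rhs F P ξ ≠ 0) ∧
          (¬ FiniteIntegral (integrand F P) θ₀ θ₁ → ¬ FiniteIntegral (integrand F P) θ₀ θ₂ →
            ∀ g θ, IsNormalExtremal F P g θ → θ 0 = θ₀ →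
              (∀ t, θ t ∈ Ioo θ₁ θ₂ ∧ timeFn F P θ₀ (θ t) = t) ∧
              ∀ ξ ∈ Ioo θ₁ θ₂, θ (timeFn F P θ₀ ξ) = ξ) ∧
          -- both integrals finite, `θ₂ = θ₁ + 2π`
          (FiniteIntegral (integrand F P) θ₀ θ₁ → FiniteIntegral (integrand F P) θ₀ θ₂ →
            θ₂ = θ₁ + 2 * Real.pi →
            NonUniqueWithPauses F P θ₀ {c | ∃ k : ℤ, c = θ₁ + 2 * Real.pi * k} ∧
            ∀ p ℓ : ℤ → ℝ, (∀ n, |p (n + 1) - p n| = 2 * Real.pi) → (∀ n, 0 ≤ ℓ n) →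
              (0 < P.φ₃ → p (-1) = θ₁ ∧ p 0 = θ₂) → (P.φ₃ < 0 → p (-1) = θ₂ ∧ p 0 = θ₁) →
              ∃ g θ a b, IsNormalExtremal F P g θ ∧ θ 0 = θ₀ ∧ FollowsItinerary θ p ℓ a b ∧
                (0 : ℝ) ∈ Ioo (a 0) (b 0)) ∧
          -- at least one integral finite, and not the previous case
          (FiniteIntegral (integrand F P) θ₀ θ₁ ∨ FiniteIntegral (integrand F P) θ₀ θ₂ →
            ¬ (FiniteIntegral (integrand F P) θ₀ θ₁ ∧ FiniteIntegral (integrand F P) θ₀ θ₂ ∧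
              θ₂ = θ₁ + 2 * Real.pi) →
            NonUniqueWithPauses F P θ₀
              {c | (FiniteIntegral (integrand F P) θ₀ θ₁ ∧ c = θ₁) ∨
                (FiniteIntegral (integrand F P) θ₀ θ₂ ∧ c = θ₂)})) ∧
      -- case 5
      (P.φ₃ = 0 → P.casimir = P.casimirMax F →
        ∃ θ₁ θ₂ : ℝ, θ₁ ≤ θ₀ ∧ θ₀ ≤ θ₂ ∧
          (∀ ξ ∈ Icc θ₁ θ₂, P.φ₅ * (rad F ξ * Real.cos ξ - P.φ₁)
            = P.φ₄ * (rad F ξ * Real.sin ξ - P.φ₂)) ∧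
          (∀ α β : ℝ, α ≤ θ₀ → θ₀ ≤ β →
            (∀ ξ ∈ Icc α β, P.φ₅ * (rad F ξ * Real.cos ξ - P.φ₁)
              = P.φ₄ * (rad F ξ * Real.sin ξ - P.φ₂)) → θ₁ ≤ α ∧ β ≤ θ₂) ∧
          (Rigid F P θ₀ θ₁ θ₂ → ∀ g θ, IsNormalExtremal F P g θ → θ 0 = θ₀ →
            (∀ t, θ t = θ₀) ∧ IsLineExtremal F P g ∧ IsMetricLine F g) ∧
          (ReachesRight F P θ₀ θ₁ θ₂ →
            NonUniqueWithPauses F P θ₀ {θ₀, θ₁ + 2 * Real.pi}) ∧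
          (ReachesLeft F P θ₀ θ₁ θ₂ →
            NonUniqueWithPauses F P θ₀ {θ₀, θ₂ - 2 * Real.pi}) ∧
          (ReachesBoth F P θ₀ θ₁ θ₂ →
            NonUniqueWithPauses F P θ₀ {c | ∃ k : ℤ, c = θ₀ + 2 * Real.pi * k} ∧
            ∀ p ℓ : ℤ → ℝ, (∀ n, |p (n + 1) - p n| = 2 * Real.pi) → (∀ n, 0 ≤ ℓ n) →
              p 0 = θ₀ →
              ∃ g θ a b, IsNormalExtremal F P g θ ∧ θ 0 = θ₀ ∧ FollowsItinerary θ p ℓ a b ∧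
                (0 : ℝ) ∈ Icc (b 0) (a 1)) ∧
          (¬ Rigid F P θ₀ θ₁ θ₂ → ¬ ReachesRight F P θ₀ θ₁ θ₂ → ¬ ReachesLeft F P θ₀ θ₁ θ₂ →
            ¬ ReachesBoth F P θ₀ θ₁ θ₂ → NonUniqueWithPauses F P θ₀ {θ₀})) := by
  refine ⟨fun M g ψ u hM h hg hψ => exists_isNormalExtremal_of_isExtremal hF hM h hg hψ,
    fun g θ => ⟨fun h => ?_, fun h => ?_⟩, isGreatest_casimirMax hF P, isLeast_casimirMin hF P,
    fun θ₀ h1 h2 => ?_⟩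
  · obtain ⟨u, hu⟩ := (isNormalExtremal_iff hF).1 h
    exact hu.givenByFormulas hF hP
  · exact (isNormalExtremal_iff hF).2 (h.exists_traj hF hP)
  have hinit : bdry F θ₀ = (P.φ₁, P.φ₂) := Prod.ext h1 h2
  refine ⟨?_, ?_, ?_, fun hmin hmax => ⟨fun hφ => oscillates_of_ne hF hP hmin hmax hφ hinit,
    fun hφ => oscillates_of_eq_zero hF hP hmin hmax hφ hinit⟩,
    fun hφ hE => casimirMax_of_ne hF hP hφ hE hinit,
    fun hφ hE => casimirMax_of_eq_zero hF hP hφ hE hinit⟩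
  -- Since 𝓔 is φ₃²/2 plus the level at the start, 𝓔 ≤ 𝓔₀ when φ₃ = 0 and 𝓔 > 𝓔₋₁ when φ₃ ≠ 0; this
  -- is why the five cases suffice.
  · have hE := casimir_eq hinit
    have hmax := level_le_casimirMax hF P θ₀
    have hmin := casimirMin_le_level hF P θ₀
    by_cases hφ : P.φ₃ = 0
    · rw [hφ] at hE
      rcases hmin.eq_or_lt with h | h
      · exact Or.inr (Or.inl ⟨hφ, by linarith⟩)
      rcases hmax.eq_or_lt with h' | h'
      · exact Or.inr (Or.inr (Or.inr (Or.inr ⟨hφ, by linarith⟩)))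
      · exact Or.inr (Or.inr (Or.inl ⟨by linarith, by linarith⟩))
    · have hpos : 0 < P.φ₃ ^ 2 := by positivity
      rcases lt_trichotomy P.casimir (P.casimirMax F) with h | h | h
      · exact Or.inr (Or.inr (Or.inl ⟨by linarith, h⟩))
      · exact Or.inr (Or.inr (Or.inr (Or.inl ⟨hφ, h⟩)))
      · exact Or.inl ⟨hφ, h⟩
  · rintro hφ hE g θ h rfl
    exact theta_inverse_of_casimirMax_lt hF hφ hE h
  · rintro - hE g θ h rfl
    exact line_of_casimirMin hF hP hE h
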